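/- **Lemma (Inflation).** Let $(M,\tau_0)$ be a symplectic $4$-manifold (smooth, without boundary, not necessarily compact), oriented by $\tau_0\wedge\tau_0$, and let $J$ be a smooth almost complex structure on $M$ that is tamed by $\tau_0$, i.e. $\tau_0(v,Jv)>0$ for every nonzero tangent vector $v$. Let $Z\subset M$ be an embedded closed connected $J$-holomorphic curve, i.e. $Z=u(S)$ for a closed connected Riemann surface $(S,j)$ and a smooth embedding $u:S\to M$ with $du\circ j=J\circ du$, and suppose that $Z\cdot Z\ge 0$. Let $a_Z\in H^2_{dR}(M)$ be the class Poincaré dual to $[Z]$, i.e. $\int_M\eta\wedge a_Z=\int_Z\eta$ for every closed $2$-form $\eta$ with compact support; the self-intersection number is $Z\cdot Z=\int_Z a_Z$. Then there is a family $\tau_\lambda$, $\lambda\ge 0$, of symplectic forms on $M$, depending smoothly on $\lambda$ and starting at the given form $\tau_0$, such that every $\tau_\lambda$ tames $J$ and $$[\tau_\lambda]=[\tau_0]+\lambda\,a_Z\in H^2_{dR}(M)\qquad\text{for all }\lambda\ge 0 .$$ -/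

import Mathlib

open scoped Manifold ContDiff Topology

noncomputable section

namespace Inflation

/-- The model space `ℝⁿ` with its Euclidean norm. -/
abbrev E (n : ℕ) : Type := EuclideanSpace ℝ (Fin n)

section Forms

variable {n : ℕ} {X : Type*} [TopologicalSpace X] [ChartedSpace (E n) X]

/-- A (not necessarily smooth) differential `k`-form on the `n`-manifold `X`: an alternating
`k`-linear form on every tangent space. -/
abbrev Form (n : ℕ) (X : Type*) [TopologicalSpace X] [ChartedSpace (E n) X] (k : ℕ) : Type _ :=
  ∀ x : X, TangentSpace (𝓡 n) x [⋀^Fin k]→L[ℝ] ℝ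

/-- The derivative at `y` of the inverse of the chart `φ` centred at `c`, as a map
`ℝⁿ → T_{φ⁻¹ y} X`. The image of the `i`-th standard basis vector is `∂/∂yᵢ`. -/
def chartFrame (c : X) (y : E n) :
    E n →L[ℝ] TangentSpace (𝓡 n) ((extChartAt (𝓡 n) c).symm y) :=
  mfderiv 𝓘(ℝ, E n) (𝓡 n) (extChartAt (𝓡 n) c).symm y

/-- The expression `(φ⁻¹)^* σ` of the form `σ` in the chart `φ` centred at `c`. It is meaningful on
the target of the chart, which is an open subset of `ℝⁿ`. -/
def inChart {k : ℕ} (σ : Form n X k) (c : X) (y : E n) : E n [⋀^Fin k]→L[ℝ] ℝ :=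
  (σ ((extChartAt (𝓡 n) c).symm y)).compContinuousLinearMap (chartFrame c y)

/-- `σ` is a `C^∞` form. -/
def IsSmoothForm {k : ℕ} (σ : Form n X k) : Prop :=
  ∀ c : X, ContDiffOn ℝ ∞ (inChart σ c) (extChartAt (𝓡 n) c).target

/-- `dσ = θ`, where `d` is computed in charts. -/
def HasExtDeriv {k : ℕ} (σ : Form n X k) (θ : Form n X (k + 1)) : Prop :=
  ∀ c : X, ∀ y ∈ (extChartAt (𝓡 n) c).target, extDeriv (inChart σ c) y = inChart θ c y

/-- `dσ = 0`. -/
def IsClosedForm {k : ℕ} (σ : Form n X k) : Prop := HasExtDeriv σ 0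

/-- `[α] = [β]` in de Rham cohomology (for closed smooth forms `α`, `β` of degree `k + 1`):
the difference `α - β` is the exterior derivative of a smooth form. -/
def Cohomologous {k : ℕ} (α β : Form n X (k + 1)) : Prop :=
  ∃ γ : Form n X k, IsSmoothForm γ ∧ HasExtDeriv γ (α - β)

/-- `σ` vanishes outside a compact set. -/
def HasCompactSuppForm {k : ℕ} (σ : Form n X k) : Prop :=
  ∃ K : Set X, IsCompact K ∧ ∀ x ∉ K, σ x = 0

/-- A family `τ_λ`, `λ ≥ 0`, of forms is smooth: in charts it depends smoothly on `(λ, y)` jointly,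
up to the boundary `λ = 0`. -/
def IsSmoothFamily {k : ℕ} (τ : ℝ → Form n X k) : Prop :=
  ∀ c : X, ContDiffOn ℝ ∞ (fun p : ℝ × E n => inChart (τ p.1) c p.2)
    (Set.Ici 0 ×ˢ (extChartAt (𝓡 n) c).target)

/-- The wedge product `α ∧ β` of two `2`-forms, evaluated on four tangent vectors. -/
def wedge₂₂ (α β : Form n X 2) (x : X) (v : Fin 4 → TangentSpace (𝓡 n) x) : ℝ :=
  α x ![v 0, v 1] * β x ![v 2, v 3] - α x ![v 0, v 2] * β x ![v 1, v 3]
    + α x ![v 0, v 3] * β x ![v 1, v 2] + α x ![v 1, v 2] * β x ![v 0, v 3]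
    - α x ![v 1, v 3] * β x ![v 0, v 2] + α x ![v 2, v 3] * β x ![v 0, v 1]

end Forms

section Integration

variable {n : ℕ} {X : Type*} [TopologicalSpace X] [ChartedSpace (E n) X]

/-- The coordinate frame `(∂/∂y₁, …, ∂/∂yₙ)` of the chart centred at `c`. -/
def coordFrame (c : X) (y : E n) (i : Fin n) :
    TangentSpace (𝓡 n) ((extChartAt (𝓡 n) c).symm y) :=
  chartFrame c y (EuclideanSpace.single i 1)

open Classical in
/-- The density with respect to `dy₁ ⋯ dyₙ`, in the chart centred at `c`, of the top-degree form `θ`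
on a manifold oriented by the set `pos` of its positive frames: `θ(∂/∂y₁, …, ∂/∂yₙ)`, with its
sign changed where the coordinate frame is not positive. -/
def density (pos : ∀ x : X, (Fin n → TangentSpace (𝓡 n) x) → Prop)
    (θ : ∀ x : X, (Fin n → TangentSpace (𝓡 n) x) → ℝ) (c : X) (y : E n) : ℝ :=
  if pos _ (coordFrame c y) then θ _ (coordFrame c y) else - θ _ (coordFrame c y)

variable [T2Space X] [SigmaCompactSpace X] [IsManifold (𝓡 n) ∞ X]

variable (n X) in
/-- A smooth partition of unity subordinate to the cover of `X` by chart domains. -/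
def chartPartition : SmoothPartitionOfUnity X (𝓡 n) X Set.univ :=
  Classical.choose (SmoothPartitionOfUnity.exists_isSubordinate_chartAt_source (𝓡 n) X)

variable (n X) in
theorem chartPartition_isSubordinate :
    (chartPartition n X).IsSubordinate (fun c => (chartAt (E n) c).source) :=
  Classical.choose_spec (SmoothPartitionOfUnity.exists_isSubordinate_chartAt_source (𝓡 n) X)

/-- The integral `∫_X θ` of a compactly supported top-degree form `θ` over the manifold `X` oriented
by the set `pos` of its positive frames: cut `θ` up by a partition of unity subordinate
to the charts and integrate the pieces in the charts. The sum has finitely many nonzero terms. -/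
def integral (pos : ∀ x : X, (Fin n → TangentSpace (𝓡 n) x) → Prop)
    (θ : ∀ x : X, (Fin n → TangentSpace (𝓡 n) x) → ℝ) : ℝ :=
  ∑ᶠ c : X, ∫ y in (extChartAt (𝓡 n) c).target,
    chartPartition n X c ((extChartAt (𝓡 n) c).symm y) * density pos θ c y

end Integration

section AlmostComplex

variable {n : ℕ} {X : Type*} [TopologicalSpace X] [ChartedSpace (E n) X] [IsManifold (𝓡 n) ∞ X]

/-- `J` is a smooth almost complex structure: a smooth section of `End(TX)` with `J² = -1`. -/
structure IsAlmostComplex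
    (J : ∀ x : X, TangentSpace (𝓡 n) x →L[ℝ] TangentSpace (𝓡 n) x) : Prop where
  smooth : ContMDiff (𝓡 n) ((𝓡 n).prod 𝓘(ℝ, E n →L[ℝ] E n)) ∞
    (fun x => Bundle.TotalSpace.mk' (E n →L[ℝ] E n)
      (E := fun x : X => TangentSpace (𝓡 n) x →L[ℝ] TangentSpace (𝓡 n) x) x (J x))
  sq_eq_neg : ∀ (x : X) (v : TangentSpace (𝓡 n) x), J x (J x v) = - v

/-- `σ` is a symplectic form: smooth, closed and nondegenerate. -/
structure IsSymplectic (σ : Form n X 2) : Prop where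
  smooth : IsSmoothForm σ
  closed : IsClosedForm σ
  nondegenerate : ∀ (x : X) (v : TangentSpace (𝓡 n) x),
    (∀ w : TangentSpace (𝓡 n) x, σ x ![v, w] = 0) → v = 0

/-- `σ` tames `J`: `σ(v, Jv) > 0` for all `v ≠ 0`. -/
def Tames (σ : Form n X 2)
    (J : ∀ x : X, TangentSpace (𝓡 n) x →L[ℝ] TangentSpace (𝓡 n) x) : Prop :=
  ∀ (x : X) (v : TangentSpace (𝓡 n) x), v ≠ 0 → 0 < σ x ![v, J x v]

end AlmostComplex

section Curves

variable {M : Type*} [TopologicalSpace M] [ChartedSpace (E 4) M]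
  {S : Type*} [TopologicalSpace S] [ChartedSpace (E 2) S]

/-- The orientation of a `4`-manifold given by a symplectic form `σ`: a frame is positive if
`σ ∧ σ` is positive on it. -/
def symplecticPos (σ : Form 4 M 2) (x : M) (v : Fin 4 → TangentSpace (𝓡 4) x) : Prop :=
  0 < wedge₂₂ σ σ x v

/-- The complex orientation of a surface with almost complex structure `j`: a frame
`(v₀, v₁)` is positive if `v₁ = a v₀ + b j v₀` with `b > 0`. -/
def complexPos (j : ∀ s : S, TangentSpace (𝓡 2) s →L[ℝ] TangentSpace (𝓡 2) s)
    (s : S) (v : Fin 2 → TangentSpace (𝓡 2) s) : Prop :=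
  ∃ a b : ℝ, 0 < b ∧ v 1 = a • v 0 + b • j s (v 0)

/-- The map `u : (S, j) → (M, J)` is `J`-holomorphic: `du ∘ j = J ∘ du`. -/
def IsHolomorphic (j : ∀ s : S, TangentSpace (𝓡 2) s →L[ℝ] TangentSpace (𝓡 2) s)
    (J : ∀ x : M, TangentSpace (𝓡 4) x →L[ℝ] TangentSpace (𝓡 4) x) (u : S → M) : Prop :=
  ∀ (s : S) (v : TangentSpace (𝓡 2) s),
    mfderiv (𝓡 2) (𝓡 4) u s (j s v) = J (u s) (mfderiv (𝓡 2) (𝓡 4) u s v)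

/-- The pullback `u^* η` of a `2`-form by `u : S → M`. -/
def pullback (u : S → M) (η : Form 4 M 2) : Form 2 S 2 :=
  fun s => (η (u s)).compContinuousLinearMap (mfderiv (𝓡 2) (𝓡 4) u s)

variable [T2Space S] [SigmaCompactSpace S] [IsManifold (𝓡 2) ∞ S]

/-- The integral `∫_Z η = ∫_S u^* η` of a `2`-form over the curve `Z = u(S)`, with `S` oriented
by `j`. -/
def curveIntegral (j : ∀ s : S, TangentSpace (𝓡 2) s →L[ℝ] TangentSpace (𝓡 2) s)
    (u : S → M) (η : Form 4 M 2) : ℝ :=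
  integral (complexPos j) (fun s v => pullback u η s v)

variable [T2Space M] [SigmaCompactSpace M] [IsManifold (𝓡 4) ∞ M]

/-- The smooth closed `2`-form `a` represents the Poincaré dual of the class `[Z]` of the
curve `Z = u(S)`, in the `4`-manifold `M` oriented by the symplectic form `σ`:
`∫_M η ∧ a = ∫_Z η` for all smooth closed compactly supported `2`-forms `η`. -/
structure IsPoincareDual (σ : Form 4 M 2)
    (j : ∀ s : S, TangentSpace (𝓡 2) s →L[ℝ] TangentSpace (𝓡 2) s)
    (u : S → M) (a : Form 4 M 2) : Prop where
  smooth : IsSmoothForm a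
  closed : IsClosedForm a
  integral_eq : ∀ η : Form 4 M 2, IsSmoothForm η → IsClosedForm η → HasCompactSuppForm η →
    integral (symplecticPos σ) (wedge₂₂ η a) = curveIntegral j u η

/-- The self-intersection number `Z · Z` of the curve `Z = u(S)`: the integral over `Z` of a closed
form that represents the Poincaré dual of `[Z]`. (Such a form exists, and the integral does not
depend on its choice.) -/
def selfIntersection (σ : Form 4 M 2)
    (j : ∀ s : S, TangentSpace (𝓡 2) s →L[ℝ] TangentSpace (𝓡 2) s) (u : S → M) : ℝ :=
  curveIntegral j u (Classical.epsilon (IsPoincareDual σ j u))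

end Curves

end Inflation

end

set_option linter.unusedSectionVars false

open scoped Manifold ContDiff Topology

noncomputable section

namespace Inflation

/-! ### Smooth families of alternating forms. -/

section ContinuousAlternating

variable {E₁ V D : Type*} [NormedAddCommGroup E₁] [NormedSpace ℝ E₁]
  [NormedAddCommGroup V] [NormedSpace ℝ V] [NormedAddCommGroup D] [NormedSpace ℝ D]

/-! The normal bundle of Z is modelled by a map into a Hermitian space, a Thom form is written down
in terms of this map, and it is changed inside its cohomology class until it is almost nonnegative
on complex lines. Adding a multiple of such a form to τ₀ preserves taming.

Model. There is a map W from M to a Hermitian space V which vanishes on Z and whose derivative along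
Z is complex linear with kernel TZ, and near Z a field P of orthogonal projections with P W = W
(`NormalData`). Let F be |W|² near Z, η = Im⟨W, dW⟩, and let `kappa` be the curvature form Im
tr(P[dP, dP]). The identity F² kappa = F dη − dF∧η (`sq_mul_kappa`) says that kappa = d(η/F) off Z.
For a cutoff b which is constant near 0, the form b'(F)/F dF∧η + b(F) kappa (`thomForm`) is
therefore d(b(F) η/F) off Z. It is closed and compactly supported, and its class depends only on
b(0).

Duality. Replacing b(t) by b(t/δ²) does not change the class. As δ → 0, a dilation of the normal
coordinates and dominated convergence show that the integral of ζ ∧ Thom converges, that the limit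
only sees ζ at the points of Z, and that it is negative for ζ = τ₀. On the other hand, a 2-form with
zero integral over Z agrees along Z, on all of TM|Z, with an exact form (`HolCurve.curveExact`): the
second cohomology of S is a line, and terms containing the differential of a normal coordinate are
exact along Z anyway. A closed ζ is thus a multiple of τ₀, plus an exact form, plus a closed form
vanishing along Z. Hence the integral of ζ ∧ Thom is κ ∫_Z ζ with one constant κ < 0, and κ⁻¹ Thom
is dual to Z. No fibre integral has to be computed.

Positivity. Let a be this dual form and c = Z·Z / ∫_Z τ₀ ≥ 0. Then a − cτ₀ agrees along Z with some
dμ. Subtracting d(b(F)μ) from κ⁻¹ Thom gives κ⁻¹ (b'(F)/F) dF∧(η − κFμ) + b(F)(κ⁻¹ kappa − dμ). The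
last bracket is cτ₀ along Z, so near Z it is at least −ετ₀ on complex lines. Moreover dF∧η is twice
Re∧Im of ⟨W, dW⟩, which is complex linear up to an error O(F); completing squares bounds the first
wedge product below by −C F² τ₀ (`HolCurve.exists_wedgeOne_ge`). A logarithmic cutoff makes |t
b'(t)| as small as desired, so the first term is at least −ετ₀ as well. Compatibility of τ₀ with J
is never needed.

Conclusion. This gives representatives ρ_k of the class of a with ρ_k ≥ −τ₀/(k+1) on complex lines.
With a partition of unity χ_k of the λ-line, χ_k supported in λ < k+1, the family τ₀ + λ Σ χ_k(λ)
ρ_k is smooth, tames J and lies in the prescribed classes (`exists_inflation`). -/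

theorem contDiffAt_alternating_apply {k : ℕ} {r : WithTop ℕ∞} {Ω : D → V [⋀^Fin k]→L[ℝ] ℝ}
    {v : Fin k → D → V} {y : D} (hΩ : ContDiffAt ℝ r Ω y) (hv : ∀ i, ContDiffAt ℝ r (v i) y) :
    ContDiffAt ℝ r (fun z => Ω z (fun i => v i z)) y := by
  induction k with
  | zero =>
    have : (fun z => Ω z (fun i => v i z)) = fun z =>
        ContinuousAlternatingMap.apply ℝ V ℝ (fun i : Fin 0 => i.elim0) (Ω z) := by
      funext z
      simp only [ContinuousAlternatingMap.apply_apply]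
      congr 1
      exact Subsingleton.elim _ _
    rw [this]
    exact (ContinuousLinearMap.contDiff _).contDiffAt.comp y hΩ
  | succ k ih =>
    -- Currying is a linear isometry, so the induction can feed in one vector at a time.
    have h0 : ContDiff ℝ r (fun θ : V [⋀^Fin (k + 1)]→L[ℝ] ℝ => θ.curryLeft) :=
      IsBoundedLinearMap.contDiff ⟨⟨fun _ _ => rfl, fun _ _ => rfl⟩, 1, one_pos, fun θ =>
        ((ContinuousAlternatingMap.curryLeftLI (𝕜 := ℝ) (E := V) (F := ℝ) (n := k)).norm_map
          θ).le.trans_eq (one_mul _).symm⟩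
    have h1 : ContDiffAt ℝ r (fun z => (Ω z).curryLeft (v 0 z)) y :=
      (h0.contDiffAt.comp y hΩ).clm_apply (hv 0)
    have h2 := ih h1 (fun i => hv i.succ)
    convert h2 using 2 with z
    simp only [ContinuousAlternatingMap.curryLeft_apply_apply]
    congr 1
    funext i
    refine Fin.cases rfl (fun _ => rfl) i

/-- A curve of alternating forms on a finite-dimensional space is smooth as soon as its values on
fixed vectors are smooth. -/
theorem contDiffAt_alternating_of_apply [FiniteDimensional ℝ E₁] {k : ℕ} {r : WithTop ℕ∞}
    {Ω : D → E₁ [⋀^Fin k]→L[ℝ] ℝ} {y : D}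
    (h : ∀ v : Fin k → E₁, ContDiffAt ℝ r (fun z => Ω z v) y) : ContDiffAt ℝ r Ω y := by
  classical
  let b := Module.finBasis ℝ E₁
  -- Evaluation on tuples of basis vectors embeds the alternating forms in a finite-dimensional
  -- space; a linear left inverse then recovers the form smoothly from its values.
  let ev : (E₁ [⋀^Fin k]→L[ℝ] ℝ) →ₗ[ℝ] ((Fin k → Fin (Module.finrank ℝ E₁)) → ℝ) :=
    { toFun := fun θ m => θ (fun i => b (m i))
      map_add' := fun _ _ => rfl
      map_smul' := fun _ _ => rfl }
  have hinj : Function.Injective ev := by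
    intro θ₁ θ₂ h12
    apply ContinuousAlternatingMap.toAlternatingMap_injective
    refine Module.Basis.ext_alternating b (fun m _ => ?_)
    exact congrFun h12 m
  have : FiniteDimensional ℝ (E₁ [⋀^Fin k]→L[ℝ] ℝ) := FiniteDimensional.of_injective ev hinj
  obtain ⟨g, hg⟩ := ev.exists_leftInverse_of_injective (LinearMap.ker_eq_bot.2 hinj)
  have h1 : ContDiffAt ℝ r (fun z => ev (Ω z)) y := by
    rw [contDiffAt_pi]
    exact fun m => h _
  have h2 : Ω = fun z => (LinearMap.toContinuousLinearMap g) (ev (Ω z)) := by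
    funext z
    exact (LinearMap.congr_fun hg (Ω z)).symm
  rw [h2]
  exact (ContinuousLinearMap.contDiff _).contDiffAt.comp y h1

theorem contDiffAt_compContinuousLinearMap [FiniteDimensional ℝ E₁] {k : ℕ} {r : WithTop ℕ∞}
    {Ω : D → V [⋀^Fin k]→L[ℝ] ℝ} {L : D → E₁ →L[ℝ] V} {y : D}
    (hΩ : ContDiffAt ℝ r Ω y) (hL : ContDiffAt ℝ r L y) :
    ContDiffAt ℝ r (fun z => (Ω z).compContinuousLinearMap (L z)) y :=
  contDiffAt_alternating_of_apply fun v =>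
    contDiffAt_alternating_apply (v := fun i z => L z (v i)) hΩ
      (fun _ => hL.clm_apply contDiffAt_const)

end ContinuousAlternating

/-! ### Pullback of differential forms. -/

section Pullback

variable {EX HX EY HY EZ HZ : Type*}
  [NormedAddCommGroup EX] [NormedSpace ℝ EX] [TopologicalSpace HX] {IX : ModelWithCorners ℝ EX HX}
  [NormedAddCommGroup EY] [NormedSpace ℝ EY] [TopologicalSpace HY] {IY : ModelWithCorners ℝ EY HY}
  [NormedAddCommGroup EZ] [NormedSpace ℝ EZ] [TopologicalSpace HZ] {IZ : ModelWithCorners ℝ EZ HZ}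
  {X Y Z : Type*} [TopologicalSpace X] [ChartedSpace HX X] [TopologicalSpace Y] [ChartedSpace HY Y]
  [TopologicalSpace Z] [ChartedSpace HZ Z]

/-- The pullback `f^* σ` of a differential form. -/
def pb (IX : ModelWithCorners ℝ EX HX) (IY : ModelWithCorners ℝ EY HY) {k : ℕ} (f : X → Y)
    (σ : ∀ y : Y, TangentSpace IY y [⋀^Fin k]→L[ℝ] ℝ) (x : X) :
    TangentSpace IX x [⋀^Fin k]→L[ℝ] ℝ :=
  (σ (f x)).compContinuousLinearMap (mfderiv IX IY f x)

theorem pb_apply {k : ℕ} (f : X → Y) (σ : ∀ y : Y, TangentSpace IY y [⋀^Fin k]→L[ℝ] ℝ) (x : X)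
    (v : Fin k → TangentSpace IX x) :
    pb IX IY f σ x v = σ (f x) (fun i => mfderiv IX IY f x (v i)) := rfl

theorem pb_comp {k : ℕ} {f : X → Y} {g : Y → Z}
    (σ : ∀ z : Z, TangentSpace IZ z [⋀^Fin k]→L[ℝ] ℝ) {x : X}
    (hg : MDifferentiableAt IY IZ g (f x)) (hf : MDifferentiableAt IX IY f x) :
    pb IX IY f (pb IY IZ g σ) x = pb IX IZ (g ∘ f) σ x := by
  ext v
  simp only [pb_apply, mfderiv_comp x hg hf]
  rfl

theorem pb_congr {k : ℕ} {f g : X → Y} (σ : ∀ y : Y, TangentSpace IY y [⋀^Fin k]→L[ℝ] ℝ) {x : X}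
    (h : f =ᶠ[𝓝 x] g) : pb IX IY f σ x = pb IX IY g σ x := by
  have h1 : mfderiv IX IY f x = mfderiv IX IY g x := h.mfderiv_eq
  -- The two forms live at the points f x and g x; viewing all tangent spaces as the model space
  -- avoids transport between them.
  exact congrArg₂ (fun (y : Y) (L : EX →L[ℝ] EY) =>
    (ContinuousAlternatingMap.compContinuousLinearMap (σ y : EY [⋀^Fin k]→L[ℝ] ℝ) L))
    h.eq_of_nhds h1

end Pullback

/-- The pullback of a form by a map defined on a vector space. -/
def pbE {V EY HY Y : Type*} [NormedAddCommGroup V] [NormedSpace ℝ V]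
    [NormedAddCommGroup EY] [NormedSpace ℝ EY] [TopologicalSpace HY] (IY : ModelWithCorners ℝ EY HY)
    [TopologicalSpace Y] [ChartedSpace HY Y] {k : ℕ} (f : V → Y)
    (σ : ∀ y : Y, TangentSpace IY y [⋀^Fin k]→L[ℝ] ℝ) (x : V) : V [⋀^Fin k]→L[ℝ] ℝ :=
  pb 𝓘(ℝ, V) IY f σ x

theorem pbE_eq_fderiv {V W : Type*} [NormedAddCommGroup V] [NormedSpace ℝ V]
    [NormedAddCommGroup W] [NormedSpace ℝ W] {k : ℕ} (f : V → W) (Ω : W → W [⋀^Fin k]→L[ℝ] ℝ)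
    (x : V) : pbE 𝓘(ℝ, W) f Ω x = (Ω (f x)).compContinuousLinearMap (fderiv ℝ f x) := by
  exact congrArg (fun L : V →L[ℝ] W => (Ω (f x)).compContinuousLinearMap L) mfderiv_eq_fderiv

theorem contDiffAt_pbE {V W : Type*} [NormedAddCommGroup V] [NormedSpace ℝ V]
    [FiniteDimensional ℝ V]
    [NormedAddCommGroup W] [NormedSpace ℝ W] {k : ℕ} {f : V → W} {Ω : W → W [⋀^Fin k]→L[ℝ] ℝ}
    {x : V} (hf : ContDiffAt ℝ ∞ f x) (hΩ : ContDiffAt ℝ ∞ Ω (f x)) :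
    ContDiffAt ℝ ∞ (pbE 𝓘(ℝ, W) f Ω) x := by
  have : pbE 𝓘(ℝ, W) f Ω =
    fun y => (Ω (f y)).compContinuousLinearMap (fderiv ℝ f y) := funext (pbE_eq_fderiv f Ω)
  rw [this]
  exact contDiffAt_compContinuousLinearMap (hΩ.comp x hf) (hf.fderiv_right (by simp))

theorem extDeriv_pbE {V W : Type*} [NormedAddCommGroup V] [NormedSpace ℝ V]
    [NormedAddCommGroup W] [NormedSpace ℝ W] {k : ℕ} {f : V → W} {Ω : W → W [⋀^Fin k]→L[ℝ] ℝ}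
    {x : V} (hf : ContDiffAt ℝ ∞ f x) (hΩ : DifferentiableAt ℝ Ω (f x)) :
    extDeriv (pbE 𝓘(ℝ, W) f Ω) x =
      pbE 𝓘(ℝ, W) f (extDeriv Ω) x := by
  have : pbE 𝓘(ℝ, W) f Ω =
    fun y => (Ω (f y)).compContinuousLinearMap (fderiv ℝ f y) := funext (pbE_eq_fderiv f Ω)
  rw [this, pbE_eq_fderiv]
  refine extDeriv_pullback hΩ hf ?_
  rw [minSmoothness_of_isRCLikeNormedField]
  exact WithTop.coe_le_coe.2 le_top

/-! ### Forms in charts, and naturality of the exterior derivative. -/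

section Charts

variable {n : ℕ} {X : Type*} [TopologicalSpace X] [ChartedSpace (E n) X]

theorem extChartAt_target_eq (c : X) :
    (extChartAt (𝓡 n) c).target = (chartAt (E n) c).target := by
  simp [extChartAt]

theorem IsSmoothForm.contDiffAt {k : ℕ} {σ : Form n X k} (hσ : IsSmoothForm σ) {c : X} {y : E n}
    (hy : y ∈ (chartAt (E n) c).target) : ContDiffAt ℝ ∞ (inChart σ c) y := by
  refine (hσ c).contDiffAt ?_
  rw [extChartAt_target_eq]
  exact (chartAt (E n) c).open_target.mem_nhds hy

variable [IsManifold (𝓡 n) ∞ X]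

theorem contMDiffAt_chart {c x : X} (hx : x ∈ (chartAt (E n) c).source) :
    ContMDiffAt (𝓡 n) (𝓡 n) ∞ (chartAt (E n) c) x :=
  (contMDiffOn_chart (n := ∞) (I := 𝓡 n)).contMDiffAt ((chartAt (E n) c).open_source.mem_nhds hx)

theorem contMDiffAt_chart_symm {c : X} {y : E n} (hy : y ∈ (chartAt (E n) c).target) :
    ContMDiffAt (𝓡 n) (𝓡 n) ∞ (chartAt (E n) c).symm y :=
  (contMDiffOn_chart_symm (n := ∞) (I := 𝓡 n)).contMDiffAt
    ((chartAt (E n) c).open_target.mem_nhds hy)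

/-- The local representative, near `x`, of the pullback of a form by a smooth map `f`. -/
theorem pb_eventuallyEq_inChart {EY HY Y : Type*} [NormedAddCommGroup EY] [NormedSpace ℝ EY]
    [TopologicalSpace HY] {IY : ModelWithCorners ℝ EY HY} [TopologicalSpace Y] [ChartedSpace HY Y]
    [IsManifold IY ∞ Y]
    {k : ℕ} (σ : Form n X k) {f : Y → X} {x : Y} (hf : ContMDiffAt IY (𝓡 n) ∞ f x) :
    ∀ᶠ y in 𝓝 x, pb IY (𝓡 n) f σ y =
      pb IY 𝓘(ℝ, E n) (chartAt (E n) (f x) ∘ f) (inChart σ (f x)) y := by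
  have h0 : ∀ᶠ y in 𝓝 x, f y ∈ (chartAt (E n) (f x)).source :=
    hf.continuousAt.eventually ((chartAt (E n) (f x)).open_source.mem_nhds
      (mem_chart_source (E n) (f x)))
  have h1 : ∀ᶠ y in 𝓝 x, ContMDiffAt IY (𝓡 n) 1 f y :=
    (contMDiffAt_iff_contMDiffAt_nhds (by simp)).1
      (hf.of_le (show (1 : WithTop ℕ∞) ≤ ∞ by exact_mod_cast le_top))
  filter_upwards [h0, h1, h0.eventually_nhds] with y hy hfy hy'
  have h2 : pb IY (𝓡 n) f σ y =
      pb IY (𝓡 n) ((chartAt (E n) (f x)).symm ∘ (chartAt (E n) (f x) ∘ f)) σ y := by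
    apply pb_congr
    filter_upwards [hy'] with z hz
    exact ((chartAt (E n) (f x)).left_inv hz).symm
  rw [h2]
  refine (pb_comp (IX := IY) (IY := 𝓘(ℝ, E n)) (IZ := 𝓡 n)
    (f := chartAt (E n) (f x) ∘ f) (g := (chartAt (E n) (f x)).symm) σ (x := y) ?_ ?_).symm
  · exact (contMDiffAt_chart_symm ((chartAt (E n) (f x)).map_source hy)).mdifferentiableAt (by simp)
  · exact ((contMDiffAt_chart hy).mdifferentiableAt (by simp)).comp y
      (hfy.mdifferentiableAt (by simp))

theorem pbE_eventuallyEq_inChart {V : Type*} [NormedAddCommGroup V] [NormedSpace ℝ V]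
    {k : ℕ} (σ : Form n X k) {f : V → X} {x : V} (hf : ContMDiffAt 𝓘(ℝ, V) (𝓡 n) ∞ f x) :
    pbE (𝓡 n) f σ =ᶠ[𝓝 x]
      pbE 𝓘(ℝ, E n) (chartAt (E n) (f x) ∘ f) (inChart σ (f x)) :=
  pb_eventuallyEq_inChart σ hf

/-- The pullback of a smooth form by a smooth map from a vector space is smooth. -/
theorem IsSmoothForm.contDiffAt_pbE {V : Type*} [NormedAddCommGroup V] [NormedSpace ℝ V]
    [FiniteDimensional ℝ V] {k : ℕ} {σ : Form n X k} (hσ : IsSmoothForm σ) {f : V → X} {x : V}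
    (hf : ContMDiffAt 𝓘(ℝ, V) (𝓡 n) ∞ f x) :
    ContDiffAt ℝ ∞ (pbE (𝓡 n) f σ) x := by
  have hg : ContDiffAt ℝ ∞ (chartAt (E n) (f x) ∘ f) x :=
    ((contMDiffAt_chart (mem_chart_source _ _)).comp x hf).contDiffAt
  refine ContDiffAt.congr_of_eventuallyEq (Inflation.contDiffAt_pbE hg (hσ.contDiffAt ?_))
    (pbE_eventuallyEq_inChart σ hf)
  exact (chartAt (E n) (f x)).map_source (mem_chart_source _ _)

theorem HasExtDeriv.extDeriv_pbE {V : Type*} [NormedAddCommGroup V] [NormedSpace ℝ V]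
    {k : ℕ} {σ : Form n X k} {θ : Form n X (k + 1)}
    (hσ : IsSmoothForm σ) (h : HasExtDeriv σ θ) {f : V → X} {x : V}
    (hf : ContMDiffAt 𝓘(ℝ, V) (𝓡 n) ∞ f x) :
    extDeriv (pbE (𝓡 n) f σ) x =
      pbE (𝓡 n) f θ x := by
  have hg : ContDiffAt ℝ ∞ (chartAt (E n) (f x) ∘ f) x :=
    ((contMDiffAt_chart (mem_chart_source _ _)).comp x hf).contDiffAt
  have hm : chartAt (E n) (f x) (f x) ∈ (chartAt (E n) (f x)).target :=
    (chartAt (E n) (f x)).map_source (mem_chart_source _ _)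
  rw [Filter.EventuallyEq.extDeriv_eq (pbE_eventuallyEq_inChart σ hf),
    Inflation.extDeriv_pbE hg ((hσ.contDiffAt hm).differentiableAt (by simp)),
    (pbE_eventuallyEq_inChart θ hf).self_of_nhds]
  simp only [pbE_eq_fderiv]
  rw [Function.comp_apply, h (f x) _ (by rw [extChartAt_target_eq]; exact hm)]

/-- Pullbacks of smooth forms on manifolds by smooth maps. -/
theorem IsSmoothForm.pb {m : ℕ} {Y : Type*} [TopologicalSpace Y] [ChartedSpace (E m) Y]
    [IsManifold (𝓡 m) ∞ Y] {k : ℕ} {σ : Form n X k} (hσ : IsSmoothForm σ) {f : Y → X}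
    (hf : ContMDiff (𝓡 m) (𝓡 n) ∞ f) : IsSmoothForm (pb (𝓡 m) (𝓡 n) f σ) := by
  intro c y hy
  rw [extChartAt_target_eq] at hy
  have hs := contMDiffAt_chart_symm hy
  refine ContDiffAt.contDiffWithinAt (ContDiffAt.congr_of_eventuallyEq
    (hσ.contDiffAt_pbE (hf.contMDiffAt.comp y hs)) ?_)
  filter_upwards [(chartAt (E m) c).open_target.mem_nhds hy] with z hz
  exact pb_comp σ (hf.contMDiffAt.mdifferentiableAt (by simp))
    ((contMDiffAt_chart_symm hz).mdifferentiableAt (by simp))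

theorem HasExtDeriv.pb {m : ℕ} {Y : Type*} [TopologicalSpace Y] [ChartedSpace (E m) Y]
    [IsManifold (𝓡 m) ∞ Y] {k : ℕ} {σ : Form n X k} {θ : Form n X (k + 1)}
    (hσ : IsSmoothForm σ) (h : HasExtDeriv σ θ) {f : Y → X}
    (hf : ContMDiff (𝓡 m) (𝓡 n) ∞ f) :
    HasExtDeriv (Inflation.pb (𝓡 m) (𝓡 n) f σ) (Inflation.pb (𝓡 m) (𝓡 n) f θ) := by
  intro c y hy
  rw [extChartAt_target_eq] at hy
  have hs := contMDiffAt_chart_symm hy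
  have : inChart (Inflation.pb (𝓡 m) (𝓡 n) f σ) c =ᶠ[𝓝 y]
      fun z => pbE (𝓡 n) (f ∘ (chartAt (E m) c).symm) σ z := by
    filter_upwards [(chartAt (E m) c).open_target.mem_nhds hy] with z hz
    exact pb_comp σ (hf.contMDiffAt.mdifferentiableAt (by simp))
      ((contMDiffAt_chart_symm hz).mdifferentiableAt (by simp))
  rw [this.extDeriv_eq, HasExtDeriv.extDeriv_pbE hσ h (hf.contMDiffAt.comp y hs)]
  exact (pb_comp θ (hf.contMDiffAt.mdifferentiableAt (by simp))
      (hs.mdifferentiableAt (by simp))).symm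

variable {V : Type*} [NormedAddCommGroup V] [NormedSpace ℝ V]

/-- The pullback to `X` of a form on a vector space `V` by `G : X → V`. -/
abbrev vpb {k : ℕ} (G : X → V) (Ω : V → V [⋀^Fin k]→L[ℝ] ℝ) : Form n X k :=
  pb (𝓡 n) 𝓘(ℝ, V) G Ω

theorem inChart_vpb {k : ℕ} {G : X → V} (hG : ContMDiff (𝓡 n) 𝓘(ℝ, V) ∞ G)
    (Ω : V → V [⋀^Fin k]→L[ℝ] ℝ) {c : X} {y : E n} (hy : y ∈ (chartAt (E n) c).target) :
    inChart (vpb G Ω) c y = pbE 𝓘(ℝ, V) (G ∘ (chartAt (E n) c).symm) Ω y :=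
  pb_comp Ω (hG.contMDiffAt.mdifferentiableAt (by simp))
    ((contMDiffAt_chart_symm hy).mdifferentiableAt (by simp))

theorem contDiffAt_comp_chart_symm {G : X → V} (hG : ContMDiff (𝓡 n) 𝓘(ℝ, V) ∞ G) {c : X} {y : E n}
    (hy : y ∈ (chartAt (E n) c).target) : ContDiffAt ℝ ∞ (G ∘ (chartAt (E n) c).symm) y :=
  (hG.contMDiffAt.comp y (contMDiffAt_chart_symm hy)).contDiffAt

theorem isSmoothForm_vpb {k : ℕ} {G : X → V} (hG : ContMDiff (𝓡 n) 𝓘(ℝ, V) ∞ G)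
    {Ω : V → V [⋀^Fin k]→L[ℝ] ℝ} (hΩ : ContDiff ℝ ∞ Ω) : IsSmoothForm (vpb G Ω : Form n X k) := by
  intro c y hy
  rw [extChartAt_target_eq] at hy
  refine ContDiffAt.contDiffWithinAt (ContDiffAt.congr_of_eventuallyEq
    (Inflation.contDiffAt_pbE (contDiffAt_comp_chart_symm hG hy) hΩ.contDiffAt) ?_)
  filter_upwards [(chartAt (E n) c).open_target.mem_nhds hy] with z hz
  exact inChart_vpb hG Ω hz

theorem hasExtDeriv_vpb {k : ℕ} {G : X → V} (hG : ContMDiff (𝓡 n) 𝓘(ℝ, V) ∞ G)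
    {Ω : V → V [⋀^Fin k]→L[ℝ] ℝ} (hΩ : ContDiff ℝ ∞ Ω) :
    HasExtDeriv (vpb G Ω : Form n X k) (vpb G (extDeriv Ω)) := by
  intro c y hy
  rw [extChartAt_target_eq] at hy
  have : inChart (vpb G Ω) c =ᶠ[𝓝 y]
      fun z => pbE 𝓘(ℝ, V) (G ∘ (chartAt (E n) c).symm) Ω z := by
    filter_upwards [(chartAt (E n) c).open_target.mem_nhds hy] with z hz
    exact inChart_vpb hG Ω hz
  rw [this.extDeriv_eq, Inflation.extDeriv_pbE (contDiffAt_comp_chart_symm hG hy)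
    (hΩ.differentiable (by simp)).differentiableAt, inChart_vpb hG _ hy]

end Charts

/-! ### Pointwise algebra of 2-forms and their wedge product. -/

section PairForms

variable {T : Type*} [AddCommGroup T] [Module ℝ T] [TopologicalSpace T]

omit [AddCommGroup T] [Module ℝ T] [TopologicalSpace T] in
theorem update_pair (a b x : T) : Function.update ![a, b] 0 x = ![x, b] := by
  funext i; fin_cases i <;> rfl

theorem form2_add_left (α : T [⋀^Fin 2]→L[ℝ] ℝ) (a a' b : T) :
    α ![a + a', b] = α ![a, b] + α ![a', b] := by
  have := α.map_update_add ![a, b] 0 a a'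
  rwa [update_pair, update_pair, update_pair] at this

theorem form2_smul_left (α : T [⋀^Fin 2]→L[ℝ] ℝ) (r : ℝ) (a b : T) :
    α ![r • a, b] = r * α ![a, b] := by
  have := α.map_update_smul ![a, b] 0 r a
  rwa [update_pair, update_pair] at this

theorem form2_self (α : T [⋀^Fin 2]→L[ℝ] ℝ) (a : T) : α ![a, a] = 0 :=
  α.map_eq_zero_of_eq _ (i := 0) (j := 1) rfl (by decide)

theorem form2_swap (α : T [⋀^Fin 2]→L[ℝ] ℝ) (a b : T) : α ![b, a] = - α ![a, b] := by
  have := form2_self α (a + b)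
  rw [form2_add_left] at this
  have h1 := α.map_update_add ![b, a] 1 a b
  have h2 := α.map_update_add ![a, b] 1 a b
  have e : ∀ x y z : T, Function.update ![x, y] 1 z = ![x, z] := by
    intro x y z; funext i; fin_cases i <;> rfl
  rw [e, e, e] at h1 h2
  rw [h1, h2, form2_self, form2_self] at this
  linarith

theorem form2_add_right (α : T [⋀^Fin 2]→L[ℝ] ℝ) (a b b' : T) :
    α ![a, b + b'] = α ![a, b] + α ![a, b'] := by
  rw [form2_swap, form2_add_left, form2_swap α a b, form2_swap α a b']; ring

theorem form2_smul_right (α : T [⋀^Fin 2]→L[ℝ] ℝ) (r : ℝ) (a b : T) :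
    α ![a, r • b] = r * α ![a, b] := by
  rw [form2_swap, form2_smul_left, form2_swap α a b]; ring

theorem form2_continuous (α : T [⋀^Fin 2]→L[ℝ] ℝ) (i j : Fin 4) :
    Continuous fun v : Fin 4 → T => α ![v i, v j] := by
  refine α.cont.comp (continuous_pi fun k => ?_)
  fin_cases k
  · exact continuous_apply i
  · exact continuous_apply j

/-- The wedge product of two alternating `2`-forms. -/
def wedgeAlt (α β : T [⋀^Fin 2]→L[ℝ] ℝ) : T [⋀^Fin 4]→L[ℝ] ℝ where
  toFun v := α ![v 0, v 1] * β ![v 2, v 3] - α ![v 0, v 2] * β ![v 1, v 3]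
    + α ![v 0, v 3] * β ![v 1, v 2] + α ![v 1, v 2] * β ![v 0, v 3]
    - α ![v 1, v 3] * β ![v 0, v 2] + α ![v 2, v 3] * β ![v 0, v 1]
  map_update_add' := by
    intro dec v i x y
    -- The field quantifies over all decidability instances; only for the standard one does
    -- `Function.update` reduce.
    have hd : dec = instDecidableEqFin 4 := Subsingleton.elim _ _
    subst hd
    fin_cases i <;>
      simp [form2_add_left, form2_add_right, Function.update] <;> ring
  map_update_smul' := by
    intro dec v i x y
    have hd : dec = instDecidableEqFin 4 := Subsingleton.elim _ _
    subst hd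
    fin_cases i <;>
      simp [form2_smul_left, form2_smul_right, Function.update] <;> ring
  map_eq_zero_of_eq' := by
    intro v i j hij hne
    fin_cases i <;> fin_cases j <;> first | exact absurd rfl hne | skip
    all_goals
      simp only [Fin.reduceFinMk, Fin.zero_eta, Fin.mk_one, Fin.isValue] at hij
      simp only [hij, form2_self]
      -- Every pairing is put into increasing order of its indices. Which rewrites apply depends on
      -- the two slots that coincide, hence `try`.
      try rw [form2_swap α (v 0) (v 1)]
      try rw [form2_swap β (v 0) (v 1)]
      try rw [form2_swap α (v 0) (v 2)]
      try rw [form2_swap β (v 0) (v 2)]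
      try rw [form2_swap α (v 0) (v 3)]
      try rw [form2_swap β (v 0) (v 3)]
      try rw [form2_swap α (v 1) (v 2)]
      try rw [form2_swap β (v 1) (v 2)]
      try rw [form2_swap α (v 1) (v 3)]
      try rw [form2_swap β (v 1) (v 3)]
      try rw [form2_swap α (v 2) (v 3)]
      try rw [form2_swap β (v 2) (v 3)]
      try ring
  cont := by
    have := form2_continuous α
    have := form2_continuous β
    fun_prop
end PairForms

/-! ### Coefficients of top-degree forms and their densities. -/

section Coefficients

theorem det_compContinuousLinearMap {n : ℕ} (Ω : E n [⋀^Fin n]→L[ℝ] ℝ) (L : E n →L[ℝ] E n) :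
    Ω.compContinuousLinearMap L (fun i => EuclideanSpace.single i 1) =
      L.det * Ω (fun i => EuclideanSpace.single i 1) := by
  have hb : (fun i => EuclideanSpace.single i (1 : ℝ)) =
      ((EuclideanSpace.basisFun (Fin n) ℝ).toBasis : Fin n → E n) := by
    funext i; simp
  have h := AlternatingMap.eq_smul_basis_det (EuclideanSpace.basisFun (Fin n) ℝ).toBasis
    Ω.toAlternatingMap
  rw [hb]
  change Ω.toAlternatingMap (L.toLinearMap ∘ _) = L.det * Ω.toAlternatingMap _
  rw [h]
  simp only [AlternatingMap.smul_apply, smul_eq_mul, Module.Basis.det_comp,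
    Module.Basis.det_self]
  rw [ContinuousLinearMap.det]
  ring

variable {n : ℕ} {X : Type*} [TopologicalSpace X] [ChartedSpace (E n) X]

/-- The coefficient of a top-degree form with respect to a parametrization. -/
def coef (f : E n → X) (σ : Form n X n) (y : E n) : ℝ :=
  pbE (𝓡 n) f σ y (fun i => EuclideanSpace.single i 1)

variable [IsManifold (𝓡 n) ∞ X]

theorem contMDiffAt_of_mem {Ψ : OpenPartialHomeomorph X (E n)}
    (hΨ : Ψ ∈ IsManifold.maximalAtlas (𝓡 n) ∞ X) {x : X} (hx : x ∈ Ψ.source) :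
    ContMDiffAt (𝓡 n) (𝓡 n) ∞ Ψ x :=
  (contMDiffOn_of_mem_maximalAtlas hΨ).contMDiffAt (Ψ.open_source.mem_nhds hx)

theorem contMDiffAt_symm_of_mem {Ψ : OpenPartialHomeomorph X (E n)}
    (hΨ : Ψ ∈ IsManifold.maximalAtlas (𝓡 n) ∞ X) {y : E n} (hy : y ∈ Ψ.target) :
    ContMDiffAt (𝓡 n) (𝓡 n) ∞ Ψ.symm y :=
  (contMDiffOn_symm_of_mem_maximalAtlas hΨ).contMDiffAt (Ψ.open_target.mem_nhds hy)

theorem contDiffAt_transition {Ψ Φ : OpenPartialHomeomorph X (E n)}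
    (hΨ : Ψ ∈ IsManifold.maximalAtlas (𝓡 n) ∞ X) (hΦ : Φ ∈ IsManifold.maximalAtlas (𝓡 n) ∞ X)
    {y : E n} (hy : y ∈ Ψ.target) (hy' : Ψ.symm y ∈ Φ.source) :
    ContDiffAt ℝ ∞ (Φ ∘ Ψ.symm) y :=
  ((contMDiffAt_of_mem hΦ hy').comp y (contMDiffAt_symm_of_mem hΨ hy)).contDiffAt

theorem pbE_transition {k : ℕ} {Ψ Φ : OpenPartialHomeomorph X (E n)}
    (hΨ : Ψ ∈ IsManifold.maximalAtlas (𝓡 n) ∞ X) (hΦ : Φ ∈ IsManifold.maximalAtlas (𝓡 n) ∞ X)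
    (σ : Form n X k) {y : E n} (hy : y ∈ Ψ.target) (hy' : Ψ.symm y ∈ Φ.source) :
    pbE (𝓡 n) Ψ.symm σ y = (pbE (𝓡 n) Φ.symm σ (Φ (Ψ.symm y))).compContinuousLinearMap
      (fderiv ℝ (Φ ∘ Ψ.symm) y) := by
  have h1 : pbE (𝓡 n) Ψ.symm σ y = pbE (𝓡 n) (Φ.symm ∘ (Φ ∘ Ψ.symm)) σ y := by
    refine pb_congr (IX := 𝓘(ℝ, E n)) σ ?_
    have : ∀ᶠ z in 𝓝 y, Ψ.symm z ∈ Φ.source :=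
      (Ψ.continuousAt_symm hy).eventually (Φ.open_source.mem_nhds hy')
    filter_upwards [this] with z hz
    exact (Φ.left_inv hz).symm
  have h2 := pb_comp (IX := 𝓘(ℝ, E n)) (IY := 𝓘(ℝ, E n)) (IZ := 𝓡 n) (f := Φ ∘ Ψ.symm)
    (g := Φ.symm) σ (x := y)
    ((contMDiffAt_symm_of_mem hΦ (Φ.map_source hy')).mdifferentiableAt (by simp))
    ((contDiffAt_transition hΨ hΦ hy hy').contMDiffAt.mdifferentiableAt (by simp))
  rw [h1]
  exact h2.symm.trans (pbE_eq_fderiv _ (pbE (𝓡 n) Φ.symm σ) y)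

theorem coef_transition {Ψ Φ : OpenPartialHomeomorph X (E n)}
    (hΨ : Ψ ∈ IsManifold.maximalAtlas (𝓡 n) ∞ X) (hΦ : Φ ∈ IsManifold.maximalAtlas (𝓡 n) ∞ X)
    (σ : Form n X n) {y : E n} (hy : y ∈ Ψ.target) (hy' : Ψ.symm y ∈ Φ.source) :
    coef Ψ.symm σ y = (fderiv ℝ (Φ ∘ Ψ.symm) y).det * coef Φ.symm σ (Φ (Ψ.symm y)) := by
  rw [coef, pbE_transition hΨ hΦ σ hy hy', det_compContinuousLinearMap, coef]

theorem det_transition_ne_zero {Ψ Φ : OpenPartialHomeomorph X (E n)}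
    (hΨ : Ψ ∈ IsManifold.maximalAtlas (𝓡 n) ∞ X) (hΦ : Φ ∈ IsManifold.maximalAtlas (𝓡 n) ∞ X)
    {y : E n} (hy : y ∈ Ψ.target) (hy' : Ψ.symm y ∈ Φ.source) :
    (fderiv ℝ (Φ ∘ Ψ.symm) y).det ≠ 0 := by
  have hz : Φ (Ψ.symm y) ∈ Φ.target := Φ.map_source hy'
  have e1 : Φ.symm (Φ (Ψ.symm y)) = Ψ.symm y := Φ.left_inv hy'
  have hz' : Φ.symm (Φ (Ψ.symm y)) ∈ Ψ.source := by rw [e1]; exact Ψ.map_target hy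
  have h1 := (contDiffAt_transition hΨ hΦ hy hy').differentiableAt (by simp)
  have h2 := (contDiffAt_transition hΦ hΨ hz hz').differentiableAt (by simp)
  have h3 : (Ψ ∘ Φ.symm) ∘ (Φ ∘ Ψ.symm) =ᶠ[𝓝 y] id := by
    have : ∀ᶠ z in 𝓝 y, Ψ.symm z ∈ Φ.source :=
      (Ψ.continuousAt_symm hy).eventually (Φ.open_source.mem_nhds hy')
    filter_upwards [this, Ψ.open_target.mem_nhds hy] with z hz hz2
    simp [Φ.left_inv hz, Ψ.right_inv hz2]
  have h4 : (fderiv ℝ (Ψ ∘ Φ.symm) (Φ (Ψ.symm y))).comp (fderiv ℝ (Φ ∘ Ψ.symm) y) =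
      ContinuousLinearMap.id ℝ (E n) := by
    rw [← fderiv_id (x := y), ← h3.fderiv_eq]
    exact (fderiv_comp y h2 h1).symm
  have h5 : (fderiv ℝ (Ψ ∘ Φ.symm) (Φ (Ψ.symm y))).det * (fderiv ℝ (Φ ∘ Ψ.symm) y).det = 1 := by
    have := congrArg ContinuousLinearMap.det h4
    simp only [ContinuousLinearMap.det] at this ⊢
    rw [← LinearMap.det_comp]
    simpa using this
  intro h0
  rw [h0, mul_zero] at h5
  exact zero_ne_one h5

/-- A top-degree form with continuous coefficients. -/
def IsContTop (σ : Form n X n) : Prop :=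
  ∀ Ψ ∈ IsManifold.maximalAtlas (𝓡 n) ∞ X, ContinuousOn (coef Ψ.symm σ) Ψ.target

/-- A nowhere vanishing continuous top-degree form. -/
structure IsVolume (ν : Form n X n) : Prop where
  cont : IsContTop ν
  ne_zero : ∀ Ψ ∈ IsManifold.maximalAtlas (𝓡 n) ∞ X, ∀ y ∈ Ψ.target, coef Ψ.symm ν y ≠ 0

/-- It suffices to look at the preferred chart at its own centre: in any other chart the coefficient
differs by a nonzero Jacobian determinant. -/
theorem isVolume_of_chart {σ : Form n X n} (h : IsContTop σ)
    (h0 : ∀ c : X, coef (chartAt (E n) c).symm σ (chartAt (E n) c c) ≠ 0) : IsVolume σ := by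
  refine ⟨h, fun Ψ hΨ y hy => ?_⟩
  have hΦ : chartAt (E n) (Ψ.symm y) ∈ IsManifold.maximalAtlas (𝓡 n) ∞ X :=
    IsManifold.chart_mem_maximalAtlas _
  rw [coef_transition hΨ hΦ σ hy (mem_chart_source _ _)]
  exact mul_ne_zero (det_transition_ne_zero hΨ hΦ hy (mem_chart_source _ _)) (h0 _)

theorem IsSmoothForm.contDiffAt_pbE_symm {k : ℕ} {σ : Form n X k} (hσ : IsSmoothForm σ)
    {Ψ : OpenPartialHomeomorph X (E n)} (hΨ : Ψ ∈ IsManifold.maximalAtlas (𝓡 n) ∞ X) {y : E n}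
    (hy : y ∈ Ψ.target) : ContDiffAt ℝ ∞ (pbE (𝓡 n) Ψ.symm σ) y :=
  hσ.contDiffAt_pbE (contMDiffAt_symm_of_mem hΨ hy)

theorem continuousAt_alternating_apply {D V : Type*} [TopologicalSpace D] [NormedAddCommGroup V]
    [NormedSpace ℝ V] {k : ℕ} {f : D → V [⋀^Fin k]→L[ℝ] ℝ} {y : D} (h : ContinuousAt f y)
    (v : Fin k → V) : ContinuousAt (fun z => f z v) y :=
  (ContinuousAlternatingMap.apply ℝ V ℝ v).continuous.continuousAt.comp h

theorem IsSmoothForm.isContTop {σ : Form n X n} (hσ : IsSmoothForm σ) : IsContTop σ :=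
  fun _ hΨ _ hy => (continuousAt_alternating_apply
    (hσ.contDiffAt_pbE_symm hΨ hy).continuousAt _).continuousWithinAt

/-- The density of `σ` in a parametrization, for the orientation given by `ν`. -/
def sden (ν σ : Form n X n) (f : E n → X) (y : E n) : ℝ :=
  SignType.sign (coef f ν y) * coef f σ y

/-- The coefficient of σ and the sign of that of ν both change by the Jacobian determinant. Together
they produce its absolute value, the factor in the change of variables formula. -/
theorem sden_transition (ν : Form n X n) {Ψ Φ : OpenPartialHomeomorph X (E n)}
    (hΨ : Ψ ∈ IsManifold.maximalAtlas (𝓡 n) ∞ X) (hΦ : Φ ∈ IsManifold.maximalAtlas (𝓡 n) ∞ X)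
    (σ : Form n X n) {y : E n} (hy : y ∈ Ψ.target) (hy' : Ψ.symm y ∈ Φ.source) :
    sden ν σ Ψ.symm y = |(fderiv ℝ (Φ ∘ Ψ.symm) y).det| * sden ν σ Φ.symm (Φ (Ψ.symm y)) := by
  rw [sden, sden, coef_transition hΨ hΦ σ hy hy', coef_transition hΨ hΦ ν hy hy', sign_mul,
    SignType.coe_mul]
  rw [← sign_mul_self (fderiv ℝ (Φ ∘ Ψ.symm) y).det]
  ring

/-- The orientation sign in a chart is locally constant, so multiplying by it spoils neither
continuity nor derivatives. -/
theorem eventually_sign_eq {ν : Form n X n} (hν : IsVolume ν) {Ψ : OpenPartialHomeomorph X (E n)}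
    (hΨ : Ψ ∈ IsManifold.maximalAtlas (𝓡 n) ∞ X) {y : E n} (hy : y ∈ Ψ.target) :
    ∀ᶠ z in 𝓝 y, SignType.sign (coef Ψ.symm ν z) = SignType.sign (coef Ψ.symm ν y) := by
  have hc : ContinuousAt (coef Ψ.symm ν) y :=
    (hν.cont Ψ hΨ).continuousAt (Ψ.open_target.mem_nhds hy)
  rcases lt_or_gt_of_ne (hν.ne_zero Ψ hΨ y hy) with h | h
  · filter_upwards [hc.eventually (gt_mem_nhds h)] with z hz
    rw [sign_neg hz, sign_neg h]
  · filter_upwards [hc.eventually (lt_mem_nhds h)] with z hz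
    rw [sign_pos hz, sign_pos h]

theorem continuousOn_sden {ν : Form n X n} (hν : IsVolume ν) {σ : Form n X n} (hσ : IsContTop σ)
    {Ψ : OpenPartialHomeomorph X (E n)} (hΨ : Ψ ∈ IsManifold.maximalAtlas (𝓡 n) ∞ X) :
    ContinuousOn (sden ν σ Ψ.symm) Ψ.target := by
  intro y hy
  have h1 : ContinuousAt (coef Ψ.symm σ) y :=
    (hσ Ψ hΨ).continuousAt (Ψ.open_target.mem_nhds hy)
  have h2 : ContinuousAt (fun z => (SignType.sign (coef Ψ.symm ν y) : ℝ) * coef Ψ.symm σ z) y :=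
    continuousAt_const.mul h1
  refine (h2.congr ?_).continuousWithinAt
  filter_upwards [eventually_sign_eq hν hΨ hy] with z hz
  rw [sden, hz]

theorem coef_eq_zero {σ : Form n X n} {f : E n → X} {y : E n} (h : σ (f y) = 0) :
    coef f σ y = 0 := by
  change (σ (f y)) _ = 0
  rw [h]
  rfl

end Coefficients

/-! ### Integration of compactly supported top-degree forms. -/

section Integral

open MeasureTheory

theorem integrableOn_of_continuousOn {n : ℕ} {U K : Set (E n)} (hU : IsOpen U) (hK : IsCompact K)
    (hKU : K ⊆ U) {f : E n → ℝ} (hf : ContinuousOn f U) (h0 : ∀ y ∈ U, y ∉ K → f y = 0) :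
    IntegrableOn f U := by
  refine IntegrableOn.of_forall_sdiff_eq_zero
    ((hf.mono hKU).integrableOn_compact hK) hU.measurableSet ?_
  exact fun y hy => h0 y hy.1 hy.2

variable {n : ℕ} {X : Type*} [TopologicalSpace X] [ChartedSpace (E n) X]
  [T2Space X] [SigmaCompactSpace X] [IsManifold (𝓡 n) ∞ X]

/-- `pos` is the orientation given by the volume form `ν`, on coordinate frames. -/
def OrientedBy (pos : ∀ x : X, (Fin n → TangentSpace (𝓡 n) x) → Prop) (ν : Form n X n) : Prop :=
  ∀ c : X, ∀ y ∈ (chartAt (E n) c).target,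
    pos _ (coordFrame c y) ↔ 0 < coef (chartAt (E n) c).symm ν y

variable {pos : ∀ x : X, (Fin n → TangentSpace (𝓡 n) x) → Prop} {ν : Form n X n}

theorem density_eq_sden (hν : IsVolume ν) (hpos : OrientedBy pos ν) (σ : Form n X n) {c : X}
    {y : E n} (hy : y ∈ (chartAt (E n) c).target) :
    density pos (fun x v => σ x v) c y = sden ν σ (chartAt (E n) c).symm y := by
  have h0 := hν.ne_zero _ (IsManifold.chart_mem_maximalAtlas c) y hy
  rw [density, sden]
  by_cases h : pos _ (coordFrame c y)
  · rw [if_pos h, sign_pos ((hpos c y hy).1 h)]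
    change _ = 1 * _
    rw [one_mul]
    rfl
  · have hn : coef (chartAt (E n) c).symm ν y < 0 :=
      lt_of_le_of_ne (not_lt.1 (fun h' => h ((hpos c y hy).2 h'))) h0
    rw [if_neg h, sign_neg hn]
    change _ = -1 * _
    rw [neg_one_mul]
    rfl

theorem integral_eq_sden (hν : IsVolume ν) (hpos : OrientedBy pos ν) (σ : Form n X n) :
    integral pos (fun x v => σ x v) = ∑ᶠ c : X, ∫ y in (chartAt (E n) c).target,
      chartPartition n X c ((chartAt (E n) c).symm y) * sden ν σ (chartAt (E n) c).symm y := by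
  rw [integral]
  refine finsum_congr fun c => ?_
  rw [extChartAt_target_eq]
  refine setIntegral_congr_fun (chartAt (E n) c).open_target.measurableSet fun y hy => ?_
  simp only [density_eq_sden hν hpos σ hy]
  rfl

theorem chartPartition_finite {K : Set X} (hK : IsCompact K) :
    {c : X | (tsupport (chartPartition n X c) ∩ K).Nonempty}.Finite :=
  (chartPartition n X).locallyFinite.closure.finite_nonempty_inter_compact hK

theorem sden_eq_zero {σ : Form n X n} {f : E n → X} {y : E n} (h : σ (f y) = 0) :
    sden ν σ f y = 0 := by
  rw [sden, coef_eq_zero h, mul_zero]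

theorem chartPartition_eq_zero {c x : X} (h : x ∉ (chartAt (E n) c).source) :
    chartPartition n X c x = 0 := by
  by_contra h0
  exact h (chartPartition_isSubordinate n X c (subset_tsupport _ h0))

/-- A compactly supported top-degree form whose support lies in the domain of a chart can be
integrated in that chart. -/
theorem integral_eq_setIntegral (hν : IsVolume ν) (hpos : OrientedBy pos ν) {σ : Form n X n}
    (hσ : IsContTop σ) {Ψ : OpenPartialHomeomorph X (E n)}
    (hΨ : Ψ ∈ IsManifold.maximalAtlas (𝓡 n) ∞ X) {K : Set X} (hK : IsCompact K)
    (hKΨ : K ⊆ Ψ.source) (hKσ : ∀ x ∉ K, σ x = 0) :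
    integral pos (fun x v => σ x v) = ∫ y in Ψ.target, sden ν σ Ψ.symm y := by
  classical
  -- Each piece is moved from its own chart to Ψ by change of variables on the overlap. Off the
  -- overlap the integrand vanishes, because σ does on one side and the partition function on the
  -- other.
  have key : ∀ c : X, (∫ y in (chartAt (E n) c).target,
      chartPartition n X c ((chartAt (E n) c).symm y) * sden ν σ (chartAt (E n) c).symm y) =
      ∫ y in Ψ.target, chartPartition n X c (Ψ.symm y) * sden ν σ Ψ.symm y := by
    intro c
    set Φ := chartAt (E n) c
    have hΦ : Φ ∈ IsManifold.maximalAtlas (𝓡 n) ∞ X := IsManifold.chart_mem_maximalAtlas c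
    set T := Ψ.symm.trans Φ
    have hTs : T.source ⊆ Ψ.target := by
      intro y hy
      simp only [T, OpenPartialHomeomorph.trans_source] at hy
      exact hy.1
    have hTs' : ∀ y ∈ T.source, Ψ.symm y ∈ Φ.source := by
      intro y hy
      simp only [T, OpenPartialHomeomorph.trans_source] at hy
      exact hy.2
    have hTt : T.target ⊆ Φ.target := by
      intro y hy
      simp only [T, OpenPartialHomeomorph.trans_target] at hy
      exact hy.1
    have h1 : (∫ y in Φ.target, chartPartition n X c (Φ.symm y) * sden ν σ Φ.symm y) =
        ∫ y in T.target, chartPartition n X c (Φ.symm y) * sden ν σ Φ.symm y := by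
      refine setIntegral_eq_of_subset_of_forall_sdiff_eq_zero Φ.open_target.measurableSet hTt ?_
      intro y hy
      rw [sden_eq_zero, mul_zero]
      apply hKσ
      intro hyK
      apply hy.2
      simp only [T, OpenPartialHomeomorph.trans_target]
      exact ⟨hy.1, hKΨ hyK⟩
    have h2 : (∫ y in Ψ.target, chartPartition n X c (Ψ.symm y) * sden ν σ Ψ.symm y) =
        ∫ y in T.source, chartPartition n X c (Ψ.symm y) * sden ν σ Ψ.symm y := by
      refine setIntegral_eq_of_subset_of_forall_sdiff_eq_zero Ψ.open_target.measurableSet hTs ?_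
      intro y hy
      rw [chartPartition_eq_zero, zero_mul]
      intro hyK
      apply hy.2
      simp only [T, OpenPartialHomeomorph.trans_source]
      exact ⟨hy.1, hyK⟩
    rw [h1, h2, integral_target_eq_integral_abs_det_fderiv_smul volume (f := T)
      (f' := fun y => fderiv ℝ (Φ ∘ Ψ.symm) y)]
    · refine setIntegral_congr_fun T.open_source.measurableSet fun y hy => ?_
      have e1 : Φ.symm (T y) = Ψ.symm y := Φ.left_inv (hTs' y hy)
      simp only [smul_eq_mul, e1]
      rw [sden_transition ν hΨ hΦ σ (hTs hy) (hTs' y hy)]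
      change _ * (_ * sden ν σ Φ.symm (Φ (Ψ.symm y))) = _
      ring
    · intro y hy
      exact ((contDiffAt_transition hΨ hΦ (hTs hy) (hTs' y hy)).differentiableAt
        (by simp)).hasFDerivAt
  rw [integral_eq_sden hν hpos, finsum_congr key]
  have hfin := chartPartition_finite (n := n) hK
  have hsup : (Function.support fun c : X =>
      ∫ y in Ψ.target, chartPartition n X c (Ψ.symm y) * sden ν σ Ψ.symm y) ⊆
      (hfin.toFinset : Set X) := by
    intro c hc
    rw [Set.Finite.coe_toFinset]
    by_contra hne
    apply hc
    refine setIntegral_eq_zero_of_forall_eq_zero fun y _ => ?_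
    by_cases hyK : Ψ.symm y ∈ K
    · have : chartPartition n X c (Ψ.symm y) = 0 := by
        by_contra h0
        exact hne ⟨_, subset_tsupport _ h0, hyK⟩
      rw [this, zero_mul]
    · rw [sden_eq_zero (hKσ _ hyK), mul_zero]
  rw [finsum_eq_sum_of_support_subset _ hsup]
  have hc := continuousOn_sden hν hσ hΨ
  rw [← integral_finsetSum]
  · refine setIntegral_congr_fun Ψ.open_target.measurableSet fun y hy => ?_
    simp only [← Finset.sum_mul]
    by_cases hyK : Ψ.symm y ∈ K
    · have h1 : ∑ c ∈ hfin.toFinset, chartPartition n X c (Ψ.symm y) = 1 := by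
        rw [← (chartPartition n X).sum_eq_one (Set.mem_univ (Ψ.symm y))]
        refine (finsum_eq_sum_of_support_subset _ ?_).symm
        intro c hc
        rw [Set.Finite.coe_toFinset]
        exact ⟨_, subset_tsupport _ hc, hyK⟩
      rw [h1, one_mul]
    · rw [sden_eq_zero (hKσ _ hyK), mul_zero]
  · intro c _
    refine integrableOn_of_continuousOn Ψ.open_target (hK.image_of_continuousOn
      (Ψ.continuousOn.mono hKΨ)) ?_ ?_ ?_
    · rintro _ ⟨x, hx, rfl⟩
      exact Ψ.map_source (hKΨ hx)
    · exact ((chartPartition n X c).contMDiff.continuous.comp_continuousOn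
        Ψ.continuousOn_symm).mul hc
    · intro y hy hyK
      rw [sden_eq_zero, mul_zero]
      exact hKσ _ fun h => hyK ⟨_, h, Ψ.right_inv hy⟩

theorem coef_add (f : E n → X) (σ σ' : Form n X n) (y : E n) :
    coef f (σ + σ') y = coef f σ y + coef f σ' y := rfl

theorem coef_smul (f : E n → X) (r : ℝ) (σ : Form n X n) (y : E n) :
    coef f (r • σ) y = r * coef f σ y := rfl

theorem IsContTop.add {σ σ' : Form n X n} (h : IsContTop σ) (h' : IsContTop σ') :
    IsContTop (σ + σ') := fun Ψ hΨ => (h Ψ hΨ).add (h' Ψ hΨ)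

theorem isContTop_zero : IsContTop (0 : Form n X n) := fun _ _ => continuousOn_const

theorem integral_add_form (hν : IsVolume ν) (hpos : OrientedBy pos ν) {σ σ' : Form n X n}
    (hσ : IsContTop σ) (hσ' : IsContTop σ') (hs : HasCompactSuppForm σ)
    (hs' : HasCompactSuppForm σ') :
    integral pos (fun x v => (σ + σ') x v) =
      integral pos (fun x v => σ x v) + integral pos (fun x v => σ' x v) := by
  -- Finiteness is essential: `finsum` is zero on infinite support and would not be additive.
  -- Likewise integrability is needed for additivity of each chart integral.
  have fin : ∀ {σ : Form n X n}, HasCompactSuppForm σ → (Function.support fun c : X =>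
      ∫ y in (chartAt (E n) c).target, chartPartition n X c ((chartAt (E n) c).symm y) *
        sden ν σ (chartAt (E n) c).symm y).Finite := by
    rintro σ ⟨K, hK, hKσ⟩
    refine (chartPartition_finite (n := n) hK).subset fun c hc => ?_
    by_contra hne
    apply hc
    refine setIntegral_eq_zero_of_forall_eq_zero fun y _ => ?_
    by_cases hyK : (chartAt (E n) c).symm y ∈ K
    · have : chartPartition n X c ((chartAt (E n) c).symm y) = 0 := by
        by_contra h0
        exact hne ⟨_, subset_tsupport _ h0, hyK⟩
      rw [this, zero_mul]
    · rw [sden_eq_zero (hKσ _ hyK), mul_zero]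
  have int : ∀ {σ : Form n X n}, IsContTop σ → HasCompactSuppForm σ → ∀ c : X,
      IntegrableOn (fun y => chartPartition n X c ((chartAt (E n) c).symm y) *
        sden ν σ (chartAt (E n) c).symm y) (chartAt (E n) c).target := by
    rintro σ hσ ⟨K, hK, hKσ⟩ c
    have hsub := chartPartition_isSubordinate n X c
    have hK' : IsCompact (tsupport (chartPartition n X c) ∩ K) :=
      hK.inter_left (isClosed_tsupport _)
    refine integrableOn_of_continuousOn (chartAt (E n) c).open_target (hK'.image_of_continuousOn
      ((chartAt (E n) c).continuousOn.mono (Set.inter_subset_left.trans hsub))) ?_ ?_ ?_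
    · rintro _ ⟨x, hx, rfl⟩
      exact (chartAt (E n) c).map_source (hsub hx.1)
    · exact ((chartPartition n X c).contMDiff.continuous.comp_continuousOn
        (chartAt (E n) c).continuousOn_symm).mul
        (continuousOn_sden hν hσ (IsManifold.chart_mem_maximalAtlas c))
    · intro y hy hyK
      by_cases h1 : (chartAt (E n) c).symm y ∈ K
      · have : chartPartition n X c ((chartAt (E n) c).symm y) = 0 := by
          by_contra h0
          exact hyK ⟨_, ⟨subset_tsupport _ h0, h1⟩, (chartAt (E n) c).right_inv hy⟩
        rw [this, zero_mul]
      · rw [sden_eq_zero (hKσ _ h1), mul_zero]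
  rw [integral_eq_sden hν hpos, integral_eq_sden hν hpos, integral_eq_sden hν hpos,
    ← finsum_add_distrib (fin hs) (fin hs')]
  refine finsum_congr fun c => ?_
  rw [← MeasureTheory.integral_add (int hσ hs c) (int hσ' hs' c)]
  congr 1
  funext y
  rw [sden, coef_add, sden, sden]
  ring

/-- No regularity or support condition is needed, since the default value zero of `finsum` and of
the integral is respected by scalar multiplication. -/
theorem integral_smul_form (hν : IsVolume ν) (hpos : OrientedBy pos ν) (σ : Form n X n) (r : ℝ) :
    integral pos (fun x v => (r • σ) x v) = r * integral pos (fun x v => σ x v) := by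
  rw [integral_eq_sden hν hpos, integral_eq_sden hν hpos, ← smul_eq_mul, smul_finsum]
  refine finsum_congr fun c => ?_
  rw [smul_eq_mul, ← MeasureTheory.integral_const_mul]
  congr 1
  funext y
  rw [sden, coef_smul, sden]
  ring

theorem integral_zero_form (hν : IsVolume ν) (hpos : OrientedBy pos ν) :
    integral pos (fun x v => (0 : Form n X n) x v) = 0 := by
  have := integral_smul_form hν hpos (0 : Form n X n) 0
  rwa [smul_zero, zero_mul] at this

theorem HasCompactSuppForm.add {k : ℕ} {σ σ' : Form n X k} (h : HasCompactSuppForm σ)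
    (h' : HasCompactSuppForm σ') : HasCompactSuppForm (σ + σ') := by
  obtain ⟨K, hK, h⟩ := h
  obtain ⟨K', hK', h'⟩ := h'
  refine ⟨K ∪ K', hK.union hK', fun x hx => ?_⟩
  rw [Set.mem_union, not_or] at hx
  rw [Pi.add_apply, h x hx.1, h' x hx.2, add_zero]

theorem integral_sum_form (hν : IsVolume ν) (hpos : OrientedBy pos ν) {ι : Type*} (s : Finset ι)
    {σ : ι → Form n X n} (hσ : ∀ i ∈ s, IsContTop (σ i))
    (hs : ∀ i ∈ s, HasCompactSuppForm (σ i)) :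
    IsContTop (∑ i ∈ s, σ i) ∧ HasCompactSuppForm (∑ i ∈ s, σ i) ∧
    integral pos (fun x v => (∑ i ∈ s, σ i) x v) = ∑ i ∈ s, integral pos (fun x v => σ i x v) := by
  classical
  induction s using Finset.induction_on with
  | empty =>
    rw [Finset.sum_empty, Finset.sum_empty]
    exact ⟨isContTop_zero, ⟨∅, isCompact_empty, fun _ _ => rfl⟩, integral_zero_form hν hpos⟩
  | insert i s hi ih =>
    obtain ⟨h1, h2, h3⟩ := ih (fun j hj => hσ j (Finset.mem_insert_of_mem hj))
      (fun j hj => hs j (Finset.mem_insert_of_mem hj))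
    have h4 := hσ i (Finset.mem_insert_self _ _)
    have h5 := hs i (Finset.mem_insert_self _ _)
    rw [Finset.sum_insert hi, Finset.sum_insert hi, ← h3]
    exact ⟨h4.add h1, h5.add h2, integral_add_form hν hpos h4 h1 h5 h2⟩

end Integral

/-! ### Linearity, locality and existence of the exterior derivative. -/

section FormAlgebra

variable {n : ℕ} {X : Type*} [TopologicalSpace X] [ChartedSpace (E n) X]

theorem inChart_add {k : ℕ} (σ σ' : Form n X k) (c : X) :
    inChart (σ + σ') c = inChart σ c + inChart σ' c := rfl

theorem inChart_smul {k : ℕ} (r : ℝ) (σ : Form n X k) (c : X) :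
    inChart (r • σ) c = r • inChart σ c := rfl

theorem inChart_zero {k : ℕ} (c : X) : inChart (0 : Form n X k) c = 0 := rfl

theorem IsSmoothForm.add {k : ℕ} {σ σ' : Form n X k} (h : IsSmoothForm σ) (h' : IsSmoothForm σ') :
    IsSmoothForm (σ + σ') := fun c => (h c).add (h' c)

theorem IsSmoothForm.smul {k : ℕ} {σ : Form n X k} (h : IsSmoothForm σ) (r : ℝ) :
    IsSmoothForm (r • σ) := fun c => (h c).const_smul r

theorem isSmoothForm_zero {k : ℕ} : IsSmoothForm (0 : Form n X k) := by
  intro c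
  rw [inChart_zero]
  exact contDiffOn_const (c := (0 : E n [⋀^Fin k]→L[ℝ] ℝ))

theorem isSmoothForm_sum {k : ℕ} {ι : Type*} (s : Finset ι) {σ : ι → Form n X k}
    (h : ∀ i ∈ s, IsSmoothForm (σ i)) : IsSmoothForm (∑ i ∈ s, σ i) := by
  classical
  induction s using Finset.induction_on with
  | empty => exact isSmoothForm_zero
  | insert i s hi ih =>
    rw [Finset.sum_insert hi]
    exact (h i (Finset.mem_insert_self _ _)).add
      (ih fun j hj => h j (Finset.mem_insert_of_mem hj))

theorem HasExtDeriv.add {k : ℕ} {σ σ' : Form n X k} {θ θ' : Form n X (k + 1)}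
    (hσ : IsSmoothForm σ) (hσ' : IsSmoothForm σ') (h : HasExtDeriv σ θ) (h' : HasExtDeriv σ' θ') :
    HasExtDeriv (σ + σ') (θ + θ') := by
  intro c y hy
  have hy' := hy
  rw [extChartAt_target_eq] at hy'
  rw [inChart_add, inChart_add, extDeriv_add ((hσ.contDiffAt hy').differentiableAt (by simp))
    ((hσ'.contDiffAt hy').differentiableAt (by simp)), h c y hy, h' c y hy]
  rfl

theorem HasExtDeriv.smul {k : ℕ} {σ : Form n X k} {θ : Form n X (k + 1)}
    (h : HasExtDeriv σ θ) (r : ℝ) : HasExtDeriv (r • σ) (r • θ) := by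
  intro c y hy
  rw [inChart_smul, inChart_smul, extDeriv_smul, h c y hy]
  rfl

theorem extDeriv_zero_form {V : Type*} [NormedAddCommGroup V] [NormedSpace ℝ V] {k : ℕ} (y : V) :
    extDeriv (0 : V → V [⋀^Fin k]→L[ℝ] ℝ) y = 0 := by
  have h := extDeriv_smul (x := y) (0 : ℝ) (0 : V → V [⋀^Fin k]→L[ℝ] ℝ)
  rwa [zero_smul, zero_smul] at h

theorem hasExtDeriv_zero {k : ℕ} : HasExtDeriv (0 : Form n X k) 0 := by
  intro c y _
  rw [inChart_zero, inChart_zero, extDeriv_zero_form]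
  rfl

theorem HasExtDeriv.sum {k : ℕ} {ι : Type*} (s : Finset ι) {σ : ι → Form n X k}
    {θ : ι → Form n X (k + 1)} (hσ : ∀ i ∈ s, IsSmoothForm (σ i))
    (h : ∀ i ∈ s, HasExtDeriv (σ i) (θ i)) : HasExtDeriv (∑ i ∈ s, σ i) (∑ i ∈ s, θ i) := by
  classical
  induction s using Finset.induction_on with
  | empty => exact hasExtDeriv_zero
  | insert i s hi ih =>
    rw [Finset.sum_insert hi, Finset.sum_insert hi]
    exact HasExtDeriv.add (hσ i (Finset.mem_insert_self _ _))
      (isSmoothForm_sum s fun j hj => hσ j (Finset.mem_insert_of_mem hj))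
      (h i (Finset.mem_insert_self _ _))
      (ih (fun j hj => hσ j (Finset.mem_insert_of_mem hj))
        fun j hj => h j (Finset.mem_insert_of_mem hj))

variable [IsManifold (𝓡 n) ∞ X]

theorem form_eq_pb_inChart {k : ℕ} (σ : Form n X k) {c x : X}
    (hx : x ∈ (chartAt (E n) c).source) :
    σ x = pb (𝓡 n) 𝓘(ℝ, E n) (chartAt (E n) c) (inChart σ c) x := by
  have h1 := pb_comp (IX := 𝓡 n) (IY := 𝓘(ℝ, E n)) (IZ := 𝓡 n) (f := chartAt (E n) c)
    (g := (chartAt (E n) c).symm) σ (x := x)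
    ((contMDiffAt_chart_symm ((chartAt (E n) c).map_source hx)).mdifferentiableAt (by simp))
    ((contMDiffAt_chart hx).mdifferentiableAt (by simp))
  refine Eq.trans ?_ h1.symm
  have h2 : pb (𝓡 n) (𝓡 n) ((chartAt (E n) c).symm ∘ chartAt (E n) c) σ x =
      pb (𝓡 n) (𝓡 n) id σ x := by
    apply pb_congr
    filter_upwards [(chartAt (E n) c).open_source.mem_nhds hx] with z hz
    exact (chartAt (E n) c).left_inv hz
  rw [h2]
  ext v
  rw [pb_apply, mfderiv_id]
  rfl

theorem form_eq_of_inChart_eq {k : ℕ} {σ σ' : Form n X k} {c x : X}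
    (hx : x ∈ (chartAt (E n) c).source)
    (h : inChart σ c (chartAt (E n) c x) = inChart σ' c (chartAt (E n) c x)) : σ x = σ' x := by
  rw [form_eq_pb_inChart σ hx, form_eq_pb_inChart σ' hx]
  exact congrArg (fun τ : E n [⋀^Fin k]→L[ℝ] ℝ =>
    τ.compContinuousLinearMap (mfderiv (𝓡 n) 𝓘(ℝ, E n) (chartAt (E n) c) x)) h

/-- The derivative in a chart depends on the germ alone. This yields uniqueness, and lets d be
computed for forms that are known explicitly only near a point. -/
theorem HasExtDeriv.eq_of_eventuallyEq {k : ℕ} {σ σ' : Form n X k} {θ θ' : Form n X (k + 1)}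
    (h : HasExtDeriv σ θ) (h' : HasExtDeriv σ' θ') {x : X} (hx : ∀ᶠ z in 𝓝 x, σ z = σ' z) :
    θ x = θ' x := by
  have hxs := mem_chart_source (E n) x
  have hy := (chartAt (E n) x).map_source hxs
  refine form_eq_of_inChart_eq hxs ?_
  have hy' := hy
  rw [← extChartAt_target_eq] at hy'
  rw [← h x _ hy', ← h' x _ hy']
  refine Filter.EventuallyEq.extDeriv_eq ?_
  have hc := (chartAt (E n) x).continuousAt_symm hy
  rw [ContinuousAt, (chartAt (E n) x).left_inv hxs] at hc
  filter_upwards [hc.eventually hx] with z hz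
  change (σ _).compContinuousLinearMap _ = (σ' _).compContinuousLinearMap _
  exact congrArg (fun τ : TangentSpace (𝓡 n) ((chartAt (E n) x).symm z) [⋀^Fin k]→L[ℝ] ℝ =>
    τ.compContinuousLinearMap (mfderiv 𝓘(ℝ, E n) (𝓡 n) (chartAt (E n) x).symm z)) hz

theorem HasExtDeriv.unique {k : ℕ} {σ : Form n X k} {θ θ' : Form n X (k + 1)}
    (h : HasExtDeriv σ θ) (h' : HasExtDeriv σ θ') : θ = θ' :=
  funext fun _ => h.eq_of_eventuallyEq h' (Filter.Eventually.of_forall fun _ => rfl)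

theorem contDiffAt_extDeriv {V : Type*} [NormedAddCommGroup V] [NormedSpace ℝ V] {k : ℕ}
    {Ω : V → V [⋀^Fin k]→L[ℝ] ℝ} {y : V} (h : ContDiffAt ℝ ∞ Ω y) :
    ContDiffAt ℝ ∞ (extDeriv Ω) y := by
  have hb : IsBoundedLinearMap ℝ (fun f : V →L[ℝ] V [⋀^Fin k]→L[ℝ] ℝ =>
      ContinuousAlternatingMap.alternatizeUncurryFin f) :=
    ⟨⟨ContinuousAlternatingMap.alternatizeUncurryFin_add,
      ContinuousAlternatingMap.alternatizeUncurryFin_smul⟩, k + 1, by positivity,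
      ContinuousAlternatingMap.norm_alternatizeUncurryFin_le⟩
  exact hb.contDiff.contDiffAt.comp y (h.fderiv_right (m := ∞) (by simp))

/-- Every smooth form has an exterior derivative. -/
theorem exists_hasExtDeriv {k : ℕ} {σ : Form n X k} (hσ : IsSmoothForm σ) :
    ∃ θ : Form n X (k + 1), IsSmoothForm θ ∧ HasExtDeriv σ θ := by
  -- At each point the derivative is computed in the preferred chart there. Naturality of `extDeriv`
  -- under transition maps shows that every other chart gives the same answer.
  let θ : Form n X (k + 1) := fun x =>
    pb (𝓡 n) 𝓘(ℝ, E n) (chartAt (E n) x) (extDeriv (inChart σ x)) x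
  have hd : HasExtDeriv σ θ := by
    intro c y hy
    rw [extChartAt_target_eq] at hy
    set x := (chartAt (E n) c).symm y with hx
    have h1 := pbE_eventuallyEq_inChart σ (contMDiffAt_chart_symm hy)
    have hg : ContDiffAt ℝ ∞ (chartAt (E n) x ∘ (chartAt (E n) c).symm) y :=
      ((contMDiffAt_chart (mem_chart_source _ _)).comp y (contMDiffAt_chart_symm hy)).contDiffAt
    have hm : chartAt (E n) x x ∈ (chartAt (E n) x).target :=
      (chartAt (E n) x).map_source (mem_chart_source _ _)
    have h2 : extDeriv (inChart σ c) y =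
        pbE 𝓘(ℝ, E n) (chartAt (E n) x ∘ (chartAt (E n) c).symm) (extDeriv (inChart σ x)) y := by
      rw [← extDeriv_pbE hg ((hσ.contDiffAt hm).differentiableAt (by simp))]
      exact h1.extDeriv_eq
    rw [h2]
    exact (pb_comp (IX := 𝓘(ℝ, E n)) (IY := 𝓡 n) (IZ := 𝓘(ℝ, E n)) (extDeriv (inChart σ x))
      ((contMDiffAt_chart (mem_chart_source _ _)).mdifferentiableAt (by simp))
      ((contMDiffAt_chart_symm hy).mdifferentiableAt (by simp))).symm
  refine ⟨θ, fun c y hy => ?_, hd⟩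
  have hy' := hy
  rw [extChartAt_target_eq] at hy'
  refine ((contDiffAt_extDeriv (hσ.contDiffAt hy')).congr_of_eventuallyEq ?_).contDiffWithinAt
  filter_upwards [(chartAt (E n) c).open_target.mem_nhds hy'] with z hz
  exact (hd c z (by rwa [extChartAt_target_eq])).symm

/-- The product of a function and a form. -/
def fsmul {k : ℕ} (f : X → ℝ) (σ : Form n X k) : Form n X k := fun x => f x • σ x

theorem inChart_fsmul {k : ℕ} (f : X → ℝ) (σ : Form n X k) (c : X) (y : E n) :
    inChart (fsmul f σ) c y = f ((chartAt (E n) c).symm y) • inChart σ c y := rfl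

theorem IsSmoothForm.fsmul {k : ℕ} {σ : Form n X k} (hσ : IsSmoothForm σ) {f : X → ℝ}
    (hf : ContMDiff (𝓡 n) 𝓘(ℝ, ℝ) ∞ f) : IsSmoothForm (fsmul f σ) := by
  intro c y hy
  rw [extChartAt_target_eq] at hy
  exact ((contDiffAt_comp_chart_symm hf hy).smul (hσ.contDiffAt hy)).contDiffWithinAt

end FormAlgebra

/-! ### Exterior derivatives of 1-forms and 2-forms in coordinates. -/

section Coordinates

variable {V : Type*} [NormedAddCommGroup V] [NormedSpace ℝ V]

theorem extDeriv_one_apply {γ : V → V [⋀^Fin 1]→L[ℝ] ℝ} {y : V} (h : DifferentiableAt ℝ γ y)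
    (v w : V) : extDeriv γ y ![v, w] =
      fderiv ℝ (fun z => γ z ![w]) y v - fderiv ℝ (fun z => γ z ![v]) y w := by
  have e0 : (0 : Fin 2).removeNth ![v, w] = ![w] := by
    funext i; fin_cases i; rfl
  have e1 : (1 : Fin 2).removeNth ![v, w] = ![v] := by
    funext i; fin_cases i; rfl
  rw [extDeriv_apply h, Fin.sum_univ_two, e0, e1]
  simp
  ring

theorem extDeriv_two_apply {ζ : V → V [⋀^Fin 2]→L[ℝ] ℝ} {y : V} (h : DifferentiableAt ℝ ζ y)
    (u v w : V) : extDeriv ζ y ![u, v, w] =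
      fderiv ℝ (fun z => ζ z ![v, w]) y u - fderiv ℝ (fun z => ζ z ![u, w]) y v +
        fderiv ℝ (fun z => ζ z ![u, v]) y w := by
  have e0 : (0 : Fin 3).removeNth ![u, v, w] = ![v, w] := by
    funext i; fin_cases i <;> rfl
  have e1 : (1 : Fin 3).removeNth ![u, v, w] = ![u, w] := by
    funext i; fin_cases i <;> rfl
  have e2 : (2 : Fin 3).removeNth ![u, v, w] = ![u, v] := by
    funext i; fin_cases i <;> rfl
  rw [extDeriv_apply h, Fin.sum_univ_three, e0, e1, e2]
  simp
  ring

end Coordinates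

/-! ### Stokes' theorem for divergences in charts. -/

section Stokes

open MeasureTheory

theorem integral_fderiv_eq_zero {n : ℕ} {h : E n → ℝ} (hh : ContDiff ℝ 1 h)
    (hs : HasCompactSupport h) (v : E n) : ∫ y, fderiv ℝ h y v = 0 := by
  have hi : Integrable (fun y => fderiv ℝ h y v) :=
    ((hh.continuous_fderiv (by simp)).clm_apply continuous_const).integrable_of_hasCompactSupport
      (hs.fderiv_apply ℝ v)
  -- Integration by parts against the constant function 1.
  have := integral_mul_fderiv_eq_neg_fderiv_mul_of_integrable (μ := volume) (f := fun _ : E n => (1 : ℝ))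
    (g := h) (v := v) (by simp) (by simpa using hi)
    (by simpa using hh.continuous.integrable_of_hasCompactSupport hs) (by simp)
    (fun x _ => (hh.differentiable (by simp)).differentiableAt)
  simpa using this

variable {n : ℕ} {X : Type*} [TopologicalSpace X] [ChartedSpace (E n) X]
  [T2Space X] [SigmaCompactSpace X] [IsManifold (𝓡 n) ∞ X]
  {pos : ∀ x : X, (Fin n → TangentSpace (𝓡 n) x) → Prop} {ν : Form n X n}

/-- The integral of a divergence which is compactly supported in a chart vanishes. -/
theorem setIntegral_sden_eq_zero (hν : IsVolume ν) {c : X} {σ : Form n X n}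
    {K : Set (E n)} (hK : IsCompact K) (hKc : K ⊆ (chartAt (E n) c).target)
    {g : Fin n → E n → ℝ} (hg : ∀ i, ∀ y ∈ (chartAt (E n) c).target, ContDiffAt ℝ 1 (g i) y)
    (hg0 : ∀ i, ∀ y ∈ (chartAt (E n) c).target, y ∉ K → g i y = 0)
    (hσ : ∀ y ∈ (chartAt (E n) c).target, coef (chartAt (E n) c).symm σ y =
      ∑ i, fderiv ℝ (g i) y (EuclideanSpace.single i 1)) :
    ∫ y in (chartAt (E n) c).target, sden ν σ (chartAt (E n) c).symm y = 0 := by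
  classical
  set Φ := chartAt (E n) c
  have hΦ : Φ ∈ IsManifold.maximalAtlas (𝓡 n) ∞ X := IsManifold.chart_mem_maximalAtlas c
  -- The orientation sign is absorbed into the functions, which are then extended by zero to all of
  -- ℝⁿ; they stay continuously differentiable because the sign is locally constant and K is a
  -- compact subset of the chart.
  let h : Fin n → E n → ℝ := fun i y =>
    if y ∈ Φ.target then (SignType.sign (coef Φ.symm ν y) : ℝ) * g i y else 0
  have hin : ∀ i, ∀ y ∈ Φ.target, h i =ᶠ[𝓝 y]
      fun z => (SignType.sign (coef Φ.symm ν y) : ℝ) * g i z := by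
    intro i y hy
    filter_upwards [Φ.open_target.mem_nhds hy, eventually_sign_eq hν hΦ hy] with z hz hz2
    simp only [h, if_pos hz, hz2]
  have hout : ∀ i, ∀ y ∉ K, h i y = 0 := by
    intro i y hy
    by_cases hyt : y ∈ Φ.target
    · simp only [h, if_pos hyt, hg0 i y hyt hy, mul_zero]
    · simp only [h, if_neg hyt]
  have hout' : ∀ i, ∀ y ∉ K, h i =ᶠ[𝓝 y] fun _ => 0 := by
    intro i y hy
    filter_upwards [hK.isClosed.isOpen_compl.mem_nhds hy] with z hz
    exact hout i z hz
  have hsm : ∀ i, ContDiff ℝ 1 (h i) := by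
    intro i
    rw [contDiff_iff_contDiffAt]
    intro y
    by_cases hy : y ∈ K
    · exact (contDiffAt_const.mul (hg i y (hKc hy))).congr_of_eventuallyEq (hin i y (hKc hy))
    · exact contDiffAt_const.congr_of_eventuallyEq (hout' i y hy)
  have hcs : ∀ i, HasCompactSupport (h i) := fun i => HasCompactSupport.intro hK (hout i)
  have h1 : ∀ y ∈ Φ.target, sden ν σ Φ.symm y =
      ∑ i, fderiv ℝ (h i) y (EuclideanSpace.single i 1) := by
    intro y hy
    rw [sden, hσ y hy, Finset.mul_sum]
    refine Finset.sum_congr rfl fun i _ => ?_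
    rw [(hin i y hy).fderiv_eq, fderiv_const_mul ((hg i y hy).differentiableAt (by simp))]
    rfl
  rw [setIntegral_congr_fun Φ.open_target.measurableSet h1,
    setIntegral_eq_integral_of_forall_compl_eq_zero, integral_finsetSum]
  · exact Finset.sum_eq_zero fun i _ => integral_fderiv_eq_zero (hsm i) (hcs i) _
  · intro i _
    exact (((hsm i).continuous_fderiv (by simp)).clm_apply
      continuous_const).integrable_of_hasCompactSupport ((hcs i).fderiv_apply ℝ _)
  · intro y hy
    refine Finset.sum_eq_zero fun i _ => ?_
    rw [(hout' i y fun hyK => hy (hKc hyK)).fderiv_eq]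
    simp

/-- Stokes' theorem for top-degree forms which are obtained by a pointwise linear operation `A` from
the exterior derivative of a compactly supported `1`-form, provided that they are divergences in
local coordinates. -/
theorem integral_eq_zero_of_hasExtDeriv (hν : IsVolume ν) (hpos : OrientedBy pos ν)
    (A : ∀ x : X, (TangentSpace (𝓡 n) x [⋀^Fin 2]→L[ℝ] ℝ) →+ (TangentSpace (𝓡 n) x [⋀^Fin n]→L[ℝ] ℝ))
    (hA : ∀ θ : Form n X 2, IsSmoothForm θ → IsContTop (fun x => A x (θ x)))
    (hdiv : ∀ (c : X) (γ : Form n X 1) (θ : Form n X 2), IsSmoothForm γ → HasExtDeriv γ θ →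
      ∃ g : Fin n → E n → ℝ, (∀ i, ∀ y ∈ (chartAt (E n) c).target, ContDiffAt ℝ 1 (g i) y) ∧
        (∀ i y, inChart γ c y = 0 → g i y = 0) ∧
        ∀ y ∈ (chartAt (E n) c).target, coef (chartAt (E n) c).symm (fun x => A x (θ x)) y =
          ∑ i, fderiv ℝ (g i) y (EuclideanSpace.single i 1))
    {γ : Form n X 1} {θ : Form n X 2} (hγ : IsSmoothForm γ) (hγs : HasCompactSuppForm γ)
    (hθ : HasExtDeriv γ θ) : integral pos (fun x v => (A x (θ x)) v) = 0 := by
  obtain ⟨K, hK, hKγ⟩ := hγs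
  have hfin := chartPartition_finite (n := n) hK
  -- A partition of unity splits the 1-form into pieces supported in single charts. Additivity of A
  -- carries the splitting over to the top-degree form.
  let γc : X → Form n X 1 := fun c => fsmul (chartPartition n X c) γ
  have hγc : ∀ c, IsSmoothForm (γc c) := fun c => hγ.fsmul (chartPartition n X c).contMDiff
  choose θc hθcs hθc using fun c => exists_hasExtDeriv (hγc c)
  have hzero : ∀ c, ∀ x ∉ tsupport (chartPartition n X c) ∩ K, θc c x = 0 := by
    intro c x hx
    refine (hθc c).eq_of_eventuallyEq hasExtDeriv_zero ?_
    have hcl : IsClosed (tsupport (chartPartition n X c) ∩ K) :=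
      (isClosed_tsupport _).inter hK.isClosed
    filter_upwards [hcl.isOpen_compl.mem_nhds hx] with z hz
    change chartPartition n X c z • γ z = 0
    by_cases hzK : z ∈ K
    · have : chartPartition n X c z = 0 := by
        by_contra h0
        exact hz ⟨subset_tsupport _ h0, hzK⟩
      rw [this, zero_smul]
    · rw [hKγ z hzK, smul_zero]
  have hsum : γ = ∑ c ∈ hfin.toFinset, γc c := by
    funext x
    rw [Finset.sum_apply]
    change γ x = ∑ c ∈ hfin.toFinset, chartPartition n X c x • γ x
    rw [← Finset.sum_smul]
    by_cases hx : x ∈ K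
    · have h1 : ∑ c ∈ hfin.toFinset, chartPartition n X c x = 1 := by
        rw [← (chartPartition n X).sum_eq_one (Set.mem_univ x)]
        refine (finsum_eq_sum_of_support_subset _ ?_).symm
        intro c hc
        rw [Set.Finite.coe_toFinset]
        exact ⟨_, subset_tsupport _ hc, hx⟩
      rw [h1, one_smul]
    · rw [hKγ x hx, smul_zero]
  have hθsum : θ = ∑ c ∈ hfin.toFinset, θc c := by
    have h2 := HasExtDeriv.sum hfin.toFinset (fun c _ => hγc c) (fun c _ => hθc c)
    rw [← hsum] at h2
    exact hθ.unique h2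
  have hAsum : (fun x => A x (θ x)) = ∑ c ∈ hfin.toFinset, fun x => A x (θc c x) := by
    funext x
    rw [hθsum, Finset.sum_apply, Finset.sum_apply, map_sum]
  have hAK : ∀ c, ∀ x ∉ tsupport (chartPartition n X c) ∩ K, A x (θc c x) = 0 := by
    intro c x hx
    rw [hzero c x hx, map_zero]
  have hKc : ∀ c, IsCompact (tsupport (chartPartition n X c) ∩ K) := fun c =>
    hK.inter_left (isClosed_tsupport _)
  have h3 := integral_sum_form hν hpos hfin.toFinset (σ := fun c x => A x (θc c x))
    (fun c _ => hA _ (hθcs c)) (fun c _ => ⟨_, hKc c, hAK c⟩)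
  have h4 : integral pos (fun x v => (A x (θ x)) v) =
      integral pos (fun x v => (∑ c ∈ hfin.toFinset, fun x => A x (θc c x)) x v) := by
    rw [← hAsum]
  rw [h4, h3.2.2]
  refine Finset.sum_eq_zero fun c _ => ?_
  have hsub := chartPartition_isSubordinate n X c
  have hΦ : chartAt (E n) c ∈ IsManifold.maximalAtlas (𝓡 n) ∞ X :=
    IsManifold.chart_mem_maximalAtlas c
  rw [integral_eq_setIntegral hν hpos (hA _ (hθcs c)) hΦ (hKc c)
    (Set.inter_subset_left.trans hsub) (hAK c)]
  obtain ⟨g, hg1, hg2, hg3⟩ := hdiv c (γc c) (θc c) (hγc c) (hθc c)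
  refine setIntegral_sden_eq_zero hν ((hKc c).image_of_continuousOn
    ((chartAt (E n) c).continuousOn.mono (Set.inter_subset_left.trans hsub))) ?_ hg1 ?_ hg3
  · rintro _ ⟨x, hx, rfl⟩
    exact (chartAt (E n) c).map_source (hsub hx.1)
  · intro i y hy hyK
    apply hg2
    rw [inChart_fsmul]
    by_cases h1 : (chartAt (E n) c).symm y ∈ K
    · have : chartPartition n X c ((chartAt (E n) c).symm y) = 0 := by
        by_contra h0
        exact hyK ⟨_, ⟨subset_tsupport _ h0, h1⟩, (chartAt (E n) c).right_inv hy⟩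
      rw [this, zero_smul]
    · have h5 := hKγ _ h1
      have h6 : inChart γ c y = 0 := by
        change (γ ((chartAt (E n) c).symm y)).compContinuousLinearMap _ = 0
        rw [h5]
        rfl
      rw [h6, smul_zero]

end Stokes

/-! ### Linear algebra of tame 2-forms on a four-dimensional space. -/

section TamePoint

variable {T : Type*} [AddCommGroup T] [Module ℝ T] [TopologicalSpace T]

theorem wedgeAlt_apply (α β : T [⋀^Fin 2]→L[ℝ] ℝ) (v : Fin 4 → T) :
    wedgeAlt α β v = α ![v 0, v 1] * β ![v 2, v 3] - α ![v 0, v 2] * β ![v 1, v 3]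
    + α ![v 0, v 3] * β ![v 1, v 2] + α ![v 1, v 2] * β ![v 0, v 3]
    - α ![v 1, v 3] * β ![v 0, v 2] + α ![v 2, v 3] * β ![v 0, v 1] := rfl

theorem wedgeAlt_comm (α β : T [⋀^Fin 2]→L[ℝ] ℝ) : wedgeAlt α β = wedgeAlt β α := by
  ext v
  rw [wedgeAlt_apply, wedgeAlt_apply]
  ring

theorem wedgeAlt_add_right (α β β' : T [⋀^Fin 2]→L[ℝ] ℝ) :
    wedgeAlt α (β + β') = wedgeAlt α β + wedgeAlt α β' := by
  ext v
  simp only [wedgeAlt_apply, ContinuousAlternatingMap.add_apply]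
  ring

theorem wedgeAlt_smul_right (r : ℝ) (α β : T [⋀^Fin 2]→L[ℝ] ℝ) :
    wedgeAlt α (r • β) = r • wedgeAlt α β := by
  ext v
  simp only [wedgeAlt_apply, ContinuousAlternatingMap.smul_apply, smul_eq_mul]
  ring

theorem wedgeAlt_zero_right (α : T [⋀^Fin 2]→L[ℝ] ℝ) : wedgeAlt α 0 = 0 := by
  ext v
  simp [wedgeAlt_apply]

theorem wedgeAlt_add_left (α α' β : T [⋀^Fin 2]→L[ℝ] ℝ) :
    wedgeAlt (α + α') β = wedgeAlt α β + wedgeAlt α' β := by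
  rw [wedgeAlt_comm, wedgeAlt_add_right, wedgeAlt_comm β, wedgeAlt_comm β]

theorem wedgeAlt_smul_left (r : ℝ) (α β : T [⋀^Fin 2]→L[ℝ] ℝ) :
    wedgeAlt (r • α) β = r • wedgeAlt α β := by
  rw [wedgeAlt_comm, wedgeAlt_smul_right, wedgeAlt_comm]

theorem wedgeAlt_zero_left (β : T [⋀^Fin 2]→L[ℝ] ℝ) : wedgeAlt 0 β = 0 := by
  rw [wedgeAlt_comm, wedgeAlt_zero_right]

/-- The value on `(v, Jv)` of a two-form, for `v` a combination of `e, Je, f, Jf`. -/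
theorem wedgeAlt_self_pos {τ : T [⋀^Fin 2]→L[ℝ] ℝ} {J : T →L[ℝ] T} (hJ : ∀ v, J (J v) = -v)
    (hτ : ∀ v, v ≠ 0 → 0 < τ ![v, J v]) {e f : T} (hf : f ≠ 0)
    (hef : ∀ x y : ℝ, e ≠ x • f + y • J f) : 0 < wedgeAlt τ τ ![e, J e, f, J f] := by
  have h0 := hτ f hf
  -- Up to the factor 2τ(f, Jf), which clears denominators, this vector minimizes the quadratic form
  -- v ↦ τ(v, Jv) on the affine plane e + span(f, Jf). Positivity there is the discriminant
  -- inequality needed below.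
  have hv : (2 * τ ![f, J f]) • e + (-(τ ![e, J f] - τ ![J e, f])) • f +
      (τ ![e, f] + τ ![J e, J f]) • J f ≠ 0 := by
    intro h
    apply hef ((2 * τ ![f, J f])⁻¹ * (τ ![e, J f] - τ ![J e, f]))
      (-((2 * τ ![f, J f])⁻¹ * (τ ![e, f] + τ ![J e, J f])))
    have h2 : (2 * τ ![f, J f]) • e = (τ ![e, J f] - τ ![J e, f]) • f -
        (τ ![e, f] + τ ![J e, J f]) • J f := by
      rw [← sub_eq_zero, ← h]
      module
    have h3 : e = (2 * τ ![f, J f])⁻¹ • ((2 * τ ![f, J f]) • e) := by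
      rw [smul_smul, inv_mul_cancel₀ (by positivity), one_smul]
    refine h3.trans ?_
    rw [h2]
    module
  have h1 := hτ _ hv
  have key : τ ![(2 * τ ![f, J f]) • e + (-(τ ![e, J f] - τ ![J e, f])) • f +
      (τ ![e, f] + τ ![J e, J f]) • J f, J ((2 * τ ![f, J f]) • e +
      (-(τ ![e, J f] - τ ![J e, f])) • f + (τ ![e, f] + τ ![J e, J f]) • J f)] =
      τ ![f, J f] * (4 * τ ![e, J e] * τ ![f, J f] - (τ ![e, J f] - τ ![J e, f]) ^ 2 -
        (τ ![e, f] + τ ![J e, J f]) ^ 2) := by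
    simp only [map_add, map_smul, hJ, form2_add_left, form2_add_right, form2_smul_left,
      form2_smul_right, ← neg_one_smul ℝ f, form2_self]
    rw [form2_swap τ f (J e), form2_swap τ (J f) f, form2_swap τ (J f) (J e)]
    ring
  rw [key] at h1
  have h2 := pos_of_mul_pos_right h1 h0.le
  rw [wedgeAlt_apply]
  simp only [Matrix.cons_val]
  -- The squares (τ(e,f)+τ(Je,Jf))² and (τ(e,Jf)−τ(Je,f))² dominate 4τ(e,f)τ(Je,Jf) and
  -- −4τ(e,Jf)τ(Je,f), the cross terms of 2(τ∧τ).
  nlinarith [sq_nonneg (τ ![e, f] - τ ![J e, J f]), sq_nonneg (τ ![e, J f] + τ ![J e, f])]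

/-- In complex notation a relation reads (g₀+ig₁)e + (g₂+ig₃)f = 0. Multiplying by g₂ − ig₃ would
solve it for f unless g₂ = g₃ = 0; then multiplying by g₀ − ig₁ kills the rest. -/
theorem linearIndependent_complex_pair {J : T →L[ℝ] T} (hJ : ∀ v, J (J v) = -v) {e f : T}
    (he : e ≠ 0) (hfe : ∀ x y : ℝ, f ≠ x • e + y • J e) :
    LinearIndependent ℝ ![e, J e, f, J f] := by
  rw [Fintype.linearIndependent_iff]
  intro g hg
  rw [Fin.sum_univ_four] at hg
  simp only [Matrix.cons_val] at hg
  have hg' : J (g 0 • e + g 1 • J e + g 2 • f + g 3 • J f) = 0 := by rw [hg, map_zero]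
  simp only [map_add, map_smul, hJ] at hg'
  have h23 : g 2 ^ 2 + g 3 ^ 2 = 0 := by
    by_contra hne
    apply hfe (-((g 2 ^ 2 + g 3 ^ 2)⁻¹ * (g 2 * g 0 + g 3 * g 1)))
      (-((g 2 ^ 2 + g 3 ^ 2)⁻¹ * (g 2 * g 1 - g 3 * g 0)))
    have h3 : f = (g 2 ^ 2 + g 3 ^ 2)⁻¹ • ((g 2 ^ 2 + g 3 ^ 2) • f) := by
      rw [smul_smul, inv_mul_cancel₀ hne, one_smul]
    have h4 : (g 2 ^ 2 + g 3 ^ 2) • f =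
        -((g 2 * g 0 + g 3 * g 1) • e + (g 2 * g 1 - g 3 * g 0) • J e) := by
      rw [← sub_eq_zero]
      have : g 2 • (g 0 • e + g 1 • J e + g 2 • f + g 3 • J f) -
        g 3 • (g 0 • J e + g 1 • -e + g 2 • J f + g 3 • -f) = 0 := by rw [hg, hg']; simp
      rw [← this]
      module
    rw [h3, h4]
    module
  have h2 : g 2 = 0 := by nlinarith [sq_nonneg (g 2), sq_nonneg (g 3)]
  have h3 : g 3 = 0 := by nlinarith [sq_nonneg (g 2), sq_nonneg (g 3)]
  rw [h2, h3] at hg hg'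
  have h01 : (g 0 ^ 2 + g 1 ^ 2) • e = 0 := by
    have : g 0 • (g 0 • e + g 1 • J e + (0 : ℝ) • f + (0 : ℝ) • J f) -
        g 1 • (g 0 • J e + g 1 • -e + (0 : ℝ) • J f + (0 : ℝ) • -f) = 0 := by rw [hg, hg']; simp
    rw [← this]
    module
  have h01' : g 0 ^ 2 + g 1 ^ 2 = 0 := (smul_eq_zero.1 h01).resolve_right he
  intro i
  fin_cases i
  · change g 0 = 0
    nlinarith [sq_nonneg (g 0), sq_nonneg (g 1)]
  · change g 1 = 0
    nlinarith [sq_nonneg (g 0), sq_nonneg (g 1)]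
  · exact h2
  · exact h3

theorem exists_not_mem_span_pair [FiniteDimensional ℝ T] (h4 : 2 < Module.finrank ℝ T) (a b : T) :
    ∃ f : T, ∀ x y : ℝ, f ≠ x • a + y • b := by
  by_contra! h
  have htop : Submodule.span ℝ ({a, b} : Set T) = ⊤ := by
    rw [Submodule.eq_top_iff']
    intro f
    obtain ⟨x, y, rfl⟩ := h f
    exact Submodule.mem_span_pair.2 ⟨x, y, rfl⟩
  classical
  have h1 := finrank_span_finset_le_card (R := ℝ) ({a, b} : Finset T)
  rw [Finset.coe_pair, Set.finrank, htop, finrank_top] at h1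
  have h2 : ({a, b} : Finset T).card ≤ 2 := Finset.card_le_two
  omega

/-- Alternating forms of top degree are proportional. -/
theorem top_form_mul_mul {n : ℕ} [NeZero n] (hT : Module.finrank ℝ T = n)
    (Ω Ω' : T [⋀^Fin n]→L[ℝ] ℝ) {v : Fin n → T} (hv : LinearIndependent ℝ v) (w : Fin n → T) :
    ∃ d : ℝ, Ω w = Ω v * d ∧ Ω' w = Ω' v * d ∧ (LinearIndependent ℝ w → d ≠ 0) := by
  let b := basisOfLinearIndependentOfCardEqFinrank hv (by rw [hT, Fintype.card_fin])
  have hb : (b : Fin n → T) = v := coe_basisOfLinearIndependentOfCardEqFinrank _ _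
  have h : ∀ Ω : T [⋀^Fin n]→L[ℝ] ℝ, Ω w = Ω v * b.det w := by
    intro Ω
    have h1 := AlternatingMap.congr_fun
      (AlternatingMap.eq_smul_basis_det b Ω.toAlternatingMap) w
    rw [hb] at h1
    exact h1
  refine ⟨b.det w, h Ω, h Ω', fun hw h0 => ?_⟩
  let b' := basisOfLinearIndependentOfCardEqFinrank hw (by rw [hT, Fintype.card_fin])
  have hb' : (b' : Fin n → T) = w := coe_basisOfLinearIndependentOfCardEqFinrank _ _
  have h2 := b.isUnit_det b'
  rw [hb', h0] at h2
  exact not_isUnit_zero h2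

/-- The form is positive on a complex frame e, Je, f, Jf, and top-degree forms are proportional.
Only nonvanishing survives, since w may have either orientation. -/
theorem wedgeAlt_self_ne_zero [FiniteDimensional ℝ T] (hT : Module.finrank ℝ T = 4)
    {τ : T [⋀^Fin 2]→L[ℝ] ℝ}
    {J : T →L[ℝ] T} (hJ : ∀ v, J (J v) = -v) (hτ : ∀ v, v ≠ 0 → 0 < τ ![v, J v]) {w : Fin 4 → T}
    (hw : LinearIndependent ℝ w) : wedgeAlt τ τ w ≠ 0 := by
  have hnt : Nontrivial T := Module.nontrivial_of_finrank_pos (R := ℝ) (by omega)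
  obtain ⟨f, hf⟩ := exists_ne (0 : T)
  obtain ⟨e, he⟩ := exists_not_mem_span_pair (by omega) f (J f)
  have he0 : e ≠ 0 := by
    intro h
    exact he 0 0 (by rw [h]; simp)
  have hfe : ∀ x y : ℝ, f ≠ x • e + y • J e := by
    intro x y hxy
    have hne : x ^ 2 + y ^ 2 ≠ 0 := by
      intro h0
      apply hf
      have hx : x = 0 := by nlinarith [sq_nonneg x, sq_nonneg y]
      have hy : y = 0 := by nlinarith [sq_nonneg x, sq_nonneg y]
      rw [hxy, hx, hy]; simp
    apply he ((x ^ 2 + y ^ 2)⁻¹ * x) (-((x ^ 2 + y ^ 2)⁻¹ * y))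
    have h3 : e = (x ^ 2 + y ^ 2)⁻¹ • ((x ^ 2 + y ^ 2) • e) := by
      rw [smul_smul, inv_mul_cancel₀ hne, one_smul]
    have h4 : (x ^ 2 + y ^ 2) • e = x • f - y • J f := by
      rw [hxy]
      simp only [map_add, map_smul, hJ]
      module
    rw [h3, h4]
    module
  obtain ⟨d, hd, -, hd0⟩ := top_form_mul_mul hT (wedgeAlt τ τ) (wedgeAlt τ τ)
    (linearIndependent_complex_pair hJ he0 hfe) w
  rw [hd]
  exact mul_ne_zero (wedgeAlt_self_pos hJ hτ hf he).ne' (hd0 hw)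

/-- A two-form which is of the form `Re a ∧ Im a` for a complex linear functional `a` is semipositive
on a tamed four-space. -/
theorem wedgeAlt_mul_pos [FiniteDimensional ℝ T] (hT : Module.finrank ℝ T = 4)
    {τ σ : T [⋀^Fin 2]→L[ℝ] ℝ}
    {J : T →L[ℝ] T} (hJ : ∀ v, J (J v) = -v) (hτ : ∀ v, v ≠ 0 → 0 < τ ![v, J v])
    {a : T →ₗ[ℝ] ℂ} (haJ : ∀ v, a (J v) = Complex.I * a v) (ha : a ≠ 0)
    (hσ : ∀ v w, σ ![v, w] = 2 * ((starRingEnd ℂ) (a v) * a w).im) {w : Fin 4 → T}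
    (hw : LinearIndependent ℝ w) : 0 < wedgeAlt τ τ w * wedgeAlt τ σ w := by
  obtain ⟨f, hf⟩ : ∃ f, a f ≠ 0 := by
    by_contra! h
    exact ha (LinearMap.ext h)
  -- The real rank of a is at most 2, so its kernel is nontrivial.
  obtain ⟨e, hee, he0⟩ : ∃ e, a e = 0 ∧ e ≠ 0 := by
    have h1 := a.finrank_range_add_finrank_ker
    have h2 := Submodule.finrank_le (LinearMap.range a)
    rw [Complex.finrank_real_complex] at h2
    have hnt : Nontrivial (LinearMap.ker a) :=
      Module.nontrivial_of_finrank_pos (R := ℝ) (by omega)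
    obtain ⟨⟨e, he⟩, hne⟩ := exists_ne (0 : LinearMap.ker a)
    exact ⟨e, he, fun h => hne (Subtype.ext h)⟩
  have hf0 : f ≠ 0 := by
    intro h
    exact hf (by rw [h, map_zero])
  have hfe : ∀ x y : ℝ, f ≠ x • e + y • J e := by
    intro x y h
    apply hf
    rw [h]
    simp [haJ, hee]
  have hef : ∀ x y : ℝ, e ≠ x • f + y • J f := by
    intro x y h
    have h1 : a e = (x + y * Complex.I) * a f := by
      rw [h]
      simp [haJ]
      ring
    rw [hee] at h1
    have h2 := (mul_eq_zero.1 h1.symm).resolve_right hf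
    have hx : x = 0 := by simpa using congrArg Complex.re h2
    have hy : y = 0 := by simpa using congrArg Complex.im h2
    exact he0 (by rw [h, hx, hy]; simp)
  obtain ⟨d, hd, hd', hd0⟩ := top_form_mul_mul hT (wedgeAlt τ τ) (wedgeAlt τ σ)
    (linearIndependent_complex_pair hJ he0 hfe) w
  have hd1 := hd0 hw
  have h1 := wedgeAlt_self_pos hJ hτ hf0 hef
  -- Since e and Je lie in the kernel of a, σ pairs only f with Jf, and a single term τ(e, Je) σ(f,
  -- Jf) remains.
  have h2 : 0 < wedgeAlt τ σ ![e, J e, f, J f] := by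
    rw [wedgeAlt_apply]
    simp only [Matrix.cons_val, hσ, haJ, hee]
    have h3 := hτ e he0
    have h4 : ((starRingEnd ℂ) (a f) * (Complex.I * a f)).im = Complex.normSq (a f) := by
      simp [Complex.normSq_apply]
    have h5 : 0 < Complex.normSq (a f) := Complex.normSq_pos.2 hf
    simp [h4]
    positivity
  rw [hd, hd']
  have : 0 < d ^ 2 := by positivity
  calc 0 < (wedgeAlt τ τ ![e, J e, f, J f] * wedgeAlt τ σ ![e, J e, f, J f]) * d ^ 2 := by positivity
    _ = _ := by ring

end TamePoint

/-! ### Wedge products of 2-forms on manifolds. -/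

section WedgeForms

variable {n : ℕ} {X : Type*} [TopologicalSpace X] [ChartedSpace (E n) X]

/-- The wedge product of two `2`-forms, as a `4`-form. -/
def wedgeForm (α β : Form n X 2) : Form n X 4 := fun x => wedgeAlt (α x) (β x)

theorem wedgeAlt_compContinuousLinearMap {T T' : Type*} [AddCommGroup T] [Module ℝ T]
    [TopologicalSpace T] [AddCommGroup T'] [Module ℝ T'] [TopologicalSpace T']
    (α β : T' [⋀^Fin 2]→L[ℝ] ℝ) (L : T →L[ℝ] T') :
    (wedgeAlt α β).compContinuousLinearMap L =
      wedgeAlt (α.compContinuousLinearMap L) (β.compContinuousLinearMap L) := by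
  ext v
  have h : ∀ i j : Fin 4, (L ∘ ![v i, v j]) = ![L (v i), L (v j)] := by
    intro i j
    funext k
    fin_cases k <;> rfl
  simp only [wedgeAlt_apply, ContinuousAlternatingMap.compContinuousLinearMap_apply, h,
    Function.comp_apply]

theorem inChart_wedgeForm (α β : Form n X 2) (c : X) (y : E n) :
    inChart (wedgeForm α β) c y = wedgeAlt (inChart α c y) (inChart β c y) :=
  wedgeAlt_compContinuousLinearMap (T := E n)
    (T' := TangentSpace (𝓡 n) ((extChartAt (𝓡 n) c).symm y)) _ _ _

theorem contDiffAt_wedgeAlt {V : Type*} [NormedAddCommGroup V] [NormedSpace ℝ V]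
    [FiniteDimensional ℝ V] {D : Type*} [NormedAddCommGroup D] [NormedSpace ℝ D]
    {r : WithTop ℕ∞} {α β : D → V [⋀^Fin 2]→L[ℝ] ℝ} {y : D}
    (hα : ContDiffAt ℝ r α y) (hβ : ContDiffAt ℝ r β y) :
    ContDiffAt ℝ r (fun z => wedgeAlt (α z) (β z)) y := by
  refine contDiffAt_alternating_of_apply fun v => ?_
  have h : ∀ {α : D → V [⋀^Fin 2]→L[ℝ] ℝ}, ContDiffAt ℝ r α y → ∀ w : Fin 2 → V,
      ContDiffAt ℝ r (fun z => α z w) y :=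
    fun h w => contDiffAt_alternating_apply (v := fun i _ => w i) h fun _ => contDiffAt_const
  simp only [wedgeAlt_apply]
  exact (((((((h hα _).mul (h hβ _)).sub ((h hα _).mul (h hβ _))).add
    ((h hα _).mul (h hβ _))).add ((h hα _).mul (h hβ _))).sub
    ((h hα _).mul (h hβ _))).add ((h hα _).mul (h hβ _)))

theorem IsSmoothForm.wedge {α β : Form n X 2} (hα : IsSmoothForm α) (hβ : IsSmoothForm β) :
    IsSmoothForm (wedgeForm α β) := by
  intro c y hy
  rw [extChartAt_target_eq] at hy
  have : inChart (wedgeForm α β) c = fun y => wedgeAlt (inChart α c y) (inChart β c y) :=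
    funext (inChart_wedgeForm α β c)
  rw [this]
  exact (contDiffAt_wedgeAlt (hα.contDiffAt hy) (hβ.contDiffAt hy)).contDiffWithinAt

end WedgeForms

/-! ### Stokes' theorem on surfaces and for closed ∧ exact on four-manifolds. -/

section StokesSpecial

theorem frame_two : (fun i : Fin 2 => (EuclideanSpace.single i 1 : E 2)) =
    ![EuclideanSpace.single 0 1, EuclideanSpace.single 1 1] := by
  funext i
  fin_cases i <;> rfl

theorem contDiffAt_form_apply {V D : Type*} [NormedAddCommGroup V] [NormedSpace ℝ V]
    [NormedAddCommGroup D] [NormedSpace ℝ D] {k : ℕ} {r : WithTop ℕ∞}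
    {Ω : D → V [⋀^Fin k]→L[ℝ] ℝ} {y : D} (hΩ : ContDiffAt ℝ r Ω y) (v : Fin k → V) :
    ContDiffAt ℝ r (fun z => Ω z v) y :=
  contDiffAt_alternating_apply (v := fun i _ => v i) hΩ fun _ => contDiffAt_const

/-- Stokes' theorem on a surface. -/
theorem integral_exact_surface {X : Type*} [TopologicalSpace X] [ChartedSpace (E 2) X]
    [T2Space X] [SigmaCompactSpace X] [IsManifold (𝓡 2) ∞ X]
    {pos : ∀ x : X, (Fin 2 → TangentSpace (𝓡 2) x) → Prop} {ν : Form 2 X 2}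
    (hν : IsVolume ν) (hpos : OrientedBy pos ν)
    {γ : Form 2 X 1} {θ : Form 2 X 2} (hγ : IsSmoothForm γ) (hγs : HasCompactSuppForm γ)
    (hθ : HasExtDeriv γ θ) : integral pos (fun x v => θ x v) = 0 := by
  refine integral_eq_zero_of_hasExtDeriv hν hpos (fun x => AddMonoidHom.id _)
    (fun θ hθ => hθ.isContTop) (fun c γ θ hγ hθ => ?_) hγ hγs hθ
  let e : Fin 2 → E 2 := fun i => EuclideanSpace.single i 1
  have hs : ∀ (y) (_ : y ∈ (chartAt (E 2) c).target) (i : Fin 2),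
      ContDiffAt ℝ ∞ (fun z => inChart γ c z ![e i]) y :=
    fun y hy i => contDiffAt_form_apply (hγ.contDiffAt hy) _
  -- The derivative of γ₀dy₀ + γ₁dy₁ is the divergence of (γ₁, −γ₀).
  refine ⟨![fun z => inChart γ c z ![e 1], fun z => -inChart γ c z ![e 0]], ?_, ?_, ?_⟩
  · intro i y hy
    fin_cases i
    · exact (hs y hy 1).of_le (by exact_mod_cast le_top)
    · exact ((hs y hy 0).neg).of_le (by exact_mod_cast le_top)
  · intro i y h
    fin_cases i <;> simp [h]
  · intro y hy
    have h1 : coef (chartAt (E 2) c).symm θ y = inChart θ c y ![e 0, e 1] := by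
      rw [coef, frame_two]
      rfl
    refine h1.trans ?_
    rw [← hθ c y (by rwa [extChartAt_target_eq]),
      extDeriv_one_apply ((hγ.contDiffAt hy).differentiableAt (by simp)), Fin.sum_univ_two]
    simp only [Matrix.cons_val_zero, Matrix.cons_val_one]
    rw [fderiv_fun_neg, neg_apply, sub_eq_add_neg]

theorem fderiv_sub_add_apply {D : Type*} [NormedAddCommGroup D] [NormedSpace ℝ D]
    {z₁ z₂ z₃ c₁ c₂ c₃ : D → ℝ} {y : D}
    (hz₁ : DifferentiableAt ℝ z₁ y) (hz₂ : DifferentiableAt ℝ z₂ y) (hz₃ : DifferentiableAt ℝ z₃ y)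
    (hc₁ : DifferentiableAt ℝ c₁ y) (hc₂ : DifferentiableAt ℝ c₂ y) (hc₃ : DifferentiableAt ℝ c₃ y)
    (v : D) : fderiv ℝ (fun x => z₁ x * c₁ x - z₂ x * c₂ x + z₃ x * c₃ x) y v =
      z₁ y * fderiv ℝ c₁ y v + c₁ y * fderiv ℝ z₁ y v - (z₂ y * fderiv ℝ c₂ y v +
        c₂ y * fderiv ℝ z₂ y v) + (z₃ y * fderiv ℝ c₃ y v + c₃ y * fderiv ℝ z₃ y v) := by
  have h := ((hz₁.hasFDerivAt.mul hc₁.hasFDerivAt).sub (hz₂.hasFDerivAt.mul hc₂.hasFDerivAt)).add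
    (hz₃.hasFDerivAt.mul hc₃.hasFDerivAt)
  have h2 := congrArg (fun L : D →L[ℝ] ℝ => L v) h.fderiv
  refine Eq.trans ?_ (h2.trans ?_)
  · rfl
  · simp

/-- Stokes' theorem on a four-manifold for the wedge product of a closed and an exact form. -/
theorem integral_closed_wedge_exact {X : Type*} [TopologicalSpace X] [ChartedSpace (E 4) X]
    [T2Space X] [SigmaCompactSpace X] [IsManifold (𝓡 4) ∞ X]
    {pos : ∀ x : X, (Fin 4 → TangentSpace (𝓡 4) x) → Prop} {ν : Form 4 X 4}
    (hν : IsVolume ν) (hpos : OrientedBy pos ν) {ζ : Form 4 X 2} (hζ : IsSmoothForm ζ)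
    (hζc : IsClosedForm ζ)
    {γ : Form 4 X 1} {θ : Form 4 X 2} (hγ : IsSmoothForm γ) (hγs : HasCompactSuppForm γ)
    (hθ : HasExtDeriv γ θ) : integral pos (fun x v => wedgeForm ζ θ x v) = 0 := by
  refine integral_eq_zero_of_hasExtDeriv hν hpos
    (fun x => AddMonoidHom.mk' (fun θ => wedgeAlt (ζ x) θ) (wedgeAlt_add_right (ζ x)))
    (fun θ hθ => (hζ.wedge hθ).isContTop) (fun c γ θ hγ hθ => ?_) hγ hγs hθ
  let e : Fin 4 → E 4 := fun i => EuclideanSpace.single i 1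
  let g : Fin 4 → E 4 → ℝ := fun i z => inChart γ c z ![e i]
  let s : Fin 4 → Fin 4 → E 4 → ℝ := fun i j z => inChart ζ c z ![e i, e j]
  have hg : ∀ (y) (_ : y ∈ (chartAt (E 4) c).target) (i : Fin 4), ContDiffAt ℝ ∞ (g i) y :=
    fun y hy i => contDiffAt_form_apply (hγ.contDiffAt hy) _
  have hs : ∀ (y) (_ : y ∈ (chartAt (E 4) c).target) (i j : Fin 4), ContDiffAt ℝ ∞ (s i j) y :=
    fun y hy i j => contDiffAt_form_apply (hζ.contDiffAt hy) _
  -- Up to sign these are the components of the 3-form ζ ∧ γ. In their divergence the derivatives of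
  -- ζ cancel by closedness, which leaves ζ ∧ dγ.
  refine ⟨![fun z => s 1 2 z * g 3 z - s 1 3 z * g 2 z + s 2 3 z * g 1 z,
    fun z => s 0 3 z * g 2 z - s 0 2 z * g 3 z + (-s 2 3) z * g 0 z,
    fun z => s 0 1 z * g 3 z - s 0 3 z * g 1 z + s 1 3 z * g 0 z,
    fun z => s 0 2 z * g 1 z - s 0 1 z * g 2 z + (-s 1 2) z * g 0 z], ?_, ?_, ?_⟩
  · intro i y hy
    have h : ∀ i, ContDiffAt ℝ 1 (g i) y := fun i => (hg y hy i).of_le (by exact_mod_cast le_top)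
    have h' : ∀ i j, ContDiffAt ℝ 1 (s i j) y :=
      fun i j => (hs y hy i j).of_le (by exact_mod_cast le_top)
    fin_cases i
    · exact (((h' 1 2).mul (h 3)).sub ((h' 1 3).mul (h 2))).add ((h' 2 3).mul (h 1))
    · exact (((h' 0 3).mul (h 2)).sub ((h' 0 2).mul (h 3))).add ((h' 2 3).neg.mul (h 0))
    · exact (((h' 0 1).mul (h 3)).sub ((h' 0 3).mul (h 1))).add ((h' 1 3).mul (h 0))
    · exact (((h' 0 2).mul (h 1)).sub ((h' 0 1).mul (h 2))).add ((h' 1 2).neg.mul (h 0))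
  · intro i y h
    fin_cases i <;> simp [g, h]
  · intro y hy
    have hy' : y ∈ (extChartAt (𝓡 4) c).target := by rwa [extChartAt_target_eq]
    have dg : ∀ i, DifferentiableAt ℝ (g i) y := fun i => (hg y hy i).differentiableAt (by simp)
    have ds : ∀ i j, DifferentiableAt ℝ (s i j) y :=
      fun i j => (hs y hy i j).differentiableAt (by simp)
    have h1 : coef (chartAt (E 4) c).symm (wedgeForm ζ θ) y =
        wedgeAlt (inChart ζ c y) (inChart θ c y) e := by
      rw [← inChart_wedgeForm]
      rfl
    refine h1.trans ?_
    have hθ' : ∀ i j, inChart θ c y ![e i, e j] = fderiv ℝ (g j) y (e i) - fderiv ℝ (g i) y (e j) := by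
      intro i j
      rw [← hθ c y hy', extDeriv_one_apply ((hγ.contDiffAt hy).differentiableAt (by simp))]
    have hζ' : ∀ i j k, fderiv ℝ (s j k) y (e i) - fderiv ℝ (s i k) y (e j) +
        fderiv ℝ (s i j) y (e k) = 0 := by
      intro i j k
      have h2 := hζc c y hy'
      rw [inChart_zero] at h2
      have h3 := extDeriv_two_apply ((hζ.contDiffAt hy).differentiableAt (by simp)) (e i) (e j) (e k)
      rw [h2] at h3
      exact h3.symm
    rw [wedgeAlt_apply, Fin.sum_univ_four]
    simp only [Matrix.cons_val]
    rw [fderiv_sub_add_apply (ds _ _) (ds _ _) (ds _ _) (dg _) (dg _) (dg _),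
      fderiv_sub_add_apply (ds _ _) (ds _ _) (ds _ _) (dg _) (dg _) (dg _),
      fderiv_sub_add_apply (ds _ _) (ds _ _) (ds _ _).neg (dg _) (dg _) (dg _),
      fderiv_sub_add_apply (ds _ _) (ds _ _) (ds _ _).neg (dg _) (dg _) (dg _)]
    simp only [hθ', fderiv_neg, neg_apply, Pi.neg_apply]
    have e012 := hζ' 0 1 2
    have e013 := hζ' 0 1 3
    have e023 := hζ' 0 2 3
    have e123 := hζ' 1 2 3
    change s 0 1 y * _ - s 0 2 y * _ + s 0 3 y * _ + s 1 2 y * _ - s 1 3 y * _ + s 2 3 y * _ = _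
    simp only [e] at *
    linear_combination (-g 3 y) * e012 + g 2 y * e013 - g 1 y * e023 + g 0 y * e123

end StokesSpecial

/-! ### Positivity of the integral. -/

section IntegralPos

open MeasureTheory

variable {n : ℕ} {X : Type*} [TopologicalSpace X] [ChartedSpace (E n) X]
  [T2Space X] [SigmaCompactSpace X] [IsManifold (𝓡 n) ∞ X]
  {pos : ∀ x : X, (Fin n → TangentSpace (𝓡 n) x) → Prop} {ν : Form n X n}

/-- The integral of `f ν` is positive if `f` is nonnegative, compactly supported and not zero. -/
theorem integral_fsmul_pos (hν : IsVolume ν) (hpos : OrientedBy pos ν) {f : X → ℝ}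
    (hf : Continuous f) (hf0 : ∀ x, 0 ≤ f x) {K : Set X} (hK : IsCompact K) (hfK : ∀ x ∉ K, f x = 0)
    {x₀ : X} (hx₀ : 0 < f x₀) : 0 < integral pos (fun x v => fsmul f ν x v) := by
  have hsden : ∀ c y, sden ν (fsmul f ν) (chartAt (E n) c).symm y =
      f ((chartAt (E n) c).symm y) * |coef (chartAt (E n) c).symm ν y| := by
    intro c y
    have : coef (chartAt (E n) c).symm (fsmul f ν) y =
      f ((chartAt (E n) c).symm y) * coef (chartAt (E n) c).symm ν y := rfl
    rw [sden, this, ← sign_mul_self (coef (chartAt (E n) c).symm ν y)]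
    ring
  rw [integral_eq_sden hν hpos]
  simp only [hsden]
  have hnn : ∀ c y, 0 ≤ chartPartition n X c ((chartAt (E n) c).symm y) *
      (f ((chartAt (E n) c).symm y) * |coef (chartAt (E n) c).symm ν y|) := fun c y =>
    mul_nonneg ((chartPartition n X).nonneg c _) (mul_nonneg (hf0 _) (abs_nonneg _))
  have hfin : (Function.support fun c : X => ∫ y in (chartAt (E n) c).target,
      chartPartition n X c ((chartAt (E n) c).symm y) *
        (f ((chartAt (E n) c).symm y) * |coef (chartAt (E n) c).symm ν y|)).Finite := by
    refine (chartPartition_finite (n := n) hK).subset fun c hc => ?_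
    by_contra hne
    apply hc
    refine (setIntegral_congr_fun (chartAt (E n) c).open_target.measurableSet
      (g := fun _ => 0) fun y _ => ?_).trans (by simp)
    by_cases hyK : (chartAt (E n) c).symm y ∈ K
    · have : chartPartition n X c ((chartAt (E n) c).symm y) = 0 := by
        by_contra h0
        exact hne ⟨_, subset_tsupport _ h0, hyK⟩
      simp only [this, zero_mul]
    · simp only [hfK _ hyK, zero_mul, mul_zero]
  have hle : ∀ c, 0 ≤ ∫ y in (chartAt (E n) c).target,
      chartPartition n X c ((chartAt (E n) c).symm y) *
        (f ((chartAt (E n) c).symm y) * |coef (chartAt (E n) c).symm ν y|) := fun c =>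
    setIntegral_nonneg (chartAt (E n) c).open_target.measurableSet fun y _ => hnn c y
  obtain ⟨c, hc⟩ : ∃ c, 0 < chartPartition n X c x₀ := by
    by_contra! h
    have h1 := (chartPartition n X).sum_eq_one (Set.mem_univ x₀)
    rw [finsum_eq_zero_of_forall_eq_zero fun c =>
      le_antisymm (h c) ((chartPartition n X).nonneg c x₀)] at h1
    exact zero_ne_one h1
  refine finsum_pos (fun c => hle c) ⟨c, ?_⟩ hfin
  set Φ := chartAt (E n) c
  have hΦ : Φ ∈ IsManifold.maximalAtlas (𝓡 n) ∞ X := IsManifold.chart_mem_maximalAtlas c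
  have hxs : x₀ ∈ Φ.source := by
    by_contra h
    rw [chartPartition_eq_zero h] at hc
    exact lt_irrefl _ hc
  have hcont : ContinuousOn (fun y => chartPartition n X c (Φ.symm y) *
        (f (Φ.symm y) * |coef Φ.symm ν y|)) Φ.target := by
    refine ContinuousOn.mul ?_ (ContinuousOn.mul ?_ (hν.cont Φ hΦ).abs)
    · exact (chartPartition n X c).contMDiff.continuous.comp_continuousOn Φ.continuousOn_symm
    · exact hf.comp_continuousOn Φ.continuousOn_symm
  have hsub : tsupport (chartPartition n X c) ∩ K ⊆ Φ.source :=
    Set.inter_subset_left.trans (chartPartition_isSubordinate n X c)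
  have hint : IntegrableOn (fun y => chartPartition n X c (Φ.symm y) *
        (f (Φ.symm y) * |coef Φ.symm ν y|)) Φ.target := by
    refine integrableOn_of_continuousOn (K := Φ '' (tsupport (chartPartition n X c) ∩ K))
      Φ.open_target ((hK.inter_left (isClosed_tsupport _)).image_of_continuousOn
        (Φ.continuousOn.mono hsub)) ?_ hcont ?_
    · rintro _ ⟨x, hx, rfl⟩
      exact Φ.map_source (hsub hx)
    · intro y hy hyK
      by_cases h1 : Φ.symm y ∈ K
      · have : chartPartition n X c (Φ.symm y) = 0 := by
          by_contra h0
          exact hyK ⟨_, ⟨subset_tsupport _ h0, h1⟩, Φ.right_inv hy⟩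
        rw [this, zero_mul]
      · rw [hfK _ h1]; ring
  rw [setIntegral_pos_iff_support_of_nonneg_ae
    (Filter.Eventually.of_forall fun y => hnn c y) hint]
  have hy0 : Φ x₀ ∈ Φ.target := Φ.map_source hxs
  have hpos0 : 0 < chartPartition n X c (Φ.symm (Φ x₀)) *
      (f (Φ.symm (Φ x₀)) * |coef Φ.symm ν (Φ x₀)|) := by
    rw [Φ.left_inv hxs]
    exact mul_pos hc (mul_pos hx₀ (abs_pos.2 (hν.ne_zero Φ hΦ _ hy0)))
  have hnhds : {y | 0 < chartPartition n X c (Φ.symm y) *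
      (f (Φ.symm y) * |coef Φ.symm ν y|)} ∈ 𝓝 (Φ x₀) :=
    (hcont.continuousAt (Φ.open_target.mem_nhds hy0)).eventually (lt_mem_nhds hpos0)
  refine (Measure.measure_pos_of_mem_nhds volume
    (Filter.inter_mem hnhds (Φ.open_target.mem_nhds hy0))).trans_le (measure_mono ?_)
  exact fun y hy => ⟨(ne_of_gt hy.1 : _), hy.2⟩

end IntegralPos

/-! ### Derivatives of vector-valued functions, and chart frames. -/

section Derivative

variable {n : ℕ} {X : Type*} [TopologicalSpace X] [ChartedSpace (E n) X]
  {V : Type*} [NormedAddCommGroup V] [NormedSpace ℝ V]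

variable (n) in
/-- The derivative of a vector-valued function on a manifold. -/
def dm (f : X → V) (x : X) : TangentSpace (𝓡 n) x →L[ℝ] V := mfderiv (𝓡 n) 𝓘(ℝ, V) f x

theorem dm_congr {f g : X → V} {x : X} (h : f =ᶠ[𝓝 x] g) : dm n f x = dm n g x := h.mfderiv_eq

theorem dm_const (c : V) (x : X) : dm n (fun _ : X => c) x = 0 := mfderiv_const

theorem dm_comp {W : Type*} [NormedAddCommGroup W] [NormedSpace ℝ W] {g : V → W} {f : X → V} {x : X}
    (hg : DifferentiableAt ℝ g (f x)) (hf : MDifferentiableAt (𝓡 n) 𝓘(ℝ, V) f x)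
    (v : TangentSpace (𝓡 n) x) : dm n (g ∘ f) x v = fderiv ℝ g (f x) (dm n f x v) := by
  have h := mfderiv_comp x hg.mdifferentiableAt hf
  rw [mfderiv_eq_fderiv] at h
  exact congrArg (fun L : TangentSpace (𝓡 n) x →L[ℝ] W => L v) h

theorem dm_clm_comp {W : Type*} [NormedAddCommGroup W] [NormedSpace ℝ W] (L : V →L[ℝ] W) {f : X → V}
    {x : X} (hf : MDifferentiableAt (𝓡 n) 𝓘(ℝ, V) f x)
    (v : TangentSpace (𝓡 n) x) : dm n (fun z => L (f z)) x v = L (dm n f x v) := by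
  have h := dm_comp (g := L) L.differentiableAt hf v
  rw [ContinuousLinearMap.fderiv] at h
  exact h

theorem dm_comp_mfderiv {m : ℕ} {Y : Type*} [TopologicalSpace Y] [ChartedSpace (E m) Y]
    {f : X → V} {g : Y → X} {y : Y} (hf : MDifferentiableAt (𝓡 n) 𝓘(ℝ, V) f (g y))
    (hg : MDifferentiableAt (𝓡 m) (𝓡 n) g y) (v : TangentSpace (𝓡 m) y) :
    dm m (f ∘ g) y v = dm n f (g y) (mfderiv (𝓡 m) (𝓡 n) g y v) :=
  congrArg (fun L : TangentSpace (𝓡 m) y →L[ℝ] V => L v) (mfderiv_comp y hf hg)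

theorem fderiv_comp_mfderiv {f : X → V} {D : Type*} [NormedAddCommGroup D] [NormedSpace ℝ D]
    {g : D → X} {y : D} (hf : MDifferentiableAt (𝓡 n) 𝓘(ℝ, V) f (g y))
    (hg : MDifferentiableAt 𝓘(ℝ, D) (𝓡 n) g y) (v : D) :
    fderiv ℝ (f ∘ g) y v = dm n f (g y) (mfderiv 𝓘(ℝ, D) (𝓡 n) g y v) := by
  have h := mfderiv_comp y hf hg
  rw [mfderiv_eq_fderiv] at h
  exact congrArg (fun L : D →L[ℝ] V => L v) h

theorem dm_add {f g : X → V} {x : X} (hf : MDifferentiableAt (𝓡 n) 𝓘(ℝ, V) f x)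
    (hg : MDifferentiableAt (𝓡 n) 𝓘(ℝ, V) g x) : dm n (f + g) x = dm n f x + dm n g x :=
  mfderiv_add hf hg

theorem finrank_tangent (x : X) : Module.finrank ℝ (TangentSpace (𝓡 n) x) = n := by
  change Module.finrank ℝ (EuclideanSpace ℝ (Fin n)) = n
  simp

instance finiteDimensional_tangent (x : X) : FiniteDimensional ℝ (TangentSpace (𝓡 n) x) :=
  inferInstanceAs (FiniteDimensional ℝ (EuclideanSpace ℝ (Fin n)))

variable [IsManifold (𝓡 n) ∞ X]

/-- The derivative of the inverse of a chart. -/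
def frameAt (Ψ : OpenPartialHomeomorph X (E n)) (y : E n) : E n →L[ℝ] TangentSpace (𝓡 n) (Ψ.symm y) :=
  mfderiv 𝓘(ℝ, E n) (𝓡 n) Ψ.symm y

theorem dm_frameAt {Ψ : OpenPartialHomeomorph X (E n)}
    (hΨ : Ψ ∈ IsManifold.maximalAtlas (𝓡 n) ∞ X) {y : E n} (hy : y ∈ Ψ.target) (v : E n) :
    dm n Ψ (Ψ.symm y) (frameAt Ψ y v) = v := by
  have h := fderiv_comp_mfderiv (f := Ψ) (g := Ψ.symm) (y := y)
    ((contMDiffAt_of_mem hΨ (Ψ.map_target hy)).mdifferentiableAt (by simp))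
    ((contMDiffAt_symm_of_mem hΨ hy).mdifferentiableAt (by simp)) v
  refine h.symm.trans ?_
  have h2 : Ψ ∘ Ψ.symm =ᶠ[𝓝 y] id := by
    filter_upwards [Ψ.open_target.mem_nhds hy] with z hz
    exact Ψ.right_inv hz
  rw [h2.fderiv_eq, fderiv_id]
  rfl

theorem frameAt_injective {Ψ : OpenPartialHomeomorph X (E n)}
    (hΨ : Ψ ∈ IsManifold.maximalAtlas (𝓡 n) ∞ X) {y : E n} (hy : y ∈ Ψ.target) :
    Function.Injective (frameAt Ψ y) :=
  Function.LeftInverse.injective (g := dm n Ψ (Ψ.symm y)) (dm_frameAt hΨ hy)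

theorem frameAt_surjective {Ψ : OpenPartialHomeomorph X (E n)}
    (hΨ : Ψ ∈ IsManifold.maximalAtlas (𝓡 n) ∞ X) {y : E n} (hy : y ∈ Ψ.target) :
    Function.Surjective (frameAt Ψ y) := by
  have := (LinearMap.injective_iff_surjective_of_finrank_eq_finrank (K := ℝ)
    (f := (frameAt Ψ y).toLinearMap) (by rw [finrank_tangent]; simp)).1 (frameAt_injective hΨ hy)
  exact this

theorem dm_injective {Ψ : OpenPartialHomeomorph X (E n)}
    (hΨ : Ψ ∈ IsManifold.maximalAtlas (𝓡 n) ∞ X) {x : X} (hx : x ∈ Ψ.source) :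
    Function.Injective (dm n Ψ x) := by
  have hy := Ψ.map_source hx
  have h := frameAt_surjective hΨ hy
  have h1 := dm_frameAt hΨ hy
  have h2 : Function.Injective (dm n Ψ (Ψ.symm (Ψ x))) :=
    (Function.RightInverse.leftInverse_of_surjective h1 h).injective
  rwa [Ψ.left_inv hx] at h2

theorem dm_surjective {Ψ : OpenPartialHomeomorph X (E n)}
    (hΨ : Ψ ∈ IsManifold.maximalAtlas (𝓡 n) ∞ X) {x : X} (hx : x ∈ Ψ.source) :
    Function.Surjective (dm n Ψ x) := by
  have := (LinearMap.injective_iff_surjective_of_finrank_eq_finrank (K := ℝ)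
    (f := (dm n Ψ x).toLinearMap) (by rw [finrank_tangent]; simp)).1 (dm_injective hΨ hx)
  exact this

theorem linearIndependent_frameAt {Ψ : OpenPartialHomeomorph X (E n)}
    (hΨ : Ψ ∈ IsManifold.maximalAtlas (𝓡 n) ∞ X) {y : E n} (hy : y ∈ Ψ.target) :
    LinearIndependent ℝ (fun i : Fin n => frameAt Ψ y (EuclideanSpace.single i 1)) := by
  have h : LinearIndependent ℝ (fun i : Fin n => (EuclideanSpace.single i 1 : E n)) := by
    have := (EuclideanSpace.basisFun (Fin n) ℝ).toBasis.linearIndependent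
    rw [OrthonormalBasis.coe_toBasis] at this
    have h2 : (EuclideanSpace.basisFun (Fin n) ℝ : Fin n → E n) =
        fun i => EuclideanSpace.single i 1 := by
      funext i
      simp
    rw [h2] at this
    exact this
  exact h.map_injOn (frameAt Ψ y).toLinearMap ((frameAt_injective hΨ hy).injOn)

theorem coef_eq_frameAt (Ψ : OpenPartialHomeomorph X (E n)) (σ : Form n X n) (y : E n) :
    coef Ψ.symm σ y = σ (Ψ.symm y) (fun i => frameAt Ψ y (EuclideanSpace.single i 1)) := rfl

end Derivative

/-- In a real plane with a complex structure, a nonzero vector is a complex basis. -/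
theorem exists_complex_combination {T : Type*} [AddCommGroup T] [Module ℝ T] [TopologicalSpace T]
    (hT : Module.finrank ℝ T = 2) {J : T →L[ℝ] T} (hJ : ∀ v, J (J v) = -v) {v : T} (hv : v ≠ 0)
    (w : T) : ∃ a b : ℝ, w = a • v + b • J v := by
  have hli : LinearIndependent ℝ ![v, J v] := by
    rw [LinearIndependent.pair_iff]
    intro a b hab
    have h2 : J (a • v + b • J v) = 0 := by rw [hab, map_zero]
    rw [map_add, map_smul, map_smul, hJ] at h2
    have h3 : (a ^ 2 + b ^ 2) • v = 0 := by
      have : a • (a • v + b • J v) - b • (a • J v + b • -v) = 0 := by rw [hab, h2]; simp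
      rw [← this]
      module
    have h4 := (smul_eq_zero.1 h3).resolve_right hv
    constructor <;> nlinarith [sq_nonneg a, sq_nonneg b]
  have hspan := hli.span_eq_top_of_card_eq_finrank (by rw [hT]; simp)
  have hw : w ∈ Submodule.span ℝ (Set.range ![v, J v]) := by rw [hspan]; trivial
  rw [Matrix.range_cons_cons_empty, Submodule.mem_span_pair] at hw
  obtain ⟨a, b, hab⟩ := hw
  exact ⟨a, b, hab.symm⟩

/-! ### Slice charts and the geometry of an embedded holomorphic curve. -/

section Curve

variable {M : Type*} [TopologicalSpace M] [T2Space M] [SigmaCompactSpace M]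
    [ChartedSpace (E 4) M] [IsManifold (𝓡 4) ∞ M]
    {S : Type*} [TopologicalSpace S] [T2Space S] [CompactSpace S] [ConnectedSpace S]
    [ChartedSpace (E 2) S] [IsManifold (𝓡 2) ∞ S]

/-- An embedded closed connected `J`-holomorphic curve in a tamed symplectic four-manifold. -/
structure HolCurve (τ₀ : Form 4 M 2) (J : ∀ x : M, TangentSpace (𝓡 4) x →L[ℝ] TangentSpace (𝓡 4) x)
    (j : ∀ s : S, TangentSpace (𝓡 2) s →L[ℝ] TangentSpace (𝓡 2) s) (u : S → M) : Prop where
  symp : IsSymplectic τ₀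
  acs : IsAlmostComplex J
  tame : Tames τ₀ J
  acsj : IsAlmostComplex j
  emb : Manifold.IsSmoothEmbedding (𝓡 2) (𝓡 4) ∞ u
  hol : IsHolomorphic j J u

/-- A chart of `M` in which the image of `u` is a plane `{y = 0}`. -/
structure SliceChart (u : S → M) where
  chart : OpenPartialHomeomorph M (E 4)
  mem : chart ∈ IsManifold.maximalAtlas (𝓡 4) ∞ M
  e : (E 2 × E 2) ≃L[ℝ] E 4
  dom : OpenPartialHomeomorph S (E 2)
  dom_mem : dom ∈ IsManifold.maximalAtlas (𝓡 2) ∞ S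
  mem_dom : ∀ t, u t ∈ chart.source → t ∈ dom.source
  chart_apply : ∀ t, u t ∈ chart.source → chart (u t) = e (dom t, 0)
  mem_range : ∀ x ∈ chart.source, (e.symm (chart x)).2 = 0 → x ∈ Set.range u

/-- The immersion normal form gives charts in which u is t ↦ (t, 0). The chart of M is then shrunk
twice: the embedding property keeps other sheets of u out, and restricting the tangential coordinate
ensures that every point of the plane comes from S. -/
theorem exists_sliceChart {u : S → M} (hu : Manifold.IsSmoothEmbedding (𝓡 2) (𝓡 4) ∞ u) (s : S) :
    ∃ C : SliceChart u, u s ∈ C.chart.source := by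
  have h := hu.isImmersion.isImmersionAt s
  have hfin : FiniteDimensional ℝ h.complement :=
    FiniteDimensional.of_injective
      (h.equiv.toLinearEquiv.toLinearMap ∘ₗ LinearMap.inr ℝ (E 2) h.complement)
      (h.equiv.injective.comp (fun a b hab => (Prod.ext_iff.1 hab).2))
  -- The complement has dimension 4 − 2, so it may be replaced by the concrete plane `E 2`.
  have hrank : Module.finrank ℝ h.complement = Module.finrank ℝ (E 2) := by
    have h1 := h.equiv.toLinearEquiv.finrank_eq
    rw [Module.finrank_prod] at h1
    simp at h1 ⊢
    omega
  let e : (E 2 × E 2) ≃L[ℝ] E 4 :=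
    ((ContinuousLinearEquiv.refl ℝ (E 2)).prodCongr
      (ContinuousLinearEquiv.ofFinrankEq hrank.symm)).trans h.equiv
  have hw : ∀ t ∈ h.domChart.source, h.codChart (u t) = e (h.domChart t, 0) := by
    intro t ht
    have h1 : h.domChart t ∈ (h.domChart.extend (𝓡 2)).target := by
      simpa using h.domChart.map_source ht
    have h2 := h.writtenInCharts h1
    simp [h.domChart.left_inv ht] at h2
    simpa [e] using h2
  -- Since u is an embedding, the domain of the chart of S is the full preimage of an open set of M.
  obtain ⟨O, hO, hOs⟩ := hu.isEmbedding.isInducing.isOpen_iff.1 h.domChart.open_source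
  have hO' : IsOpen (h.codChart.source ∩ h.codChart ⁻¹'
      ((fun p => (e.symm p).1) ⁻¹' h.domChart.target)) :=
    h.codChart.isOpen_inter_preimage
      (h.domChart.open_target.preimage (continuous_fst.comp e.symm.continuous))
  have hsrc : (h.codChart.restr (O ∩ (h.codChart.source ∩ h.codChart ⁻¹'
      ((fun p => (e.symm p).1) ⁻¹' h.domChart.target)))).source =
      O ∩ (h.codChart.source ∩ h.codChart ⁻¹'
      ((fun p => (e.symm p).1) ⁻¹' h.domChart.target)) := by
    rw [h.codChart.restr_source' _ (hO.inter hO')]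
    exact Set.inter_eq_right.2 fun x hx => hx.2.1
  refine ⟨⟨h.codChart.restr (O ∩ (h.codChart.source ∩ h.codChart ⁻¹'
      ((fun p => (e.symm p).1) ⁻¹' h.domChart.target))),
      restr_mem_maximalAtlas _ h.codChart_mem_maximalAtlas (hO.inter hO'), e, h.domChart,
      h.domChart_mem_maximalAtlas, ?_, ?_, ?_⟩, ?_⟩
  · intro t ht
    rw [hsrc] at ht
    rw [← hOs]
    exact ht.1
  · intro t ht
    rw [hsrc] at ht
    exact hw t (by rw [← hOs]; exact ht.1)
  · intro x hx hx0
    rw [hsrc] at hx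
    have hz : (e.symm (h.codChart x)).1 ∈ h.domChart.target := hx.2.2
    refine ⟨h.domChart.symm (e.symm (h.codChart x)).1, ?_⟩
    have ht := h.domChart.map_target hz
    have h3 := hw _ ht
    rw [h.domChart.right_inv hz] at h3
    apply h.codChart.injOn (h.source_subset_preimage_source ht) hx.2.1
    rw [h3]
    refine Eq.trans ?_ (e.apply_symm_apply _)
    exact congrArg e (Prod.ext rfl hx0.symm)
  · change u s ∈ (h.codChart.restr _).source
    rw [hsrc]
    refine ⟨?_, h.mem_codChart_source, ?_⟩
    · have : s ∈ u ⁻¹' O := by rw [hOs]; exact h.mem_domChart_source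
      exact this
    · change (e.symm (h.codChart (u s))).1 ∈ h.domChart.target
      rw [hw s h.mem_domChart_source, e.symm_apply_apply]
      exact h.domChart.map_source h.mem_domChart_source

namespace SliceChart

variable {u : S → M} (C : SliceChart u)

/-- The tangential coordinates. -/
def z (x : M) : E 2 := (C.e.symm (C.chart x)).1

/-- The normal coordinates. -/
def y (x : M) : E 2 := (C.e.symm (C.chart x)).2

theorem contMDiffAt_z {x : M} (hx : x ∈ C.chart.source) : ContMDiffAt (𝓡 4) 𝓘(ℝ, E 2) ∞ C.z x :=
  (((ContinuousLinearMap.fst ℝ (E 2) (E 2)).comp (C.e.symm : E 4 →L[ℝ] E 2 × E 2)).contDiff.contMDiff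
    (n := ∞)).contMDiffAt.comp x (contMDiffAt_of_mem C.mem hx)

theorem contMDiffAt_y {x : M} (hx : x ∈ C.chart.source) : ContMDiffAt (𝓡 4) 𝓘(ℝ, E 2) ∞ C.y x :=
  (((ContinuousLinearMap.snd ℝ (E 2) (E 2)).comp (C.e.symm : E 4 →L[ℝ] E 2 × E 2)).contDiff.contMDiff
    (n := ∞)).contMDiffAt.comp x (contMDiffAt_of_mem C.mem hx)

theorem dm_z {x : M} (hx : x ∈ C.chart.source) (v : TangentSpace (𝓡 4) x) :
    dm 4 C.z x v = (C.e.symm (dm 4 C.chart x v)).1 :=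
  dm_clm_comp ((ContinuousLinearMap.fst ℝ (E 2) (E 2)).comp (C.e.symm : E 4 →L[ℝ] E 2 × E 2))
    ((contMDiffAt_of_mem C.mem hx).mdifferentiableAt (by simp)) v

theorem dm_y {x : M} (hx : x ∈ C.chart.source) (v : TangentSpace (𝓡 4) x) :
    dm 4 C.y x v = (C.e.symm (dm 4 C.chart x v)).2 :=
  dm_clm_comp ((ContinuousLinearMap.snd ℝ (E 2) (E 2)).comp (C.e.symm : E 4 →L[ℝ] E 2 × E 2))
    ((contMDiffAt_of_mem C.mem hx).mdifferentiableAt (by simp)) v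

theorem y_apply_u {s : S} (hs : u s ∈ C.chart.source) : C.y (u s) = 0 := by
  rw [y, C.chart_apply s hs, C.e.symm_apply_apply]

theorem z_apply_u {s : S} (hs : u s ∈ C.chart.source) : C.z (u s) = C.dom s := by
  rw [z, C.chart_apply s hs, C.e.symm_apply_apply]

theorem mem_range_iff {x : M} (hx : x ∈ C.chart.source) : x ∈ Set.range u ↔ C.y x = 0 := by
  constructor
  · rintro ⟨s, rfl⟩
    exact C.y_apply_u hx
  · exact C.mem_range x hx

theorem dm_y_surjective {x : M} (hx : x ∈ C.chart.source) : Function.Surjective (dm 4 C.y x) := by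
  intro w
  obtain ⟨v, hv⟩ := dm_surjective C.mem hx (C.e (0, w))
  exact ⟨v, by rw [C.dm_y hx, hv, C.e.symm_apply_apply]⟩

theorem eventually_mem (hu : Continuous u) {s : S} (hs : u s ∈ C.chart.source) :
    ∀ᶠ t in 𝓝 s, u t ∈ C.chart.source :=
  hu.continuousAt.eventually (C.chart.open_source.mem_nhds hs)

variable (hu : Manifold.IsSmoothEmbedding (𝓡 2) (𝓡 4) ∞ u)

include hu in
theorem dm_y_mfderiv {s : S} (hs : u s ∈ C.chart.source) (v : TangentSpace (𝓡 2) s) :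
    dm 4 C.y (u s) (mfderiv (𝓡 2) (𝓡 4) u s v) = 0 := by
  rw [← dm_comp_mfderiv ((C.contMDiffAt_y hs).mdifferentiableAt (by simp))
    (hu.isImmersion.contMDiff.contMDiffAt.mdifferentiableAt (by simp))]
  have : C.y ∘ u =ᶠ[𝓝 s] fun _ => 0 := by
    filter_upwards [C.eventually_mem hu.isEmbedding.continuous hs] with t ht
    exact C.y_apply_u ht
  rw [dm_congr this, dm_const]
  rfl

include hu in
theorem dm_z_mfderiv {s : S} (hs : u s ∈ C.chart.source) (v : TangentSpace (𝓡 2) s) :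
    dm 4 C.z (u s) (mfderiv (𝓡 2) (𝓡 4) u s v) = dm 2 C.dom s v := by
  rw [← dm_comp_mfderiv ((C.contMDiffAt_z hs).mdifferentiableAt (by simp))
    (hu.isImmersion.contMDiff.contMDiffAt.mdifferentiableAt (by simp))]
  have : C.z ∘ u =ᶠ[𝓝 s] C.dom := by
    filter_upwards [C.eventually_mem hu.isEmbedding.continuous hs] with t ht
    exact C.z_apply_u ht
  rw [dm_congr this]

include hu in
theorem mfderiv_injective {s : S} (hs : u s ∈ C.chart.source) :
    Function.Injective (mfderiv (𝓡 2) (𝓡 4) u s) := by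
  intro v w hvw
  apply dm_injective C.dom_mem (C.mem_dom s hs)
  rw [← C.dm_z_mfderiv hu hs, ← C.dm_z_mfderiv hu hs, hvw]

include hu in
-- The tangent plane of the curve lies in the kernel of dy, and both have dimension 2.
theorem exists_mfderiv_eq {s : S} (hs : u s ∈ C.chart.source) {w : TangentSpace (𝓡 4) (u s)}
    (hw : dm 4 C.y (u s) w = 0) : ∃ v, mfderiv (𝓡 2) (𝓡 4) u s v = w := by
  have h1 : LinearMap.range (mfderiv (𝓡 2) (𝓡 4) u s).toLinearMap ≤
      LinearMap.ker (dm 4 C.y (u s)).toLinearMap := by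
    rintro _ ⟨v, rfl⟩
    exact C.dm_y_mfderiv hu hs v
  have h2 := LinearMap.finrank_range_of_inj
    (f := (mfderiv (𝓡 2) (𝓡 4) u s).toLinearMap) (C.mfderiv_injective hu hs)
  have h3 := (dm 4 C.y (u s)).toLinearMap.finrank_range_add_finrank_ker
  rw [LinearMap.range_eq_top.2 (C.dm_y_surjective hs), finrank_top] at h3
  rw [finrank_tangent] at h2 h3
  have h4 := Submodule.eq_of_le_of_finrank_eq h1 (by
    rw [h2]
    simp at h3
    omega)
  have h5 : w ∈ LinearMap.ker (dm 4 C.y (u s)).toLinearMap := hw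
  rw [← h4] at h5
  exact h5

end SliceChart

namespace HolCurve

variable {τ₀ : Form 4 M 2} {J : ∀ x : M, TangentSpace (𝓡 4) x →L[ℝ] TangentSpace (𝓡 4) x}
    {j : ∀ s : S, TangentSpace (𝓡 2) s →L[ℝ] TangentSpace (𝓡 2) s} {u : S → M}
    (h : HolCurve τ₀ J j u)

include h

theorem contMDiff : ContMDiff (𝓡 2) (𝓡 4) ∞ u := h.emb.isImmersion.contMDiff

theorem continuous : Continuous u := h.emb.isEmbedding.continuous

theorem isCompact_range : IsCompact (Set.range u) := by
  rw [← Set.image_univ]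
  exact isCompact_univ.image h.continuous

theorem mfderiv_injective (s : S) : Function.Injective (mfderiv (𝓡 2) (𝓡 4) u s) := by
  obtain ⟨C, hC⟩ := exists_sliceChart h.emb s
  exact C.mfderiv_injective h.emb hC

/-- The tangent spaces of the curve are complex. -/
theorem dm_y_J (C : SliceChart u) {x : M} (hx : x ∈ C.chart.source) (hxu : x ∈ Set.range u)
    {w : TangentSpace (𝓡 4) x} (hw : dm 4 C.y x w = 0) : dm 4 C.y x (J x w) = 0 := by
  obtain ⟨s, rfl⟩ := hxu
  obtain ⟨v, rfl⟩ := C.exists_mfderiv_eq h.emb hx hw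
  rw [← h.hol s v]
  exact C.dm_y_mfderiv h.emb hx _

theorem isVolume : IsVolume (wedgeForm τ₀ τ₀) := by
  refine isVolume_of_chart (h.symp.smooth.wedge h.symp.smooth).isContTop fun c => ?_
  rw [coef_eq_frameAt]
  exact wedgeAlt_self_ne_zero (T := TangentSpace (𝓡 4) _) (finrank_tangent _)
    (h.acs.sq_eq_neg _) (h.tame _)
    (linearIndependent_frameAt (IsManifold.chart_mem_maximalAtlas c)
      ((chartAt (E 4) c).map_source (mem_chart_source _ _)))

omit h in
theorem orientedBy (τ₀ : Form 4 M 2) : OrientedBy (symplecticPos τ₀) (wedgeForm τ₀ τ₀) :=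
  fun _ _ _ => Iff.rfl

theorem pullback_apply_pos (s : S) {v : TangentSpace (𝓡 2) s} (hv : v ≠ 0) :
    0 < pullback u τ₀ s ![v, j s v] := by
  have h1 : pullback u τ₀ s ![v, j s v] = τ₀ (u s) ![mfderiv (𝓡 2) (𝓡 4) u s v,
      J (u s) (mfderiv (𝓡 2) (𝓡 4) u s v)] := by
    rw [← h.hol]
    change τ₀ (u s) _ = _
    congr 1
    funext i
    fin_cases i <;> rfl
  rw [h1]
  refine h.tame _ _ fun h0 => hv (h.mfderiv_injective s ?_)
  rw [h0, map_zero]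

/-- On a surface the almost complex structure determines a basis. -/
theorem exists_combination (s : S) {v : TangentSpace (𝓡 2) s} (hv : v ≠ 0)
    (w : TangentSpace (𝓡 2) s) : ∃ a b : ℝ, w = a • v + b • j s v :=
  exists_complex_combination (finrank_tangent s) (h.acsj.sq_eq_neg s) hv w

theorem pullback_combination (s : S) (v : TangentSpace (𝓡 2) s) (a b : ℝ) :
    pullback u τ₀ s ![v, a • v + b • j s v] = b * pullback u τ₀ s ![v, j s v] := by
  rw [form2_add_right, form2_smul_right, form2_smul_right, form2_self]
  ring

omit h in
theorem _root_.Inflation.coef_two_eq {X : Type*} [TopologicalSpace X] [ChartedSpace (E 2) X]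
    (c : X) (σ : Form 2 X 2) (y : E 2) :
    coef (chartAt (E 2) c).symm σ y = σ _ ![coordFrame c y 0, coordFrame c y 1] := by
  change σ _ _ = σ _ _
  congr 1
  funext i
  fin_cases i <;> rfl

omit h in
theorem _root_.Inflation.coordFrame_ne_zero {n : ℕ} {X : Type*} [TopologicalSpace X]
    [ChartedSpace (E n) X] [IsManifold (𝓡 n) ∞ X] {c : X} {y : E n}
    (hy : y ∈ (chartAt (E n) c).target) (i : Fin n) : coordFrame c y i ≠ 0 :=
  (linearIndependent_frameAt (IsManifold.chart_mem_maximalAtlas c) hy).ne_zero i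

/-- A tame form restricts to an area form on a holomorphic curve. It serves as reference volume for
all integrals over S and induces the complex orientation. -/
theorem isVolume_pullback : IsVolume (pullback u τ₀) := by
  refine isVolume_of_chart (h.symp.smooth.pb h.contMDiff).isContTop fun c => ?_
  have hy : chartAt (E 2) c c ∈ (chartAt (E 2) c).target :=
    (chartAt (E 2) c).map_source (mem_chart_source _ _)
  rw [coef_two_eq]
  obtain ⟨a, b, hab⟩ := h.exists_combination _ (coordFrame_ne_zero hy 0) (coordFrame c _ 1)
  rw [hab, h.pullback_combination]
  refine mul_ne_zero (fun hb => ?_) (h.pullback_apply_pos _ (coordFrame_ne_zero hy 0)).ne'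
  rw [hb, zero_smul, add_zero] at hab
  have h1 := linearIndependent_frameAt (IsManifold.chart_mem_maximalAtlas c) hy
  have h2 : LinearIndependent ℝ ![coordFrame c (chartAt (E 2) c c) 0,
      coordFrame c (chartAt (E 2) c c) 1] := by
    have h3 : ![coordFrame c (chartAt (E 2) c c) 0, coordFrame c (chartAt (E 2) c c) 1] =
        fun i : Fin 2 => coordFrame c (chartAt (E 2) c c) i := by
      funext i
      fin_cases i <;> rfl
    rw [h3]
    exact h1
  rw [LinearIndependent.pair_iff] at h2
  have := (h2 a (-1) (by rw [← hab, neg_one_smul, add_neg_cancel])).2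
  norm_num at this

theorem orientedBy_pullback : OrientedBy (complexPos j) (pullback u τ₀) := by
  intro c y hy
  rw [coef_two_eq]
  have h0 := h.pullback_apply_pos _ (coordFrame_ne_zero hy 0)
  constructor
  · rintro ⟨a, b, hb, hab⟩
    rw [hab, h.pullback_combination]
    exact mul_pos hb h0
  · intro hp
    obtain ⟨a, b, hab⟩ := h.exists_combination _ (coordFrame_ne_zero hy 0) (coordFrame c y 1)
    refine ⟨a, b, ?_, hab⟩
    rw [hab, h.pullback_combination] at hp
    exact pos_of_mul_pos_left hp h0.le

theorem curveIntegral_add {α β : Form 4 M 2} (hα : IsSmoothForm α) (hβ : IsSmoothForm β) :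
    curveIntegral j u (α + β) = curveIntegral j u α + curveIntegral j u β :=
  integral_add_form h.isVolume_pullback h.orientedBy_pullback
    (σ := pullback u α) (σ' := pullback u β) (hα.pb h.contMDiff).isContTop
    (hβ.pb h.contMDiff).isContTop ⟨Set.univ, isCompact_univ, fun x hx => absurd (Set.mem_univ x) hx⟩
    ⟨Set.univ, isCompact_univ, fun x hx => absurd (Set.mem_univ x) hx⟩

theorem curveIntegral_smul (r : ℝ) (α : Form 4 M 2) :
    curveIntegral j u (r • α) = r * curveIntegral j u α :=
  integral_smul_form h.isVolume_pullback h.orientedBy_pullback (pullback u α) r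

theorem curveIntegral_exact {μ : Form 4 M 1} {θ : Form 4 M 2} (hμ : IsSmoothForm μ)
    (hθ : HasExtDeriv μ θ) : curveIntegral j u θ = 0 :=
  integral_exact_surface h.isVolume_pullback h.orientedBy_pullback (hμ.pb h.contMDiff)
    ⟨Set.univ, isCompact_univ, fun x hx => absurd (Set.mem_univ x) hx⟩ (HasExtDeriv.pb hμ hθ h.contMDiff)

omit h in
theorem curveIntegral_congr {α β : Form 4 M 2} (hαβ : ∀ x ∈ Set.range u, α x = β x) :
    curveIntegral j u α = curveIntegral j u β := by
  have : pullback u α = pullback u β := by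
    funext s
    rw [pullback, pullback, hαβ _ ⟨s, rfl⟩]
  rw [curveIntegral, curveIntegral, this]

theorem curveIntegral_fsmul_pos {f : M → ℝ} (hf : Continuous f) (hf0 : ∀ x, 0 ≤ f x) {s : S}
    (hs : 0 < f (u s)) : 0 < curveIntegral j u (fsmul f τ₀) :=
  integral_fsmul_pos h.isVolume_pullback h.orientedBy_pullback (f := f ∘ u) (hf.comp h.continuous)
    (fun _ => hf0 _) isCompact_univ (fun x hx => absurd (Set.mem_univ x) hx) (x₀ := s) hs

end HolCurve

end Curve

/-! ### One-forms, differentials of functions, and the Leibniz rule. -/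

section OneForms

section Point

variable {T : Type*} [AddCommGroup T] [Module ℝ T] [TopologicalSpace T]

/-- A linear functional as an alternating `1`-form. -/
def one (f : T →L[ℝ] ℝ) : T [⋀^Fin 1]→L[ℝ] ℝ := ContinuousAlternatingMap.ofSubsingleton ℝ T ℝ 0 f

theorem form1_add (α : T [⋀^Fin 1]→L[ℝ] ℝ) (a b : T) : α ![a + b] = α ![a] + α ![b] := by
  have h := α.map_update_add ![a] 0 a b
  have e : ∀ x : T, Function.update ![a] 0 x = ![x] := by
    intro x; funext i; fin_cases i; rfl
  rwa [e, e, e] at h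

theorem form1_smul (α : T [⋀^Fin 1]→L[ℝ] ℝ) (r : ℝ) (a : T) : α ![r • a] = r * α ![a] := by
  have h := α.map_update_smul ![a] 0 r a
  have e : ∀ x : T, Function.update ![a] 0 x = ![x] := by
    intro x; funext i; fin_cases i; rfl
  rwa [e, e] at h

theorem form1_continuous (α : T [⋀^Fin 1]→L[ℝ] ℝ) (i : Fin 2) :
    Continuous fun v : Fin 2 → T => α ![v i] := by
  refine α.cont.comp (continuous_pi fun k => ?_)
  fin_cases k
  exact continuous_apply i

/-- The wedge product of two `1`-forms. -/
def wedge11 (α β : T [⋀^Fin 1]→L[ℝ] ℝ) : T [⋀^Fin 2]→L[ℝ] ℝ where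
  toFun v := α ![v 0] * β ![v 1] - α ![v 1] * β ![v 0]
  map_update_add' := by
    intro dec v i x y
    have hd : dec = instDecidableEqFin 2 := Subsingleton.elim _ _
    subst hd
    fin_cases i <;> simp [form1_add, Function.update] <;> ring
  map_update_smul' := by
    intro dec v i x y
    have hd : dec = instDecidableEqFin 2 := Subsingleton.elim _ _
    subst hd
    fin_cases i <;> simp [form1_smul, Function.update] <;> ring
  map_eq_zero_of_eq' := by
    intro v i j hij hne
    fin_cases i <;> fin_cases j <;> first | exact absurd rfl hne | skip
    all_goals
      simp only [Fin.zero_eta, Fin.mk_one, Fin.isValue] at hij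
      simp only [hij]
      ring
  cont := by
    have := form1_continuous α
    have := form1_continuous β
    fun_prop

theorem wedge11_apply (α β : T [⋀^Fin 1]→L[ℝ] ℝ) (v w : T) :
    wedge11 α β ![v, w] = α ![v] * β ![w] - α ![w] * β ![v] := rfl

theorem form2_ext {α β : T [⋀^Fin 2]→L[ℝ] ℝ} (h : ∀ v w, α ![v, w] = β ![v, w]) : α = β := by
  ext v
  have : v = ![v 0, v 1] := by
    funext i
    fin_cases i <;> rfl
  rw [this]
  exact h _ _

end Point

variable {n : ℕ} {X : Type*} [TopologicalSpace X] [ChartedSpace (E n) X]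

/-- The differential of a function, as a `1`-form. -/
def dfn (f : X → ℝ) : Form n X 1 := fun x => one (dm n f x)

theorem dfn_apply (f : X → ℝ) (x : X) (v : TangentSpace (𝓡 n) x) :
    (dfn f : Form n X 1) x ![v] = dm n f x v := rfl

/-- The wedge product of two `1`-forms on a manifold. -/
def wedgeOne (α β : Form n X 1) : Form n X 2 := fun x => wedge11 (α x) (β x)

theorem inChart_apply_pair (σ : Form n X 2) (c : X) (y v w : E n) :
    inChart σ c y ![v, w] = σ _ ![chartFrame c y v, chartFrame c y w] := by
  change σ _ _ = σ _ _
  congr 1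
  funext i
  fin_cases i <;> rfl

theorem inChart_apply_single (σ : Form n X 1) (c : X) (y v : E n) :
    inChart σ c y ![v] = σ _ ![chartFrame c y v] := by
  change σ _ _ = σ _ _
  congr 1
  funext i
  fin_cases i
  rfl

theorem inChart_wedgeOne (α β : Form n X 1) (c : X) (y : E n) :
    inChart (wedgeOne α β) c y = wedge11 (inChart α c y) (inChart β c y) := by
  refine form2_ext fun v w => ?_
  rw [inChart_apply_pair, wedge11_apply]
  simp only [inChart_apply_single]
  exact wedge11_apply _ _ _ _

theorem IsSmoothForm.wedgeOne {α β : Form n X 1} (hα : IsSmoothForm α) (hβ : IsSmoothForm β) :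
    IsSmoothForm (wedgeOne α β) := by
  intro c y hy
  rw [extChartAt_target_eq] at hy
  have h1 : inChart (Inflation.wedgeOne α β) c = fun y => wedge11 (inChart α c y) (inChart β c y) :=
    funext (inChart_wedgeOne α β c)
  rw [h1]
  refine (contDiffAt_alternating_of_apply fun v => ?_).contDiffWithinAt
  have ha := fun w => contDiffAt_form_apply (hα.contDiffAt hy) w
  have hb := fun w => contDiffAt_form_apply (hβ.contDiffAt hy) w
  exact ((ha _).mul (hb _)).sub ((ha _).mul (hb _))

variable [IsManifold (𝓡 n) ∞ X]

theorem dfn_eq_vpb (f : X → ℝ) :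
    (dfn f : Form n X 1) = vpb f (fun _ => one (ContinuousLinearMap.id ℝ ℝ)) := rfl

theorem isSmoothForm_dfn {f : X → ℝ} (hf : ContMDiff (𝓡 n) 𝓘(ℝ, ℝ) ∞ f) :
    IsSmoothForm (dfn f : Form n X 1) := by
  rw [dfn_eq_vpb]
  exact isSmoothForm_vpb hf contDiff_const

theorem hasExtDeriv_dfn {f : X → ℝ} (hf : ContMDiff (𝓡 n) 𝓘(ℝ, ℝ) ∞ f) :
    HasExtDeriv (dfn f : Form n X 1) 0 := by
  rw [dfn_eq_vpb]
  have h := hasExtDeriv_vpb (n := n) hf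
    (Ω := fun _ => one (ContinuousLinearMap.id ℝ ℝ)) contDiff_const
  have h0 : extDeriv (fun _ : ℝ => one (ContinuousLinearMap.id ℝ ℝ)) = 0 := by
    funext y
    refine form2_ext fun v w => ?_
    rw [extDeriv_one_apply (differentiableAt_const _)]
    simp
  rw [h0] at h
  exact h

/-- The Leibniz rule for the product of a function and a `1`-form. -/
theorem HasExtDeriv.fsmul {σ : Form n X 1} {θ : Form n X 2} (hσ : IsSmoothForm σ)
    (h : HasExtDeriv σ θ) {f : X → ℝ} (hf : ContMDiff (𝓡 n) 𝓘(ℝ, ℝ) ∞ f) :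
    HasExtDeriv (Inflation.fsmul f σ) (Inflation.wedgeOne (dfn f) σ + Inflation.fsmul f θ) := by
  intro c y hy
  have hy' := hy
  rw [extChartAt_target_eq] at hy'
  have hF := contDiffAt_comp_chart_symm hf hy'
  have hσ' := fun w => (contDiffAt_form_apply (hσ.contDiffAt hy') w).differentiableAt (by simp)
  have hFd := hF.differentiableAt (by simp)
  refine form2_ext fun v w => ?_
  have hd : ∀ v, inChart (dfn f : Form n X 1) c y ![v] =
      fderiv ℝ (f ∘ (chartAt (E n) c).symm) y v := by
    intro v
    rw [inChart_apply_single, dfn_apply]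
    exact (fderiv_comp_mfderiv (hf.mdifferentiableAt (by simp))
      ((contMDiffAt_chart_symm hy').mdifferentiableAt (by simp)) v).symm
  have hp : ∀ v w, fderiv ℝ (fun z => inChart (Inflation.fsmul f σ) c z ![w]) y v =
      f ((chartAt (E n) c).symm y) * fderiv ℝ (fun z => inChart σ c z ![w]) y v +
      inChart σ c y ![w] * fderiv ℝ (f ∘ (chartAt (E n) c).symm) y v := by
    intro v w
    have h1 := congrArg (fun L : E n →L[ℝ] ℝ => L v)
      (hFd.hasFDerivAt.mul (hσ' ![w]).hasFDerivAt).fderiv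
    exact h1
  rw [extDeriv_one_apply (((hσ.fsmul hf).contDiffAt hy').differentiableAt (by simp)), hp, hp,
    inChart_add, Pi.add_apply, ContinuousAlternatingMap.add_apply, inChart_wedgeOne, wedge11_apply,
    inChart_fsmul, ContinuousAlternatingMap.smul_apply, ← h c y hy,
    extDeriv_one_apply ((hσ.contDiffAt hy').differentiableAt (by simp)), hd, hd, smul_eq_mul]
  ring

theorem hasExtDeriv_fsmul_dfn {f g : X → ℝ} (hf : ContMDiff (𝓡 n) 𝓘(ℝ, ℝ) ∞ f)
    (hg : ContMDiff (𝓡 n) 𝓘(ℝ, ℝ) ∞ g) :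
    HasExtDeriv (fsmul f (dfn g : Form n X 1)) (wedgeOne (dfn f) (dfn g)) := by
  have h := HasExtDeriv.fsmul (isSmoothForm_dfn hg) (hasExtDeriv_dfn hg) hf
  have h0 : fsmul f (0 : Form n X 2) = 0 := by
    funext x
    exact smul_zero _
  rwa [h0, add_zero] at h

end OneForms

/-! ### The almost complex structure in a chart. -/

section ComplexStructureInChart

variable {n : ℕ} {X : Type*} [TopologicalSpace X] [ChartedSpace (E n) X] [IsManifold (𝓡 n) ∞ X]

/-- The expression of an endomorphism field in a chart. -/
def Jc (J : ∀ x : X, TangentSpace (𝓡 n) x →L[ℝ] TangentSpace (𝓡 n) x)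
    (Ψ : OpenPartialHomeomorph X (E n)) (y : E n) : E n →L[ℝ] E n :=
  (dm n Ψ (Ψ.symm y)).comp ((J (Ψ.symm y)).comp (frameAt Ψ y))

variable {J : ∀ x : X, TangentSpace (𝓡 n) x →L[ℝ] TangentSpace (𝓡 n) x}
  {Ψ : OpenPartialHomeomorph X (E n)}

theorem frameAt_dm (hΨ : Ψ ∈ IsManifold.maximalAtlas (𝓡 n) ∞ X) {y : E n} (hy : y ∈ Ψ.target)
    (v : TangentSpace (𝓡 n) (Ψ.symm y)) : frameAt Ψ y (dm n Ψ (Ψ.symm y) v) = v := by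
  obtain ⟨w, rfl⟩ := frameAt_surjective hΨ hy v
  rw [dm_frameAt hΨ hy]

theorem frameAt_Jc (hΨ : Ψ ∈ IsManifold.maximalAtlas (𝓡 n) ∞ X) {y : E n} (hy : y ∈ Ψ.target)
    (v : E n) : frameAt Ψ y (Jc J Ψ y v) = J (Ψ.symm y) (frameAt Ψ y v) :=
  frameAt_dm hΨ hy _

/-- Smoothness of J as a section of the endomorphism bundle is smoothness in the tangent coordinates
of the preferred chart; conjugating with the derivatives of the transition maps moves it to Ψ. -/
theorem contDiffAt_Jc (hJ : IsAlmostComplex J) (hΨ : Ψ ∈ IsManifold.maximalAtlas (𝓡 n) ∞ X)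
    {y : E n} (hy : y ∈ Ψ.target) : ContDiffAt ℝ ∞ (Jc J Ψ) y := by
  set x₀ := Ψ.symm y with hx₀
  set Φ := chartAt (E n) x₀ with hΦd
  have hΦ : Φ ∈ IsManifold.maximalAtlas (𝓡 n) ∞ X := IsManifold.chart_mem_maximalAtlas _
  have hs : x₀ ∈ Φ.source := mem_chart_source _ _
  have h1 := ((contMDiffAt_hom_bundle _).1 (hJ.smooth x₀)).2
  have hsm := contMDiffAt_symm_of_mem hΨ hy
  have h2 := h1.comp y hsm
  have : IsManifold (𝓡 n) 1 X := IsManifold.of_le (n := ∞) (by exact_mod_cast le_top)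
  have ht : ContDiffAt ℝ ∞ (Φ ∘ Ψ.symm) y := contDiffAt_transition hΨ hΦ hy hs
  have ht' : ContDiffAt ℝ ∞ (Ψ ∘ Φ.symm) (Φ (Ψ.symm y)) :=
    contDiffAt_transition hΦ hΨ (Φ.map_source hs) (by
      rw [Φ.left_inv hs]
      exact Ψ.map_target hy)
  have h3 : ContDiffAt ℝ ∞ (fun z => (fderiv ℝ (Ψ ∘ Φ.symm) (Φ (Ψ.symm z))).comp
      ((inTangentCoordinates (𝓡 n) (𝓡 n) id id J x₀ (Ψ.symm z)).comp
        (fderiv ℝ (Φ ∘ Ψ.symm) z))) y := by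
    refine ContDiffAt.clm_comp ?_ (ContDiffAt.clm_comp h2.contDiffAt (ht.fderiv_right (by simp)))
    exact (ht'.fderiv_right (m := ∞) (by simp)).comp y ht
  refine h3.congr_of_eventuallyEq ?_
  have hev : ∀ᶠ z in 𝓝 y, Ψ.symm z ∈ Φ.source :=
    hsm.continuousAt.eventually (Φ.open_source.mem_nhds hs)
  filter_upwards [hev, Ψ.open_target.mem_nhds hy] with z hz hzt
  have hyz : Φ (Ψ.symm z) ∈ Φ.target := Φ.map_source hz
  ext1 v
  have e1 := inTangentCoordinates_eq_mfderiv_comp (I := 𝓡 n) (I' := 𝓡 n) (f := id) (g := id)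
    (ϕ := J) (x₀ := x₀) (x := Ψ.symm z) hz hz
  have e2 : fderiv ℝ (Φ ∘ Ψ.symm) z v = dm n Φ (Ψ.symm z) (frameAt Ψ z v) :=
    fderiv_comp_mfderiv ((contMDiffAt_of_mem hΦ hz).mdifferentiableAt (by simp))
      ((contMDiffAt_symm_of_mem hΨ hzt).mdifferentiableAt (by simp)) v
  have e3 : ∀ w, inTangentCoordinates (𝓡 n) (𝓡 n) id id J x₀ (Ψ.symm z)
      (dm n Φ (Ψ.symm z) w) = dm n Φ (Ψ.symm z) (J (Ψ.symm z) w) := by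
    intro w
    rw [e1]
    have e4 : mfderivWithin 𝓘(ℝ, E n) (𝓡 n) (extChartAt (𝓡 n) x₀).symm (Set.range (𝓡 n))
        (extChartAt (𝓡 n) x₀ (Ψ.symm z)) = frameAt Φ (Φ (Ψ.symm z)) := by
      simp only [mfld_simps, mfderivWithin_univ]
      rfl
    have e5 : ∀ (p : X) (hp : p ∈ Φ.source) (w : TangentSpace (𝓡 n) p),
        (frameAt Φ (Φ p) (dm n Φ p w) : E n) = w := by
      intro p hp w
      have hq := Φ.map_source hp
      have := frameAt_dm hΦ hq
      rw [Φ.left_inv hp] at this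
      exact this w
    change (mfderiv (𝓡 n) (𝓡 n) (extChartAt (𝓡 n) x₀) (Ψ.symm z) : E n →L[ℝ] E n)
      (J (Ψ.symm z) (mfderivWithin 𝓘(ℝ, E n) (𝓡 n) (extChartAt (𝓡 n) x₀).symm (Set.range (𝓡 n))
        (extChartAt (𝓡 n) x₀ (Ψ.symm z)) (dm n Φ (Ψ.symm z) w))) = _
    rw [e4]
    have e6 := e5 _ hz w
    have e7 : mfderiv (𝓡 n) (𝓡 n) (extChartAt (𝓡 n) x₀) (Ψ.symm z) = dm n Φ (Ψ.symm z) := by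
      have : (extChartAt (𝓡 n) x₀ : X → E n) = Φ := by
        funext p
        simp [hΦd, extChartAt]
      rw [this]
      rfl
    rw [e7]
    exact congrArg (fun q : TangentSpace (𝓡 n) (Ψ.symm z) => dm n Φ (Ψ.symm z) (J (Ψ.symm z) q)) e6
  have e8 : ∀ (p : X) (hp : p ∈ Φ.source) (hp' : p ∈ Ψ.source) (w : TangentSpace (𝓡 n) p),
      fderiv ℝ (Ψ ∘ Φ.symm) (Φ p) (dm n Φ p w) = dm n Ψ p w := by
    intro p hp hp' w
    have hq := Φ.map_source hp
    have h4 : MDifferentiableAt (𝓡 n) 𝓘(ℝ, E n) Ψ (Φ.symm (Φ p)) := by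
      rw [Φ.left_inv hp]
      exact (contMDiffAt_of_mem hΨ hp').mdifferentiableAt (by simp)
    rw [fderiv_comp_mfderiv h4 ((contMDiffAt_symm_of_mem hΦ hq).mdifferentiableAt (by simp))]
    have := frameAt_dm hΦ hq
    rw [Φ.left_inv hp] at this ⊢
    exact congrArg (dm n Ψ p) (this w)
  change dm n Ψ (Ψ.symm z) (J (Ψ.symm z) (frameAt Ψ z v)) = fderiv ℝ (Ψ ∘ Φ.symm) (Φ (Ψ.symm z))
    (inTangentCoordinates (𝓡 n) (𝓡 n) id id J x₀ (Ψ.symm z) (fderiv ℝ (Φ ∘ Ψ.symm) z v))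
  rw [e2, e3, e8 _ hz (Ψ.map_target hzt)]

end ComplexStructureInChart

/-! ### Comparison of vanishing functions and perturbation of tame forms. -/

section LocalEstimates

/-- A function which vanishes on a submanifold is bounded by any other such function whose derivative
is injective in the normal directions. -/
theorem eventually_norm_le_of_vanishing {A B D F V : Type*} [NormedAddCommGroup A] [NormedSpace ℝ A]
    [NormedAddCommGroup B] [NormedSpace ℝ B] [FiniteDimensional ℝ B]
    [NormedAddCommGroup D] [NormedSpace ℝ D] [NormedAddCommGroup F] [NormedSpace ℝ F]
    [NormedAddCommGroup V] [NormedSpace ℝ V] (e : (A × B) ≃L[ℝ] D) {a : A} {f : D → F} {g : D → V}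
    {f' : D →L[ℝ] F} {g' : D →L[ℝ] V} (hf : HasStrictFDerivAt f f' (e (a, 0)))
    (hg : HasStrictFDerivAt g g' (e (a, 0)))
    (hf0 : ∀ᶠ p in 𝓝 (e (a, 0)), (e.symm p).2 = 0 → f p = 0)
    (hg0 : ∀ᶠ p in 𝓝 (e (a, 0)), (e.symm p).2 = 0 → g p = 0)
    (hinj : ∀ w, g' (e (0, w)) = 0 → w = 0) :
    ∃ C : ℝ, 0 ≤ C ∧ ∀ᶠ p in 𝓝 (e (a, 0)), ‖f p‖ ≤ C * ‖g p‖ := by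
  let i : B →L[ℝ] D := (e : A × B →L[ℝ] D).comp (ContinuousLinearMap.inr ℝ A B)
  have hi : ∀ w, i w = e (0, w) := fun w => rfl
  -- An injective linear map on the finite-dimensional normal space is bounded below.
  obtain ⟨K, hK, hL⟩ := ((g'.comp i).toLinearMap).exists_antilipschitzWith
    (LinearMap.ker_eq_bot'.2 hinj)
  have hLw : ∀ w, ‖w‖ ≤ K * ‖g' (i w)‖ := fun w => by
    have := hL.le_mul_norm_sub 0 w
    simpa using this
  -- Projection to the plane, where both functions vanish. Strict differentiability at the base
  -- point, applied to the pairs (p, π p), expresses f p and g p through the normal component alone,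
  -- with uniform error.
  let π : D → D := fun p => e ((e.symm p).1, 0)
  have hπ : Filter.Tendsto (fun p => (p, π p)) (𝓝 (e (a, 0))) (𝓝 (e (a, 0), e (a, 0))) := by
    have hc : Continuous fun p : D => (p, π p) := by fun_prop
    have h1 := hc.tendsto (e (a, 0))
    have h2 : π (e (a, 0)) = e (a, 0) := by simp [π]
    rwa [h2] at h1
  have hπ2 := (continuous_snd.tendsto _).comp hπ
  have hsub : ∀ p, p - π p = i (e.symm p).2 := by
    intro p
    rw [hi]
    apply e.symm.injective
    rw [map_sub, e.symm_apply_apply]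
    simp only [e.symm_apply_apply]
    ext <;> simp
  have hπ0 : ∀ p, (e.symm (π p)).2 = 0 := by
    intro p
    change (e.symm (e ((e.symm p).1, 0))).2 = 0
    rw [e.symm_apply_apply]
  have hKpos : (0 : ℝ) < K := hK
  have hden : (0 : ℝ) < 2 * K * (‖i‖ + 1) := by positivity
  -- With this constant the error term of g costs at most half of the norm of the normal component.
  have h1 := hπ.eventually (hg.isLittleO.def (c := (2 * K * (‖i‖ + 1))⁻¹) (by positivity))
  have h2 := hπ.eventually (hf.isLittleO.def (c := 1) one_pos)
  refine ⟨(‖f'‖ + 1) * (‖i‖ + 1) * (2 * K), by positivity, ?_⟩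
  filter_upwards [h1, h2, hπ2.eventually hf0, hπ2.eventually hg0] with p h1 h2 h3 h4
  have h3' : f (π p) = 0 := h3 (hπ0 p)
  have h4' : g (π p) = 0 := h4 (hπ0 p)
  simp only [h3', h4', sub_zero, hsub] at h1 h2
  set w := (e.symm p).2
  have hiw : ‖i w‖ ≤ (‖i‖ + 1) * ‖w‖ := (i.le_opNorm w).trans (by nlinarith [norm_nonneg w])
  have h5 : ‖w‖ ≤ 2 * K * ‖g p‖ := by
    have h6 : ‖g' (i w)‖ ≤ ‖g p‖ + (2 * K * (‖i‖ + 1))⁻¹ * ‖i w‖ := by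
      have := norm_sub_norm_le (g' (i w)) (g p)
      rw [norm_sub_rev] at this
      linarith
    have h7 : K * ((2 * K * (‖i‖ + 1))⁻¹ * ‖i w‖) ≤ ‖w‖ / 2 := by
      calc K * ((2 * K * (‖i‖ + 1))⁻¹ * ‖i w‖)
          ≤ K * ((2 * K * (‖i‖ + 1))⁻¹ * ((‖i‖ + 1) * ‖w‖)) := by gcongr
        _ = ‖w‖ / 2 := by field_simp
    have h8 := hLw w
    have h9 : (K : ℝ) * ‖g' (i w)‖ ≤ K * (‖g p‖ + (2 * K * (‖i‖ + 1))⁻¹ * ‖i w‖) := by gcongr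
    nlinarith
  calc ‖f p‖ ≤ ‖f' (i w)‖ + 1 * ‖i w‖ := by
        have := norm_sub_norm_le (f p) (f' (i w))
        linarith
    _ ≤ ‖f'‖ * ‖i w‖ + 1 * ‖i w‖ := by gcongr; exact f'.le_opNorm _
    _ = (‖f'‖ + 1) * ‖i w‖ := by ring
    _ ≤ (‖f'‖ + 1) * ((‖i‖ + 1) * (2 * K * ‖g p‖)) := by
        gcongr
        exact hiw.trans (by gcongr)
    _ = _ := by ring

variable {D V : Type*} [TopologicalSpace D] [NormedAddCommGroup V] [NormedSpace ℝ V]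

theorem form2_norm_le (Ω : V [⋀^Fin 2]→L[ℝ] ℝ) (v w : V) : |Ω ![v, w]| ≤ ‖Ω‖ * (‖v‖ * ‖w‖) := by
  have := Ω.le_opNorm ![v, w]
  simpa [Fin.prod_univ_two] using this

theorem eventually_abs_sub_le {Ω : D → V [⋀^Fin 2]→L[ℝ] ℝ} {A : D → V →L[ℝ] V} {y₀ : D}
    (hΩ : ContinuousAt Ω y₀) (hA : ContinuousAt A y₀) {ε : ℝ} (hε : 0 < ε) :
    ∀ᶠ y in 𝓝 y₀, ∀ v, |Ω y ![v, A y v] - Ω y₀ ![v, A y₀ v]| ≤ ε * ‖v‖ ^ 2 := by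
  have h1 : Filter.Tendsto (fun y => ‖Ω y - Ω y₀‖ * ‖A y‖ + ‖Ω y₀‖ * ‖A y - A y₀‖) (𝓝 y₀) (𝓝 0) := by
    have h2 : ContinuousAt (fun y => ‖Ω y - Ω y₀‖ * ‖A y‖ + ‖Ω y₀‖ * ‖A y - A y₀‖) y₀ := by
      fun_prop
    have h3 := h2.tendsto
    simpa using h3
  filter_upwards [h1.eventually (gt_mem_nhds hε)] with y hy v
  have e1 : Ω y ![v, A y v] - Ω y₀ ![v, A y₀ v] =
      (Ω y - Ω y₀) ![v, A y v] + Ω y₀ ![v, (A y - A y₀) v] := by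
    have : A y v = (A y - A y₀) v + A y₀ v := by simp
    rw [ContinuousAlternatingMap.sub_apply]
    conv_rhs => rw [this, form2_add_right, form2_add_right]
    conv_lhs => rw [this, form2_add_right]
    have h4 : (A y - A y₀) v + A y₀ v - A y₀ v = (A y - A y₀) v := by abel
    simp only [sub_apply]
    ring
  rw [e1]
  calc _ ≤ |(Ω y - Ω y₀) ![v, A y v]| + |Ω y₀ ![v, (A y - A y₀) v]| := abs_add_le _ _
    _ ≤ ‖Ω y - Ω y₀‖ * (‖v‖ * (‖A y‖ * ‖v‖)) + ‖Ω y₀‖ * (‖v‖ * (‖A y - A y₀‖ * ‖v‖)) := by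
        refine add_le_add ((form2_norm_le _ _ _).trans ?_) ((form2_norm_le _ _ _).trans ?_)
        · gcongr; exact (A y).le_opNorm v
        · gcongr; exact (A y - A y₀).le_opNorm v
    _ = (‖Ω y - Ω y₀‖ * ‖A y‖ + ‖Ω y₀‖ * ‖A y - A y₀‖) * ‖v‖ ^ 2 := by ring
    _ ≤ ε * ‖v‖ ^ 2 := by gcongr

/-- The constant is the minimum over the unit sphere; the expression is homogeneous of degree 2. -/
theorem exists_pos_le_form [FiniteDimensional ℝ V] {Ω : V [⋀^Fin 2]→L[ℝ] ℝ} {A : V →L[ℝ] V}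
    (h : ∀ v, v ≠ 0 → 0 < Ω ![v, A v]) : ∃ c : ℝ, 0 < c ∧ ∀ v, c * ‖v‖ ^ 2 ≤ Ω ![v, A v] := by
  have : ProperSpace V := FiniteDimensional.proper_real V
  have hcont : Continuous fun v => Ω ![v, A v] := by
    refine Ω.cont.comp (continuous_pi fun k => ?_)
    fin_cases k
    · exact continuous_id
    · exact A.continuous
  have hsc : ∀ (r : ℝ) v, Ω ![r • v, A (r • v)] = r ^ 2 * Ω ![v, A v] := by
    intro r v
    rw [map_smul, form2_smul_left, form2_smul_right]
    ring
  rcases subsingleton_or_nontrivial V with hV | hV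
  · refine ⟨1, one_pos, fun v => ?_⟩
    rw [Subsingleton.elim v 0]
    have := hsc 0 (0 : V)
    simp only [smul_zero, map_zero] at this ⊢
    rw [this]
    simp
  · obtain ⟨v₀, hv₀, hmin⟩ := (isCompact_sphere (0 : V) 1).exists_isMinOn
      (NormedSpace.sphere_nonempty.2 zero_le_one) hcont.continuousOn
    have hv0 : v₀ ≠ 0 := by
      intro h0
      rw [h0] at hv₀
      simp at hv₀
    refine ⟨Ω ![v₀, A v₀], h v₀ hv0, fun v => ?_⟩
    by_cases hv : v = 0
    · have := hsc 0 (0 : V)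
      simp only [smul_zero, map_zero] at this
      rw [hv, map_zero, this]
      simp
    · have hn : 0 < ‖v‖ := norm_pos_iff.2 hv
      have h1 : (‖v‖⁻¹ • v) ∈ Metric.sphere (0 : V) 1 := by
        simp [norm_smul, hn.ne']
      have h2 := hmin h1
      simp only [Set.mem_ofPred_eq] at h2
      rw [hsc] at h2
      calc _ ≤ (‖v‖⁻¹ ^ 2 * Ω ![v, A v]) * ‖v‖ ^ 2 := by gcongr
        _ = _ := by field_simp

end LocalEstimates

/-! ### Retraction onto idempotents and rank-one projections. -/

section SpectralProjection

section Banach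

variable {A : Type*} [NormedRing A] [NormedAlgebra ℂ A] [CompleteSpace A]

/-- The Sylvester operator D ↦ SD + DS' differs from multiplication by 2 by an operator of norm less
than 2. This gives uniqueness of square roots near 1, hence their commutation and self-adjointness,
without functional calculus. -/
theorem eq_zero_of_mul_add_mul_eq_zero {S S' D : A} (hS : ‖S - 1‖ < 1) (hS' : ‖S' - 1‖ < 1)
    (h : S * D + D * S' = 0) : D = 0 := by
  by_contra hD
  have hn : 0 < ‖D‖ := norm_pos_iff.2 hD
  have h1 : (2 : ℂ) • D = -((S - 1) * D + D * (S' - 1)) := by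
    rw [two_smul]
    have : (S - 1) * D + D * (S' - 1) = S * D + D * S' - (D + D) := by noncomm_ring
    rw [this, h]
    simp
  have h2 : ‖(2 : ℂ) • D‖ = 2 * ‖D‖ := by simp [norm_smul]
  have h3 : ‖-((S - 1) * D + D * (S' - 1))‖ ≤ ‖S - 1‖ * ‖D‖ + ‖D‖ * ‖S' - 1‖ := by
    rw [norm_neg]
    exact (norm_add_le _ _).trans (add_le_add (norm_mul_le _ _) (norm_mul_le _ _))
  rw [← h1, h2] at h3
  nlinarith

variable (A) in
-- Inverse function theorem for squaring at 1, where its derivative is multiplication by 2.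
theorem exists_contDiffAt_sqrt : ∃ s : A → A, ContDiffAt ℂ ω s 1 ∧ s 1 = 1 ∧
    ∀ᶠ X in 𝓝 (1 : A), s X * s X = X := by
  let f : A → A := fun X => X * X
  let f' : A ≃L[ℂ] A := ContinuousLinearEquiv.smulLeft (Units.mk0 (2 : ℂ) two_ne_zero)
  have hf : ContDiffAt ℂ ω f 1 := contDiffAt_id.mul contDiffAt_id
  have hf' : HasFDerivAt f (f' : A →L[ℂ] A) 1 := by
    have h := (hasFDerivAt_id (𝕜 := ℂ) (1 : A)).mul' (hasFDerivAt_id (𝕜 := ℂ) (1 : A))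
    refine h.congr_fderiv (ContinuousLinearMap.ext fun X => ?_)
    change 1 * X + X * 1 = (2 : ℂ) • X
    rw [two_smul, one_mul, mul_one]
  refine ⟨hf.localInverse hf' (by simp), ?_, ?_, ?_⟩
  · have := hf.to_localInverse hf' (by simp)
    simpa [f] using this
  · have := hf.localInverse_apply_image hf' (by simp)
    simpa [f] using this
  · have := (hf.hasStrictFDerivAt' hf' (by simp)).eventually_right_inverse
    simp only [f, mul_one] at this
    exact this

variable [NormedSpace ℝ A] [IsScalarTower ℝ ℂ A] [StarRing A] [NormedStarGroup A]
  [StarModule ℂ A]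

variable (A) in
/-- A smooth retraction of a neighbourhood of the set of idempotents onto it. -/
theorem exists_idempotent_retraction : ∃ r : A → A, ∀ Q₀ : A, Q₀ * Q₀ = Q₀ →
    ContDiffAt ℝ ω r Q₀ ∧ r Q₀ = Q₀ ∧
      ∀ᶠ Q in 𝓝 Q₀, r Q * r Q = r Q ∧ (star Q = Q → star (r Q) = r Q) := by
  obtain ⟨s, hs, hs1, hsq⟩ := exists_contDiffAt_sqrt A
  -- An idempotent Q corresponds to the involution R = 2Q − 1. For Q near an idempotent, R
  -- (R²)^(−1/2) is again an involution, and r Q is the corresponding idempotent.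
  let R : A → A := fun Q => Q + Q - 1
  let r : A → A := fun Q => (2⁻¹ : ℂ) • (1 + R Q * Ring.inverse (s (R Q * R Q)))
  refine ⟨r, fun Q₀ h₀ => ?_⟩
  have hR0 : R Q₀ * R Q₀ = 1 := by
    have : R Q₀ * R Q₀ = (Q₀ * Q₀ + Q₀ * Q₀ + Q₀ * Q₀ + Q₀ * Q₀) - (Q₀ + Q₀ + Q₀ + Q₀) + 1 := by
      simp only [R]
      noncomm_ring
    rw [this, h₀]
    abel
  have hR : ContDiff ℂ ω R := (contDiff_id.add contDiff_id).sub contDiff_const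
  have hRR : ContDiffAt ℂ ω (fun Q => R Q * R Q) Q₀ := (hR.mul hR).contDiffAt
  have hsR : ContDiffAt ℂ ω (fun Q => s (R Q * R Q)) Q₀ := by
    rw [← hR0] at hs
    exact hs.comp Q₀ hRR
  have hsR1 : s (R Q₀ * R Q₀) = 1 := by rw [hR0, hs1]
  have hinv : ContDiffAt ℂ ω (fun Q => Ring.inverse (s (R Q * R Q))) Q₀ := by
    have h1 := contDiffAt_ringInverse ℂ (n := ω) (1 : Aˣ)
    rw [Units.val_one, ← hsR1] at h1
    exact h1.comp Q₀ hsR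
  refine ⟨?_, ?_, ?_⟩
  · have h1 : ContDiffAt ℂ ω r Q₀ :=
      (contDiffAt_const.add (hR.contDiffAt.mul hinv)).const_smul _
    exact h1.restrict_scalars ℝ
  · simp only [r, hsR1, Ring.inverse_one, mul_one]
    have : (1 : A) + R Q₀ = (2 : ℂ) • Q₀ := by
      simp only [R, two_smul]
      abel
    rw [this, smul_smul]
    norm_num
  · have hc : Filter.Tendsto (fun Q => s (R Q * R Q)) (𝓝 Q₀) (𝓝 1) := by
      have := hsR.continuousAt.tendsto
      rwa [hsR1] at this
    have hball : ∀ᶠ Q in 𝓝 Q₀, ‖s (R Q * R Q) - 1‖ < 1 := by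
      filter_upwards [hc.eventually (Metric.ball_mem_nhds (1 : A) one_pos)] with Q hQ
      exact mem_ball_iff_norm.1 hQ
    have hunit : ∀ᶠ Q in 𝓝 Q₀, IsUnit (s (R Q * R Q)) :=
      hc.eventually (Units.isOpen.mem_nhds isUnit_one)
    have hRt : Filter.Tendsto (fun Q => R Q * R Q) (𝓝 Q₀) (𝓝 1) := by
      have := hRR.continuousAt.tendsto
      rwa [hR0] at this
    filter_upwards [hball, hunit, hRt.eventually hsq] with Q hQb hQu hQs
    set S := s (R Q * R Q) with hS
    set I := Ring.inverse S with hI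
    have hSI : S * I = 1 := Ring.mul_inverse_cancel _ hQu
    have hIS : I * S = 1 := Ring.inverse_mul_cancel _ hQu
    -- S² = R² commutes with R, so the commutator of S and R is annihilated by the Sylvester
    -- operator.
    have hcomm : S * R Q = R Q * S := by
      have h1 : S * (S * R Q - R Q * S) + (S * R Q - R Q * S) * S = 0 := by
        have : S * (S * R Q - R Q * S) + (S * R Q - R Q * S) * S =
          (S * S) * R Q - R Q * (S * S) := by noncomm_ring
        rw [this, hQs]
        noncomm_ring
      exact sub_eq_zero.1 (eq_zero_of_mul_add_mul_eq_zero hQb hQb h1)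
    have hcommI : I * R Q = R Q * I := by
      calc I * R Q = I * (R Q * S) * I := by rw [mul_assoc, mul_assoc, hSI, mul_one]
        _ = I * (S * R Q) * I := by rw [hcomm]
        _ = R Q * I := by rw [← mul_assoc, hIS, one_mul]
    have hsq1 : (R Q * I) * (R Q * I) = 1 := by
      calc (R Q * I) * (R Q * I) = R Q * (I * R Q) * I := by noncomm_ring
        _ = (R Q * R Q) * (I * I) := by rw [hcommI]; noncomm_ring
        _ = S * (S * I) * I := by rw [← hQs]; noncomm_ring
        _ = 1 := by rw [hSI, mul_one, hSI]
    constructor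
    · change ((2⁻¹ : ℂ) • (1 + R Q * I)) * ((2⁻¹ : ℂ) • (1 + R Q * I)) = (2⁻¹ : ℂ) • (1 + R Q * I)
      rw [smul_mul_smul_comm]
      have : (1 + R Q * I) * (1 + R Q * I) = (2 : ℂ) • (1 + R Q * I) := by
        have h2 : (1 + R Q * I) * (1 + R Q * I) = 1 + R Q * I + R Q * I + (R Q * I) * (R Q * I) := by
          noncomm_ring
        rw [h2, hsq1, two_smul]
        abel
      rw [this, smul_smul]
      norm_num
    · intro hstar
      have hRs : star (R Q) = R Q := by simp [R, hstar]
      have hSs : star S = S := by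
        -- S and its adjoint are square roots of the same self-adjoint element, both near 1.
        have h1 : star S * (star S - S) + (star S - S) * S = 0 := by
          have : star S * (star S - S) + (star S - S) * S = star S * star S - S * S := by noncomm_ring
          rw [this, ← star_mul, hQs, star_mul, hRs, sub_self]
        have h2 : ‖star S - 1‖ < 1 := by
          have : star S - 1 = star (S - 1) := by simp
          rwa [this, norm_star]
        exact sub_eq_zero.1 (eq_zero_of_mul_add_mul_eq_zero h2 hQb h1)
      have hIs : star I = I := by
        have h1 : star I * S = 1 := by
          calc star I * S = star I * star S := by rw [hSs]
            _ = 1 := by rw [← star_mul, hSI, star_one]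
        calc star I = star I * (S * I) := by rw [hSI, mul_one]
          _ = I := by rw [← mul_assoc, h1, one_mul]
      change star ((2⁻¹ : ℂ) • (1 + R Q * I)) = _
      rw [star_smul, star_add, star_mul, hIs, hRs, hcommI, star_one]
      simp [r, hI, hS]

end Banach

section RankOne

open scoped InnerProductSpace

variable {V : Type*} [NormedAddCommGroup V] [InnerProductSpace ℂ V] [CompleteSpace V]

/-- A selfadjoint idempotent which is close to an idempotent of rank one has rank at most one. -/
theorem rank_one_of_norm_sub_lt {P₀ P : V →L[ℂ] V} {e : V} (h₀ : ∀ x, ∃ c : ℂ, P₀ x = c • e)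
    (hP : P * P = P) (hPs : IsSelfAdjoint P) (hn : ‖P - P₀‖ < 1) {w : V} (hw : P w = w) (y : V) :
    ((‖w‖ ^ 2 : ℝ) : ℂ) • P y = ⟪w, y⟫_ℂ • w := by
  by_cases hw0 : w = 0
  · simp [hw0]
  -- P₀ is injective on the range of P because the two are at distance less than 1; as P₀ has rank
  -- one, the range of P is at most a line.
  have key : ∀ x, P x = x → P₀ x = 0 → x = 0 := by
    intro x hx hx0
    by_contra hne
    have h1 : x = (P - P₀) x := by simp [hx, hx0]
    have h2 := (P - P₀).le_opNorm x
    rw [← h1] at h2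
    have : 0 < ‖x‖ := norm_pos_iff.2 hne
    nlinarith
  obtain ⟨c, hc⟩ := h₀ (P y)
  obtain ⟨d, hd⟩ := h₀ w
  have hd0 : d ≠ 0 := by
    intro h
    rw [h, zero_smul] at hd
    exact hw0 (key w hw hd)
  have hPP : ∀ x, P (P x) = P x := fun x => congrArg (fun L : V →L[ℂ] V => L x) hP
  have h3 : P y - (c / d) • w = 0 := by
    apply key
    · rw [map_sub, map_smul, hPP, hw]
    · rw [map_sub, map_smul, hc, hd, smul_smul, div_mul_cancel₀ _ hd0, sub_self]
  have h4 : P y = (c / d) • w := sub_eq_zero.1 h3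
  have h5 : ⟪w, y⟫_ℂ = (c / d) * ((‖w‖ ^ 2 : ℝ) : ℂ) := by
    have h6 : ⟪w, P y⟫_ℂ = ⟪w, y⟫_ℂ := by
      rw [← ContinuousLinearMap.adjoint_inner_left, hPs.adjoint_eq, hw]
    rw [← h6, h4, inner_smul_right, inner_self_eq_norm_sq_to_K]
    norm_cast
  rw [h5, h4, smul_smul, mul_comm]

end RankOne

end SpectralProjection

/-! ### Complex linear normal maps to a Hermitian space. -/

section NormalMaps

section Algebra

variable {n : ℕ} {X : Type*} [TopologicalSpace X] [ChartedSpace (E n) X]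
  {V V' V'' : Type*} [NormedAddCommGroup V] [NormedSpace ℝ V] [NormedAddCommGroup V']
  [NormedSpace ℝ V'] [NormedAddCommGroup V''] [NormedSpace ℝ V'']

theorem dm_bilinear {B : V × V' → V''} (hB : IsBoundedBilinearMap ℝ B) {f : X → V} {g : X → V'} {x : X}
    (hf : MDifferentiableAt (𝓡 n) 𝓘(ℝ, V) f x) (hg : MDifferentiableAt (𝓡 n) 𝓘(ℝ, V') g x)
    (v : TangentSpace (𝓡 n) x) :
    dm n (fun z => B (f z, g z)) x v = B (f x, dm n g x v) + B (dm n f x v, g x) := by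
  have hfg : MDifferentiableAt (𝓡 n) 𝓘(ℝ, V × V') (fun z => (f z, g z)) x := hf.prodMk_space hg
  have h1 := dm_comp (g := B) (hB.differentiableAt _) hfg v
  refine h1.trans ?_
  rw [hB.fderiv]
  have h2 : (dm n (fun z => (f z, g z)) x v).1 = dm n f x v :=
    (dm_clm_comp (ContinuousLinearMap.fst ℝ V V') hfg v).symm
  have h3 : (dm n (fun z => (f z, g z)) x v).2 = dm n g x v :=
    (dm_clm_comp (ContinuousLinearMap.snd ℝ V V') hfg v).symm
  rw [← h2, ← h3]
  rfl

theorem dm_sum {ι : Type*} (s : Finset ι) {f : ι → X → V} {x : X}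
    (hf : ∀ i ∈ s, MDifferentiableAt (𝓡 n) 𝓘(ℝ, V) (f i) x) (v : TangentSpace (𝓡 n) x) :
    MDifferentiableAt (𝓡 n) 𝓘(ℝ, V) (fun z => ∑ i ∈ s, f i z) x ∧
      dm n (fun z => ∑ i ∈ s, f i z) x v = ∑ i ∈ s, dm n (f i) x v := by
  classical
  induction s using Finset.induction_on with
  | empty =>
    simp only [Finset.sum_empty]
    exact ⟨mdifferentiableAt_const, by rw [dm_const]; rfl⟩
  | insert i s hi ih =>
    obtain ⟨h1, h2⟩ := ih fun k hk => hf k (Finset.mem_insert_of_mem hk)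
    simp only [Finset.sum_insert hi]
    have h3 := hf i (Finset.mem_insert_self i s)
    refine ⟨h3.add h1, ?_⟩
    have := DFunLike.congr_fun (dm_add h3 h1) v
    rw [← h2]
    exact this

end Algebra

variable {M : Type*} [TopologicalSpace M] [T2Space M] [SigmaCompactSpace M]
    [ChartedSpace (E 4) M] [IsManifold (𝓡 4) ∞ M]
    {S : Type*} [TopologicalSpace S] [T2Space S] [CompactSpace S] [ConnectedSpace S]
    [ChartedSpace (E 2) S] [IsManifold (𝓡 2) ∞ S]

/-- A vector-valued function which vanishes on the curve and whose derivative identifies the normal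
bundle of the curve with a complex line subbundle of a trivial bundle. -/
structure NormalMap (J : ∀ x : M, TangentSpace (𝓡 4) x →L[ℝ] TangentSpace (𝓡 4) x) (u : S → M)
    {V : Type*} [NormedAddCommGroup V] [InnerProductSpace ℂ V] (W : M → V) : Prop where
  smooth : ContMDiff (𝓡 4) 𝓘(ℝ, V) ∞ W
  zero : ∀ s, W (u s) = 0
  apply_J : ∀ s (v : TangentSpace (𝓡 4) (u s)),
    dm 4 W (u s) (J (u s) v) = Complex.I • dm 4 W (u s) v
  ker : ∀ s (v : TangentSpace (𝓡 4) (u s)), dm 4 W (u s) v = 0 →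
    ∃ t, mfderiv (𝓡 2) (𝓡 4) u s t = v

namespace SliceChart

variable {u : S → M} (C : SliceChart u)
  (J : ∀ x : M, TangentSpace (𝓡 4) x →L[ℝ] TangentSpace (𝓡 4) x)

/-- A complex normal coordinate. -/
def w (x : M) : ℂ :=
  ((C.y x 0 : ℝ) : ℂ) - Complex.I * (((C.e.symm (Jc J C.chart (C.chart x) (C.e (0, C.y x)))).2 0 : ℝ) : ℂ)

variable {J}

theorem w_apply_u {s : S} (hs : u s ∈ C.chart.source) : C.w J (u s) = 0 := by
  rw [w, C.y_apply_u hs]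
  have : C.e (0, 0) = 0 := map_zero C.e
  rw [this, map_zero, map_zero]
  simp

/-- The last component of the tangent vector with given chart coordinates. -/
def coordC : E 4 →L[ℝ] ℂ :=
  (Complex.ofRealCLM.comp (EuclideanSpace.proj (0 : Fin 2))).comp
    ((ContinuousLinearMap.snd ℝ (E 2) (E 2)).comp (C.e.symm : E 4 →L[ℝ] E 2 × E 2))

theorem w_eq : C.w J = fun x => C.coordC (C.chart x) +
    (-Complex.I) * C.coordC (Jc J C.chart (C.chart x) (C.e (0, C.y x))) := by
  funext x
  change _ - _ = _ + (-Complex.I) * _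
  rw [neg_mul, ← sub_eq_add_neg]
  rfl

variable (hJ : IsAlmostComplex J)
include hJ

theorem contMDiffAt_Jc {x : M} (hx : x ∈ C.chart.source) :
    ContMDiffAt (𝓡 4) 𝓘(ℝ, E 4 →L[ℝ] E 4) ∞ (fun x => Jc J C.chart (C.chart x)) x :=
  ((contDiffAt_Jc hJ C.mem (C.chart.map_source hx)).contMDiffAt).comp x (contMDiffAt_of_mem C.mem hx)

theorem contMDiffAt_ey {x : M} (hx : x ∈ C.chart.source) :
    ContMDiffAt (𝓡 4) 𝓘(ℝ, E 4) ∞ (fun x => C.e (0, C.y x)) x :=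
  ((((C.e : E 2 × E 2 →L[ℝ] E 4).comp (ContinuousLinearMap.inr ℝ (E 2) (E 2))).contDiff.contMDiff
    (n := ∞)).contMDiffAt).comp x (C.contMDiffAt_y hx)

theorem contMDiffAt_w {x : M} (hx : x ∈ C.chart.source) :
    ContMDiffAt (𝓡 4) 𝓘(ℝ, ℂ) ∞ (C.w J) x := by
  rw [w_eq]
  have h1 : ContMDiffAt (𝓡 4) 𝓘(ℝ, E 4) ∞
      (fun x => Jc J C.chart (C.chart x) (C.e (0, C.y x))) x :=
    (C.contMDiffAt_Jc hJ hx).clm_apply (C.contMDiffAt_ey hJ hx)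
  have h2 := ((C.coordC.contDiff.contMDiff (n := ∞)).contMDiffAt).comp x (contMDiffAt_of_mem C.mem hx)
  have h3 := ((((-Complex.I) • C.coordC).contDiff.contMDiff (n := ∞)).contMDiffAt).comp x h1
  exact h2.add h3

/-- The vector e(0, y) vanishes on the curve, so derivatives of J do not enter; and since J
preserves the tangent plane of the curve, applying J to the normal coordinate vector or to v gives
the same normal part. The resulting expression λ(v) − iλ(Jv) is the complex linear functional with
real part λ. -/
theorem dm_w (hyJ : ∀ (x : M), x ∈ C.chart.source → x ∈ Set.range u → ∀ w : TangentSpace (𝓡 4) x,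
      dm 4 C.y x w = 0 → dm 4 C.y x (J x w) = 0)
    {s : S} (hs : u s ∈ C.chart.source) (v : TangentSpace (𝓡 4) (u s)) :
    dm 4 (C.w J) (u s) v = ((dm 4 C.y (u s) v 0 : ℝ) : ℂ) -
      Complex.I * ((dm 4 C.y (u s) (J (u s) v) 0 : ℝ) : ℂ) := by
  have hc := (contMDiffAt_of_mem C.mem hs).mdifferentiableAt (by simp)
  have h1 := ((C.contMDiffAt_Jc hJ hs).mdifferentiableAt (by simp))
  have h2 := ((C.contMDiffAt_ey hJ hs).mdifferentiableAt (by simp))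
  have hy := ((C.contMDiffAt_y hs).mdifferentiableAt (by simp))
  have h3 := ((C.contMDiffAt_Jc hJ hs).clm_apply (C.contMDiffAt_ey hJ hs)).mdifferentiableAt (by simp)
  have hb := dm_bilinear (isBoundedBilinearMap_apply (𝕜 := ℝ) (E := E 4) (F := E 4)) h1 h2 v
  have hz : C.e (0, C.y (u s)) = 0 := by
    rw [C.y_apply_u hs]
    exact map_zero C.e
  simp only [hz, map_zero, add_zero] at hb
  have hey : dm 4 (fun x => C.e (0, C.y x)) (u s) v = C.e (0, dm 4 C.y (u s) v) :=
    dm_clm_comp ((C.e : E 2 × E 2 →L[ℝ] E 4).comp (ContinuousLinearMap.inr ℝ (E 2) (E 2))) hy v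
  rw [hey] at hb
  have e1 : dm 4 (fun x => C.coordC (C.chart x)) (u s) v = C.coordC (dm 4 C.chart (u s) v) :=
    dm_clm_comp _ hc v
  have e2 := dm_clm_comp ((-Complex.I) • C.coordC) h3 v
  have e3 := DFunLike.congr_fun (dm_add ((((C.coordC.contDiff.contMDiff (n := ∞)).contMDiffAt).comp (u s)
    (contMDiffAt_of_mem C.mem hs)).mdifferentiableAt (by simp))
    (((((-Complex.I) • C.coordC).contDiff.contMDiff (n := ∞)).contMDiffAt.comp (u s)
    ((C.contMDiffAt_Jc hJ hs).clm_apply (C.contMDiffAt_ey hJ hs))).mdifferentiableAt (by simp))) v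
  rw [w_eq]
  refine e3.trans ?_
  refine (congrArg₂ (· + ·) e1 (e2.trans (congrArg _ hb))).trans ?_
  have hdy : ∀ a : TangentSpace (𝓡 4) (u s),
      C.coordC (dm 4 C.chart (u s) a) = ((dm 4 C.y (u s) a 0 : ℝ) : ℂ) := by
    intro a
    rw [C.dm_y hs]
    rfl
  have hJc : ∀ a : TangentSpace (𝓡 4) (u s), Jc J C.chart (C.chart (u s)) (dm 4 C.chart (u s) a) =
      dm 4 C.chart (u s) (J (u s) a) := by
    have h4 := C.chart.map_source hs
    have h5 := fun a => congrArg (fun q => dm 4 C.chart (C.chart.symm (C.chart (u s)))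
      (J (C.chart.symm (C.chart (u s))) q)) (frameAt_dm C.mem h4 a)
    simp only [Jc, ContinuousLinearMap.comp_apply]
    rw [C.chart.left_inv hs] at h5 ⊢
    exact h5
  obtain ⟨a, ha⟩ := dm_surjective C.mem hs (C.e (0, dm 4 C.y (u s) v))
  have hya : dm 4 C.y (u s) (v - a) = 0 := by
    rw [map_sub, C.dm_y hs a, ha, C.e.symm_apply_apply, sub_self]
  have hyJa := hyJ _ hs ⟨s, rfl⟩ _ hya
  rw [map_sub, map_sub, sub_eq_zero] at hyJa
  rw [hdy, ← ha]
  change _ + ((-Complex.I) • C.coordC) (Jc J C.chart (C.chart (u s)) (dm 4 C.chart (u s) a)) = _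
  rw [hJc]
  change _ + (-Complex.I) * C.coordC _ = _
  rw [hdy, hyJa, neg_mul, sub_eq_add_neg]

end SliceChart

namespace HolCurve

variable {τ₀ : Form 4 M 2} {J : ∀ x : M, TangentSpace (𝓡 4) x →L[ℝ] TangentSpace (𝓡 4) x}
    {j : ∀ s : S, TangentSpace (𝓡 2) s →L[ℝ] TangentSpace (𝓡 2) s} {u : S → M}
    (h : HolCurve τ₀ J j u)

include h

theorem dm_w (C : SliceChart u) {s : S} (hs : u s ∈ C.chart.source) (v : TangentSpace (𝓡 4) (u s)) :
    dm 4 (C.w J) (u s) v = ((dm 4 C.y (u s) v 0 : ℝ) : ℂ) -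
      Complex.I * ((dm 4 C.y (u s) (J (u s) v) 0 : ℝ) : ℂ) :=
  C.dm_w h.acs (fun _ hx hxu _ hw => h.dm_y_J C hx hxu hw) hs v

theorem dm_w_J (C : SliceChart u) {s : S} (hs : u s ∈ C.chart.source) (v : TangentSpace (𝓡 4) (u s)) :
    dm 4 (C.w J) (u s) (J (u s) v) = Complex.I * dm 4 (C.w J) (u s) v := by
  rw [h.dm_w C hs, h.dm_w C hs, h.acs.sq_eq_neg, map_neg]
  have : ((-(dm 4 C.y (u s) v)) 0 : ℝ) = -(dm 4 C.y (u s) v 0) := rfl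
  rw [this]
  push_cast
  linear_combination ((dm 4 C.y (u s) (J (u s) v) 0 : ℝ) : ℂ) * Complex.I_mul_I

theorem dm_w_ker (C : SliceChart u) {s : S} (hs : u s ∈ C.chart.source) {v : TangentSpace (𝓡 4) (u s)}
    (hv : dm 4 (C.w J) (u s) v = 0) : ∃ t, mfderiv (𝓡 2) (𝓡 4) u s t = v := by
  rw [h.dm_w C hs] at hv
  have hre := congrArg Complex.re hv
  have him := congrArg Complex.im hv
  simp at hre him
  apply C.exists_mfderiv_eq h.emb hs
  set p : ℝ := dm 4 C.y (u s) v 1 with hp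
  set q : ℝ := dm 4 C.y (u s) (J (u s) v) 1 with hq
  -- Both dy(v) and dy(Jv) are multiples, by p and q, of the second coordinate vector, so qv − pJv
  -- is tangent to the curve. Hence so is J(qv − pJv) = qJv + pv, whose second normal coordinate is
  -- q² + p².
  have h1 : dm 4 C.y (u s) (q • v - p • J (u s) v) = 0 := by
    rw [map_sub, map_smul, map_smul]
    ext i
    fin_cases i
    · simp [hre, him]
    · simp [hp, hq]
      ring
  have h2 := h.dm_y_J C hs ⟨s, rfl⟩ h1
  rw [map_sub, map_smul, map_smul, h.acs.sq_eq_neg, map_sub, map_smul, map_smul, map_neg] at h2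
  have h3 := congrArg (fun ξ : E 2 => ξ 1) h2
  simp at h3
  have h4 : p = 0 := by
    change q * q + p * p = 0 at h3
    nlinarith [sq_nonneg p, sq_nonneg q]
  ext i
  fin_cases i
  · simpa using hre
  · simpa using h4

/-- Local complex normal coordinates are cut off by a partition of unity and attached to linearly
independent vectors. They vanish on the curve, so the cutoffs are not differentiated there;
independence and some positive cutoff at each point give the right kernel. -/
theorem exists_normalMap : ∃ (k : ℕ) (W : M → EuclideanSpace ℂ (Fin k)), NormalMap J u W := by
  choose C hC using exists_sliceChart (S := S) h.emb
  obtain ⟨t, ht⟩ := h.isCompact_range.elim_finite_subcover (fun s => (C s).chart.source)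
    (fun s => (C s).chart.open_source) (by
      rintro _ ⟨s, rfl⟩
      exact Set.mem_iUnion.2 ⟨s, hC s⟩)
  obtain ⟨χ, hχ⟩ := SmoothPartitionOfUnity.exists_isSubordinate (𝓡 4) h.isCompact_range.isClosed
    (fun i : t => (C i).chart.source) (fun i => (C i).chart.open_source) (by
      refine ht.trans ?_
      simp only [Set.iUnion_subset_iff]
      intro i hi
      exact Set.subset_iUnion (fun i : t => (C i).chart.source) ⟨i, hi⟩)
  have main : ∀ (V : Type) [NormedAddCommGroup V] [InnerProductSpace ℂ V] (b : t → V),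
      LinearIndependent ℂ b → ∃ W : M → V, NormalMap J u W := by
    intro V _ _ b hb
    let L : t → ℂ →L[ℝ] V := fun i =>
      ((ContinuousLinearMap.toSpanSingleton ℂ (b i)).restrictScalars ℝ)
    let f : t → M → ℂ := fun i x => χ i x • (C i).w J x
    have hf : ∀ i, ContMDiff (𝓡 4) 𝓘(ℝ, ℂ) ∞ (f i) := by
      intro i
      refine contMDiff_of_tsupport fun x hx => ?_
      have hx2 : x ∈ (C i).chart.source := hχ i (closure_mono (fun y hy => by
        simp only [f, Function.mem_support] at hy ⊢
        exact fun h0 => hy (by rw [h0, zero_smul])) hx)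
      exact ((χ i).contMDiff.contMDiffAt).smul ((C i).contMDiffAt_w h.acs hx2)
    have hLf : ∀ i, ContMDiff (𝓡 4) 𝓘(ℝ, V) ∞ (fun x => L i (f i x)) := fun i =>
      ((L i).contDiff.contMDiff (n := ∞)).comp (hf i)
    have hdf : ∀ i s v, dm 4 (f i) (u s) v = χ i (u s) • dm 4 ((C i).w J) (u s) v ∧
        (χ i (u s) ≠ 0 → u s ∈ (C i).chart.source) := by
      intro i s v
      by_cases hs : u s ∈ tsupport (χ i)
      · have hs2 := hχ i hs
        refine ⟨?_, fun _ => hs2⟩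
        have := dm_bilinear (isBoundedBilinearMap_smul (𝕜 := ℝ) (E := ℂ))
          ((χ i).contMDiff.contMDiffAt.mdifferentiableAt (by simp))
          (((C i).contMDiffAt_w h.acs hs2).mdifferentiableAt (by simp)) v
        simp only [(C i).w_apply_u hs2, smul_zero, add_zero] at this
        exact this
      · have h0 : χ i (u s) = 0 := image_eq_zero_of_notMem_tsupport hs
        refine ⟨?_, fun hne => absurd h0 hne⟩
        rw [h0, zero_smul]
        have : f i =ᶠ[𝓝 (u s)] fun _ => 0 := by
          filter_upwards [notMem_tsupport_iff_eventuallyEq.1 hs] with x hx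
          simp only [f]
          rw [hx]
          simp
        rw [dm_congr this, dm_const]
        rfl
    have hdW : ∀ s v, dm 4 (fun x => ∑ i, L i (f i x)) (u s) v =
        ∑ i, ((χ i (u s) : ℂ) * dm 4 ((C i).w J) (u s) v) • b i := by
      intro s v
      rw [(dm_sum Finset.univ (fun i _ => (hLf i).contMDiffAt.mdifferentiableAt (by simp)) v).2]
      refine Finset.sum_congr rfl fun i _ => ?_
      rw [dm_clm_comp _ ((hf i).contMDiffAt.mdifferentiableAt (by simp)), (hdf i s v).1,
        Complex.real_smul]
      rfl
    refine ⟨fun x => ∑ i, L i (f i x), contMDiff_finsetSum fun i _ => hLf i, fun s => ?_,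
      fun s v => ?_, fun s v hv => ?_⟩
    · refine Finset.sum_eq_zero fun i _ => ?_
      have : f i (u s) = 0 := by
        by_cases h0 : χ i (u s) = 0
        · simp [f, h0]
        · simp [f, (C i).w_apply_u ((hdf i s 0).2 h0)]
      rw [this, map_zero]
    · rw [hdW, hdW, Finset.smul_sum]
      refine Finset.sum_congr rfl fun i _ => ?_
      by_cases h0 : χ i (u s) = 0
      · simp [h0]
      · rw [h.dm_w_J _ ((hdf i s 0).2 h0), smul_smul]
        ring_nf
    · rw [hdW] at hv
      have hz := (Fintype.linearIndependent_iff.1 hb) _ hv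
      obtain ⟨i, hi⟩ := χ.exists_pos_of_mem (⟨s, rfl⟩ : u s ∈ Set.range u)
      have := hz i
      rw [mul_eq_zero] at this
      exact h.dm_w_ker (C i) ((hdf i s 0).2 hi.ne') (this.resolve_left (by exact_mod_cast hi.ne'))
  refine ⟨t.card, main _ (fun i => EuclideanSpace.single (t.equivFin i) 1) ?_⟩
  have h1 := (EuclideanSpace.basisFun (Fin t.card) ℂ).toBasis.linearIndependent
  have h2 := h1.comp t.equivFin t.equivFin.injective
  have h3 : (fun i => EuclideanSpace.single (t.equivFin i) (1 : ℂ)) =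
      (EuclideanSpace.basisFun (Fin t.card) ℂ).toBasis ∘ t.equivFin := by
    funext i
    simp
  rw [h3]
  exact h2

end HolCurve

end NormalMaps

/-! ### The projection field and the squared distance function. -/

section NormalProjection

open scoped InnerProductSpace

theorem dm_eq_fderiv_comp_symm {n : ℕ} {X : Type*} [TopologicalSpace X] [ChartedSpace (E n) X]
    [IsManifold (𝓡 n) ∞ X] {V : Type*} [NormedAddCommGroup V] [NormedSpace ℝ V] {f : X → V}
    {Ψ : OpenPartialHomeomorph X (E n)} (hΨ : Ψ ∈ IsManifold.maximalAtlas (𝓡 n) ∞ X) {x : X}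
    (hx : x ∈ Ψ.source) (hf : MDifferentiableAt (𝓡 n) 𝓘(ℝ, V) f x) (v : TangentSpace (𝓡 n) x) :
    dm n f x v = fderiv ℝ (f ∘ Ψ.symm) (Ψ x) (dm n Ψ x v) := by
  have h1 : f =ᶠ[𝓝 x] (f ∘ Ψ.symm) ∘ Ψ := by
    filter_upwards [Ψ.open_source.mem_nhds hx] with z hz
    simp [Ψ.left_inv hz]
  have h2 : MDifferentiableAt 𝓘(ℝ, E n) 𝓘(ℝ, V) (f ∘ Ψ.symm) (Ψ x) := by
    refine MDifferentiableAt.comp (I' := 𝓡 n) (Ψ x) ?_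
      ((contMDiffAt_symm_of_mem hΨ (Ψ.map_source hx)).mdifferentiableAt (by simp))
    rwa [Ψ.left_inv hx]
  rw [dm_congr h1]
  exact dm_comp h2.differentiableAt ((contMDiffAt_of_mem hΨ hx).mdifferentiableAt (by simp)) v

theorem contDiffAt_comp_symm {n : ℕ} {X : Type*} [TopologicalSpace X] [ChartedSpace (E n) X]
    [IsManifold (𝓡 n) ∞ X] {V : Type*} [NormedAddCommGroup V] [NormedSpace ℝ V] {f : X → V}
    {Ψ : OpenPartialHomeomorph X (E n)} (hΨ : Ψ ∈ IsManifold.maximalAtlas (𝓡 n) ∞ X) {x : X}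
    (hx : x ∈ Ψ.source) (hf : ContMDiffAt (𝓡 n) 𝓘(ℝ, V) ∞ f x) :
    ContDiffAt ℝ ∞ (f ∘ Ψ.symm) (Ψ x) := by
  refine ContMDiffAt.contDiffAt ?_
  refine ContMDiffAt.comp (I' := 𝓡 n) (Ψ x) ?_ (contMDiffAt_symm_of_mem hΨ (Ψ.map_source hx))
  rwa [Ψ.left_inv hx]

variable {M : Type*} [TopologicalSpace M] [T2Space M] [SigmaCompactSpace M]
    [ChartedSpace (E 4) M] [IsManifold (𝓡 4) ∞ M]
    {S : Type*} [TopologicalSpace S] [T2Space S] [CompactSpace S] [ConnectedSpace S]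
    [ChartedSpace (E 2) S] [IsManifold (𝓡 2) ∞ S]
    {V : Type*} [NormedAddCommGroup V] [InnerProductSpace ℂ V]

namespace NormalMap

variable {J : ∀ x : M, TangentSpace (𝓡 4) x →L[ℝ] TangentSpace (𝓡 4) x} {u : S → M}
  {W : M → V} (hW : NormalMap J u W) (hu : Manifold.IsSmoothEmbedding (𝓡 2) (𝓡 4) ∞ u)
include hW

theorem mdifferentiableAt (x : M) : MDifferentiableAt (𝓡 4) 𝓘(ℝ, V) W x :=
  hW.smooth.contMDiffAt.mdifferentiableAt (by simp)

include hu in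
theorem dm_mfderiv (s : S) (t : TangentSpace (𝓡 2) s) :
    dm 4 W (u s) (mfderiv (𝓡 2) (𝓡 4) u s t) = 0 := by
  rw [← dm_comp_mfderiv (hW.mdifferentiableAt _)
    (hu.isImmersion.contMDiff.contMDiffAt.mdifferentiableAt (by simp))]
  have : W ∘ u = fun _ => 0 := funext hW.zero
  rw [this, dm_const]
  rfl

include hu in
theorem finrank_range (s : S) : Module.finrank ℝ (LinearMap.range (dm 4 W (u s)).toLinearMap) = 2 := by
  obtain ⟨C, hC⟩ := exists_sliceChart hu s
  have h1 : LinearMap.range (mfderiv (𝓡 2) (𝓡 4) u s).toLinearMap =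
      LinearMap.ker (dm 4 W (u s)).toLinearMap := by
    ext v
    constructor
    · rintro ⟨t, rfl⟩
      exact hW.dm_mfderiv hu s t
    · exact hW.ker s v
  have h2 := LinearMap.finrank_range_of_inj
    (f := (mfderiv (𝓡 2) (𝓡 4) u s).toLinearMap) (C.mfderiv_injective hu hC)
  have h3 := (dm 4 W (u s)).toLinearMap.finrank_range_add_finrank_ker
  rw [← h1, h2] at h3
  rw [finrank_tangent, finrank_tangent] at h3
  omega

include hu in
theorem exists_dm_ne_zero (s : S) : ∃ v, dm 4 W (u s) v ≠ 0 := by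
  by_contra! hcon
  have h1 := hW.finrank_range hu s
  have h2 : LinearMap.range (dm 4 W (u s)).toLinearMap = ⊥ := by
    rw [LinearMap.range_eq_bot]
    ext v
    exact hcon v
  rw [h2, finrank_bot] at h1
  exact absurd h1 (by norm_num)

include hu in
-- The image of dW has real dimension 2 and contains dW(v) and i dW(v), so it is the complex line
-- through dW(v).
theorem exists_smul {s : S} {v : TangentSpace (𝓡 4) (u s)} (hv : dm 4 W (u s) v ≠ 0)
    (w : TangentSpace (𝓡 4) (u s)) : ∃ c : ℂ, dm 4 W (u s) w = c • dm 4 W (u s) v := by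
  set D := dm 4 W (u s)
  have hli : LinearIndependent ℝ ![D v, Complex.I • D v] := by
    rw [LinearIndependent.pair_iff]
    intro a b hab
    have h1 : ((a : ℂ) + b * Complex.I) • D v = 0 := by
      rw [← hab, add_smul, mul_smul]
      rfl
    have h2 := (smul_eq_zero.1 h1).resolve_right hv
    have h3 := congrArg Complex.re h2
    have h4 := congrArg Complex.im h2
    simpa using And.intro h3 h4
  have hle : Submodule.span ℝ (Set.range ![D v, Complex.I • D v]) ≤ LinearMap.range D.toLinearMap := by
    rw [Submodule.span_le, Matrix.range_cons_cons_empty]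
    rintro x (rfl | rfl)
    · exact ⟨v, rfl⟩
    · exact ⟨J (u s) v, hW.apply_J s v⟩
  have heq := Submodule.eq_of_le_of_finrank_eq hle (by
    rw [finrank_span_eq_card hli, hW.finrank_range hu s]
    simp)
  have hw : D w ∈ LinearMap.range D.toLinearMap := ⟨w, rfl⟩
  rw [← heq, Matrix.range_cons_cons_empty, Submodule.mem_span_pair] at hw
  obtain ⟨a, b, hab⟩ := hw
  refine ⟨(a : ℂ) + b * Complex.I, ?_⟩
  rw [← hab, add_smul, mul_smul]
  rfl

include hu in
/-- A function which vanishes on the curve is bounded by a normal map. -/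
theorem eventually_norm_le {F : Type*} [NormedAddCommGroup F] [NormedSpace ℝ F] {f : M → F} {s : S}
    (hf : ContMDiffAt (𝓡 4) 𝓘(ℝ, F) ∞ f (u s)) (hf0 : ∀ᶠ x in 𝓝 (u s), x ∈ Set.range u → f x = 0) :
    ∃ C : ℝ, 0 ≤ C ∧ ∀ᶠ x in 𝓝 (u s), ‖f x‖ ≤ C * ‖W x‖ := by
  obtain ⟨C, hC⟩ := exists_sliceChart hu s
  have hp : C.chart (u s) = C.e (C.dom s, 0) := C.chart_apply s hC
  have hcs : Filter.Tendsto C.chart.symm (𝓝 (C.chart (u s))) (𝓝 (u s)) := by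
    have := C.chart.continuousAt_symm (C.chart.map_source hC)
    rwa [ContinuousAt, C.chart.left_inv hC] at this
  have hZ : ∀ᶠ p in 𝓝 (C.chart (u s)), (C.e.symm p).2 = 0 → C.chart.symm p ∈ Set.range u := by
    filter_upwards [C.chart.open_target.mem_nhds (C.chart.map_source hC)] with p hp h0
    refine C.mem_range _ (C.chart.map_target hp) ?_
    rwa [C.chart.right_inv hp]
  have h1 := (contDiffAt_comp_symm C.mem hC hf).hasStrictFDerivAt (by simp)
  have h2 := (contDiffAt_comp_symm C.mem hC hW.smooth.contMDiffAt).hasStrictFDerivAt (by simp)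
  have hinj : ∀ w, fderiv ℝ (W ∘ C.chart.symm) (C.chart (u s)) (C.e (0, w)) = 0 → w = 0 := by
    intro w hw
    obtain ⟨v, hv⟩ := dm_surjective C.mem hC (C.e (0, w))
    rw [← hv, ← dm_eq_fderiv_comp_symm C.mem hC (hW.mdifferentiableAt _)] at hw
    obtain ⟨t, rfl⟩ := hW.ker s v hw
    have h3 := C.dm_y_mfderiv hu hC t
    rw [C.dm_y hC, hv, C.e.symm_apply_apply] at h3
    exact h3
  rw [hp] at h1 h2 hinj hcs hZ
  obtain ⟨K, hK, hK2⟩ := eventually_norm_le_of_vanishing C.e h1 h2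
    (by filter_upwards [hZ, hcs.eventually hf0] with p h4 h5 h6 using h5 (h4 h6))
    (by
      filter_upwards [hZ] with p h4 h6
      obtain ⟨t, ht⟩ := h4 h6
      simp only [Function.comp_apply, ← ht]
      exact hW.zero t)
    hinj
  refine ⟨K, hK, ?_⟩
  have h7 := (C.chart.continuousAt hC)
  rw [ContinuousAt, hp] at h7
  filter_upwards [h7.eventually hK2, C.chart.open_source.mem_nhds hC] with x hx hxs
  simpa [C.chart.left_inv hxs] using hx

end NormalMap
/-- A normal map with values in a line bundle, given by a field of projections near the curve, and
a proper function which agrees with the square of its norm near the curve. -/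
structure NormalData (J : ∀ x : M, TangentSpace (𝓡 4) x →L[ℝ] TangentSpace (𝓡 4) x) (u : S → M)
    (V : Type*) [NormedAddCommGroup V] [InnerProductSpace ℂ V] [CompleteSpace V] where
  W : M → V
  P : M → V →L[ℂ] V
  F : M → ℝ
  m : ℝ
  K : Set M
  normalMap : NormalMap J u W
  contMDiff_P : ContMDiff (𝓡 4) 𝓘(ℝ, V →L[ℂ] V) ∞ P
  contMDiff_F : ContMDiff (𝓡 4) 𝓘(ℝ, ℝ) ∞ F
  F_nonneg : ∀ x, 0 ≤ F x
  F_eq_zero : ∀ x, F x = 0 ↔ x ∈ Set.range u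
  m_pos : 0 < m
  isCompact_K : IsCompact K
  mem_K : ∀ x, F x < m → x ∈ K
  F_eq : ∀ x, F x < m → F x = ‖W x‖ ^ 2
  P_mul : ∀ x, F x < m → P x * P x = P x
  P_self : ∀ x, F x < m → IsSelfAdjoint (P x)
  P_W : ∀ x, F x < m → P x (W x) = W x
  rank_one : ∀ x, F x < m → ∀ y, ((‖W x‖ ^ 2 : ℝ) : ℂ) • P x y = ⟪W x, y⟫_ℂ • W x

theorem isBoundedBilinearMap_rankOne :
    IsBoundedBilinearMap ℝ (fun p : V × V => InnerProductSpace.rankOne ℂ p.1 p.2) :=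
  ⟨fun x y z => by simp, fun c x y => by
      ext z
      exact smul_comm ⟪y, z⟫_ℂ c x, fun x y z => by simp, fun c x y => by
      ext z
      change ⟪c • y, z⟫_ℂ • x = c • (⟪y, z⟫_ℂ • x)
      rw [← Complex.coe_smul c y, inner_smul_left, Complex.conj_ofReal, mul_smul, Complex.coe_smul], 1, one_pos,
    fun x y => by simp⟩

theorem isBoundedBilinearMap_clm_apply :
    IsBoundedBilinearMap ℝ (fun p : (V →L[ℂ] V) × V => p.1 p.2) :=
  ⟨fun _ _ _ => rfl, fun _ _ _ => rfl, fun f x y => map_add f x y, fun c f x => by simp, 1, one_pos,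
    fun f x => by simpa using f.le_opNorm x⟩

variable {J : ∀ x : M, TangentSpace (𝓡 4) x →L[ℝ] TangentSpace (𝓡 4) x} {u : S → M}
  {W : M → V}

/-- Self-adjointness and the conditions on the curve are convex, so local projections of the form
e⊗e*/|e|² can be patched. Off the curve the result need not be idempotent; that is repaired later by
the retraction. -/
theorem NormalMap.exists_selfAdjoint_extension [CompleteSpace V] (hW : NormalMap J u W)
    (hu : Manifold.IsSmoothEmbedding (𝓡 2) (𝓡 4) ∞ u) :
    ∃ Q : M → V →L[ℂ] V, ContMDiff (𝓡 4) 𝓘(ℝ, V →L[ℂ] V) ∞ Q ∧ (∀ x, star (Q x) = Q x) ∧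
      ∀ s, (∀ v, Q (u s) (dm 4 W (u s) v) = dm 4 W (u s) v) ∧
        ∀ y, (∀ v, ⟪dm 4 W (u s) v, y⟫_ℂ = 0) → Q (u s) y = 0 := by
  have hZc : IsClosed (Set.range u) := by
    rw [← Set.image_univ]
    exact (isCompact_univ.image hu.isEmbedding.continuous).isClosed
  obtain ⟨Q, hQ⟩ := exists_contMDiffMap_forall_mem_convex_of_local (n := (⊤ : ℕ∞)) (𝓡 4)
    (t := fun x : M => {Q : V →L[ℂ] V | star Q = Q ∧ (x ∈ Set.range u →
      (∀ v, Q (dm 4 W x v) = dm 4 W x v) ∧ ∀ y, (∀ v, ⟪dm 4 W x v, y⟫_ℂ = 0) → Q y = 0)})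
    (by
      rintro x A ⟨hA1, hA2⟩ B ⟨hB1, hB2⟩ a b ha hb hab
      refine ⟨by rw [star_add, star_smul, star_smul, hA1, hB1]; simp, fun hx => ⟨fun v => ?_, fun y hy => ?_⟩⟩
      · have h1 := (hA2 hx).1 v
        have h2 := (hB2 hx).1 v
        change a • A _ + b • B _ = _
        rw [h1, h2, ← add_smul, hab, one_smul]
      · have h1 := (hA2 hx).2 y hy
        have h2 := (hB2 hx).2 y hy
        change a • A _ + b • B _ = _
        rw [h1, h2, smul_zero, smul_zero, add_zero])
    (by
      intro x
      by_cases hx : x ∈ Set.range u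
      swap
      · exact ⟨(Set.range u)ᶜ, hZc.isOpen_compl.mem_nhds hx, fun _ => 0, contMDiffOn_const,
          fun y hy => ⟨star_zero _, fun h => absurd h hy⟩⟩
      obtain ⟨s, rfl⟩ := hx
      obtain ⟨C, hC⟩ := exists_sliceChart hu s
      obtain ⟨v₀, hv₀⟩ := hW.exists_dm_ne_zero hu s
      let c := dm 4 C.chart (u s) v₀
      -- The derivative of W in a fixed chart direction transverse to the curve at u s: along the
      -- curve it spans the line.
      let e : M → V := fun y => fderiv ℝ (W ∘ C.chart.symm) (C.chart y) c
      have he : ∀ y ∈ C.chart.source, ContMDiffAt (𝓡 4) 𝓘(ℝ, V) ∞ e y := by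
        intro y hy
        have h1 : ContDiffAt ℝ ∞ (fun p => fderiv ℝ (W ∘ C.chart.symm) p c) (C.chart y) :=
          (((contDiffAt_comp_symm C.mem hy hW.smooth.contMDiffAt).fderiv_right (m := ∞)
            (by simp)).clm_apply contDiffAt_const)
        exact h1.contMDiffAt.comp y (contMDiffAt_of_mem C.mem hy)
      have hes : e (u s) ≠ 0 := by
        simp only [e, c]
        rwa [← dm_eq_fderiv_comp_symm C.mem hC (hW.mdifferentiableAt _)]
      have hne : ∀ᶠ y in 𝓝 (u s), e y ≠ 0 := (he _ hC).continuousAt.eventually_ne hes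
      refine ⟨{y | y ∈ C.chart.source ∧ e y ≠ 0},
        Filter.inter_mem (C.chart.open_source.mem_nhds hC) hne,
        fun y => (‖e y‖ ^ 2)⁻¹ • InnerProductSpace.rankOne ℂ (e y) (e y), ?_, ?_⟩
      · rintro y ⟨hy, hy0⟩
        refine ContMDiffAt.contMDiffWithinAt ?_
        have h1 := he y hy
        have h4 : ContMDiffAt (𝓡 4) 𝓘(ℝ, ℝ) ∞ (fun y => (‖e y‖ ^ 2)⁻¹) y := by
          have h2 : ContDiffAt ℝ ∞ (fun v : V => (‖v‖ ^ 2)⁻¹) (e y) := by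
            have h3 : ContDiffAt ℝ ∞ (fun v : V => ‖v‖ ^ 2) (e y) := by
              exact (contDiff_norm_sq ℂ).contDiffAt
            exact h3.inv (by simpa using hy0)
          exact h2.contMDiffAt.comp y h1
        have h5 := (((isBoundedBilinearMap_rankOne (V := V)).contDiff.contMDiff
            (n := ∞)).contMDiffAt).comp y (h1.prodMk_space h1)
        exact h4.smul h5
      · rintro y ⟨hy, hy0⟩
        refine ⟨?_, ?_⟩
        · rw [star_smul]
          congr 1
          rw [ContinuousLinearMap.star_eq_adjoint, InnerProductSpace.adjoint_rankOne]
        rintro ⟨t, rfl⟩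
        obtain ⟨v, hv⟩ := dm_surjective C.mem hy c
        have hev : e (u t) = dm 4 W (u t) v := by
          rw [dm_eq_fderiv_comp_symm C.mem hy (hW.mdifferentiableAt _), hv]
        have hn : ((‖e (u t)‖ ^ 2 : ℝ) : ℂ) ≠ 0 := by
          have := norm_ne_zero_iff.2 hy0
          exact_mod_cast pow_ne_zero 2 this
        refine ⟨fun w => ?_, fun z hz => ?_⟩
        · obtain ⟨a, ha⟩ := hW.exists_smul hu (v := v) (by rwa [← hev]) w
          rw [ha, ← hev, map_smul]
          congr 1
          change (‖e (u t)‖ ^ 2)⁻¹ • (InnerProductSpace.rankOne ℂ (e (u t)) (e (u t)) (e (u t))) = _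
          rw [InnerProductSpace.rankOne_apply, inner_self_eq_norm_sq_to_K, ← Complex.coe_smul, smul_smul]
          push_cast at hn ⊢
          have h5 : ((‖e (u t)‖ : ℂ) ^ 2)⁻¹ * (‖e (u t)‖ : ℂ) ^ 2 = 1 := inv_mul_cancel₀ hn
          exact (congrArg (fun q : ℂ => q • e (u t)) h5).trans (one_smul _ _)
        · change (‖e (u t)‖ ^ 2)⁻¹ • (InnerProductSpace.rankOne ℂ (e (u t)) (e (u t)) z) = _
          rw [InnerProductSpace.rankOne_apply, hev, hz v, zero_smul, smul_zero])
  exact ⟨Q, Q.contMDiff, fun x => (hQ x).1, fun s => (hQ (u s)).2 ⟨s, rfl⟩⟩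
-- Near the curve Q is retracted to projections P, and W is replaced by P W. Because W vanishes on
-- the curve, this leaves its derivative there unchanged, and afterwards P W = W holds in a
-- neighbourhood.
theorem NormalMap.nonempty_normalData [FiniteDimensional ℂ V] [CompleteSpace V]
    (hW₀ : NormalMap J u W) (hu : Manifold.IsSmoothEmbedding (𝓡 2) (𝓡 4) ∞ u) :
    Nonempty (NormalData J u V) := by
  have : LocallyCompactSpace M := ChartedSpace.locallyCompactSpace (E 4) M
  have hZ : IsCompact (Set.range u) := by
    rw [← Set.image_univ]
    exact isCompact_univ.image hu.isEmbedding.continuous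
  obtain ⟨Q, hQ, hQs, hQu⟩ := hW₀.exists_selfAdjoint_extension hu
  obtain ⟨r, hr⟩ := exists_idempotent_retraction (V →L[ℂ] V)
  have hspan : ∀ s, ∃ e : V, e ≠ 0 ∧ Q (u s) e = e ∧ ∀ y, ∃ c : ℂ, Q (u s) y = c • e := by
    intro s
    obtain ⟨v, hv⟩ := hW₀.exists_dm_ne_zero hu s
    set e := dm 4 W (u s) v with he
    have hee : ⟪e, e⟫_ℂ ≠ 0 := inner_self_ne_zero.2 hv
    refine ⟨e, hv, (hQu s).1 v, fun y => ⟨⟪e, y⟫_ℂ / ⟪e, e⟫_ℂ, ?_⟩⟩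
    have h1 : Q (u s) (y - (⟪e, y⟫_ℂ / ⟪e, e⟫_ℂ) • e) = 0 := by
      refine (hQu s).2 _ fun w => ?_
      obtain ⟨c, hc⟩ := hW₀.exists_smul hu hv w
      rw [hc, inner_smul_left, inner_sub_right, inner_smul_right, ← he, div_mul_cancel₀ _ hee,
        sub_self, mul_zero]
    rw [map_sub, map_smul, (hQu s).1 v, sub_eq_zero] at h1
    exact h1
  have hQid : ∀ s, Q (u s) * Q (u s) = Q (u s) := by
    intro s
    obtain ⟨e, -, he, h1⟩ := hspan s
    ext y
    obtain ⟨c, hc⟩ := h1 y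
    change Q (u s) (Q (u s) y) = Q (u s) y
    rw [hc, map_smul, he]
  -- The properties of r ∘ Q that hold on a neighbourhood of the curve.
  let good : M → Prop := fun x => ContMDiffAt (𝓡 4) 𝓘(ℝ, V →L[ℂ] V) ∞ (fun y => r (Q y)) x ∧
    r (Q x) * r (Q x) = r (Q x) ∧ IsSelfAdjoint (r (Q x)) ∧
    ∀ w, r (Q x) w = w → ∀ y, ((‖w‖ ^ 2 : ℝ) : ℂ) • r (Q x) y = ⟪w, y⟫_ℂ • w
  have hgood : ∀ s, ∀ᶠ x in 𝓝 (u s), good x := by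
    intro s
    obtain ⟨h1, h2, h3⟩ := hr _ (hQid s)
    have hQc : ContinuousAt Q (u s) := hQ.continuous.continuousAt
    have h4 := hQc.eventually (h1.eventually (by simp))
    have h5 := hQc.eventually h3
    have h6 : ContinuousAt (fun x => r (Q x)) (u s) :=
      ContinuousAt.comp (f := Q) (g := r) (x := u s) h1.continuousAt hQc
    have h7 : ∀ᶠ x in 𝓝 (u s), ‖r (Q x) - Q (u s)‖ < 1 := by
      have h8 : ContinuousAt (fun x => ‖r (Q x) - Q (u s)‖) (u s) := (h6.sub continuousAt_const).norm
      refine h8.eventually_lt continuousAt_const ?_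
      simp [h2]
    filter_upwards [h4, h5, h7] with x h4 h5 h7
    obtain ⟨e, -, -, he⟩ := hspan s
    have hsa : IsSelfAdjoint (r (Q x)) := h5.2 (hQs x)
    exact ⟨(h4.of_le (by exact_mod_cast le_top)).contMDiffAt.comp x hQ.contMDiffAt, h5.1, hsa,
      fun w hw y => rank_one_of_norm_sub_lt he h5.1 hsa h7 hw y⟩
  have hsub : Set.range u ⊆ interior {x | good x} := by
    rintro _ ⟨s, rfl⟩
    exact mem_interior_iff_mem_nhds.2 (hgood s)
  obtain ⟨K₁, hK₁, hZK₁, hK₁O⟩ := exists_compact_between hZ isOpen_interior hsub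
  obtain ⟨χ, hχ1, hχ0, hχI⟩ := exists_contMDiffMap_one_nhds_of_subset_interior
    (n := (⊤ : ℕ∞)) (𝓡 4) hZ.isClosed hZK₁
  have hχs : tsupport χ ⊆ K₁ := closure_minimal (fun x hx => by
    by_contra h
    exact hx (hχ0 x h)) hK₁.isClosed
  let P : M → V →L[ℂ] V := fun x => χ x • r (Q x)
  have hP : ContMDiff (𝓡 4) 𝓘(ℝ, V →L[ℂ] V) ∞ P := by
    refine contMDiff_of_tsupport fun x hx => ?_
    have hx2 : x ∈ tsupport χ := closure_mono (fun y hy => by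
      simp only [P, Function.mem_support] at hy ⊢
      exact fun h0 => hy (by rw [h0, zero_smul])) hx
    have h1 : x ∈ {x | good x} := interior_subset (hK₁O (hχs hx2))
    exact (χ.contMDiff.contMDiffAt).smul h1.1
  let W' : M → V := fun x => P x (W x)
  have hW' : ContMDiff (𝓡 4) 𝓘(ℝ, V) ∞ W' := fun x =>
    (((isBoundedBilinearMap_clm_apply (V := V)).contDiff.contMDiff (n := ∞)).contMDiffAt).comp x
      (hP.contMDiffAt.prodMk_space hW₀.smooth.contMDiffAt)
  have hχu : ∀ s, χ (u s) = 1 := fun s => hχ1.self_of_nhdsSet _ ⟨s, rfl⟩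
  have hPu : ∀ s, P (u s) = Q (u s) := by
    intro s
    simp only [P]
    rw [hχu, one_smul, (hr _ (hQid s)).2.1]
  have hdW' : ∀ s v, dm 4 W' (u s) v = dm 4 W (u s) v := by
    intro s v
    have h1 := dm_bilinear (isBoundedBilinearMap_clm_apply (V := V))
      (hP.contMDiffAt.mdifferentiableAt (by simp) (x := u s)) (hW₀.mdifferentiableAt (u s)) v
    simp only [hW₀.zero, map_zero, add_zero] at h1
    refine h1.trans ?_
    rw [hPu, (hQu s).1]
  have hN : NormalMap J u W' :=
    { smooth := hW'
      zero := fun s => by simp only [W', hW₀.zero, map_zero]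
      apply_J := fun s v => by rw [hdW', hdW', hW₀.apply_J]
      ker := fun s v hv => hW₀.ker s v (by rw [← hdW', hv]) }
  -- In addition W' detects the curve nearby, since the normal coordinates are bounded by a multiple
  -- of |W'|.
  let better : M → Prop := fun x => good x ∧ χ x = 1 ∧ (W' x = 0 → x ∈ Set.range u)
  have hbetter : Set.range u ⊆ interior {x | better x} := by
    rintro _ ⟨s, rfl⟩
    refine mem_interior_iff_mem_nhds.2 ?_
    obtain ⟨C, hC⟩ := exists_sliceChart hu s
    obtain ⟨c, -, hc⟩ := hN.eventually_norm_le hu (C.contMDiffAt_y hC) (by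
      filter_upwards [C.chart.open_source.mem_nhds hC] with x hx hxu
      exact (C.mem_range_iff hx).1 hxu)
    have h1 := Filter.Eventually.filter_mono (nhds_le_nhdsSet (Set.mem_range_self s)) hχ1
    filter_upwards [hgood s, h1, hc, C.chart.open_source.mem_nhds hC] with x h1 h2 h3 h4
    refine ⟨h1, h2, fun h5 => (C.mem_range_iff h4).2 ?_⟩
    rw [h5, norm_zero, mul_zero] at h3
    exact norm_le_zero_iff.1 h3
  obtain ⟨K, hK, hZK, hKO⟩ := exists_compact_between hZ isOpen_interior hbetter
  have hKb : ∀ x ∈ K, better x := fun x hx => by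
    have h1 : x ∈ {x | better x} := interior_subset (hKO hx)
    exact h1
  obtain ⟨ψ, hψ1, hψ0, hψI⟩ := exists_contMDiffMap_one_nhds_of_subset_interior
    (n := (⊤ : ℕ∞)) (𝓡 4) hZ.isClosed hZK
  -- The added term is 0 near the curve and 1 outside K, so F can be small only inside K.
  let F : M → ℝ := fun x => ‖W' x‖ ^ 2 + (1 - ψ x)
  have hF : ContMDiff (𝓡 4) 𝓘(ℝ, ℝ) ∞ F := by
    have h1 : ContMDiff (𝓡 4) 𝓘(ℝ, ℝ) ∞ (fun x => ‖W' x‖ ^ 2) :=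
      ((contDiff_norm_sq ℂ (E := V)).contMDiff (n := ∞)).comp hW'
    exact h1.add (contMDiff_const.sub ψ.contMDiff)
  have hF0 : ∀ x, 0 ≤ F x := fun x => by
    have := (hψI x).2
    have h2 : 0 ≤ ‖W' x‖ ^ 2 := by positivity
    simp only [F]
    linarith
  have hFz : ∀ x, F x = 0 ↔ x ∈ Set.range u := by
    intro x
    constructor
    · intro h
      have h1 := (hψI x).2
      have h2 : 0 ≤ ‖W' x‖ ^ 2 := by positivity
      simp only [F] at h
      have h3 : ψ x = 1 := by linarith
      have h4 : x ∈ K := by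
        by_contra hx
        rw [hψ0 x hx] at h3
        exact zero_ne_one h3
      have h5 : ‖W' x‖ ^ 2 = 0 := by linarith
      exact (hKb x h4).2.2 (by simpa using h5)
    · rintro ⟨s, rfl⟩
      simp only [F]
      rw [hN.zero, hψ1.self_of_nhdsSet _ ⟨s, rfl⟩]
      simp
  obtain ⟨A, hAo, hZA, hA⟩ := eventually_nhdsSet_iff_exists.1 hψ1
  -- Below the threshold m a point lies in K because F ≥ 1 elsewhere, and in A because m bounds F
  -- from below on the compact set K \ A. On A the function ψ equals 1, so there F is exactly |W'|².
  have hpos : ∃ m : ℝ, 0 < m ∧ m ≤ 1 ∧ ∀ x ∈ K \ A, m ≤ F x := by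
    rcases (K \ A).eq_empty_or_nonempty with h0 | h0
    · exact ⟨1, one_pos, le_rfl, by simp [h0]⟩
    obtain ⟨x₀, hx₀, hmin⟩ := (hK.diff hAo).exists_isMinOn h0 hF.continuous.continuousOn
    have h1 : 0 < F x₀ := lt_of_le_of_ne (hF0 x₀) fun h =>
      hx₀.2 (hZA ((hFz x₀).1 h.symm))
    exact ⟨min (F x₀) 1, lt_min h1 one_pos, min_le_right _ _, fun x hx =>
      (min_le_left _ _).trans (hmin hx)⟩
  obtain ⟨m, hm, hm1, hmA⟩ := hpos
  have hmem : ∀ x, F x < m → x ∈ K ∧ x ∈ A := by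
    intro x hx
    have h1 : x ∈ K := by
      by_contra h
      have h2 : 0 ≤ ‖W' x‖ ^ 2 := by positivity
      simp only [F, hψ0 x h] at hx
      linarith
    exact ⟨h1, by
      by_contra h
      exact absurd (hmA x ⟨h1, h⟩) (not_le.2 hx)⟩
  have hPx : ∀ x, F x < m → P x = r (Q x) := fun x hx => by
    simp only [P]
    rw [(hKb x (hmem x hx).1).2.1, one_smul]
  have hPW : ∀ x, F x < m → P x (W' x) = W' x := fun x hx => by
    have h1 := (hKb x (hmem x hx).1).1.2.1
    simp only [W', hPx x hx]
    exact DFunLike.congr_fun h1 (W x)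
  exact ⟨{
    W := W'
    P := P
    F := F
    m := m
    K := K
    normalMap := hN
    contMDiff_P := hP
    contMDiff_F := hF
    F_nonneg := hF0
    F_eq_zero := hFz
    m_pos := hm
    isCompact_K := hK
    mem_K := fun x hx => (hmem x hx).1
    F_eq := fun x hx => by
      simp only [F]
      rw [hA x (hmem x hx).2]
      simp
    P_mul := fun x hx => by rw [hPx x hx]; exact (hKb x (hmem x hx).1).1.2.1
    P_self := fun x hx => by rw [hPx x hx]; exact (hKb x (hmem x hx).1).1.2.2.1
    P_W := hPW
    rank_one := fun x hx y => by
      have := (hKb x (hmem x hx).1).1.2.2.2 (W' x) (by rw [← hPx x hx, hPW x hx]) y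
      rw [hPx x hx]
      exact this }⟩

end NormalProjection

/-! ### Curvature, connection form and explicit Thom forms. -/

section ThomForms

open scoped InnerProductSpace

section Algebra

variable {V : Type*} [NormedAddCommGroup V] [InnerProductSpace ℂ V]

/-- The primitive `Im⟨w, dw⟩` of a multiple of the symplectic form of a Hermitian vector space. -/
def imEta (w : V) : V [⋀^Fin 1]→L[ℝ] ℝ :=
  one (Complex.imCLM.comp ((innerSL ℂ w).restrictScalars ℝ))

/-- The function `w ↦ Im⟨w, b⟩`. -/
def imInner (b : V) : V →L[ℝ] ℝ := -(Complex.imCLM.comp ((innerSL ℂ b).restrictScalars ℝ))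

theorem imInner_apply (b w : V) : imInner b w = (⟪w, b⟫_ℂ).im := by
  rw [← inner_conj_symm]
  rfl

theorem isBoundedBilinearMap_re_inner :
    IsBoundedBilinearMap ℝ (fun p : V × V => (⟪p.1, p.2⟫_ℂ).re) :=
  ⟨fun x y z => by simp, fun c x y => by
      change (⟪c • x, y⟫_ℂ).re = c * (⟪x, y⟫_ℂ).re
      rw [← Complex.coe_smul c x, inner_smul_left]
      simp, fun x y z => by simp, fun c x y => by
      change (⟪x, c • y⟫_ℂ).re = c * (⟪x, y⟫_ℂ).re
      rw [← Complex.coe_smul c y, inner_smul_right]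
      simp, 1, one_pos,
    fun x y => by
      rw [one_mul]
      exact (Complex.abs_re_le_norm _).trans (norm_inner_le_norm x y)⟩

theorem contDiff_imEta [FiniteDimensional ℂ V] : ContDiff ℝ ∞ (imEta (V := V)) := by
  have : FiniteDimensional ℝ V := FiniteDimensional.complexToReal V
  refine contDiff_iff_contDiffAt.2 fun w => contDiffAt_alternating_of_apply fun v => ?_
  have : (fun z : V => imEta z v) = imInner (v 0) := by
    funext z
    rw [imInner_apply]
    rfl
  rw [this]
  exact (imInner (v 0)).contDiff.contDiffAt

theorem extDeriv_imEta [FiniteDimensional ℂ V] (w a b : V) :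
    extDeriv imEta w ![a, b] = 2 * (⟪a, b⟫_ℂ).im := by
  have h : ∀ b : V, (fun z : V => imEta z ![b]) = imInner b := fun b => by
    funext z
    rw [imInner_apply]
    rfl
  rw [extDeriv_one_apply (contDiff_imEta.differentiable (by simp)).differentiableAt, h, h,
    ContinuousLinearMap.fderiv, ContinuousLinearMap.fderiv, imInner_apply, imInner_apply]
  have h2 : (⟪b, a⟫_ℂ).im = -(⟪a, b⟫_ℂ).im := by rw [← inner_conj_symm, Complex.conj_im]
  rw [h2]
  ring

variable [FiniteDimensional ℂ V]

/-- The imaginary part of the trace. -/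
def imTr : (V →L[ℂ] V) →L[ℝ] ℝ :=
  ∑ k, (Complex.imCLM.comp (((innerSL ℂ (stdOrthonormalBasis ℂ V k)).comp
    (ContinuousLinearMap.apply ℂ V (stdOrthonormalBasis ℂ V k))).restrictScalars ℝ))

theorem imTr_apply (X : V →L[ℂ] V) : imTr X =
    (∑ k, ⟪stdOrthonormalBasis ℂ V k, X (stdOrthonormalBasis ℂ V k)⟫_ℂ).im := by
  rw [Complex.im_sum, imTr, sum_apply]
  rfl

/-- The two-form `Im tr (p [dp, dp])`. -/
def comForm (p : V →L[ℂ] V) : (V →L[ℂ] V) [⋀^Fin 2]→L[ℝ] ℝ where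
  toFun v := imTr (p * (v 0 * v 1 - v 1 * v 0))
  map_update_add' := by
    intro dec v i x y
    have hd : dec = instDecidableEqFin 2 := Subsingleton.elim _ _
    subst hd
    rw [← map_add]
    congr 1
    fin_cases i <;> simp [Function.update] <;> noncomm_ring
  map_update_smul' := by
    intro dec v i c x
    have hd : dec = instDecidableEqFin 2 := Subsingleton.elim _ _
    subst hd
    rw [← map_smul]
    congr 1
    fin_cases i <;> simp [Function.update, ← smul_sub]
  map_eq_zero_of_eq' := by
    intro v i j hij hne
    fin_cases i <;> fin_cases j <;> first | exact absurd rfl hne | skip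
    all_goals
      simp only [Fin.zero_eta, Fin.mk_one, Fin.isValue] at hij
      simp only [hij]
      simp
  cont := by fun_prop

theorem comForm_apply (p a b : V →L[ℂ] V) :
    comForm p ![a, b] = imTr (p * (a * b - b * a)) := rfl

theorem contDiff_comForm : ContDiff ℝ ∞ (comForm (V := V)) := by
  have : FiniteDimensional ℝ (V →L[ℂ] V) := FiniteDimensional.complexToReal _
  refine contDiff_iff_contDiffAt.2 fun p => contDiffAt_alternating_of_apply fun v => ?_
  exact imTr.contDiff.contDiffAt.comp p (contDiffAt_id.mul contDiffAt_const)

/-- The equations for A w and B w are what differentiating P W = W produces. Multiplying by |w|²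
makes P accessible as w⊗w* without dividing by |w|², so the identity also makes sense where w = 0.
-/
theorem norm_sq_mul_comForm [CompleteSpace V] {P A B : V →L[ℂ] V} {w a b : V} (hP : P * P = P)
    (hPs : IsSelfAdjoint P) (hA : IsSelfAdjoint A) (hB : IsSelfAdjoint B)
    (ha : A w = a - P a) (hb : B w = b - P b)
    (h1 : ∀ y, ((‖w‖ ^ 2 : ℝ) : ℂ) • P y = ⟪w, y⟫_ℂ • w) :
    ‖w‖ ^ 2 * (‖w‖ ^ 2 * comForm P ![A, B]) = ‖w‖ ^ 2 * (2 * (⟪a, b⟫_ℂ).im) -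
      (2 * (⟪w, a⟫_ℂ).re * (⟪w, b⟫_ℂ).im - 2 * (⟪w, b⟫_ℂ).re * (⟪w, a⟫_ℂ).im) := by
  have hadj : ∀ {T : V →L[ℂ] V}, IsSelfAdjoint T → ∀ x y, ⟪T x, y⟫_ℂ = ⟪x, T y⟫_ℂ := fun hT x y => by
    rw [← ContinuousLinearMap.adjoint_inner_right, ContinuousLinearMap.isSelfAdjoint_iff'.1 hT]
  -- The trace of w⊗w* composed with X is ⟨w, X w⟩.
  have htr : ∀ X : V →L[ℂ] V, ‖w‖ ^ 2 * imTr (P * X) = (⟪w, X w⟫_ℂ).im := by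
    intro X
    set e := stdOrthonormalBasis ℂ V
    have h2 : ∀ k, ((‖w‖ ^ 2 : ℝ) : ℂ) * ⟪e k, P (X (e k))⟫_ℂ =
        ⟪ContinuousLinearMap.adjoint X w, e k⟫_ℂ * ⟪e k, w⟫_ℂ := by
      intro k
      rw [← inner_smul_right, h1, inner_smul_right, ContinuousLinearMap.adjoint_inner_left]
    have h3 : ((‖w‖ ^ 2 : ℝ) : ℂ) * ∑ k, ⟪e k, P (X (e k))⟫_ℂ = ⟪w, X w⟫_ℂ := by
      rw [Finset.mul_sum, Finset.sum_congr rfl fun k _ => h2 k, e.sum_inner_mul_inner,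
        ContinuousLinearMap.adjoint_inner_left]
    rw [imTr_apply, ← h3, Complex.im_ofReal_mul]
    rfl
  rw [comForm_apply, htr]
  have h4 : ⟪w, (A * B - B * A) w⟫_ℂ = ⟪a - P a, b - P b⟫_ℂ - ⟪b - P b, a - P a⟫_ℂ := by
    change ⟪w, A (B w) - B (A w)⟫_ℂ = _
    rw [inner_sub_right, ← hadj hA w, ← hadj hB w, ha, hb]
  have h5 : ∀ a b : V, ((‖w‖ ^ 2 : ℝ) : ℂ) * ⟪a - P a, b - P b⟫_ℂ =
      ((‖w‖ ^ 2 : ℝ) : ℂ) * ⟪a, b⟫_ℂ - ⟪w, b⟫_ℂ * ⟪a, w⟫_ℂ := by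
    intro a b
    have h6 : P (b - P b) = 0 := by
      rw [map_sub]
      exact sub_eq_zero.2 (DFunLike.congr_fun hP b).symm
    rw [inner_sub_left, hadj hPs, h6, inner_zero_right, sub_zero, inner_sub_right, mul_sub,
      ← inner_smul_right (y := P b), h1, inner_smul_right]
  have h7 : ((‖w‖ ^ 2 : ℝ) : ℂ) * ⟪w, (A * B - B * A) w⟫_ℂ =
      ((‖w‖ ^ 2 : ℝ) : ℂ) * (⟪a, b⟫_ℂ - ⟪b, a⟫_ℂ) - ⟪w, b⟫_ℂ * ⟪a, w⟫_ℂ + ⟪w, a⟫_ℂ * ⟪b, w⟫_ℂ := by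
    rw [h4, mul_sub, h5, h5]
    ring
  have h8 := congrArg Complex.im h7
  rw [Complex.im_ofReal_mul] at h8
  rw [h8, ← inner_conj_symm b a, ← inner_conj_symm a w, ← inner_conj_symm b w]
  simp only [Complex.add_im, Complex.sub_im, Complex.mul_im, Complex.sub_re,
    Complex.conj_im, Complex.conj_re, Complex.ofReal_re, Complex.ofReal_im]
  ring

end Algebra

variable {M : Type*} [TopologicalSpace M] [T2Space M] [SigmaCompactSpace M]
    [ChartedSpace (E 4) M] [IsManifold (𝓡 4) ∞ M]
    {S : Type*} [TopologicalSpace S] [T2Space S] [CompactSpace S] [ConnectedSpace S]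
    [ChartedSpace (E 2) S] [IsManifold (𝓡 2) ∞ S]
    {V : Type*} [NormedAddCommGroup V] [InnerProductSpace ℂ V] [FiniteDimensional ℂ V]
    [CompleteSpace V]
    {J : ∀ x : M, TangentSpace (𝓡 4) x →L[ℝ] TangentSpace (𝓡 4) x} {u : S → M}

theorem HasExtDeriv.isClosedForm {n : ℕ} {X : Type*} [TopologicalSpace X] [ChartedSpace (E n) X]
    [IsManifold (𝓡 n) ∞ X] {k : ℕ} {σ : Form n X k} {θ : Form n X (k + 1)} (hσ : IsSmoothForm σ)
    (h : HasExtDeriv σ θ) : IsClosedForm θ := by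
  intro c y hy
  have hy' := hy
  rw [extChartAt_target_eq] at hy'
  have h1 : inChart θ c =ᶠ[𝓝 y] extDeriv (inChart σ c) := by
    filter_upwards [(chartAt (E n) c).open_target.mem_nhds hy'] with z hz
    exact (h c z (by rwa [extChartAt_target_eq])).symm
  rw [h1.extDeriv_eq, extDeriv_extDeriv_apply (hσ.contDiffAt hy') (by
    rw [minSmoothness_of_isRCLikeNormedField]
    exact WithTop.coe_le_coe.2 (le_top : (2 : ℕ∞) ≤ ⊤))]
  rw [inChart_zero]
  rfl

/-- A profile function: constant near `(-∞, 0]` and zero near `[m, ∞)`. -/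
structure Profile (m : ℝ) (b : ℝ → ℝ) : Prop where
  smooth : ContDiff ℝ ∞ b
  eq_const : ∃ t₀ > 0, ∀ t < t₀, b t = b 0
  eq_zero : ∃ t₁ < m, ∀ t > t₁, b t = 0

namespace Profile

variable {m : ℝ} {b : ℝ → ℝ} (hb : Profile m b)
include hb

/-- A profile with b(0) = 0 vanishes near 0, so the quotient is zero there, also at t = 0 by the
convention for division. -/
theorem contDiff_div (h0 : b 0 = 0) : ContDiff ℝ ∞ fun t => b t / t := by
  obtain ⟨t₀, ht₀, h1⟩ := hb.eq_const
  rw [contDiff_iff_contDiffAt]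
  intro t
  rcases lt_or_ge t t₀ with ht | ht
  · have : (fun t => b t / t) =ᶠ[𝓝 t] fun _ => 0 := by
      filter_upwards [gt_mem_nhds ht] with s hs
      rw [h1 s hs, h0, zero_div]
    exact contDiffAt_const.congr_of_eventuallyEq this
  · exact hb.smooth.contDiffAt.div contDiffAt_id (ht₀.trans_le ht).ne'

theorem deriv : Profile m (deriv b) where
  smooth := by
    have h := hb.smooth
    rw [show (∞ : WithTop ℕ∞) = ∞ + 1 from rfl, contDiff_succ_iff_deriv] at h
    exact h.2.2
  eq_const := by
    obtain ⟨t₀, ht₀, h1⟩ := hb.eq_const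
    have h2 : ∀ t < t₀, _root_.deriv b t = 0 := fun t ht => by
      have : b =ᶠ[𝓝 t] fun _ => b 0 := by
        filter_upwards [gt_mem_nhds ht] with s hs using h1 s hs
      rw [this.deriv_eq, deriv_const]
    exact ⟨t₀, ht₀, fun t ht => by rw [h2 t ht, h2 0 ht₀]⟩
  eq_zero := by
    obtain ⟨t₁, ht₁, h1⟩ := hb.eq_zero
    refine ⟨t₁, ht₁, fun t ht => ?_⟩
    have : b =ᶠ[𝓝 t] fun _ => 0 := by
      filter_upwards [lt_mem_nhds ht] with s hs using h1 s hs
    rw [this.deriv_eq, deriv_const]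

theorem deriv_eq_zero : ∃ t₀ > 0, ∀ t < t₀, _root_.deriv b t = 0 := by
  obtain ⟨t₀, ht₀, h1⟩ := hb.eq_const
  refine ⟨t₀, ht₀, fun t ht => ?_⟩
  have : b =ᶠ[𝓝 t] fun _ => b 0 := by
    filter_upwards [gt_mem_nhds ht] with s hs using h1 s hs
  rw [this.deriv_eq, deriv_const]

theorem deriv_zero : _root_.deriv b 0 = 0 := by
  obtain ⟨t₀, ht₀, h⟩ := hb.deriv_eq_zero
  exact h 0 ht₀

end Profile

namespace NormalData

variable (D : NormalData J u V)

theorem contMDiff_comp_F {q : ℝ → ℝ} (hq : ContDiff ℝ ∞ q) :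
    ContMDiff (𝓡 4) 𝓘(ℝ, ℝ) ∞ fun x => q (D.F x) :=
  hq.contMDiff.comp D.contMDiff_F

/-- The one-form `Im⟨W, dW⟩`. -/
def eta : Form 4 M 1 := vpb D.W imEta

/-- Its exterior derivative `Im⟨dW, dW⟩`. -/
def deta : Form 4 M 2 := vpb D.W (extDeriv imEta)

/-- The curvature form of the line bundle. -/
def kappa : Form 4 M 2 := vpb D.P comForm

theorem isSmoothForm_eta : IsSmoothForm D.eta := isSmoothForm_vpb D.normalMap.smooth contDiff_imEta

theorem hasExtDeriv_eta : HasExtDeriv D.eta D.deta :=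
  hasExtDeriv_vpb D.normalMap.smooth contDiff_imEta

theorem isSmoothForm_kappa : IsSmoothForm D.kappa := isSmoothForm_vpb D.contMDiff_P contDiff_comForm

theorem eta_apply (x : M) (v : TangentSpace (𝓡 4) x) :
    D.eta x ![v] = (⟪D.W x, dm 4 D.W x v⟫_ℂ).im := rfl

theorem deta_apply (x : M) (v w : TangentSpace (𝓡 4) x) :
    D.deta x ![v, w] = 2 * (⟪dm 4 D.W x v, dm 4 D.W x w⟫_ℂ).im := by
  rw [← extDeriv_imEta (D.W x)]
  change extDeriv imEta (D.W x) (dm 4 D.W x ∘ ![v, w]) = _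
  congr 1
  funext i
  fin_cases i <;> rfl

theorem kappa_apply (x : M) (v w : TangentSpace (𝓡 4) x) :
    D.kappa x ![v, w] = comForm (D.P x) ![dm 4 D.P x v, dm 4 D.P x w] := rfl

variable {D}

theorem eventually_lt {x : M} (hx : D.F x < D.m) : ∀ᶠ z in 𝓝 x, D.F z < D.m :=
  D.contMDiff_F.continuous.continuousAt.eventually_lt continuousAt_const hx

theorem dm_F {x : M} (hx : D.F x < D.m) (v : TangentSpace (𝓡 4) x) :
    dm 4 D.F x v = 2 * (⟪D.W x, dm 4 D.W x v⟫_ℂ).re := by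
  have h1 : D.F =ᶠ[𝓝 x] fun z => (⟪D.W z, D.W z⟫_ℂ).re := by
    filter_upwards [eventually_lt hx] with z hz
    rw [D.F_eq z hz, inner_self_eq_norm_sq_to_K]
    norm_cast
  have h2 := dm_bilinear (isBoundedBilinearMap_re_inner (V := V)) (D.normalMap.mdifferentiableAt x)
    (D.normalMap.mdifferentiableAt x) v
  rw [dm_congr h1]
  refine h2.trans ?_
  change (⟪D.W x, dm 4 D.W x v⟫_ℂ).re + (⟪dm 4 D.W x v, D.W x⟫_ℂ).re = _
  rw [← inner_conj_symm (dm 4 D.W x v), Complex.conj_re]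
  ring

theorem mdifferentiableAt_P (x : M) : MDifferentiableAt (𝓡 4) 𝓘(ℝ, V →L[ℂ] V) D.P x :=
  D.contMDiff_P.contMDiffAt.mdifferentiableAt (by simp)

theorem isSelfAdjoint_dm_P {x : M} (hx : D.F x < D.m) (v : TangentSpace (𝓡 4) x) :
    IsSelfAdjoint (dm 4 D.P x v) := by
  -- The adjoint is only conjugate linear over ℂ; as a real linear map it commutes with
  -- differentiation.
  let L : (V →L[ℂ] V) →L[ℝ] (V →L[ℂ] V) :=
    LinearMap.mkContinuous
      { toFun := star
        map_add' := star_add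
        map_smul' := fun c X => by
          rw [← Complex.coe_smul c X, star_smul, RCLike.star_def, Complex.conj_ofReal]
          rfl } 1 (fun X => by
          rw [one_mul]
          exact (norm_star X).le)
  have h1 : (fun z => L (D.P z)) =ᶠ[𝓝 x] D.P := by
    filter_upwards [eventually_lt hx] with z hz
    exact D.P_self z hz
  have h2 := dm_clm_comp L (mdifferentiableAt_P (D := D) x) v
  rw [dm_congr h1] at h2
  exact h2.symm

theorem dm_P_W {x : M} (hx : D.F x < D.m) (v : TangentSpace (𝓡 4) x) :
    dm 4 D.P x v (D.W x) = dm 4 D.W x v - D.P x (dm 4 D.W x v) := by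
  have h1 : (fun z => D.P z (D.W z)) =ᶠ[𝓝 x] D.W := by
    filter_upwards [eventually_lt hx] with z hz
    exact D.P_W z hz
  have h2 := dm_bilinear (isBoundedBilinearMap_clm_apply (V := V)) (mdifferentiableAt_P (D := D) x)
    (D.normalMap.mdifferentiableAt x) v
  rw [dm_congr h1] at h2
  exact eq_sub_of_add_eq' h2.symm

/-- The basic relation between the curvature and the connection form. -/
theorem sq_mul_kappa {x : M} (hx : D.F x < D.m) (v w : TangentSpace (𝓡 4) x) :
    D.F x * (D.F x * D.kappa x ![v, w]) =
      D.F x * D.deta x ![v, w] - wedgeOne (dfn D.F) D.eta x ![v, w] := by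
  have h := norm_sq_mul_comForm (D.P_mul x hx) (D.P_self x hx) (isSelfAdjoint_dm_P hx v)
    (isSelfAdjoint_dm_P hx w) (dm_P_W hx v) (dm_P_W hx w) (D.rank_one x hx)
  rw [← D.F_eq x hx] at h
  rw [kappa_apply, h, deta_apply]
  change _ = _ - wedge11 (dfn D.F x) (D.eta x) ![v, w]
  rw [wedge11_apply, dfn_apply, dfn_apply, eta_apply, eta_apply, dm_F hx, dm_F hx]

variable (D)

/-- The exact form `d(q(F)η)`. -/
def exactForm (q : ℝ → ℝ) : Form 4 M 2 :=
  wedgeOne (dfn fun x => q (D.F x)) D.eta + fsmul (fun x => q (D.F x)) D.deta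

/-- The form which represents a multiple of the Thom class. -/
def thomForm (b : ℝ → ℝ) : Form 4 M 2 :=
  fsmul (fun x => deriv b (D.F x) / D.F x) (wedgeOne (dfn D.F) D.eta) +
    fsmul (fun x => b (D.F x)) D.kappa

variable {D}

theorem dm_comp_F {q : ℝ → ℝ} {x : M} (hq : DifferentiableAt ℝ q (D.F x))
    (v : TangentSpace (𝓡 4) x) :
    dm 4 (fun x => q (D.F x)) x v = deriv q (D.F x) * dm 4 D.F x v := by
  have h := dm_comp (g := q) hq (D.contMDiff_F.contMDiffAt.mdifferentiableAt (by simp)) v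
  refine h.trans ?_
  rw [← fderiv_apply_one_eq_deriv, mul_comm, ← smul_eq_mul, ← map_smul, smul_eq_mul, mul_one]

theorem exactForm_apply {q : ℝ → ℝ} {x : M} (hq : DifferentiableAt ℝ q (D.F x))
    (v w : TangentSpace (𝓡 4) x) : D.exactForm q x ![v, w] =
      deriv q (D.F x) * wedgeOne (dfn D.F) D.eta x ![v, w] + q (D.F x) * D.deta x ![v, w] := by
  change wedge11 (dfn (fun x => q (D.F x)) x) (D.eta x) ![v, w] + q (D.F x) * D.deta x ![v, w] =
    _ * wedge11 (dfn D.F x) (D.eta x) ![v, w] + _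
  rw [wedge11_apply, wedge11_apply, dfn_apply, dfn_apply, dfn_apply, dfn_apply, dm_comp_F hq,
    dm_comp_F hq]
  ring

theorem thomForm_apply (b : ℝ → ℝ) (x : M) (v w : TangentSpace (𝓡 4) x) :
    D.thomForm b x ![v, w] = deriv b (D.F x) / D.F x * wedgeOne (dfn D.F) D.eta x ![v, w] +
      b (D.F x) * D.kappa x ![v, w] := rfl

theorem hasExtDeriv_exactForm {q : ℝ → ℝ} (hq : ContDiff ℝ ∞ q) :
    HasExtDeriv (fsmul (fun x => q (D.F x)) D.eta) (D.exactForm q) :=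
  HasExtDeriv.fsmul D.isSmoothForm_eta D.hasExtDeriv_eta (D.contMDiff_comp_F hq)

/-- Off the curve `sq_mul_kappa` reads kappa = d(η/F), so the Thom form is d(b(F) η/F), which is
d(q(F) η) when b(t) = t q(t). -/
theorem thomForm_eq_exactForm {b q : ℝ → ℝ} {x : M} (hx : D.F x < D.m) (h0 : D.F x ≠ 0)
    (hq : DifferentiableAt ℝ q (D.F x)) (hbq : b =ᶠ[𝓝 (D.F x)] fun t => t * q t) :
    D.thomForm b x = D.exactForm q x := by
  refine form2_ext fun v w => ?_
  rw [thomForm_apply, exactForm_apply hq, hbq.deriv_eq, hbq.self_of_nhds]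
  have h1 : deriv (fun t => t * q t) (D.F x) = q (D.F x) + D.F x * deriv q (D.F x) := by
    have : HasDerivAt (fun t => t * q t) (1 * q (D.F x) + D.F x * deriv q (D.F x)) (D.F x) :=
      (hasDerivAt_id (D.F x)).mul hq.hasDerivAt
    rw [this.deriv, one_mul]
  have h2 := sq_mul_kappa hx v w
  rw [h1]
  field_simp
  linear_combination q (D.F x) * h2

theorem thomForm_eq_zero {b : ℝ → ℝ} {x : M} (hb : b =ᶠ[𝓝 (D.F x)] fun _ => 0) :
    D.thomForm b x = 0 := by
  refine form2_ext fun v w => ?_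
  rw [thomForm_apply, hb.deriv_eq, hb.self_of_nhds]
  simp

theorem exactForm_eq_zero {b : ℝ → ℝ} {x : M} (hb : b =ᶠ[𝓝 (D.F x)] fun _ => 0) :
    D.exactForm b x = 0 := by
  refine form2_ext fun v w => ?_
  have hd : DifferentiableAt ℝ b (D.F x) :=
    (differentiableAt_const (0 : ℝ)).congr_of_eventuallyEq hb
  rw [exactForm_apply hd, hb.deriv_eq, hb.self_of_nhds]
  simp

section Profiles

variable {b : ℝ → ℝ} (hb : Profile D.m b)
include hb

theorem isSmoothForm_thomForm : IsSmoothForm (D.thomForm b) :=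
  (((isSmoothForm_dfn D.contMDiff_F).wedgeOne D.isSmoothForm_eta).fsmul
    (D.contMDiff_comp_F (hb.deriv.contDiff_div hb.deriv_zero))).add
    (D.isSmoothForm_kappa.fsmul (D.contMDiff_comp_F hb.smooth))

theorem mem_K_of_thomForm_ne_zero {x : M} (hx : D.thomForm b x ≠ 0) : x ∈ D.K := by
  refine D.mem_K x ?_
  by_contra! h
  obtain ⟨t₁, ht₁, h1⟩ := hb.eq_zero
  refine hx (thomForm_eq_zero ?_)
  filter_upwards [lt_mem_nhds (ht₁.trans_le h)] with s hs using h1 s hs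

theorem hasCompactSuppForm_thomForm : HasCompactSuppForm (D.thomForm b) :=
  ⟨D.K, D.isCompact_K, fun x hx => by
    by_contra h
    exact hx (mem_K_of_thomForm_ne_zero hb h)⟩

theorem hasCompactSuppForm_fsmul_eta : HasCompactSuppForm (fsmul (fun x => b (D.F x) / D.F x) D.eta) :=
  ⟨D.K, D.isCompact_K, fun x hx => by
    obtain ⟨t₁, ht₁, h1⟩ := hb.eq_zero
    have h2 : D.m ≤ D.F x := by
      by_contra! h
      exact hx (D.mem_K x h)
    change (b (D.F x) / D.F x) • D.eta x = 0
    rw [h1 _ (ht₁.trans_le h2), zero_div, zero_smul]⟩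

/-- When b(0) = 0 the primitive b(F) η/F extends smoothly by zero across the curve. Applied to
differences of profiles, this shows that the class of a Thom form depends only on b(0). -/
theorem hasExtDeriv_thomForm (h0 : b 0 = 0) :
    HasExtDeriv (fsmul (fun x => b (D.F x) / D.F x) D.eta) (D.thomForm b) := by
  have hq := hb.contDiff_div h0
  have h := hasExtDeriv_exactForm (D := D) hq
  convert h using 1
  funext x
  obtain ⟨t₀, ht₀, h1⟩ := hb.eq_const
  obtain ⟨t₁, ht₁, h2⟩ := hb.eq_zero
  rcases lt_or_ge (D.F x) t₀ with hx | hx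
  · rw [thomForm_eq_zero, exactForm_eq_zero]
    · filter_upwards [gt_mem_nhds hx] with s hs
      rw [h1 s hs, h0, zero_div]
    · filter_upwards [gt_mem_nhds hx] with s hs
      rw [h1 s hs, h0]
  rcases lt_or_ge (D.F x) D.m with hx2 | hx2
  · have hne := (ht₀.trans_le hx).ne'
    refine thomForm_eq_exactForm hx2 hne (hq.differentiable (by simp)).differentiableAt ?_
    filter_upwards [eventually_ne_nhds hne] with s hs
    field_simp
  · rw [thomForm_eq_zero, exactForm_eq_zero]
    · filter_upwards [lt_mem_nhds (ht₁.trans_le hx2)] with s hs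
      rw [h2 s hs, zero_div]
    · filter_upwards [lt_mem_nhds (ht₁.trans_le hx2)] with s hs using h2 s hs

/-- The Thom form agrees with an exact form away from the curve. -/
theorem exists_exactForm {x : M} (hx : D.F x ≠ 0) :
    ∃ q : ℝ → ℝ, ContDiff ℝ ∞ q ∧ ∀ᶠ z in 𝓝 x, D.thomForm b z = D.exactForm q z := by
  have hpos : 0 < D.F x := lt_of_le_of_ne (D.F_nonneg x) hx.symm
  set δ := D.F x / 2 with hδ
  have hδ0 : 0 < δ := by positivity
  -- The quotient b(t)/t, cut off smoothly: zero for t ≤ δ/2 and unchanged for t ≥ δ, where δ is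
  -- half the value of F at x.
  let q : ℝ → ℝ := fun t => b t * Real.smoothTransition (2 * t / δ - 1) / t
  have hq : ContDiff ℝ ∞ q := by
    rw [contDiff_iff_contDiffAt]
    intro t
    rcases lt_or_ge t (δ / 2) with ht | ht
    · have : q =ᶠ[𝓝 t] fun _ => 0 := by
        filter_upwards [gt_mem_nhds ht] with s hs
        have h1 : Real.smoothTransition (2 * s / δ - 1) = 0 := by
          apply Real.smoothTransition.zero_of_nonpos
          rw [sub_nonpos, div_le_one hδ0]
          linarith
        simp only [q]
        rw [h1, mul_zero, zero_div]
      exact contDiffAt_const.congr_of_eventuallyEq this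
    · have h1 : ContDiff ℝ ∞ fun t : ℝ => Real.smoothTransition (2 * t / δ - 1) :=
        Real.smoothTransition.contDiff.comp (by fun_prop)
      exact (hb.smooth.contDiffAt.mul h1.contDiffAt).div contDiffAt_id (by
        have : 0 < t := lt_of_lt_of_le (by positivity) ht
        exact this.ne')
  have hqb : ∀ t > δ, b t = t * q t := by
    intro t ht
    have h1 : Real.smoothTransition (2 * t / δ - 1) = 1 := by
      apply Real.smoothTransition.one_of_one_le
      rw [le_sub_iff_add_le, le_div_iff₀ hδ0]
      linarith
    have : t ≠ 0 := (hδ0.trans ht).ne'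
    simp only [q]
    rw [h1]
    field_simp
  refine ⟨q, hq, ?_⟩
  obtain ⟨t₁, ht₁, h2⟩ := hb.eq_zero
  have h3 : ∀ᶠ z in 𝓝 x, δ < D.F z :=
    continuousAt_const.eventually_lt D.contMDiff_F.continuous.continuousAt (by linarith)
  filter_upwards [h3] with z hz
  rcases lt_or_ge (D.F z) D.m with hx2 | hx2
  · refine thomForm_eq_exactForm hx2 (hδ0.trans hz).ne'
      (hq.differentiable (by simp)).differentiableAt ?_
    filter_upwards [lt_mem_nhds hz] with s hs using hqb s hs
  · rw [thomForm_eq_zero, exactForm_eq_zero]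
    · filter_upwards [lt_mem_nhds (ht₁.trans_le hx2)] with s hs
      simp only [q]
      rw [h2 s hs, zero_mul, zero_div]
    · filter_upwards [lt_mem_nhds (ht₁.trans_le hx2)] with s hs using h2 s hs

/-- Off the curve the form is locally exact, so its derivative vanishes there; on the curve it
vanishes by continuity, because the complement is dense. -/
theorem isClosedForm_thomForm (hu : Manifold.IsSmoothEmbedding (𝓡 2) (𝓡 4) ∞ u) :
    IsClosedForm (D.thomForm b) := by
  obtain ⟨θ, hθs, hθ⟩ := exists_hasExtDeriv (isSmoothForm_thomForm hb)
  have h1 : ∀ x ∉ Set.range u, θ x = 0 := by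
    intro x hx
    rw [← D.F_eq_zero] at hx
    obtain ⟨q, hq, h⟩ := exists_exactForm hb hx
    have h2 : IsSmoothForm (fsmul (fun x => q (D.F x)) D.eta) :=
      D.isSmoothForm_eta.fsmul (D.contMDiff_comp_F hq)
    exact hθ.eq_of_eventuallyEq ((hasExtDeriv_exactForm hq).isClosedForm h2) h
  have h2 : ∀ s, θ (u s) = 0 := by
    intro s
    obtain ⟨C, hC⟩ := exists_sliceChart hu s
    set c := u s
    have hcs := mem_chart_source (E 4) c
    have hy := (chartAt (E 4) c).map_source hcs
    refine form_eq_of_inChart_eq (σ' := 0) hcs ?_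
    have hcont : ContinuousAt (inChart θ c) (chartAt (E 4) c c) := (hθs.contDiffAt hy).continuousAt
    have hcont2 : ContinuousAt (fun x => inChart θ c (chartAt (E 4) c x)) c :=
      hcont.comp ((chartAt (E 4) c).continuousAt hcs)
    -- Approaches the point of the curve along the normal slice, which meets the curve only at its
    -- centre.
    let p : E 2 → M := fun w => C.chart.symm (C.e (C.dom s, w))
    have hp0 : p 0 = c := by
      simp only [p]
      rw [← C.chart_apply s hC, C.chart.left_inv hC]
    have he0 : C.e (C.dom s, 0) = C.chart c := (C.chart_apply s hC).symm
    have hp1 : ContinuousAt (fun w : E 2 => C.e (C.dom s, w)) 0 := by fun_prop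
    have hp : ContinuousAt p 0 := by
      refine ContinuousAt.comp (g := C.chart.symm) ?_ hp1
      rw [he0]
      exact C.chart.continuousAt_symm (C.chart.map_source hC)
    have hev : ∀ᶠ w in 𝓝[≠] (0 : E 2), inChart θ c (chartAt (E 4) c (p w)) = inChart 0 c (chartAt (E 4) c c) := by
      have h3 : ∀ᶠ w in 𝓝[≠] (0 : E 2), C.e (C.dom s, w) ∈ C.chart.target :=
        nhdsWithin_le_nhds (hp1.eventually (C.chart.open_target.mem_nhds (by
          change C.e (C.dom s, 0) ∈ _
          rw [he0]
          exact C.chart.map_source hC)))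
      have h4 : ∀ᶠ w in 𝓝[≠] (0 : E 2), p w ∈ (chartAt (E 4) c).source :=
        nhdsWithin_le_nhds (hp.eventually ((chartAt (E 4) c).open_source.mem_nhds (by rwa [hp0])))
      filter_upwards [h3, h4, self_mem_nhdsWithin] with w h3 h4 h5
      have h6 : p w ∉ Set.range u := by
        rw [C.mem_range_iff (C.chart.map_target h3), SliceChart.y, C.chart.right_inv h3,
          C.e.symm_apply_apply]
        exact h5
      have h7 := h1 _ h6
      rw [← (chartAt (E 4) c).left_inv h4] at h7
      rw [inChart_zero]
      change (θ _).compContinuousLinearMap _ = _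
      have h8 : ∀ y, θ ((chartAt (E 4) c).symm y) = 0 → inChart θ c y = 0 := by
        intro y hy
        change (θ ((chartAt (E 4) c).symm y)).compContinuousLinearMap (chartFrame c y) = 0
        rw [hy]
        rfl
      exact h8 _ h7
    have hlim : Filter.Tendsto (fun w => inChart θ c (chartAt (E 4) c (p w))) (𝓝[≠] 0)
        (𝓝 (inChart θ c (chartAt (E 4) c c))) := by
      refine Filter.Tendsto.mono_left ?_ nhdsWithin_le_nhds
      have h9 : ContinuousAt (fun w => inChart θ c (chartAt (E 4) c (p w))) 0 :=
        ContinuousAt.comp (g := fun x => inChart θ c (chartAt (E 4) c x)) (by rwa [hp0]) hp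
      rw [ContinuousAt, hp0] at h9
      exact h9
    have : (𝓝[≠] (0 : E 2)).NeBot := inferInstance
    exact tendsto_nhds_unique hlim (tendsto_const_nhds.congr' (hev.mono fun w hw => hw.symm))
  have h3 : θ = 0 := by
    funext x
    by_cases hx : x ∈ Set.range u
    · obtain ⟨s, rfl⟩ := hx
      exact h2 s
    · exact h1 x hx
  rwa [h3] at hθ

theorem thomForm_apply_u (s : S) : D.thomForm b (u s) = b 0 • D.kappa (u s) := by
  have h0 : D.F (u s) = 0 := (D.F_eq_zero _).2 ⟨s, rfl⟩
  refine form2_ext fun v w => ?_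
  rw [thomForm_apply, h0, hb.deriv_zero]
  simp

theorem thomForm_sub {b' : ℝ → ℝ} (hb' : Profile D.m b') :
    D.thomForm (fun t => b t - b' t) = D.thomForm b - D.thomForm b' := by
  funext x
  refine form2_ext fun v w => ?_
  rw [Pi.sub_apply, ContinuousAlternatingMap.sub_apply, thomForm_apply, thomForm_apply,
    thomForm_apply, deriv_fun_sub (hb.smooth.differentiable (by simp)).differentiableAt
      (hb'.smooth.differentiable (by simp)).differentiableAt]
  ring

end Profiles

end NormalData

theorem Profile.sub {m : ℝ} {b b' : ℝ → ℝ} (hb : Profile m b) (hb' : Profile m b') :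
    Profile m fun t => b t - b' t where
  smooth := hb.smooth.sub hb'.smooth
  eq_const := by
    obtain ⟨t₀, ht₀, h⟩ := hb.eq_const
    obtain ⟨t₁, ht₁, h'⟩ := hb'.eq_const
    exact ⟨min t₀ t₁, lt_min ht₀ ht₁, fun t ht => by
      rw [h t (ht.trans_le (min_le_left _ _)), h' t (ht.trans_le (min_le_right _ _))]⟩
  eq_zero := by
    obtain ⟨t₀, ht₀, h⟩ := hb.eq_zero
    obtain ⟨t₁, ht₁, h'⟩ := hb'.eq_zero
    exact ⟨max t₀ t₁, max_lt ht₀ ht₁, fun t ht => by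
      rw [h t ((le_max_left _ _).trans_lt ht), h' t ((le_max_right _ _).trans_lt ht), sub_zero]⟩

end ThomForms

/-! ### Concentrated Thom forms and the limit of their integrals. -/

section Scaling

open scoped InnerProductSpace
open MeasureTheory

section Algebra

variable {V : Type*} [NormedAddCommGroup V] [InnerProductSpace ℂ V] {T : Type*} [AddCommGroup T]
  [Module ℝ T] [TopologicalSpace T]

/-- The pullback of the symplectic form of `ℂ` by the functional `⟨w, L ·⟩`. -/
def lineForm (w : V) (L : T →L[ℝ] V) : T [⋀^Fin 2]→L[ℝ] ℝ :=
  (2 : ℝ) • wedge11 (one ((Complex.reCLM.comp ((innerSL ℂ w).restrictScalars ℝ)).comp L))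
    (one ((Complex.imCLM.comp ((innerSL ℂ w).restrictScalars ℝ)).comp L))

theorem lineForm_apply (w : V) (L : T →L[ℝ] V) (v v' : T) : lineForm w L ![v, v'] =
    2 * ((⟪w, L v⟫_ℂ).re * (⟪w, L v'⟫_ℂ).im - (⟪w, L v'⟫_ℂ).re * (⟪w, L v⟫_ℂ).im) := rfl

theorem lineForm_smul (r : ℝ) (w : V) (L : T →L[ℝ] V) :
    lineForm (r • w) L = r ^ 2 • lineForm w L := by
  refine form2_ext fun v v' => ?_
  rw [ContinuousAlternatingMap.smul_apply, lineForm_apply, lineForm_apply, ← Complex.coe_smul r w]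
  simp only [inner_smul_left, Complex.conj_ofReal, Complex.re_ofReal_mul, Complex.im_ofReal_mul,
    smul_eq_mul]
  ring

/-- A tame form wedge the form of a nonzero complex functional is positive. -/
theorem wedgeAlt_lineForm_pos [FiniteDimensional ℝ T] (hT : Module.finrank ℝ T = 4)
    {τ : T [⋀^Fin 2]→L[ℝ] ℝ} {J : T →L[ℝ] T} (hJ : ∀ v, J (J v) = -v)
    (hτ : ∀ v, v ≠ 0 → 0 < τ ![v, J v]) {L : T →L[ℝ] V} (hL : ∀ v, L (J v) = Complex.I • L v)
    {w : V} {v₀ : T} (hw : L v₀ = w) (hw0 : w ≠ 0) {e : Fin 4 → T} (he : LinearIndependent ℝ e) :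
    0 < wedgeAlt τ τ e * wedgeAlt τ (lineForm w L) e := by
  let a : T →ₗ[ℝ] ℂ := (((innerSL ℂ w).restrictScalars ℝ).comp L : T →L[ℝ] ℂ)
  have ha : ∀ v, a v = ⟪w, L v⟫_ℂ := fun _ => rfl
  refine wedgeAlt_mul_pos hT hJ hτ (a := a) (fun v => ?_) (fun h => ?_) (fun v v' => ?_) he
  · rw [ha, ha, hL, inner_smul_right]
  · have h1 : a v₀ = 0 := by rw [h]; rfl
    rw [ha, hw] at h1
    exact hw0 (inner_self_eq_zero.1 h1)
  · rw [lineForm_apply, ha, ha]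
    simp only [Complex.mul_im, Complex.conj_re, Complex.conj_im]
    ring

end Algebra

/-- The product of the identity and a dilation. -/
def dilation {A B D : Type*} [NormedAddCommGroup A] [NormedSpace ℝ A] [NormedAddCommGroup B]
    [NormedSpace ℝ B] [NormedAddCommGroup D] [NormedSpace ℝ D] (e : (A × B) ≃L[ℝ] D) (δ : ℝ) :
    D →L[ℝ] D :=
  (e : A × B →L[ℝ] D).comp (((ContinuousLinearMap.id ℝ A).prodMap
    (δ • ContinuousLinearMap.id ℝ B)).comp (e.symm : D →L[ℝ] A × B))

theorem dilation_apply {A B D : Type*} [NormedAddCommGroup A] [NormedSpace ℝ A]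
    [NormedAddCommGroup B] [NormedSpace ℝ B] [NormedAddCommGroup D] [NormedSpace ℝ D]
    (e : (A × B) ≃L[ℝ] D) (δ : ℝ) (p : D) :
    dilation e δ p = e ((e.symm p).1, δ • (e.symm p).2) := rfl

theorem det_dilation (e : (E 2 × E 2) ≃L[ℝ] E 4) (δ : ℝ) : (dilation e δ).det = δ ^ 2 := by
  have h1 : (dilation e δ).toLinearMap = e.toLinearEquiv.toLinearMap ∘ₗ
      ((LinearMap.id.prodMap (δ • LinearMap.id)) ∘ₗ e.toLinearEquiv.symm.toLinearMap) := rfl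
  rw [ContinuousLinearMap.det, h1, LinearMap.det_conj, LinearMap.det_prodMap]
  simp

theorem integral_dilation (e : (E 2 × E 2) ≃L[ℝ] E 4) {δ : ℝ} (hδ : 0 < δ) (g : E 4 → ℝ) :
    ∫ p, g p = ∫ p, δ ^ 2 * g (dilation e δ p) := by
  have hinj : Function.Injective (dilation e δ) := by
    intro p q hpq
    rw [dilation_apply, dilation_apply, e.injective.eq_iff, Prod.mk.injEq] at hpq
    apply e.symm.injective
    exact Prod.ext hpq.1 (smul_right_injective _ hδ.ne' hpq.2)
  have hsurj : Set.range (dilation e δ) = Set.univ := by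
    rw [Set.range_eq_univ]
    intro p
    refine ⟨e ((e.symm p).1, δ⁻¹ • (e.symm p).2), ?_⟩
    rw [dilation_apply, e.symm_apply_apply, smul_smul, mul_inv_cancel₀ hδ.ne', one_smul]
    exact e.apply_symm_apply p
  have h := integral_image_eq_integral_abs_det_fderiv_smul volume MeasurableSet.univ
    (fun x _ => (dilation e δ).hasFDerivAt.hasFDerivWithinAt) hinj.injOn g
  rw [Set.image_univ, hsurj, Measure.restrict_univ] at h
  rw [h]
  simp only [det_dilation, smul_eq_mul, abs_of_nonneg (sq_nonneg δ)]

theorem Profile.scale {m : ℝ} {b : ℝ → ℝ} (hb : Profile m b) (hm : 0 < m) {δ : ℝ} (hδ : 0 < δ)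
    (hδ1 : δ ≤ 1) : Profile m fun t => b (t / δ ^ 2) where
  smooth := hb.smooth.comp (by fun_prop)
  eq_const := by
    obtain ⟨t₀, ht₀, h⟩ := hb.eq_const
    refine ⟨t₀ * δ ^ 2, by positivity, fun t ht => ?_⟩
    rw [zero_div, h]
    rwa [div_lt_iff₀ (by positivity)]
  eq_zero := by
    obtain ⟨t₁, ht₁, h⟩ := hb.eq_zero
    -- The maximum with 0 is needed since t₁ may be negative, while t ≤ t/δ² requires t ≥ 0.
    refine ⟨max t₁ 0, max_lt ht₁ hm, fun t ht => h _ ?_⟩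
    have h0 : 0 < t := (le_max_right _ _).trans_lt ht
    refine ((le_max_left _ _).trans_lt ht).trans_le ?_
    rw [le_div_iff₀ (by positivity)]
    have : δ ^ 2 ≤ 1 := pow_le_one₀ hδ.le hδ1
    nlinarith

variable {M : Type*} [TopologicalSpace M] [T2Space M] [SigmaCompactSpace M]
    [ChartedSpace (E 4) M] [IsManifold (𝓡 4) ∞ M]
    {S : Type*} [TopologicalSpace S] [T2Space S] [CompactSpace S] [ConnectedSpace S]
    [ChartedSpace (E 2) S] [IsManifold (𝓡 2) ∞ S]
    {V : Type*} [NormedAddCommGroup V] [InnerProductSpace ℂ V] [FiniteDimensional ℂ V]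
    [CompleteSpace V]
    {J : ∀ x : M, TangentSpace (𝓡 4) x →L[ℝ] TangentSpace (𝓡 4) x} {u : S → M}

namespace NormalData

variable {D : NormalData J u V} {b : ℝ → ℝ}

theorem wedgeOne_dfn_eta {x : M} (hx : D.F x < D.m) :
    wedgeOne (dfn D.F) D.eta x = lineForm (D.W x) (dm 4 D.W x) := by
  refine form2_ext fun v w => ?_
  change wedge11 (dfn D.F x) (D.eta x) ![v, w] = _
  rw [wedge11_apply, dfn_apply, dfn_apply, eta_apply, eta_apply, dm_F hx, dm_F hx, lineForm_apply]
  ring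

/-- In terms of w = W/δ, the factor δ² (the Jacobian of the normal dilation) balances the blow-up of
the dF∧η term and makes the curvature term disappear in the limit. -/
theorem thomForm_scale {x : M} (hx : D.F x < D.m) {δ : ℝ} (hδ : 0 < δ) :
    δ ^ 2 • D.thomForm (fun t => b (t / δ ^ 2)) x =
      (deriv b (‖δ⁻¹ • D.W x‖ ^ 2) / ‖δ⁻¹ • D.W x‖ ^ 2) • lineForm (δ⁻¹ • D.W x) (dm 4 D.W x) +
      (δ ^ 2 * b (‖δ⁻¹ • D.W x‖ ^ 2)) • D.kappa x := by
  have h1 : ‖δ⁻¹ • D.W x‖ ^ 2 = D.F x / δ ^ 2 := by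
    rw [norm_smul, mul_pow, ← D.F_eq x hx]
    simp
    ring
  refine form2_ext fun v w => ?_
  have h2 : deriv (fun t => b (t / δ ^ 2)) (D.F x) = deriv b (D.F x / δ ^ 2) / δ ^ 2 := by
    have h3 := deriv_comp_mul_left (δ ^ 2)⁻¹ b (D.F x)
    simp only [div_eq_mul_inv, mul_comm _ (δ ^ 2)⁻¹]
    exact h3
  rw [h1, lineForm_smul, ContinuousAlternatingMap.smul_apply, thomForm_apply, wedgeOne_dfn_eta hx, h2]
  simp only [ContinuousAlternatingMap.add_apply, ContinuousAlternatingMap.smul_apply, smul_eq_mul]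
  rcases eq_or_ne (D.F x) 0 with h0 | h0
  · simp [h0, mul_assoc]
  · field_simp

/-- The normal coordinates are controlled by the distance function. -/
theorem exists_norm_y_sq_le (hu : Manifold.IsSmoothEmbedding (𝓡 2) (𝓡 4) ∞ u) (C : SliceChart u) {K : Set M}
    (hK : IsCompact K) (hKC : K ⊆ C.chart.source) :
    ∃ c : ℝ, 0 ≤ c ∧ ∀ x ∈ K, ‖C.y x‖ ^ 2 ≤ c * D.F x := by
  refine hK.induction_on (p := fun s => ∃ c : ℝ, 0 ≤ c ∧ ∀ x ∈ s, ‖C.y x‖ ^ 2 ≤ c * D.F x)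
    ⟨0, le_rfl, by simp⟩ (fun s t hst ⟨c, hc, h⟩ => ⟨c, hc, fun x hx => h x (hst hx)⟩)
    (fun s t ⟨c, hc, h⟩ ⟨c', hc', h'⟩ => ⟨max c c', hc.trans (le_max_left _ _), ?_⟩) ?_
  · rintro x (hx | hx)
    · exact (h x hx).trans (mul_le_mul_of_nonneg_right (le_max_left _ _) (D.F_nonneg x))
    · exact (h' x hx).trans (mul_le_mul_of_nonneg_right (le_max_right _ _) (D.F_nonneg x))
  intro x hx
  suffices ∃ c : ℝ, 0 ≤ c ∧ ∀ᶠ z in 𝓝 x, ‖C.y z‖ ^ 2 ≤ c * D.F z by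
    obtain ⟨c, hc, h⟩ := this
    exact ⟨_, mem_nhdsWithin_of_mem_nhds h, c, hc, fun z hz => hz⟩
  by_cases h0 : D.F x = 0
  · have hx2 := h0
    rw [D.F_eq_zero] at hx2
    obtain ⟨s, rfl⟩ := hx2
    obtain ⟨c, hc, h⟩ := D.normalMap.eventually_norm_le hu (C.contMDiffAt_y (hKC hx)) (by
      filter_upwards [C.chart.open_source.mem_nhds (hKC hx)] with x hx hxu
      exact (C.mem_range_iff hx).1 hxu)
    refine ⟨c ^ 2, sq_nonneg c, ?_⟩
    filter_upwards [h, eventually_lt (D := D) (x := u s) (by rw [h0]; exact D.m_pos)] with z hz hz2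
    rw [D.F_eq z hz2, ← mul_pow]
    exact pow_le_pow_left₀ (norm_nonneg _) hz 2
  · have hpos : 0 < D.F x := lt_of_le_of_ne (D.F_nonneg x) (Ne.symm h0)
    have hy : ContinuousAt (fun z => ‖C.y z‖ ^ 2) x := ((C.contMDiffAt_y (hKC hx)).continuousAt.norm).pow 2
    have h1 := hy.eventually_lt (continuousAt_const (y := ‖C.y x‖ ^ 2 + 1)) (lt_add_one _)
    have h2 := ContinuousAt.eventually_lt (continuousAt_const (y := D.F x / 2))
      D.contMDiff_F.continuous.continuousAt (half_lt_self hpos)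
    refine ⟨(‖C.y x‖ ^ 2 + 1) / (D.F x / 2), by positivity, ?_⟩
    filter_upwards [h1, h2] with z h1 h2
    calc ‖C.y z‖ ^ 2 ≤ (‖C.y x‖ ^ 2 + 1) / (D.F x / 2) * (D.F x / 2) := by
          rw [div_mul_cancel₀ _ (by positivity)]
          exact h1.le
      _ ≤ _ := by gcongr

/-- The distance function is small only near the curve. -/
theorem exists_forall_mem_of_lt {U : Set M} (hU : IsOpen U) (hZU : Set.range u ⊆ U) :
    ∃ ε > 0, ∀ x, D.F x < ε → x ∈ U := by
  rcases (D.K \ U).eq_empty_or_nonempty with h0 | h0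
  · exact ⟨D.m, D.m_pos, fun x hx => by
      by_contra h
      have : x ∈ D.K \ U := ⟨D.mem_K x hx, h⟩
      rw [h0] at this
      exact this⟩
  obtain ⟨x₀, hx₀, hmin⟩ := (D.isCompact_K.diff hU).exists_isMinOn h0
    D.contMDiff_F.continuous.continuousOn
  have h1 : 0 < D.F x₀ := lt_of_le_of_ne (D.F_nonneg x₀) fun h =>
    hx₀.2 (hZU ((D.F_eq_zero x₀).1 h.symm))
  refine ⟨min (D.F x₀) D.m, lt_min h1 D.m_pos, fun x hx => ?_⟩
  by_contra h
  exact absurd (hmin ⟨D.mem_K x (hx.trans_le (min_le_right _ _)), h⟩)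
    (not_le.2 (hx.trans_le (min_le_left _ _)))

end NormalData

namespace SliceChart

variable (C : SliceChart u)

/-- The foot of the normal line through a point of the chart. -/
def foot (p : E 4) : E 4 := C.e ((C.e.symm p).1, 0)

theorem foot_eq (p : E 4) : C.foot p = dilation C.e 0 p := by
  rw [dilation_apply, zero_smul]
  rfl

theorem foot_mem_range {p : E 4} (hp : C.foot p ∈ C.chart.target) : C.chart.symm (C.foot p) ∈ Set.range u := by
  refine C.mem_range _ (C.chart.map_target hp) ?_
  rw [C.chart.right_inv hp, foot, C.e.symm_apply_apply]

/-- The normal derivative of the normal map. -/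
def normalVec (W : M → V) (p : E 4) : V :=
  fderiv ℝ (W ∘ C.chart.symm) (C.foot p) (C.e (0, (C.e.symm p).2))

theorem exists_dm_eq_normalVec {W : M → V} (hW : ContMDiff (𝓡 4) 𝓘(ℝ, V) ∞ W) {p : E 4}
    (hp : C.foot p ∈ C.chart.target) :
    ∃ v, dm 4 W (C.chart.symm (C.foot p)) v = C.normalVec W p := by
  refine ⟨frameAt C.chart (C.foot p) (C.e (0, (C.e.symm p).2)), ?_⟩
  exact (fderiv_comp_mfderiv (hW.contMDiffAt.mdifferentiableAt (by simp))
    ((contMDiffAt_symm_of_mem C.mem hp).mdifferentiableAt (by simp)) _).symm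

theorem contDiffAt_comp_symm {W : M → V} (hW : ContMDiff (𝓡 4) 𝓘(ℝ, V) ∞ W) {p : E 4}
    (hp : p ∈ C.chart.target) : ContDiffAt ℝ ∞ (W ∘ C.chart.symm) p := by
  have := Inflation.contDiffAt_comp_symm C.mem (C.chart.map_target hp) (f := W) hW.contMDiffAt
  rwa [C.chart.right_inv hp] at this

theorem tendsto_normalVec {W : M → V} (hW : ContMDiff (𝓡 4) 𝓘(ℝ, V) ∞ W) (hW0 : ∀ s, W (u s) = 0)
    {p : E 4} (hp : C.foot p ∈ C.chart.target) :
    Filter.Tendsto (fun δ : ℝ => δ⁻¹ • W (C.chart.symm (dilation C.e δ p))) (𝓝[>] 0)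
      (𝓝 (C.normalVec W p)) := by
  have h1 : HasDerivAt (fun δ : ℝ => dilation C.e δ p) (C.e (0, (C.e.symm p).2)) 0 := by
    have h2 : ∀ δ : ℝ, dilation C.e δ p = C.foot p + δ • C.e (0, (C.e.symm p).2) := by
      intro δ
      rw [dilation_apply, foot, ← map_smul, ← map_add]
      simp
    rw [funext h2]
    have h3 := ((hasDerivAt_id (0 : ℝ)).smul_const (C.e (0, (C.e.symm p).2))).const_add (C.foot p)
    simpa using h3
  have h0 : dilation C.e 0 p = C.foot p := (C.foot_eq p).symm
  have h2 : HasFDerivAt (W ∘ C.chart.symm) (fderiv ℝ (W ∘ C.chart.symm) (C.foot p))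
      (dilation C.e 0 p) := by
    rw [h0]
    exact ((C.contDiffAt_comp_symm hW hp).differentiableAt (by simp)).hasFDerivAt
  have h3 := (h2.comp_hasDerivAt (0 : ℝ) h1).tendsto_slope_zero_right
  refine h3.congr fun δ => ?_
  obtain ⟨s, hs⟩ := C.foot_mem_range hp
  simp only [Function.comp_apply, zero_add]
  rw [h0, ← hs, hW0, sub_zero]

end SliceChart

namespace NormalData

variable {τ₀ : Form 4 M 2} {j : ∀ s : S, TangentSpace (𝓡 2) s →L[ℝ] TangentSpace (𝓡 2) s}
  (D : NormalData J u V) (C : SliceChart u)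

/-- The coefficient of the product of a form and a rescaled Thom form in a slice chart. -/
def scaledCoef (ζ : Form 4 M 2) (b : ℝ → ℝ) (w : V) (p : E 4) (δ : ℝ) : ℝ :=
  deriv b (‖w‖ ^ 2) / ‖w‖ ^ 2 * wedgeAlt (ζ (C.chart.symm p))
      (lineForm w (dm 4 D.W (C.chart.symm p))) (fun i => frameAt C.chart p (EuclideanSpace.single i 1)) +
    δ ^ 2 * b (‖w‖ ^ 2) * coef C.chart.symm (wedgeForm ζ D.kappa) p

variable {D C} {ζ : Form 4 M 2} (hζ : IsSmoothForm ζ) {b : ℝ → ℝ} (hb : Profile D.m b)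
include hζ

/-- Joint continuity in (w, p, δ), up to δ = 0, supplies both the pointwise limit and the uniform
bound in the dominated convergence below. The factor b'(t)/t is harmless because b' vanishes near 0.
-/
theorem continuousAt_scaledCoef (hb : Profile D.m b) {w : V} {p : E 4} (hp : p ∈ C.chart.target) (δ : ℝ) :
    ContinuousAt (fun q : V × E 4 × ℝ => D.scaledCoef C ζ b q.1 q.2.1 q.2.2) (w, p, δ) := by
  have h1 : Continuous fun t : ℝ => deriv b t / t :=
    (hb.deriv.contDiff_div hb.deriv_zero).continuous
  have h2 : ContinuousAt (fun q : V × E 4 × ℝ => deriv b (‖q.1‖ ^ 2) / ‖q.1‖ ^ 2) (w, p, δ) :=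
    (h1.comp (by fun_prop : Continuous fun q : V × E 4 × ℝ => ‖q.1‖ ^ 2)).continuousAt
  have h3 : ContinuousAt (fun q : V × E 4 × ℝ => q.2.2 ^ 2 * b (‖q.1‖ ^ 2)) (w, p, δ) := by
    have := hb.smooth.continuous
    fun_prop
  have hp1 : ContinuousAt (fun q : V × E 4 × ℝ => q.2.1) (w, p, δ) := by fun_prop
  have h4 : ContinuousAt (fun q : V × E 4 × ℝ => coef C.chart.symm (wedgeForm ζ D.kappa) q.2.1)
      (w, p, δ) := by
    have h5 : ContinuousAt (coef C.chart.symm (wedgeForm ζ D.kappa)) p :=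
      ((hζ.wedge D.isSmoothForm_kappa).isContTop _ C.mem).continuousAt
        (C.chart.open_target.mem_nhds hp)
    exact ContinuousAt.comp (f := fun q : V × E 4 × ℝ => q.2.1) (x := (w, p, δ)) h5 hp1
  have hL : ∀ i : Fin 4, ContinuousAt (fun q : V × E 4 × ℝ => ⟪q.1, dm 4 D.W (C.chart.symm q.2.1)
      (frameAt C.chart q.2.1 (EuclideanSpace.single i 1))⟫_ℂ) (w, p, δ) := by
    intro i
    have h5 : ContinuousAt (fun p => dm 4 D.W (C.chart.symm p)
        (frameAt C.chart p (EuclideanSpace.single i 1))) p := by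
      have h6 : ContinuousAt (fun p => fderiv ℝ (D.W ∘ C.chart.symm) p (EuclideanSpace.single i 1)) p :=
        (((C.contDiffAt_comp_symm D.normalMap.smooth hp).fderiv_right (m := 0) (by simp)).clm_apply
          contDiffAt_const).continuousAt
      refine h6.congr ?_
      filter_upwards [C.chart.open_target.mem_nhds hp] with z hz
      exact fderiv_comp_mfderiv (D.normalMap.mdifferentiableAt _)
        ((contMDiffAt_symm_of_mem C.mem hz).mdifferentiableAt (by simp)) _
    have h7 := ContinuousAt.comp (f := fun q : V × E 4 × ℝ => q.2.1) (x := (w, p, δ)) h5 hp1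
    exact ContinuousAt.inner (𝕜 := ℂ) continuousAt_fst h7
  have hz : ∀ i k : Fin 4, ContinuousAt (fun q : V × E 4 × ℝ => ζ (C.chart.symm q.2.1)
      ![frameAt C.chart q.2.1 (EuclideanSpace.single i 1),
        frameAt C.chart q.2.1 (EuclideanSpace.single k 1)]) (w, p, δ) := by
    intro i k
    have h5 := continuousAt_alternating_apply (hζ.contDiffAt_pbE_symm C.mem hp).continuousAt
      ![EuclideanSpace.single i 1, EuclideanSpace.single k 1]
    have h6 : ContinuousAt (fun p => ζ (C.chart.symm p) ![frameAt C.chart p (EuclideanSpace.single i 1),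
        frameAt C.chart p (EuclideanSpace.single k 1)]) p := by
      refine h5.congr (Filter.Eventually.of_forall fun z => ?_)
      change ζ (C.chart.symm z) _ = _
      congr 1
      funext l
      fin_cases l <;> rfl
    exact ContinuousAt.comp (f := fun q : V × E 4 × ℝ => q.2.1) (x := (w, p, δ)) h6 hp1
  have hl : ∀ i k : Fin 4, ContinuousAt (fun q : V × E 4 × ℝ =>
      lineForm q.1 (dm 4 D.W (C.chart.symm q.2.1)) ![frameAt C.chart q.2.1 (EuclideanSpace.single i 1),
        frameAt C.chart q.2.1 (EuclideanSpace.single k 1)]) (w, p, δ) := by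
    intro i k
    simp only [lineForm_apply]
    have hre : ∀ i, _ := fun i => Complex.continuous_re.continuousAt.comp (hL i)
    have him : ∀ i, _ := fun i => Complex.continuous_im.continuousAt.comp (hL i)
    exact continuousAt_const.mul (((hre i).mul (him k)).sub ((hre k).mul (him i)))
  refine (h2.mul ?_).add (h3.mul h4)
  simp only [wedgeAlt_apply]
  exact (((((((hz _ _).mul (hl _ _)).sub ((hz _ _).mul (hl _ _))).add
    ((hz _ _).mul (hl _ _))).add ((hz _ _).mul (hl _ _))).sub
    ((hz _ _).mul (hl _ _))).add ((hz _ _).mul (hl _ _)))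

omit hζ in
theorem coef_thomForm_scale {δ : ℝ} (hδ : 0 < δ) {p : E 4} (hp : D.F (C.chart.symm p) < D.m) :
    δ ^ 2 * coef C.chart.symm (wedgeForm ζ (D.thomForm fun t => b (t / δ ^ 2))) p =
      D.scaledCoef C ζ b (δ⁻¹ • D.W (C.chart.symm p)) p δ := by
  have h := thomForm_scale (b := b) hp hδ
  have h2 := congrArg (fun R => wedgeAlt (ζ (C.chart.symm p)) R
    (fun i => frameAt C.chart p (EuclideanSpace.single i 1))) h
  simp only [wedgeAlt_add_right, wedgeAlt_smul_right, ContinuousAlternatingMap.add_apply,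
    ContinuousAlternatingMap.smul_apply, smul_eq_mul] at h2
  exact h2

variable (D C) (τ₀) (ζ) (b) in
/-- The limit density. -/
def limitDensity (p : E 4) : ℝ := C.chart.target.indicator (fun q =>
    SignType.sign (coef C.chart.symm (wedgeForm τ₀ τ₀) q) *
      D.scaledCoef C ζ b (C.normalVec D.W p) q 0) (C.foot p)

/-- After dilating the normal coordinates by δ, the integrand is the scaled coefficient at w = W/δ,
and W/δ converges to the normal derivative of W. Dominated convergence gives the limit, and the same
bound makes the limit integrable. -/
theorem tendsto_integral_thomForm (h : HolCurve τ₀ J j u) (hb : Profile D.m b) {K : Set M}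
    (hK : IsCompact K) (hKC : K ⊆ C.chart.source) (hζK : ∀ x ∉ K, ζ x = 0) :
    Filter.Tendsto (fun δ : ℝ => integral (symplecticPos τ₀)
      (fun x v => wedgeForm ζ (D.thomForm fun t => b (t / δ ^ 2)) x v)) (𝓝[>] 0)
      (𝓝 (∫ p, D.limitDensity τ₀ C ζ b p)) ∧ Integrable (D.limitDensity τ₀ C ζ b) := by
  classical
  set ν := wedgeForm τ₀ τ₀ with hν
  have hνv := h.isVolume
  obtain ⟨t₁', ht₁', hb1'⟩ := hb.eq_zero
  set t₁ := max t₁' 0 with ht₁d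
  have ht₁ : t₁ < D.m := max_lt ht₁' D.m_pos
  have ht₁0 : 0 ≤ t₁ := le_max_right _ _
  have hb1 : ∀ t > t₁, b t = 0 := fun t ht => hb1' t ((le_max_left _ _).trans_lt ht)
  have hsmall : ∀ᶠ δ : ℝ in 𝓝[>] 0, 0 < δ ∧ δ ≤ 1 := by
    filter_upwards [self_mem_nhdsWithin, nhdsWithin_le_nhds (Iic_mem_nhds (zero_lt_one (α := ℝ)))]
      with δ h1 h2 using ⟨h1, h2⟩
  let R : ℝ → Form 4 M 2 := fun δ => D.thomForm fun t => b (t / δ ^ 2)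
  have hwz : ∀ δ, ∀ x ∉ K, wedgeForm ζ (R δ) x = 0 := fun δ x hx => by
    change wedgeAlt (ζ x) _ = 0
    rw [hζK x hx, wedgeAlt_zero_left]
  let g : ℝ → E 4 → ℝ := fun δ => C.chart.target.indicator (sden ν (wedgeForm ζ (R δ)) C.chart.symm)
  -- The integrand after substituting the dilation, with its Jacobian δ².
  let G : ℝ → E 4 → ℝ := fun δ p => δ ^ 2 * g δ (dilation C.e δ p)
  have hR : ∀ δ, 0 < δ ∧ δ ≤ 1 → IsContTop (wedgeForm ζ (R δ)) := fun δ hδ =>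
    (hζ.wedge (isSmoothForm_thomForm (hb.scale D.m_pos hδ.1 hδ.2))).isContTop
  have hint : ∀ᶠ δ : ℝ in 𝓝[>] 0, ∫ p, G δ p = integral (symplecticPos τ₀)
      (fun x v => wedgeForm ζ (D.thomForm fun t => b (t / δ ^ 2)) x v) := by
    filter_upwards [hsmall] with δ hδ
    rw [← integral_dilation C.e hδ.1]
    rw [integral_indicator C.chart.open_target.measurableSet]
    exact (integral_eq_setIntegral hνv (HolCurve.orientedBy τ₀) (hR δ hδ) C.mem hK hKC
      (hwz δ)).symm
  set K' := C.chart '' K with hK'd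
  have hK' : IsCompact K' := hK.image_of_continuousOn (C.chart.continuousOn.mono hKC)
  have hK't : K' ⊆ C.chart.target := by
    rintro _ ⟨x, hx, rfl⟩
    exact C.chart.map_source (hKC hx)
  have hgK : ∀ δ, ∀ q ∉ K', g δ q = 0 := by
    intro δ q hq
    by_cases hqt : q ∈ C.chart.target
    · simp only [g]
      rw [Set.indicator_of_mem hqt, sden_eq_zero (hwz δ _ fun hx => hq ?_)]
      exact ⟨_, hx, C.chart.right_inv hqt⟩
    · exact Set.indicator_of_notMem hqt _
  have hgF : ∀ δ, 0 < δ ∧ δ ≤ 1 → ∀ q ∈ C.chart.target, δ ^ 2 * t₁ < D.F (C.chart.symm q) → g δ q = 0 := by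
    intro δ hδ q hq hF
    simp only [g]
    rw [Set.indicator_of_mem hq, sden_eq_zero]
    change wedgeAlt _ (R δ _) = 0
    have : R δ (C.chart.symm q) = 0 := by
      refine thomForm_eq_zero ?_
      filter_upwards [lt_mem_nhds hF] with s hs
      refine hb1 _ ?_
      have hδ2 : 0 < δ ^ 2 := pow_pos hδ.1 2
      rwa [gt_iff_lt, lt_div_iff₀ hδ2, mul_comm]
    rw [this, wedgeAlt_zero_right]
  have hval : ∀ δ, 0 < δ ∧ δ ≤ 1 → ∀ q ∈ C.chart.target, D.F (C.chart.symm q) < D.m →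
      δ ^ 2 * g δ q = SignType.sign (coef C.chart.symm ν q) *
        D.scaledCoef C ζ b (δ⁻¹ • D.W (C.chart.symm q)) q δ := by
    intro δ hδ q hq hF
    simp only [g]
    rw [Set.indicator_of_mem hq, sden, ← coef_thomForm_scale hδ.1 hF]
    ring
  -- domination
  have hprop : ProperSpace V := FiniteDimensional.proper ℂ V
  -- On the support of the rescaled Thom form F ≤ δ²t₁, so |W/δ| ≤ √t₁: all arguments of the scaled
  -- coefficient stay in one compact set.
  obtain ⟨cst, hcst⟩ := ((isCompact_closedBall (0 : V) (Real.sqrt t₁)).prod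
    (hK'.prod (isCompact_Icc (a := (0 : ℝ)) (b := 1)))).exists_bound_of_continuousOn
    (f := fun q : V × E 4 × ℝ => D.scaledCoef C ζ b q.1 q.2.1 q.2.2)
    (fun q hq => (continuousAt_scaledCoef hζ hb (hK't hq.2.1) q.2.2).continuousWithinAt)
  obtain ⟨cy, hcy0, hcy⟩ := exists_norm_y_sq_le (D := D) h.emb C hK hKC
  obtain ⟨r, hr⟩ := (hK'.image C.e.symm.continuous).isBounded.exists_norm_le
  -- A compact set containing the support of every G δ. In the normal direction, |y|² ≤ cy F ≤ cy
  -- δ²t₁ becomes cy t₁ once the dilation is undone.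
  set B : Set (E 4) := C.e '' (Metric.closedBall 0 r ×ˢ Metric.closedBall 0 (Real.sqrt (cy * t₁))) with hB
  have hBc : IsCompact B := ((isCompact_closedBall _ _).prod (isCompact_closedBall _ _)).image
    C.e.continuous
  have hsgn : ∀ s : SignType, |(s : ℝ)| ≤ 1 := by
    intro s
    cases s <;> simp
  have hbound : ∀ δ, 0 < δ ∧ δ ≤ 1 → ∀ p, ‖G δ p‖ ≤ B.indicator (fun _ => max cst 0) p := by
    intro δ hδ p
    have hδ2 : 0 < δ ^ 2 := pow_pos hδ.1 2
    by_cases hG : g δ (dilation C.e δ p) = 0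
    · simp only [G]
      rw [hG, mul_zero, norm_zero]
      exact Set.indicator_nonneg (fun _ _ => le_max_right _ _) _
    set q := dilation C.e δ p with hq
    have hqK : q ∈ K' := by
      by_contra hcon
      exact hG (hgK δ q hcon)
    have hqt := hK't hqK
    have hFq : D.F (C.chart.symm q) ≤ δ ^ 2 * t₁ := by
      by_contra! hcon
      exact hG (hgF δ hδ q hqt hcon)
    have hFm : D.F (C.chart.symm q) < D.m := by
      refine hFq.trans_lt (lt_of_le_of_lt ?_ ht₁)
      have : δ ^ 2 ≤ 1 := pow_le_one₀ hδ.1.le hδ.2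
      nlinarith
    have hw : δ⁻¹ • D.W (C.chart.symm q) ∈ Metric.closedBall (0 : V) (Real.sqrt t₁) := by
      rw [mem_closedBall_zero_iff]
      apply Real.le_sqrt_of_sq_le
      rw [norm_smul, mul_pow, ← D.F_eq _ hFm, norm_inv, inv_pow, Real.norm_eq_abs, sq_abs,
        inv_mul_le_iff₀ hδ2]
      exact hFq
    have hpB : p ∈ B := by
      refine ⟨C.e.symm p, ⟨?_, ?_⟩, C.e.apply_symm_apply p⟩
      · rw [mem_closedBall_zero_iff]
        have h1 := hr _ ⟨q, hqK, rfl⟩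
        have h2 : (C.e.symm q).1 = (C.e.symm p).1 := by
          rw [hq, dilation_apply, C.e.symm_apply_apply]
        rw [← h2]
        exact (norm_fst_le _).trans h1
      · rw [mem_closedBall_zero_iff]
        apply Real.le_sqrt_of_sq_le
        obtain ⟨x, hx, hxq⟩ := hqK
        have hx2 : C.chart.symm q = x := by rw [← hxq, C.chart.left_inv (hKC hx)]
        have h1 := hcy x hx
        have h2 : C.y x = δ • (C.e.symm p).2 := by
          rw [SliceChart.y, hxq, hq, dilation_apply, C.e.symm_apply_apply]
        rw [h2, norm_smul, mul_pow, Real.norm_eq_abs, sq_abs] at h1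
        rw [hx2] at hFq
        have h3 : δ ^ 2 * ‖(C.e.symm p).2‖ ^ 2 ≤ δ ^ 2 * (cy * t₁) := by
          refine h1.trans ?_
          calc cy * D.F x ≤ cy * (δ ^ 2 * t₁) := by gcongr
            _ = _ := by ring
        exact le_of_mul_le_mul_left h3 hδ2
    rw [Set.indicator_of_mem hpB]
    simp only [G]
    rw [hval δ hδ q hqt hFm, norm_mul]
    have h1 := hcst (δ⁻¹ • D.W (C.chart.symm q), q, δ) ⟨hw, hqK, hδ.1.le, hδ.2⟩
    calc _ ≤ 1 * cst := by
          gcongr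
          · exact hsgn _
      _ ≤ _ := by
          rw [one_mul]
          exact le_max_left _ _
  have hmeas : ∀ δ, 0 < δ ∧ δ ≤ 1 → AEStronglyMeasurable (G δ) volume := by
    intro δ hδ
    have h1 : Measurable (g δ) := by
      have h2 := ContinuousOn.measurable_piecewise
        (continuousOn_sden (Ψ := C.chart) hνv (hR δ hδ) C.mem)
        (continuousOn_const (c := (0 : ℝ)) (s := C.chart.targetᶜ))
        C.chart.open_target.measurableSet
      simp only [g]
      rwa [← Set.piecewise_eq_indicator]
    exact (measurable_const.mul (h1.comp (dilation C.e δ).continuous.measurable)).aestronglyMeasurable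
  have hlim : ∀ p, Filter.Tendsto (fun δ => G δ p) (𝓝[>] 0) (𝓝 (D.limitDensity τ₀ C ζ b p)) := by
    intro p
    have hcont : Filter.Tendsto (fun δ : ℝ => dilation C.e δ p) (𝓝[>] 0) (𝓝 (C.foot p)) := by
      have h1 : Continuous fun δ : ℝ => dilation C.e δ p := by
        simp only [dilation_apply]
        fun_prop
      rw [C.foot_eq]
      exact (h1.tendsto 0).mono_left nhdsWithin_le_nhds
    by_cases hp : C.foot p ∈ C.chart.target
    · have hF0 : D.F (C.chart.symm (C.foot p)) = 0 := (D.F_eq_zero _).2 (C.foot_mem_range hp)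
      have hev1 : ∀ᶠ δ : ℝ in 𝓝[>] 0, dilation C.e δ p ∈ C.chart.target :=
        hcont.eventually (C.chart.open_target.mem_nhds hp)
      have hev2 : ∀ᶠ δ : ℝ in 𝓝[>] 0, D.F (C.chart.symm (dilation C.e δ p)) < D.m := by
        have h1 := (C.chart.continuousAt_symm hp).tendsto.comp hcont
        have h2 : ∀ᶠ x in 𝓝 (C.chart.symm (C.foot p)), D.F x < D.m :=
          eventually_lt (by rw [hF0]; exact D.m_pos)
        exact h1.eventually h2
      have hev3 := hcont.eventually (eventually_sign_eq hνv C.mem hp)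
      have h1 := C.tendsto_normalVec D.normalMap.smooth D.normalMap.zero hp
      have h2 := (continuousAt_scaledCoef hζ hb (w := C.normalVec D.W p) hp 0).tendsto.comp
        (h1.prodMk_nhds (hcont.prodMk_nhds (Filter.Tendsto.mono_left (Filter.tendsto_id (x := 𝓝 (0 : ℝ)))
          nhdsWithin_le_nhds)))
      have h3 := h2.const_mul (SignType.sign (coef C.chart.symm ν (C.foot p)) : ℝ)
      rw [limitDensity, Set.indicator_of_mem hp]
      refine h3.congr' ?_
      filter_upwards [hev1, hev2, hev3, hsmall] with δ e1 e2 e3 e4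
      simp only [G]
      rw [hval δ e4 _ e1 e2, e3]
      rfl
    · rw [limitDensity, Set.indicator_of_notMem hp]
      -- If the foot lies outside the chart, nearby dilated points miss the compact K', and G is
      -- zero for small δ.
      have hnK : C.foot p ∉ K' := fun hcon => hp (hK't hcon)
      refine tendsto_const_nhds.congr' ?_
      filter_upwards [hcont.eventually (hK'.isClosed.isOpen_compl.mem_nhds hnK)] with δ hδ
      simp only [G]
      rw [hgK δ _ hδ, mul_zero]
  have hBint : Integrable (B.indicator fun _ => max cst 0) (volume : Measure (E 4)) :=
    (integrable_indicator_iff hBc.measurableSet).2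
      (integrableOn_const hBc.measure_lt_top.ne)
  have hfin := tendsto_integral_filter_of_dominated_convergence
    (B.indicator fun _ => max cst 0)
    (hsmall.mono fun δ hδ => hmeas δ hδ)
    (hsmall.mono fun δ hδ => Filter.Eventually.of_forall fun p => hbound δ hδ p) hBint
    (Filter.Eventually.of_forall hlim)
  refine ⟨hfin.congr' hint, ?_⟩
  -- Measurability of the limit is obtained along a sequence tending to 0 from the right.
  have hseq : Filter.Tendsto (fun k : ℕ => ((k : ℝ) + 1)⁻¹) Filter.atTop (𝓝[>] 0) := by
    refine tendsto_nhdsWithin_iff.2 ⟨?_, Filter.Eventually.of_forall fun k => by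
      simp only [Set.mem_Ioi]
      positivity⟩
    simpa using tendsto_one_div_add_atTop_nhds_zero_nat (𝕜 := ℝ)
  have hk : ∀ k : ℕ, 0 < ((k : ℝ) + 1)⁻¹ ∧ ((k : ℝ) + 1)⁻¹ ≤ 1 := fun k =>
    ⟨by positivity, inv_le_one_of_one_le₀ (by linarith [Nat.cast_nonneg (α := ℝ) k])⟩
  have hmeasL : AEStronglyMeasurable (D.limitDensity τ₀ C ζ b) volume :=
    aestronglyMeasurable_of_tendsto_ae Filter.atTop (fun k : ℕ => hmeas _ (hk k))
      (Filter.Eventually.of_forall fun p => (hlim p).comp hseq)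
  refine hBint.mono' hmeasL (Filter.Eventually.of_forall fun p => ?_)
  exact le_of_tendsto (hlim p).norm (hsmall.mono fun δ hδ => hbound δ hδ p)

end NormalData

end Scaling

/-! ### Sign and locality of the limit integrals. -/

section ThomIntegral

open scoped InnerProductSpace
open MeasureTheory

variable {M : Type*} [TopologicalSpace M] [T2Space M] [SigmaCompactSpace M]
    [ChartedSpace (E 4) M] [IsManifold (𝓡 4) ∞ M]
    {S : Type*} [TopologicalSpace S] [T2Space S] [CompactSpace S] [ConnectedSpace S]
    [ChartedSpace (E 2) S] [IsManifold (𝓡 2) ∞ S]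
    {V : Type*} [NormedAddCommGroup V] [InnerProductSpace ℂ V] [FiniteDimensional ℂ V]
    [CompleteSpace V]
    {J : ∀ x : M, TangentSpace (𝓡 4) x →L[ℝ] TangentSpace (𝓡 4) x} {u : S → M}

/-- Compactly supported functions in slice charts whose sum is one near the curve. -/
theorem exists_slice_partition (hu : Manifold.IsSmoothEmbedding (𝓡 2) (𝓡 4) ∞ u) :
    ∃ (t : Finset S) (C : S → SliceChart u) (φ : S → M → ℝ) (K : S → Set M) (U : Set M),
      IsOpen U ∧ Set.range u ⊆ U ∧ (∀ x ∈ U, ∑ i ∈ t, φ i x = 1) ∧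
      ∀ i ∈ t, ContMDiff (𝓡 4) 𝓘(ℝ, ℝ) ∞ (φ i) ∧ (∀ x, 0 ≤ φ i x) ∧ IsCompact (K i) ∧
        K i ⊆ (C i).chart.source ∧ ∀ x ∉ K i, φ i x = 0 := by
  classical
  have : LocallyCompactSpace M := ChartedSpace.locallyCompactSpace (E 4) M
  have hZ : IsCompact (Set.range u) := by
    rw [← Set.image_univ]
    exact isCompact_univ.image hu.isEmbedding.continuous
  choose C hC using exists_sliceChart (S := S) hu
  obtain ⟨t, ht⟩ := hZ.elim_finite_subcover (fun s => (C s).chart.source)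
    (fun s => (C s).chart.open_source) (by
      rintro _ ⟨s, rfl⟩
      exact Set.mem_iUnion.2 ⟨s, hC s⟩)
  have ht2 : Set.range u ⊆ ⋃ i : t, (C i).chart.source := by
    refine ht.trans ?_
    simp only [Set.iUnion_subset_iff]
    intro i hi
    exact Set.subset_iUnion (fun i : t => (C i).chart.source) ⟨i, hi⟩
  obtain ⟨K₀, hK₀, hZK₀, hK₀s⟩ := exists_compact_between hZ
    (isOpen_iUnion fun i : t => (C i).chart.open_source) ht2
  obtain ⟨K₁, hK₁, hK₀₁, -⟩ := exists_compact_between hK₀ isOpen_univ (Set.subset_univ _)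
  obtain ⟨χ, hχ⟩ := SmoothPartitionOfUnity.exists_isSubordinate (𝓡 4) hK₀.isClosed
    (fun i : t => (C i).chart.source) (fun i => (C i).chart.open_source) hK₀s
  obtain ⟨ρ, hρ1, hρ0, hρI⟩ := exists_contMDiffMap_one_nhds_of_subset_interior
    (n := (⊤ : ℕ∞)) (𝓡 4) hK₀.isClosed hK₀₁
  let φ : S → M → ℝ := fun s x => if hs : s ∈ t then χ ⟨s, hs⟩ x * ρ x else 0
  let K : S → Set M := fun s => if hs : s ∈ t then K₁ ∩ tsupport (χ ⟨s, hs⟩) else ∅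
  refine ⟨t, C, φ, K, interior K₀, isOpen_interior, hZK₀, fun x hx => ?_, fun i hi => ?_⟩
  · have hx0 := interior_subset hx
    rw [← Finset.sum_coe_sort]
    have h1 := χ.sum_eq_one hx0
    rw [finsum_eq_sum_of_fintype] at h1
    rw [← h1]
    refine Finset.sum_congr rfl fun i _ => ?_
    simp only [φ, Subtype.coe_eta, i.2, dite_true]
    rw [hρ1.self_of_nhdsSet _ hx0, mul_one]
  · simp only [φ, K, hi, dite_true]
    refine ⟨(χ _).contMDiff.mul ρ.contMDiff, fun x => mul_nonneg (χ.nonneg _ x) (hρI x).1,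
      hK₁.inter_right (isClosed_tsupport _), fun x hx => hχ ⟨i, hi⟩ hx.2, fun x hx => ?_⟩
    by_contra hne
    refine hx ⟨?_, subset_tsupport _ (left_ne_zero_of_mul hne)⟩
    by_contra hxK
    exact hne (by rw [hρ0 x hxK, mul_zero])

namespace NormalData

variable {τ₀ : Form 4 M 2} {j : ∀ s : S, TangentSpace (𝓡 2) s →L[ℝ] TangentSpace (𝓡 2) s}
  {D : NormalData J u V} {C : SliceChart u} {ζ : Form 4 M 2} {b : ℝ → ℝ}

/-- The limit evaluates ζ only at feet of normal lines, which are points of the curve; the curvature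
term carries the factor 0². -/
theorem limitDensity_eq_zero (hζ0 : ∀ s, ζ (u s) = 0) (p : E 4) : D.limitDensity τ₀ C ζ b p = 0 := by
  by_cases hp : C.foot p ∈ C.chart.target
  · rw [limitDensity, Set.indicator_of_mem hp]
    have h1 : ζ (C.chart.symm (C.foot p)) = 0 := by
      obtain ⟨s, hs⟩ := C.foot_mem_range hp
      rw [← hs, hζ0]
    rw [scaledCoef, h1, wedgeAlt_zero_left]
    simp
  · rw [limitDensity, Set.indicator_of_notMem hp]

/-- Along the curve dW is complex linear, so τ₀ ∧ `lineForm` is positive for the orientation of τ₀ ∧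
τ₀ whenever the normal vector is nonzero. The sign of the density is therefore that of b'. -/
theorem limitDensity_nonpos (h : HolCurve τ₀ J j u) {φ : M → ℝ} (hb' : ∀ t, deriv b t ≤ 0)
    (hφ : ∀ x, 0 ≤ φ x) (p : E 4) : D.limitDensity τ₀ C (fsmul φ τ₀) b p ≤ 0 ∧
      (C.foot p ∈ C.chart.target → 0 < φ (C.chart.symm (C.foot p)) → C.normalVec D.W p ≠ 0 →
        deriv b (‖C.normalVec D.W p‖ ^ 2) < 0 → D.limitDensity τ₀ C (fsmul φ τ₀) b p < 0) := by
  by_cases hp : C.foot p ∈ C.chart.target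
  swap
  · rw [limitDensity, Set.indicator_of_notMem hp]
    exact ⟨le_rfl, fun hcon => absurd hcon hp⟩
  rw [limitDensity, Set.indicator_of_mem hp, scaledCoef]
  set w := C.normalVec D.W p with hw
  set q := C.foot p with hq
  set e := fun i : Fin 4 => frameAt C.chart q (EuclideanSpace.single i 1) with he
  have h0 : wedgeAlt (fsmul φ τ₀ (C.chart.symm q)) (lineForm w (dm 4 D.W (C.chart.symm q))) e =
      φ (C.chart.symm q) * wedgeAlt (τ₀ (C.chart.symm q)) (lineForm w (dm 4 D.W (C.chart.symm q))) e := by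
    change wedgeAlt (φ (C.chart.symm q) • τ₀ (C.chart.symm q)) _ e = _
    rw [wedgeAlt_smul_left]
    rfl
  rw [h0]
  rcases eq_or_ne w 0 with hw0 | hw0
  · refine ⟨?_, fun _ _ hcon => absurd hw0 hcon⟩
    rw [hw0]
    simp
  have hL : ∀ x ∈ Set.range u, ∀ v, dm 4 D.W x (J x v) = Complex.I • dm 4 D.W x v := by
    rintro _ ⟨s, rfl⟩ v
    exact D.normalMap.apply_J s v
  obtain ⟨v₀, hv₀⟩ := C.exists_dm_eq_normalVec D.normalMap.smooth hp
  have hpos := wedgeAlt_lineForm_pos (finrank_tangent (C.chart.symm q)) (h.acs.sq_eq_neg _)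
    (h.tame (C.chart.symm q)) (hL _ (C.foot_mem_range hp)) hv₀ hw0
    (linearIndependent_frameAt C.mem hp)
  have hcoef : coef C.chart.symm (wedgeForm τ₀ τ₀) q = wedgeAlt (τ₀ (C.chart.symm q))
    (τ₀ (C.chart.symm q)) e := rfl
  have hsg : 0 < (SignType.sign (coef C.chart.symm (wedgeForm τ₀ τ₀) q) : ℝ) *
      wedgeAlt (τ₀ (C.chart.symm q)) (lineForm w (dm 4 D.W (C.chart.symm q))) e := by
    rw [hcoef]
    rcases pos_and_pos_or_neg_and_neg_of_mul_pos hpos with ⟨h1, h2⟩ | ⟨h1, h2⟩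
    · rw [sign_pos h1]
      simpa using h2
    · rw [sign_neg h1]
      simpa using h2
  have hn : 0 < ‖w‖ ^ 2 := pow_pos (norm_pos_iff.2 hw0) 2
  have heq : ∀ A B s c k d : ℝ, s * (A / B * (c * k) + 0 ^ 2 * d) = A / B * (c * (s * k)) := by
    intros
    ring
  simp only [mul_assoc]
  rw [heq]
  refine ⟨mul_nonpos_of_nonpos_of_nonneg (div_nonpos_of_nonpos_of_nonneg (hb' _) hn.le)
    (mul_nonneg (hφ _) hsg.le), fun _ h1 _ h2 =>
    mul_neg_of_neg_of_pos (div_neg_of_neg_of_pos h2 hn) (mul_pos h1 hsg)⟩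

theorem integral_limitDensity_neg (h : HolCurve τ₀ J j u) {φ : M → ℝ} (hb : Profile D.m b)
    (hb' : ∀ t, deriv b t ≤ 0) {t₀ : ℝ} (ht₀ : 0 < t₀) (hbt : deriv b t₀ < 0)
    (hφc : Continuous φ) (hφ : ∀ x, 0 ≤ φ x) {s : S} (hs : u s ∈ C.chart.source) (hφs : 0 < φ (u s))
    (hint : Integrable (D.limitDensity τ₀ C (fsmul φ τ₀) b)) :
    ∫ p, D.limitDensity τ₀ C (fsmul φ τ₀) b p < 0 := by
  have hct := C.chart.map_source hs
  let y₀ : E 2 := EuclideanSpace.single 0 1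
  have hy₀ : y₀ ≠ 0 := by simp [y₀]
  let p : ℝ → E 4 := fun r => C.e (C.dom s, r • y₀)
  have hfoot : ∀ r, C.foot (p r) = C.chart (u s) := by
    intro r
    rw [C.chart_apply s hs, SliceChart.foot, C.e.symm_apply_apply]
  set a : V := fderiv ℝ (D.W ∘ C.chart.symm) (C.chart (u s)) (C.e (0, y₀)) with ha
  have hnv : ∀ r, C.normalVec D.W (p r) = r • a := by
    intro r
    rw [SliceChart.normalVec, hfoot, ha, ← map_smul, ← map_smul, C.e.symm_apply_apply]
    simp
  have ha0 : a ≠ 0 := by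
    intro h0
    obtain ⟨v, hv⟩ := dm_surjective C.mem hs (C.e (0, y₀))
    rw [ha, ← hv, ← dm_eq_fderiv_comp_symm C.mem hs (D.normalMap.mdifferentiableAt _)] at h0
    obtain ⟨t, rfl⟩ := D.normalMap.ker s v h0
    have h3 := C.dm_y_mfderiv h.emb hs t
    rw [C.dm_y hs, hv, C.e.symm_apply_apply] at h3
    exact hy₀ h3
  have han := norm_pos_iff.2 ha0
  -- Chosen so that the squared norm of the normal vector is t₀, where b' is negative.
  set r := Real.sqrt t₀ / ‖a‖ with hr
  have hr0 : 0 < r := div_pos (Real.sqrt_pos.2 ht₀) han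
  have hnorm : ‖C.normalVec D.W (p r)‖ ^ 2 = t₀ := by
    rw [hnv, norm_smul, Real.norm_of_nonneg hr0.le, hr, div_mul_cancel₀ _ han.ne', Real.sq_sqrt ht₀.le]
  have hfc : Continuous C.foot := by
    unfold SliceChart.foot
    fun_prop
  have hpt : C.foot (p r) ∈ C.chart.target := by rwa [hfoot]
  have hnc : ContinuousAt (C.normalVec D.W) (p r) := by
    have h1 : ContinuousAt (fun q => fderiv ℝ (D.W ∘ C.chart.symm) q) (C.foot (p r)) :=
      ((C.contDiffAt_comp_symm D.normalMap.smooth hpt).fderiv_right (m := 0) (by simp)).continuousAt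
    have h2 : ContinuousAt (fun q => fderiv ℝ (D.W ∘ C.chart.symm) (C.foot q)) (p r) :=
      ContinuousAt.comp (g := fun q => fderiv ℝ (D.W ∘ C.chart.symm) q) h1 hfc.continuousAt
    exact h2.clm_apply (by fun_prop)
  have hev : ∀ᶠ q in 𝓝 (p r), D.limitDensity τ₀ C (fsmul φ τ₀) b q < 0 := by
    have e1 := hfc.continuousAt.eventually (C.chart.open_target.mem_nhds hpt)
    have e2 : ∀ᶠ q in 𝓝 (p r), 0 < φ (C.chart.symm (C.foot q)) := by
      have h1 : ContinuousAt (fun q => φ (C.chart.symm q)) (C.foot (p r)) :=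
        hφc.continuousAt.comp (C.chart.continuousAt_symm hpt)
      have h2 : ContinuousAt (fun q => φ (C.chart.symm (C.foot q))) (p r) :=
        ContinuousAt.comp (g := fun q => φ (C.chart.symm q)) h1 hfc.continuousAt
      refine h2.eventually (lt_mem_nhds ?_)
      change 0 < φ (C.chart.symm (C.foot (p r)))
      rw [hfoot, C.chart.left_inv hs]
      exact hφs
    have e3 : ∀ᶠ q in 𝓝 (p r), C.normalVec D.W q ≠ 0 := hnc.eventually_ne (by
      rw [hnv]
      exact smul_ne_zero hr0.ne' ha0)
    have e4 : ∀ᶠ q in 𝓝 (p r), deriv b (‖C.normalVec D.W q‖ ^ 2) < 0 := by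
      have h1 : ContinuousAt (fun q => deriv b (‖C.normalVec D.W q‖ ^ 2)) (p r) :=
        hb.deriv.smooth.continuous.continuousAt.comp (hnc.norm.pow 2)
      refine h1.eventually (gt_mem_nhds ?_)
      change deriv b (‖C.normalVec D.W (p r)‖ ^ 2) < 0
      rwa [hnorm]
    filter_upwards [e1, e2, e3, e4] with q e1 e2 e3 e4
    exact (limitDensity_nonpos h hb' hφ q).2 e1 e2 e3 e4
  have hpos : 0 < ∫ q, -(D.limitDensity τ₀ C (fsmul φ τ₀) b q) := by
    rw [integral_pos_iff_support_of_nonneg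
      (fun q => neg_nonneg.2 (limitDensity_nonpos h hb' hφ q).1) hint.neg]
    refine MeasureTheory.Measure.measure_pos_of_mem_nhds volume (Filter.mem_of_superset hev fun q hq => ?_)
    rw [Function.mem_support]
    exact (neg_pos.2 hq).ne'
  rw [integral_neg] at hpos
  linarith

/-- Localization of the integral against concentrated Thom forms. -/
theorem tendsto_integral_thomForm_sum (h : HolCurve τ₀ J j u) (hb : Profile D.m b) (hζ : IsSmoothForm ζ)
    {t : Finset S} {C : S → SliceChart u} {φ : S → M → ℝ} {K : S → Set M} {U : Set M}
    (hU : IsOpen U) (hZU : Set.range u ⊆ U) (h1 : ∀ x ∈ U, ∑ i ∈ t, φ i x = 1)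
    (hφ : ∀ i ∈ t, ContMDiff (𝓡 4) 𝓘(ℝ, ℝ) ∞ (φ i) ∧ (∀ x, 0 ≤ φ i x) ∧ IsCompact (K i) ∧
        K i ⊆ (C i).chart.source ∧ ∀ x ∉ K i, φ i x = 0) :
    Filter.Tendsto (fun δ : ℝ => integral (symplecticPos τ₀)
      (fun x v => wedgeForm ζ (D.thomForm fun t => b (t / δ ^ 2)) x v)) (𝓝[>] 0)
      (𝓝 (∑ i ∈ t, ∫ p, D.limitDensity τ₀ (C i) (fsmul (φ i) ζ) b p)) ∧
    ∀ i ∈ t, Integrable (D.limitDensity τ₀ (C i) (fsmul (φ i) ζ) b) := by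
  have hloc := fun i (hi : i ∈ t) => tendsto_integral_thomForm (D := D) (C := C i)
    (hζ.fsmul (hφ i hi).1) h hb (hφ i hi).2.2.1 (hφ i hi).2.2.2.1
    (fun x hx => by
      change φ i x • ζ x = 0
      rw [(hφ i hi).2.2.2.2 x hx, zero_smul])
  refine ⟨?_, fun i hi => (hloc i hi).2⟩
  have hsum := tendsto_finsetSum t fun i hi => (hloc i hi).1
  refine hsum.congr' ?_
  obtain ⟨ε, hε, hεU⟩ := exists_forall_mem_of_lt (D := D) hU hZU
  obtain ⟨t₁, ht₁, hb1⟩ := hb.eq_zero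
  -- For such δ the rescaled Thom form is supported in U, where the functions φ i sum to 1.
  have hδ : ∀ᶠ δ : ℝ in 𝓝[>] 0, 0 < δ ∧ δ ≤ 1 ∧ δ ^ 2 * t₁ < ε := by
    have hc : Filter.Tendsto (fun δ : ℝ => δ ^ 2 * t₁) (𝓝[>] 0) (𝓝 0) := by
      have : Continuous fun δ : ℝ => δ ^ 2 * t₁ := by fun_prop
      have h2 := (this.tendsto 0).mono_left (nhdsWithin_le_nhds (s := Set.Ioi 0))
      simpa using h2
    filter_upwards [self_mem_nhdsWithin, nhdsWithin_le_nhds (Iic_mem_nhds (zero_lt_one (α := ℝ))),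
      hc.eventually (gt_mem_nhds hε)] with δ h1 h2 h3 using ⟨h1, h2, h3⟩
  filter_upwards [hδ] with δ hδ
  have hP := hb.scale D.m_pos hδ.1 hδ.2.1
  have hsm := isSmoothForm_thomForm hP
  have hi := integral_sum_form h.isVolume (HolCurve.orientedBy τ₀) t
    (σ := fun i => wedgeForm (fsmul (φ i) ζ) (D.thomForm fun t => b (t / δ ^ 2)))
    (fun i hi => ((hζ.fsmul (hφ i hi).1).wedge hsm).isContTop)
    (fun i hi => ⟨K i, (hφ i hi).2.2.1, fun x hx => by
      change wedgeAlt (φ i x • ζ x) _ = 0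
      rw [(hφ i hi).2.2.2.2 x hx, zero_smul, wedgeAlt_zero_left]⟩)
  rw [← hi.2.2]
  have heq : (∑ i ∈ t, wedgeForm (fsmul (φ i) ζ) (D.thomForm fun t => b (t / δ ^ 2))) =
      wedgeForm ζ (D.thomForm fun t => b (t / δ ^ 2)) := by
    funext x
    rw [Finset.sum_apply]
    have h2 : ∀ i ∈ t, wedgeForm (fsmul (φ i) ζ) (D.thomForm fun t => b (t / δ ^ 2)) x =
        φ i x • wedgeForm ζ (D.thomForm fun t => b (t / δ ^ 2)) x := fun i _ =>
      wedgeAlt_smul_left _ _ _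
    rw [Finset.sum_congr rfl h2, ← Finset.sum_smul]
    by_cases hx : D.F x < ε
    · rw [h1 x (hεU x hx), one_smul]
    · have h3 : D.thomForm (fun t => b (t / δ ^ 2)) x = 0 := by
        refine thomForm_eq_zero ?_
        have h4 : δ ^ 2 * t₁ < D.F x := hδ.2.2.trans_le (not_lt.1 hx)
        filter_upwards [lt_mem_nhds h4] with s hs
        refine hb1 _ ?_
        rwa [gt_iff_lt, lt_div_iff₀ (pow_pos hδ.1 2), mul_comm]
      have h4 : wedgeForm ζ (D.thomForm fun t => b (t / δ ^ 2)) x = 0 := by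
        change wedgeAlt _ _ = 0
        rw [h3, wedgeAlt_zero_right]
      rw [h4, smul_zero]
  rw [heq]

theorem tendsto_integral_zero (h : HolCurve τ₀ J j u) (hb : Profile D.m b) (hζ : IsSmoothForm ζ)
    (hζ0 : ∀ s, ζ (u s) = 0) :
    Filter.Tendsto (fun δ : ℝ => integral (symplecticPos τ₀)
      (fun x v => wedgeForm ζ (D.thomForm fun t => b (t / δ ^ 2)) x v)) (𝓝[>] 0) (𝓝 0) := by
  obtain ⟨t, C, φ, K, U, hU, hZU, h1, hφ⟩ := exists_slice_partition h.emb
  have h2 := (tendsto_integral_thomForm_sum h hb hζ hU hZU h1 hφ).1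
  have h3 : ∑ i ∈ t, ∫ p, D.limitDensity τ₀ (C i) (fsmul (φ i) ζ) b p = 0 := by
    refine Finset.sum_eq_zero fun i _ => ?_
    have h4 : D.limitDensity τ₀ (C i) (fsmul (φ i) ζ) b = fun _ => 0 := funext fun p =>
      limitDensity_eq_zero (fun s => by
        change φ i (u s) • ζ (u s) = 0
        rw [hζ0, smul_zero]) p
    rw [h4, MeasureTheory.integral_zero]
  rwa [h3] at h2

theorem exists_tendsto_neg (h : HolCurve τ₀ J j u) (hb : Profile D.m b) (hb' : ∀ t, deriv b t ≤ 0)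
    {t₀ : ℝ} (ht₀ : 0 < t₀) (hbt : deriv b t₀ < 0) : ∃ I < 0,
    Filter.Tendsto (fun δ : ℝ => integral (symplecticPos τ₀)
      (fun x v => wedgeForm τ₀ (D.thomForm fun t => b (t / δ ^ 2)) x v)) (𝓝[>] 0) (𝓝 I) := by
  obtain ⟨t, C, φ, K, U, hU, hZU, h1, hφ⟩ := exists_slice_partition h.emb
  obtain ⟨h2, hint⟩ := tendsto_integral_thomForm_sum (D := D) h hb h.symp.smooth hU hZU h1 hφ
  refine ⟨_, ?_, h2⟩
  have hle : ∀ i ∈ t, ∫ p, D.limitDensity τ₀ (C i) (fsmul (φ i) τ₀) b p ≤ 0 := fun i hi =>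
    integral_nonpos fun p => (limitDensity_nonpos h hb' (hφ i hi).2.1 p).1
  obtain ⟨s⟩ : Nonempty S := inferInstance
  obtain ⟨i, hi, hpos⟩ : ∃ i ∈ t, 0 < φ i (u s) := by
    by_contra! hcon
    have h3 := h1 (u s) (hZU ⟨s, rfl⟩)
    have h4 := Finset.sum_nonpos hcon
    rw [h3] at h4
    exact absurd h4 (by norm_num)
  refine Finset.sum_neg' hle ⟨i, hi, integral_limitDensity_neg h hb hb' ht₀ hbt
    (hφ i hi).1.continuous (hφ i hi).2.1 (s := s) ?_ hpos (hint i hi)⟩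
  refine (hφ i hi).2.2.2.1 ?_
  by_contra hcon
  exact hpos.ne' ((hφ i hi).2.2.2.2 _ hcon)

end NormalData

end ThomIntegral

/-! ### The Poincaré lemma with compact support in a square. -/

section CompactPoincare

open MeasureTheory Convolution

theorem integral_Iic_eq_of_vanishing {F : ℝ → ℝ} (hF : Continuous F) {a b : ℝ}
    (h0 : ∀ x, x ∉ Set.Ioo a b → F x = 0) (x : ℝ) : ∫ t in Set.Iic x, F t = ∫ t in a..x, F t := by
  have hc : HasCompactSupport F := HasCompactSupport.intro (isCompact_Icc (a := a) (b := b))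
    fun x hx => h0 x fun h => hx (Set.Ioo_subset_Icc_self h)
  have hi : Integrable F := hF.integrable_of_hasCompactSupport hc
  have h1 := intervalIntegral.integral_Iic_sub_Iic (a := a) (b := x) hi.integrableOn hi.integrableOn
  have h2 : ∫ t in Set.Iic a, F t = 0 :=
    setIntegral_eq_zero_of_forall_eq_zero fun t ht => h0 t fun h => absurd h.1 (not_lt.2 ht)
  rw [← h1, h2, sub_zero]

/-- Smooth dependence of a primitive on a parameter. -/
theorem contDiff_primitive {F : ℝ × ℝ → ℝ} (hF : ContDiff ℝ ∞ F) {a b : ℝ}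
    (h0 : ∀ p x, x ∉ Set.Ioo a b → F (p, x) = 0) :
    ContDiff ℝ ∞ fun q : ℝ × ℝ => ∫ t in a..q.2, F (q.1, t) := by
  -- The primitive is the convolution with the indicator of [0, ∞), so smoothness in the parameter
  -- follows from that of convolutions.
  have hf : LocallyIntegrable (Set.indicator (Set.Ici (0 : ℝ)) fun _ => (1 : ℝ)) volume :=
    (locallyIntegrable_const 1).indicator measurableSet_Ici
  have h := contDiffOn_convolution_right_with_param (𝕜 := ℝ) (n := (⊤ : ℕ∞))
    (ContinuousLinearMap.mul ℝ ℝ) (g := fun p x => F (p, x))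
    isOpen_univ (isCompact_Icc (a := a) (b := b))
    (fun p x _ hx => h0 p x fun h => hx (Set.Ioo_subset_Icc_self h)) hf hF.contDiffOn
  rw [Set.univ_prod_univ, contDiffOn_univ] at h
  convert h using 2 with q
  rw [← integral_Iic_eq_of_vanishing (F := fun t => F (q.1, t)) (hF.continuous.comp (by fun_prop))
    (h0 q.1), convolution_def,
    ← integral_indicator measurableSet_Iic, ← integral_sub_left_eq_self _ _ q.2]
  refine integral_congr_ae (Filter.Eventually.of_forall fun t => ?_)
  by_cases ht : 0 ≤ t
  · simp [Set.indicator, ht]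
  · simp [Set.indicator, ht]

theorem hasDerivAt_primitive {F : ℝ → ℝ} (hF : Continuous F) (a x : ℝ) :
    HasDerivAt (fun s => ∫ t in a..s, F t) (F x) x :=
  intervalIntegral.integral_hasDerivAt_right (hF.intervalIntegrable _ _)
    (hF.stronglyMeasurableAtFilter _ _) hF.continuousAt

theorem exists_bump_interval {a b : ℝ} (hab : a < b) : ∃ ρ : ℝ → ℝ, ContDiff ℝ ∞ ρ ∧
    (∀ x, x ∉ Set.Ioo a b → ρ x = 0) ∧ ∫ t in a..b, ρ t = 1 := by
  let f : ContDiffBump ((a + b) / 2) := ⟨(b - a) / 4, (b - a) / 2, by linarith, by linarith⟩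
  have hz : ∀ x, x ∉ Set.Ioo a b → f.normed volume x = 0 := by
    intro x hx
    by_contra hne
    have h1 : x ∈ Function.support (f.normed volume) := hne
    rw [f.support_normed_eq, Real.ball_eq_Ioo] at h1
    refine hx ⟨?_, ?_⟩
    · have := h1.1
      simp only [f] at this
      linarith
    · have := h1.2
      simp only [f] at this
      linarith
  refine ⟨f.normed volume, f.contDiff_normed, hz, ?_⟩
  rw [← integral_Iic_eq_of_vanishing (f.contDiff_normed (n := (⊤ : ℕ∞))).continuous hz,
    setIntegral_eq_integral_of_forall_compl_eq_zero]
  · exact f.integral_normed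
  · intro x hx
    exact hz x fun h => hx h.2.le

theorem primitive_eq_zero {F : ℝ → ℝ} {a b : ℝ} (h0 : ∀ x, x ∉ Set.Ioo a b → F x = 0)
    (hF : Continuous F) (hI : ∫ t in a..b, F t = 0) {x : ℝ} (hx : x ∉ Set.Ioo a b) :
    ∫ t in a..x, F t = 0 := by
  rcases le_or_gt x a with h | h
  · rw [intervalIntegral.integral_symm, intervalIntegral.integral_zero_ae, neg_zero]
    refine Filter.Eventually.of_forall fun t ht => h0 t fun hi => ?_
    rw [Set.uIoc_of_le h] at ht
    exact absurd hi.1 (not_lt.2 ht.2)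
  · have hb : b ≤ x := by
      by_contra hlt
      exact hx ⟨h, not_le.1 hlt⟩
    rw [← intervalIntegral.integral_add_adjacent_intervals (hF.intervalIntegrable a b)
      (hF.intervalIntegrable b x), hI, intervalIntegral.integral_zero_ae, zero_add]
    refine Filter.Eventually.of_forall fun t ht => h0 t fun hi => ?_
    rw [Set.uIoc_of_le hb] at ht
    exact absurd hi.2 (not_lt.2 ht.1.le)

/-- A function with support in a rectangle is a divergence up to a multiple of a fixed function. -/
theorem exists_divergence_prod {a b c d : ℝ} {ρ₁ ρ₂ : ℝ → ℝ} (hρ₁ : ContDiff ℝ ∞ ρ₁)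
    (hρ₂ : ContDiff ℝ ∞ ρ₂)
    (h₁ : ∀ x, x ∉ Set.Ioo a b → ρ₁ x = 0) (h₂ : ∀ x, x ∉ Set.Ioo c d → ρ₂ x = 0)
    (hi₁ : ∫ t in a..b, ρ₁ t = 1) (hi₂ : ∫ t in c..d, ρ₂ t = 1) {f : ℝ × ℝ → ℝ}
    (hf : ContDiff ℝ ∞ f) (hf₂ : ∀ p x, x ∉ Set.Ioo a b → f (p, x) = 0)
    (hf₁ : ∀ p x, p ∉ Set.Ioo c d → f (p, x) = 0) :
    ∃ (g h : ℝ × ℝ → ℝ) (k : ℝ), ContDiff ℝ ∞ g ∧ ContDiff ℝ ∞ h ∧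
      (∀ p x, p ∉ Set.Ioo c d ∨ x ∉ Set.Ioo a b → g (p, x) = 0 ∧ h (p, x) = 0) ∧
      ∀ p x, f (p, x) = deriv (fun s => g (s, x)) p + deriv (fun s => h (p, s)) x
        + k * (ρ₂ p * ρ₁ x) := by
  -- The fibre integral. Subtracting its product with ρ₁ leaves a function A with zero integral on
  -- every fibre, whose fibrewise primitive is compactly supported.
  let H : ℝ → ℝ := fun p => ∫ t in a..b, f (p, t)
  have hH : ContDiff ℝ ∞ H := (contDiff_primitive hf hf₂).comp (contDiff_id.prodMk contDiff_const)
  let k : ℝ := ∫ s in c..d, H s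
  have hH0 : ∀ p, p ∉ Set.Ioo c d → H p = 0 := by
    intro p hp
    simp only [H, hf₁ p _ hp, intervalIntegral.integral_zero]
  let A : ℝ × ℝ → ℝ := fun q => f q - ρ₁ q.2 * H q.1
  have hA : ContDiff ℝ ∞ A := hf.sub ((hρ₁.comp contDiff_snd).mul (hH.comp contDiff_fst))
  have hA0 : ∀ p x, x ∉ Set.Ioo a b → A (p, x) = 0 := by
    intro p x hx
    simp only [A, hf₂ p x hx, h₁ x hx, zero_mul, sub_zero]
  -- The remaining part ρ₁ H is treated in the other variable, after removing the multiple k ρ₂ that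
  -- carries the total integral.
  let B : ℝ × ℝ → ℝ := fun q => ρ₁ q.1 * (H q.2 - k * ρ₂ q.2)
  have hB : ContDiff ℝ ∞ B := (hρ₁.comp contDiff_fst).mul
    ((hH.comp contDiff_snd).sub (contDiff_const.mul (hρ₂.comp contDiff_snd)))
  have hB0 : ∀ p x, x ∉ Set.Ioo c d → B (p, x) = 0 := by
    intro p x hx
    simp only [B, hH0 x hx, h₂ x hx, mul_zero, sub_zero]
  have hsec : ∀ {F : ℝ × ℝ → ℝ}, ContDiff ℝ ∞ F → ∀ p, Continuous fun t => F (p, t) := by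
    intro F hF p
    exact hF.continuous.comp (by fun_prop)
  have hAI : ∀ p, ∫ t in a..b, A (p, t) = 0 := by
    intro p
    have hc : Continuous fun t => ρ₁ t * H p := hρ₁.continuous.mul continuous_const
    simp only [A]
    rw [intervalIntegral.integral_sub ((hsec hf p).intervalIntegrable _ _)
      (hc.intervalIntegrable _ _),
      intervalIntegral.integral_mul_const, hi₁, one_mul, sub_self]
  have hBI : ∀ p, ∫ t in c..d, B (p, t) = 0 := by
    intro p
    have hc : Continuous fun t => k * ρ₂ t := continuous_const.mul hρ₂.continuous
    simp only [B]
    rw [intervalIntegral.integral_const_mul, intervalIntegral.integral_sub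
      (hH.continuous.intervalIntegrable _ _) (hc.intervalIntegrable _ _),
      intervalIntegral.integral_const_mul, hi₂, mul_one, sub_self, mul_zero]
  refine ⟨fun q => ∫ t in c..q.1, B (q.2, t), fun q => ∫ t in a..q.2, A (q.1, t), k,
    (contDiff_primitive hB hB0).comp (contDiff_snd.prodMk contDiff_fst),
    contDiff_primitive hA hA0, ?_, ?_⟩
  · rintro p x (h | h)
    · refine ⟨primitive_eq_zero (hB0 x) (hsec hB x) (hBI x) h, ?_⟩
      simp only [A, hf₁ p _ h, hH0 p h, mul_zero, sub_zero, intervalIntegral.integral_zero]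
    · refine ⟨?_, primitive_eq_zero (hA0 p) (hsec hA p) (hAI p) h⟩
      simp only [B, h₁ x h, zero_mul, intervalIntegral.integral_zero]
  · intro p x
    simp only
    rw [(hasDerivAt_primitive (hsec hB x) c p).deriv, (hasDerivAt_primitive (hsec hA p) a x).deriv]
    simp only [A, B]
    ring

/-- A function with support in an open square is a divergence up to a multiple of a fixed
function. -/
theorem exists_divergence (a : E 2) {r : ℝ} (hr : 0 < r) :
    ∃ β : E 2 → ℝ, ContDiff ℝ ∞ β ∧ (∀ z, ¬ (∀ i, |z i - a i| < r) → β z = 0) ∧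
      ∀ f : E 2 → ℝ, ContDiff ℝ ∞ f → (∀ z, ¬ (∀ i, |z i - a i| < r) → f z = 0) →
        ∃ (g h : E 2 → ℝ) (k : ℝ), ContDiff ℝ ∞ g ∧ ContDiff ℝ ∞ h ∧
          (∀ z, ¬ (∀ i, |z i - a i| < r) → g z = 0 ∧ h z = 0) ∧
          ∀ z, f z = fderiv ℝ g z (EuclideanSpace.single 0 1) +
            fderiv ℝ h z (EuclideanSpace.single 1 1) + k * β z := by
  obtain ⟨ρ₂, hρ₂, h₂, hi₂⟩ := exists_bump_interval (a := a 0 - r) (b := a 0 + r) (by linarith)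
  obtain ⟨ρ₁, hρ₁, h₁, hi₁⟩ := exists_bump_interval (a := a 1 - r) (b := a 1 + r) (by linarith)
  let P : E 2 → ℝ × ℝ := fun z => (z 0, z 1)
  have hP : ContDiff ℝ ∞ P := by fun_prop
  let L : ℝ × ℝ → E 2 := fun q => !₂[q.1, q.2]
  have hL : ContDiff ℝ ∞ L := by
    refine contDiff_euclidean.2 fun i => ?_
    fin_cases i
    · exact contDiff_fst
    · exact contDiff_snd
  have hLP : ∀ z, L (P z) = z := by
    intro z
    ext i
    fin_cases i <;> rfl
  have hin : ∀ z : E 2, (∀ i, |z i - a i| < r) ↔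
      z 0 ∈ Set.Ioo (a 0 - r) (a 0 + r) ∧ z 1 ∈ Set.Ioo (a 1 - r) (a 1 + r) := by
    intro z
    simp only [Fin.forall_fin_two, abs_lt, Set.mem_Ioo]
    constructor
    · rintro ⟨⟨a, b⟩, c, d⟩
      refine ⟨⟨?_, ?_⟩, ?_, ?_⟩ <;> linarith
    · rintro ⟨⟨a, b⟩, c, d⟩
      refine ⟨⟨?_, ?_⟩, ?_, ?_⟩ <;> linarith
  refine ⟨fun z => ρ₂ (z 0) * ρ₁ (z 1), ?_, fun z hz => ?_, fun f hf hf0 => ?_⟩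
  · exact (hρ₂.comp (contDiff_fst.comp hP)).mul (hρ₁.comp (contDiff_snd.comp hP))
  · rw [hin, not_and_or] at hz
    rcases hz with hz | hz
    · simp only [h₂ _ hz, zero_mul]
    · simp only [h₁ _ hz, mul_zero]
  · obtain ⟨g, h, k, hg, hh, hz, heq⟩ := exists_divergence_prod hρ₁ hρ₂ h₁ h₂ hi₁ hi₂
      (hf.comp hL) (fun p x hx => hf0 _ fun hc => hx ((hin _).1 hc).2)
      (fun p x hx => hf0 _ fun hc => hx ((hin _).1 hc).1)
    refine ⟨g ∘ P, h ∘ P, k, hg.comp hP, hh.comp hP, fun z hz' => ?_, fun z => ?_⟩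
    · rw [hin, not_and_or] at hz'
      exact hz _ _ hz'
    · have h1 := heq (z 0) (z 1)
      have e0 : (f ∘ L) (z 0, z 1) = f z := congrArg f (hLP z)
      rw [e0] at h1
      have key : ∀ {G : ℝ × ℝ → ℝ}, ContDiff ℝ ∞ G → ∀ i : Fin 2,
          fderiv ℝ (G ∘ P) z (EuclideanSpace.single i 1) =
            deriv (fun s : ℝ => G (P (z + s • EuclideanSpace.single i (1 : ℝ)))) 0 := by
        intro G hG i
        have hd : DifferentiableAt ℝ (G ∘ P) z := (hG.comp hP).differentiable (by simp) z
        exact hd.lineDeriv_eq_fderiv.symm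
      rw [h1, key hg, key hh]
      have s0 : deriv (fun s : ℝ => g (P (z + s • EuclideanSpace.single (0 : Fin 2) (1 : ℝ)))) 0 =
          deriv (fun s => g (s, z 1)) (z 0) := by
        have := deriv_comp_const_add (fun s => g (s, z 1)) (z 0) 0
        rw [add_zero] at this
        rw [← this]
        congr 1
        funext s
        simp [P]
      have s1 : deriv (fun s : ℝ => h (P (z + s • EuclideanSpace.single (1 : Fin 2) (1 : ℝ)))) 0 =
          deriv (fun s => h (z 0, s)) (z 1) := by
        have := deriv_comp_const_add (fun s => h (z 0, s)) (z 1) 0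
        rw [add_zero] at this
        rw [← this]
        congr 1
        funext s
        simp [P]
      rw [s0, s1]

end CompactPoincare

/-! ### Forms that are exact along the curve. -/

section CurveExact

variable {M : Type*} [TopologicalSpace M] [T2Space M] [SigmaCompactSpace M]
    [ChartedSpace (E 4) M] [IsManifold (𝓡 4) ∞ M]
    {S : Type*} [TopologicalSpace S] [T2Space S] [CompactSpace S] [ConnectedSpace S]
    [ChartedSpace (E 2) S] [IsManifold (𝓡 2) ∞ S] {u : S → M}

/-- The form agrees along the curve with the exterior derivative of a smooth form. -/
def CurveExact (u : S → M) (ξ : Form 4 M 2) : Prop :=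
  ∃ (μ : Form 4 M 1) (θ : Form 4 M 2), IsSmoothForm μ ∧ HasExtDeriv μ θ ∧ ∀ s, θ (u s) = ξ (u s)

namespace CurveExact

variable {ξ ξ' : Form 4 M 2}

theorem congr (h : CurveExact u ξ) (e : ∀ s, ξ (u s) = ξ' (u s)) : CurveExact u ξ' := by
  obtain ⟨μ, θ, h1, h2, h3⟩ := h
  exact ⟨μ, θ, h1, h2, fun s => (h3 s).trans (e s)⟩

theorem add (h : CurveExact u ξ) (h' : CurveExact u ξ') : CurveExact u (ξ + ξ') := by
  obtain ⟨μ, θ, h1, h2, h3⟩ := h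
  obtain ⟨μ', θ', h1', h2', h3'⟩ := h'
  refine ⟨μ + μ', θ + θ', h1.add h1', h2.add h1 h1' h2', fun s => ?_⟩
  rw [Pi.add_apply, Pi.add_apply, h3, h3']

theorem smul (h : CurveExact u ξ) (r : ℝ) : CurveExact u (r • ξ) := by
  obtain ⟨μ, θ, h1, h2, h3⟩ := h
  refine ⟨r • μ, r • θ, h1.smul r, h2.smul r, fun s => ?_⟩
  rw [Pi.smul_apply, Pi.smul_apply, h3]

theorem zero : CurveExact u (0 : Form 4 M 2) := ⟨0, 0, isSmoothForm_zero, hasExtDeriv_zero, fun _ => rfl⟩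

theorem sum {ι : Type*} (t : Finset ι) {ξ : ι → Form 4 M 2} (h : ∀ i ∈ t, CurveExact u (ξ i)) :
    CurveExact u (∑ i ∈ t, ξ i) := by
  classical
  induction t using Finset.induction_on with
  | empty => simpa using zero
  | insert a t ha ih =>
    rw [Finset.sum_insert ha]
    exact (h a (Finset.mem_insert_self _ _)).add (ih fun i hi => h i (Finset.mem_insert_of_mem hi))

theorem wedgeOne {f g : M → ℝ} (hf : ContMDiff (𝓡 4) 𝓘(ℝ, ℝ) ∞ f)
    (hg : ContMDiff (𝓡 4) 𝓘(ℝ, ℝ) ∞ g) :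
    CurveExact u (Inflation.wedgeOne (dfn f) (dfn g) : Form 4 M 2) :=
  ⟨_, _, (isSmoothForm_dfn hg).fsmul hf, hasExtDeriv_fsmul_dfn hf hg, fun _ => rfl⟩

/-- Where g vanishes, d(ag) = a dg, so a df∧dg agrees there with −d(ag)∧df = d(−ag df). Thus every
term containing the differential of a normal coordinate is exact along the curve. -/
theorem fsmul_wedgeOne {a f g : M → ℝ} (ha : ContMDiff (𝓡 4) 𝓘(ℝ, ℝ) ∞ a)
    (hf : ContMDiff (𝓡 4) 𝓘(ℝ, ℝ) ∞ f)
    (hg : ContMDiff (𝓡 4) 𝓘(ℝ, ℝ) ∞ g) (hg0 : ∀ s, g (u s) = 0) :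
    CurveExact u (fsmul a (Inflation.wedgeOne (dfn f) (dfn g)) : Form 4 M 2) := by
  refine ((wedgeOne (u := u) (ha.mul hg) hf).smul (-1)).congr fun s => form2_ext fun v w => ?_
  have hd : ∀ v, dm 4 (fun x => a x * g x) (u s) v = a (u s) * dm 4 g (u s) v := by
    intro v
    have := dm_bilinear (isBoundedBilinearMap_mul (𝕜 := ℝ) (A := ℝ))
      ((ha (u s)).mdifferentiableAt (by simp)) ((hg (u s)).mdifferentiableAt (by simp)) v
    rw [this, hg0, mul_zero, add_zero]
  change -1 * (dm 4 (fun x => a x * g x) (u s) v * dm 4 f (u s) w -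
    dm 4 (fun x => a x * g x) (u s) w * dm 4 f (u s) v) =
    a (u s) * (dm 4 f (u s) v * dm 4 g (u s) w - dm 4 f (u s) w * dm 4 g (u s) v)
  rw [hd, hd]
  ring

end CurveExact

theorem HolCurve.curveIntegral_eq_zero {τ₀ : Form 4 M 2}
    {J : ∀ x : M, TangentSpace (𝓡 4) x →L[ℝ] TangentSpace (𝓡 4) x}
    {j : ∀ s : S, TangentSpace (𝓡 2) s →L[ℝ] TangentSpace (𝓡 2) s} (h : HolCurve τ₀ J j u)
    {ξ : Form 4 M 2} (hξ : CurveExact u ξ) : curveIntegral j u ξ = 0 := by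
  obtain ⟨μ, θ, h1, h2, h3⟩ := hξ
  rw [← h.curveIntegral_exact h1 h2]
  refine HolCurve.curveIntegral_congr ?_
  rintro _ ⟨s, rfl⟩
  exact (h3 s).symm

theorem contMDiff_mul_of_eq_zero {n : ℕ} {X : Type*} [TopologicalSpace X] [ChartedSpace (E n) X]
    {χ f : X → ℝ} (hχ : ContMDiff (𝓡 n) 𝓘(ℝ, ℝ) ∞ χ)
    {K U : Set X} (hK : IsClosed K) (hKU : K ⊆ U) (hχK : ∀ x ∉ K, χ x = 0)
    (hf : ∀ x ∈ U, ContMDiffAt (𝓡 n) 𝓘(ℝ, ℝ) ∞ f x) :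
    ContMDiff (𝓡 n) 𝓘(ℝ, ℝ) ∞ fun x => χ x * f x := by
  intro x
  by_cases hx : x ∈ U
  · exact (hχ x).mul (hf x hx)
  · refine (contMDiffAt_const (c := (0 : ℝ))).congr_of_eventuallyEq ?_
    filter_upwards [hK.isOpen_compl.mem_nhds fun h => hx (hKU h)] with z hz
    rw [hχK z hz, zero_mul]

namespace SliceChart

variable (C : SliceChart u)

/-- The coordinate vectors along the curve and normal to it. -/
def basisVec : Fin 2 ⊕ Fin 2 → E 4 :=
  Sum.elim (fun i => C.e (EuclideanSpace.single i 1, 0)) fun i => C.e (0, EuclideanSpace.single i 1)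

/-- The coordinates along the curve and normal to it. -/
def coord (a : Fin 2 ⊕ Fin 2) (x : M) : ℝ := Sum.elim (fun i => C.z x i) (fun i => C.y x i) a

/-- The coefficients of a form. -/
def coeff (ξ : Form 4 M 2) (a b : Fin 2 ⊕ Fin 2) (x : M) : ℝ :=
  pbE (𝓡 4) C.chart.symm ξ (C.chart x) ![C.basisVec a, C.basisVec b]

theorem contMDiffAt_coord {x : M} (hx : x ∈ C.chart.source) (a : Fin 2 ⊕ Fin 2) :
    ContMDiffAt (𝓡 4) 𝓘(ℝ, ℝ) ∞ (C.coord a) x := by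
  rcases a with i | i
  · exact ((EuclideanSpace.proj (𝕜 := ℝ) i).contDiff.contMDiff (n := ∞)).contMDiffAt.comp x
      (C.contMDiffAt_z hx)
  · exact ((EuclideanSpace.proj (𝕜 := ℝ) i).contDiff.contMDiff (n := ∞)).contMDiffAt.comp x
      (C.contMDiffAt_y hx)

theorem contMDiffAt_coeff {ξ : Form 4 M 2} (hξ : IsSmoothForm ξ) {x : M} (hx : x ∈ C.chart.source)
    (a b : Fin 2 ⊕ Fin 2) : ContMDiffAt (𝓡 4) 𝓘(ℝ, ℝ) ∞ (C.coeff ξ a b) x := by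
  have h1 := contDiffAt_form_apply (hξ.contDiffAt_pbE_symm C.mem (C.chart.map_source hx))
    ![C.basisVec a, C.basisVec b]
  exact h1.contMDiffAt.comp x (contMDiffAt_of_mem C.mem hx)

theorem dm_coord_inl {x : M} (hx : x ∈ C.chart.source) (i : Fin 2) (v : TangentSpace (𝓡 4) x) :
    dm 4 (C.coord (Sum.inl i)) x v = dm 4 C.z x v i :=
  dm_clm_comp (EuclideanSpace.proj (𝕜 := ℝ) i) ((C.contMDiffAt_z hx).mdifferentiableAt (by simp)) v

theorem dm_coord_inr {x : M} (hx : x ∈ C.chart.source) (i : Fin 2) (v : TangentSpace (𝓡 4) x) :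
    dm 4 (C.coord (Sum.inr i)) x v = dm 4 C.y x v i :=
  dm_clm_comp (EuclideanSpace.proj (𝕜 := ℝ) i) ((C.contMDiffAt_y hx).mdifferentiableAt (by simp)) v

theorem dm_chart_eq {x : M} (hx : x ∈ C.chart.source) (v : TangentSpace (𝓡 4) x) :
    dm 4 C.chart x v = dm 4 (C.coord (Sum.inl 0)) x v • C.basisVec (Sum.inl 0) +
      dm 4 (C.coord (Sum.inl 1)) x v • C.basisVec (Sum.inl 1) +
      dm 4 (C.coord (Sum.inr 0)) x v • C.basisVec (Sum.inr 0) +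
      dm 4 (C.coord (Sum.inr 1)) x v • C.basisVec (Sum.inr 1) := by
  rw [C.dm_coord_inl hx, C.dm_coord_inl hx, C.dm_coord_inr hx, C.dm_coord_inr hx, C.dm_z hx,
    C.dm_y hx]
  apply C.e.symm.injective
  simp only [basisVec, Sum.elim_inl, Sum.elim_inr, ← map_smul, ← map_add, C.e.symm_apply_apply]
  ext i <;> fin_cases i <;> simp

theorem apply_eq_coeff (ξ : Form 4 M 2) {x : M} (hx : x ∈ C.chart.source) :
    ξ x = C.coeff ξ (Sum.inl 0) (Sum.inl 1) x •
        wedge11 (dfn (C.coord (Sum.inl 0)) x) (dfn (C.coord (Sum.inl 1)) x) +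
      C.coeff ξ (Sum.inl 0) (Sum.inr 0) x •
        wedge11 (dfn (C.coord (Sum.inl 0)) x) (dfn (C.coord (Sum.inr 0)) x) +
      C.coeff ξ (Sum.inl 0) (Sum.inr 1) x •
        wedge11 (dfn (C.coord (Sum.inl 0)) x) (dfn (C.coord (Sum.inr 1)) x) +
      C.coeff ξ (Sum.inl 1) (Sum.inr 0) x •
        wedge11 (dfn (C.coord (Sum.inl 1)) x) (dfn (C.coord (Sum.inr 0)) x) +
      C.coeff ξ (Sum.inl 1) (Sum.inr 1) x •
        wedge11 (dfn (C.coord (Sum.inl 1)) x) (dfn (C.coord (Sum.inr 1)) x) +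
      C.coeff ξ (Sum.inr 0) (Sum.inr 1) x •
        wedge11 (dfn (C.coord (Sum.inr 0)) x) (dfn (C.coord (Sum.inr 1)) x) := by
  refine form2_ext fun v w => ?_
  have h1 : ξ x ![v, w] = pbE (𝓡 4) C.chart.symm ξ (C.chart x) ![dm 4 C.chart x v, dm 4 C.chart x w] := by
    obtain ⟨y, hy, rfl⟩ : ∃ y ∈ C.chart.target, C.chart.symm y = x :=
      ⟨C.chart x, C.chart.map_source hx, C.chart.left_inv hx⟩
    rw [C.chart.right_inv hy]
    have e1 := frameAt_dm C.mem hy v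
    have e2 := frameAt_dm C.mem hy w
    rw [← e1, ← e2, dm_frameAt C.mem hy, dm_frameAt C.mem hy]
    change _ = ξ _ (fun i => frameAt C.chart y (![_, _] i))
    congr 1
    funext i
    fin_cases i <;> rfl
  rw [h1, C.dm_chart_eq hx v, C.dm_chart_eq hx w]
  simp only [ContinuousAlternatingMap.add_apply, ContinuousAlternatingMap.smul_apply, wedge11_apply,
    dfn_apply, coeff, smul_eq_mul]
  generalize pbE (𝓡 4) C.chart.symm ξ (C.chart x) = Ω
  simp only [form2_add_left, form2_add_right, form2_smul_left, form2_smul_right, form2_self]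
  rw [form2_swap Ω (C.basisVec (Sum.inl 0)) (C.basisVec (Sum.inl 1)),
    form2_swap Ω (C.basisVec (Sum.inl 0)) (C.basisVec (Sum.inr 0)),
    form2_swap Ω (C.basisVec (Sum.inl 0)) (C.basisVec (Sum.inr 1)),
    form2_swap Ω (C.basisVec (Sum.inl 1)) (C.basisVec (Sum.inr 0)),
    form2_swap Ω (C.basisVec (Sum.inl 1)) (C.basisVec (Sum.inr 1)),
    form2_swap Ω (C.basisVec (Sum.inr 0)) (C.basisVec (Sum.inr 1))]
  ring

end SliceChart

end CurveExact

/-! ### The second cohomology of the curve is a line. -/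

section CurveCohomology

variable {M : Type*} [TopologicalSpace M] [T2Space M] [SigmaCompactSpace M]
    [ChartedSpace (E 4) M] [IsManifold (𝓡 4) ∞ M]
    {S : Type*} [TopologicalSpace S] [T2Space S] [CompactSpace S] [ConnectedSpace S]
    [ChartedSpace (E 2) S] [IsManifold (𝓡 2) ∞ S] {u : S → M}

theorem exists_square_subset {V : Set (E 2)} (hV : IsOpen V) {a : E 2} (ha : a ∈ V) :
    ∃ (r : ℝ) (B : Set (E 2)), 0 < r ∧ IsCompact B ∧ B ⊆ V ∧ ∀ z : E 2, (∀ i, |z i - a i| < r) → z ∈ B := by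
  obtain ⟨ε, hε, hB⟩ := Metric.nhds_basis_closedBall.mem_iff.1 (hV.mem_nhds ha)
  refine ⟨ε / 2, Metric.closedBall a ε, by positivity, isCompact_closedBall a ε, hB, fun z hz => ?_⟩
  rw [mem_closedBall_iff_norm, EuclideanSpace.norm_eq, Fin.sum_univ_two]
  refine Real.sqrt_le_iff.2 ⟨hε.le, ?_⟩
  have h0 := sq_lt_sq' (neg_lt_of_abs_lt (hz 0)) (lt_of_abs_lt (hz 0))
  have h1 := sq_lt_sq' (neg_lt_of_abs_lt (hz 1)) (lt_of_abs_lt (hz 1))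
  simp only [PiLp.sub_apply, Real.norm_eq_abs, sq_abs]
  nlinarith

/-- In a slice chart all terms with a normal differential are exact along the curve. The remaining
tangential coefficient is a function supported in a square, so by the compactly supported Poincaré
lemma it is a divergence plus a multiple of one fixed bump. -/
theorem HolCurve.exists_local_generator {τ₀ : Form 4 M 2}
    {J : ∀ x : M, TangentSpace (𝓡 4) x →L[ℝ] TangentSpace (𝓡 4) x}
    {j : ∀ s : S, TangentSpace (𝓡 2) s →L[ℝ] TangentSpace (𝓡 2) s} (h : HolCurve τ₀ J j u) (s₀ : S) :
    ∃ O : Set M, IsOpen O ∧ u s₀ ∈ O ∧ ∃ ω₀ : Form 4 M 2, IsSmoothForm ω₀ ∧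
      ∀ ξ : Form 4 M 2, IsSmoothForm ξ → (∀ s, u s ∉ O → ξ (u s) = 0) →
        ∃ k : ℝ, CurveExact u (ξ - k • ω₀) := by
  have : LocallyCompactSpace M := ChartedSpace.locallyCompactSpace (E 4) M
  obtain ⟨C, hC⟩ := exists_sliceChart h.emb s₀
  -- The coordinates of those points of S whose image lies in the slice chart.
  let V : Set (E 2) := C.dom.target ∩ C.dom.symm ⁻¹' (u ⁻¹' C.chart.source)
  have hV : IsOpen V :=
    C.dom.isOpen_inter_preimage_symm (C.chart.open_source.preimage h.continuous)
  have hdom : ∀ s, u s ∈ C.chart.source → C.dom s ∈ V := fun s hs =>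
    ⟨C.dom.map_source (C.mem_dom s hs), by
      change u (C.dom.symm (C.dom s)) ∈ C.chart.source
      rwa [C.dom.left_inv (C.mem_dom s hs)]⟩
  obtain ⟨r, B, hr, hBc, hBV, hsq⟩ := exists_square_subset hV (hdom s₀ hC)
  set a := C.dom s₀
  let K : Set M := (fun z => u (C.dom.symm z)) '' B
  have hK : IsCompact K := hBc.image_of_continuousOn
    (h.continuous.comp_continuousOn (C.dom.continuousOn_symm.mono fun z hz => (hBV hz).1))
  have hKs : K ⊆ C.chart.source := by
    rintro _ ⟨z, hz, rfl⟩
    exact (hBV hz).2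
  obtain ⟨K', hK', hKK', hK's⟩ := exists_compact_between hK C.chart.open_source hKs
  -- Equal to 1 near the part of the curve over B, this cutoff extends the local coordinates and
  -- coefficients to M without changing derivatives there.
  obtain ⟨χ, hχ1, hχ0, -⟩ := exists_contMDiffMap_one_nhds_of_subset_interior
    (n := (⊤ : ℕ∞)) (𝓡 4) hK.isClosed hKK'
  have hsm : ∀ {f : M → ℝ}, (∀ x ∈ C.chart.source, ContMDiffAt (𝓡 4) 𝓘(ℝ, ℝ) ∞ f x) →
      ContMDiff (𝓡 4) 𝓘(ℝ, ℝ) ∞ fun x => χ x * f x := fun hf =>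
    contMDiff_mul_of_eq_zero χ.contMDiff hK'.isClosed hK's hχ0 hf
  let q : Fin 2 ⊕ Fin 2 → M → ℝ := fun i x => χ x * C.coord i x
  have hq : ∀ i, ContMDiff (𝓡 4) 𝓘(ℝ, ℝ) ∞ (q i) := fun i => hsm fun x hx => C.contMDiffAt_coord hx i
  have hq0 : ∀ i s, q (Sum.inr i) (u s) = 0 := by
    intro i s
    by_cases hs : u s ∈ C.chart.source
    · simp only [q, SliceChart.coord, Sum.elim_inr, C.y_apply_u hs, PiLp.zero_apply, mul_zero]
    · simp only [q, hχ0 _ fun hc => hs (hK's hc), zero_mul]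
  obtain ⟨β, hβ, hβ0, hdiv⟩ := exists_divergence a hr
  let P : Form 4 M 2 := wedgeOne (dfn (q (Sum.inl 0))) (dfn (q (Sum.inl 1)))
  have hP : IsSmoothForm P := (isSmoothForm_dfn (hq _)).wedgeOne (isSmoothForm_dfn (hq _))
  have hz : ∀ {g : E 2 → ℝ}, ContDiff ℝ ∞ g → ContMDiff (𝓡 4) 𝓘(ℝ, ℝ) ∞ fun x => χ x * g (C.z x) :=
    fun hg => hsm fun x hx => hg.contMDiff.contMDiffAt.comp x (C.contMDiffAt_z hx)
  refine ⟨C.chart.source ∩ C.z ⁻¹' {z | ∀ i, |z i - a i| < r}, ?_, ⟨hC, ?_⟩,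
    fsmul (fun x => χ x * β (C.z x)) P, hP.fsmul (hz hβ), fun ξ hξ hξ0 => ?_⟩
  · refine ContinuousOn.isOpen_inter_preimage
      (fun x hx => (C.contMDiffAt_z hx).continuousAt.continuousWithinAt) C.chart.open_source ?_
    have : {z : E 2 | ∀ i, |z i - a i| < r} = ⋂ i, {z | |z i - a i| < r} := by
      ext z
      simp
    rw [this]
    exact isOpen_iInter_of_finite fun i => isOpen_lt (by fun_prop) continuous_const
  · intro i
    rw [C.z_apply_u hC, sub_self, abs_zero]
    exact hr
  have hout : ∀ s, u s ∈ C.chart.source → ¬ (∀ i, |C.dom s i - a i| < r) → ξ (u s) = 0 := by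
    intro s hs hn
    refine hξ0 s fun hc => hn ?_
    have := hc.2
    rwa [Set.mem_preimage, C.z_apply_u hs] at this
  have hcoeff0 : ∀ s, u s ∈ C.chart.source → ξ (u s) = 0 → ∀ i k, C.coeff ξ i k (u s) = 0 := by
    intro s hs h0 i k
    change ξ (C.chart.symm (C.chart (u s))) _ = 0
    rw [C.chart.left_inv hs, h0]
    rfl
  -- The value of a function in the chart along the curve.
  let A : Fin 2 ⊕ Fin 2 → Fin 2 ⊕ Fin 2 → M → ℝ := fun i k x => χ x * C.coeff ξ i k x
  have hA : ∀ i k, ContMDiff (𝓡 4) 𝓘(ℝ, ℝ) ∞ (A i k) := fun i k =>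
    hsm fun x hx => C.contMDiffAt_coeff hξ hx i k
  -- Either the point lies over B, where χ is 1 nearby, or all the localized data vanish there.
  have hcase : ∀ s, (u s ∈ C.chart.source ∧ C.dom s ∈ B) ∨
      (ξ (u s) = 0 ∧ (∀ i k, A i k (u s) = 0) ∧ ∀ g : E 2 → ℝ,
        (∀ z, ¬ (∀ i, |z i - a i| < r) → g z = 0) → ∀ᶠ x in 𝓝 (u s), χ x * g (C.z x) = 0) := by
    intro s
    by_cases hs : u s ∈ C.chart.source
    · by_cases hb : C.dom s ∈ B
      · exact Or.inl ⟨hs, hb⟩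
      · have h0 := hout s hs fun hc => hb (hsq _ hc)
        refine Or.inr ⟨h0, fun i k => ?_, fun g hg => ?_⟩
        · simp only [A, hcoeff0 s hs h0, mul_zero]
        · rw [← C.z_apply_u hs] at hb
          filter_upwards [(C.contMDiffAt_z hs).continuousAt.preimage_mem_nhds
            (hBc.isClosed.isOpen_compl.mem_nhds hb)] with x hx
          rw [hg _ fun hc => hx (hsq _ hc), mul_zero]
    · refine Or.inr ⟨hξ0 s fun hc => hs hc.1, fun i k => ?_, fun g _ => ?_⟩
      · simp only [A, hχ0 _ fun hc => hs (hK's hc), zero_mul]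
      · filter_upwards [hK'.isClosed.isOpen_compl.mem_nhds fun hc => hs (hK's hc)] with x hx
        rw [hχ0 _ hx, zero_mul]
  have hone : ∀ s, u s ∈ C.chart.source → C.dom s ∈ B → ∀ᶠ x in 𝓝 (u s), χ x = 1 := by
    intro s hs hb
    refine (Filter.eventually_of_mem · fun x hx => hx) ?_
    refine (nhds_le_nhdsSet (s := K) ⟨C.dom s, hb, ?_⟩) hχ1
    simp only [C.dom.left_inv (C.mem_dom s hs)]
  have hdq : ∀ s, u s ∈ C.chart.source → C.dom s ∈ B → ∀ f : M → ℝ,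
      dm 4 (fun x => χ x * f x) (u s) = dm 4 f (u s) := fun s hs hb f =>
    dm_congr ((hone s hs hb).mono fun x hx => by
      change χ x * f x = f x
      rw [hx, one_mul])
  -- Only the tangential coefficient matters.
  have hred : CurveExact u (ξ - fsmul (A (Sum.inl 0) (Sum.inl 1)) P) := by
    have e1 := CurveExact.fsmul_wedgeOne (u := u) (hA (Sum.inl 0) (Sum.inr 0)) (hq (Sum.inl 0))
      (hq (Sum.inr 0)) (hq0 0)
    have e2 := CurveExact.fsmul_wedgeOne (u := u) (hA (Sum.inl 0) (Sum.inr 1)) (hq (Sum.inl 0))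
      (hq (Sum.inr 1)) (hq0 1)
    have e3 := CurveExact.fsmul_wedgeOne (u := u) (hA (Sum.inl 1) (Sum.inr 0)) (hq (Sum.inl 1))
      (hq (Sum.inr 0)) (hq0 0)
    have e4 := CurveExact.fsmul_wedgeOne (u := u) (hA (Sum.inl 1) (Sum.inr 1)) (hq (Sum.inl 1))
      (hq (Sum.inr 1)) (hq0 1)
    have e5 := CurveExact.fsmul_wedgeOne (u := u) (hA (Sum.inr 0) (Sum.inr 1)) (hq (Sum.inr 0))
      (hq (Sum.inr 1)) (hq0 1)
    refine ((((e1.add e2).add e3).add e4).add e5).congr fun s => ?_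
    rcases hcase s with ⟨hs, hb⟩ | ⟨h0, hA0, -⟩
    · have hx : χ (u s) = 1 := (hone s hs hb).self_of_nhds
      have hd : ∀ i, (dfn (q i) : Form 4 M 1) (u s) = dfn (C.coord i) (u s) := fun i =>
        congrArg one (hdq s hs hb _)
      have hAA : ∀ i k, A i k (u s) = C.coeff ξ i k (u s) := fun i k => by
        simp only [A, hx, one_mul]
      have key := C.apply_eq_coeff ξ hs
      change A _ _ (u s) • wedge11 (dfn (q _) (u s)) (dfn (q _) (u s)) +
        A _ _ (u s) • wedge11 (dfn (q _) (u s)) (dfn (q _) (u s)) +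
        A _ _ (u s) • wedge11 (dfn (q _) (u s)) (dfn (q _) (u s)) +
        A _ _ (u s) • wedge11 (dfn (q _) (u s)) (dfn (q _) (u s)) +
        A _ _ (u s) • wedge11 (dfn (q _) (u s)) (dfn (q _) (u s)) =
        ξ (u s) - A _ _ (u s) • wedge11 (dfn (q _) (u s)) (dfn (q _) (u s))
      rw [eq_sub_iff_add_eq]
      simp only [hd, hAA]
      rw [key]
      abel
    · change A _ _ (u s) • _ + A _ _ (u s) • _ + A _ _ (u s) • _ + A _ _ (u s) • _ +
        A _ _ (u s) • _ = ξ (u s) - A _ _ (u s) • _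
      simp only [hA0, h0, zero_smul, add_zero, sub_zero]
  classical
  -- The tangential coefficient as a function of the coordinate on the curve, extended by zero.
  let f : E 2 → ℝ := fun z => if z ∈ V then C.coeff ξ (Sum.inl 0) (Sum.inl 1) (u (C.dom.symm z)) else 0
  have hfout : ∀ z, ¬ (∀ i, |z i - a i| < r) → f z = 0 := by
    intro z hz'
    simp only [f]
    split_ifs with hzV
    · refine hcoeff0 _ hzV.2 (hout _ hzV.2 ?_) _ _
      rwa [C.dom.right_inv hzV.1]
    · rfl
  have hf : ContDiff ℝ ∞ f := by
    rw [contDiff_iff_contDiffAt]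
    intro z
    by_cases hzV : z ∈ V
    · have h1 : ContDiffAt ℝ ∞ (fun z => pbE (𝓡 4) C.chart.symm ξ (C.e (z, 0))
          ![C.basisVec (Sum.inl 0), C.basisVec (Sum.inl 1)]) z := by
        have ht : C.e (z, 0) ∈ C.chart.target := by
          have := C.chart.map_source hzV.2
          rwa [C.chart_apply _ hzV.2, C.dom.right_inv hzV.1] at this
        refine contDiffAt_form_apply ?_ _
        refine ContDiffAt.comp (g := pbE (𝓡 4) C.chart.symm ξ) z (hξ.contDiffAt_pbE_symm C.mem ht) ?_
        exact (C.e.contDiff.comp (contDiff_id.prodMk contDiff_const)).contDiffAt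
      refine h1.congr_of_eventuallyEq ?_
      filter_upwards [hV.mem_nhds hzV] with w hw
      simp only [f, if_pos hw, SliceChart.coeff]
      rw [C.chart_apply _ hw.2, C.dom.right_inv hw.1]
    · refine (contDiffAt_const (c := (0 : ℝ))).congr_of_eventuallyEq ?_
      filter_upwards [hBc.isClosed.isOpen_compl.mem_nhds fun hb => hzV (hBV hb)] with w hw
      exact hfout w fun hb => hw (hsq w hb)
  obtain ⟨g, g', k, hg, hg', hg0, heq⟩ := hdiv f hf hfout
  refine ⟨k, ?_⟩
  -- In coordinates, dg∧dz₁ + dz₀∧dg' is (∂₀g + ∂₁g') dz₀∧dz₁, the divergence part of the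
  -- coefficient.
  have e1 := CurveExact.wedgeOne (u := u) (hz hg) (hq (Sum.inl 1))
  have e2 := CurveExact.wedgeOne (u := u) (hq (Sum.inl 0)) (hz hg')
  refine (hred.add (e1.add e2)).congr fun s => ?_
  suffices hs : (fsmul (A (Sum.inl 0) (Sum.inl 1)) P : Form 4 M 2) (u s) =
      (wedgeOne (dfn fun x => χ x * g (C.z x)) (dfn (q (Sum.inl 1))) : Form 4 M 2) (u s) +
      (wedgeOne (dfn (q (Sum.inl 0))) (dfn fun x => χ x * g' (C.z x)) : Form 4 M 2) (u s) +
      k • (fsmul (fun x => χ x * β (C.z x)) P : Form 4 M 2) (u s) by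
    change ξ (u s) - (fsmul (A (Sum.inl 0) (Sum.inl 1)) P : Form 4 M 2) (u s) + (_ + _) = ξ (u s) - k • _
    rw [hs]
    abel
  rcases hcase s with ⟨hs, hb⟩ | ⟨h0, hA0, hβs⟩
  · have hx : χ (u s) = 1 := (hone s hs hb).self_of_nhds
    have hfs : f (C.dom s) = C.coeff ξ (Sum.inl 0) (Sum.inl 1) (u s) := by
      simp only [f, if_pos (hdom s hs), C.dom.left_inv (C.mem_dom s hs)]
    have hchain : ∀ {G : E 2 → ℝ}, ContDiff ℝ ∞ G → ∀ v, dm 4 (fun x => χ x * G (C.z x)) (u s) v =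
        dm 4 (C.coord (Sum.inl 0)) (u s) v * fderiv ℝ G (C.dom s) (EuclideanSpace.single 0 1) +
        dm 4 (C.coord (Sum.inl 1)) (u s) v * fderiv ℝ G (C.dom s) (EuclideanSpace.single 1 1) := by
      intro G hG v
      rw [hdq s hs hb]
      have h1 := dm_comp (g := G) (f := C.z) (x := u s) (hG.differentiable (by simp) _)
        ((C.contMDiffAt_z hs).mdifferentiableAt (by simp)) v
      rw [show (fun x => G (C.z x)) = G ∘ C.z from rfl, h1, C.z_apply_u hs, C.dm_coord_inl hs,
        C.dm_coord_inl hs, ← smul_eq_mul, ← smul_eq_mul, ← map_smul, ← map_smul, ← map_add]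
      congr 1
      ext i
      fin_cases i <;> simp
    refine form2_ext fun v w => ?_
    change A _ _ (u s) * (dm 4 (q _) (u s) v * dm 4 (q _) (u s) w -
        dm 4 (q _) (u s) w * dm 4 (q _) (u s) v) =
      (dm 4 (fun x => χ x * g (C.z x)) (u s) v * dm 4 (q _) (u s) w -
        dm 4 (fun x => χ x * g (C.z x)) (u s) w * dm 4 (q _) (u s) v) +
      (dm 4 (q _) (u s) v * dm 4 (fun x => χ x * g' (C.z x)) (u s) w -
        dm 4 (q _) (u s) w * dm 4 (fun x => χ x * g' (C.z x)) (u s) v) +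
      k * ((χ (u s) * β (C.z (u s))) * (dm 4 (q _) (u s) v * dm 4 (q _) (u s) w -
        dm 4 (q _) (u s) w * dm 4 (q _) (u s) v))
    have hA1 : A (Sum.inl 0) (Sum.inl 1) (u s) = f (C.dom s) := by
      rw [hfs]
      simp only [A, hx, one_mul]
    rw [hA1, heq, hchain hg, hchain hg, hchain hg', hchain hg', hx, C.z_apply_u hs]
    simp only [q, hdq s hs hb]
    ring
  · have hd : ∀ {G : E 2 → ℝ}, (∀ z, ¬ (∀ i, |z i - a i| < r) → G z = 0) →
        ∀ v, dm 4 (fun x => χ x * G (C.z x)) (u s) v = 0 := by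
      intro G hG v
      rw [dm_congr (hβs G hG), dm_const]
      rfl
    refine form2_ext fun v w => ?_
    change A _ _ (u s) * _ = (dm 4 (fun x => χ x * g (C.z x)) (u s) v * _ -
        dm 4 (fun x => χ x * g (C.z x)) (u s) w * _) +
      (_ * dm 4 (fun x => χ x * g' (C.z x)) (u s) w -
        _ * dm 4 (fun x => χ x * g' (C.z x)) (u s) v) +
      k * ((χ (u s) * β (C.z (u s))) * _)
    rw [hA0, (hβs _ hβ0).self_of_nhds, hd fun z hz => (hg0 z hz).1, hd fun z hz => (hg0 z hz).1,
      hd fun z hz => (hg0 z hz).2, hd fun z hz => (hg0 z hz).2]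
    ring

theorem exists_bump_of_mem {O : Set M} (hO : IsOpen O) {x : M} (hx : x ∈ O) :
    ∃ φ : M → ℝ, ContMDiff (𝓡 4) 𝓘(ℝ, ℝ) ∞ φ ∧ (∀ y, 0 ≤ φ y) ∧ 0 < φ x ∧ ∀ y ∉ O, φ y = 0 := by
  have : LocallyCompactSpace M := ChartedSpace.locallyCompactSpace (E 4) M
  obtain ⟨K, hK, hxK, hKO⟩ := exists_compact_subset hO hx
  obtain ⟨χ, hχ1, hχ0, hχI⟩ := exists_contMDiffMap_one_nhds_of_subset_interior
    (n := (⊤ : ℕ∞)) (𝓡 4) (isClosed_singleton (x := x)) (t := K) (by simpa using hxK)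
  refine ⟨χ, χ.contMDiff, fun y => (hχI y).1, ?_, fun y hy => hχ0 y fun hc => hy (hKO hc)⟩
  rw [hχ1.self_of_nhdsSet x rfl]
  exact one_pos

/-- A form with zero integral over the curve is exact along the curve. -/
theorem HolCurve.curveExact {τ₀ : Form 4 M 2}
    {J : ∀ x : M, TangentSpace (𝓡 4) x →L[ℝ] TangentSpace (𝓡 4) x}
    {j : ∀ s : S, TangentSpace (𝓡 2) s →L[ℝ] TangentSpace (𝓡 2) s} (h : HolCurve τ₀ J j u)
    {ξ : Form 4 M 2} (hξ : IsSmoothForm ξ) (hint : curveIntegral j u ξ = 0) : CurveExact u ξ := by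
  choose O hO hmem ω₀ hω₀ hloc using h.exists_local_generator
  let s₀ : S := Classical.arbitrary S
  -- The points near which one fixed generator suffices. Connectedness of S makes this set
  -- everything once it is open and closed.
  let A : Set S := {s | ∃ O' : Set M, IsOpen O' ∧ u s ∈ O' ∧
      ∀ ξ : Form 4 M 2, IsSmoothForm ξ → (∀ s, u s ∉ O' → ξ (u s) = 0) →
        ∃ k : ℝ, CurveExact u (ξ - k • ω₀ s₀)}
  have hcomb : ∀ {a b c : Form 4 M 2} {k l : ℝ}, CurveExact u (a - k • b) → CurveExact u (b - l • c) →
      CurveExact u (a - (k * l) • c) := by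
    intro a b c k l h1 h2
    refine (h1.add (h2.smul k)).congr fun s => form2_ext fun v w => ?_
    change a (u s) ![v, w] - k * b (u s) ![v, w] + k * (b (u s) ![v, w] - l * c (u s) ![v, w]) =
      a (u s) ![v, w] - k * l * c (u s) ![v, w]
    ring
  have hinv : ∀ {a b : Form 4 M 2} {k : ℝ}, k ≠ 0 → CurveExact u (a - k • b) →
      CurveExact u (b - k⁻¹ • a) := by
    intro a b k hk h1
    refine (h1.smul (-k⁻¹)).congr fun s => form2_ext fun v w => ?_
    change -k⁻¹ * (a (u s) ![v, w] - k * b (u s) ![v, w]) = b (u s) ![v, w] - k⁻¹ * a (u s) ![v, w]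
    field_simp
    ring
  have hne : ∀ {a b : Form 4 M 2} {k : ℝ}, CurveExact u (a - k • b) → curveIntegral j u a ≠ 0 →
      k ≠ 0 := by
    rintro a b k h1 ha rfl
    refine ha (h.curveIntegral_eq_zero (h1.congr fun s => ?_))
    change a (u s) - (0 : ℝ) • b (u s) = a (u s)
    rw [zero_smul, sub_zero]
  have hAopen : IsOpen A := by
    rw [isOpen_iff_mem_nhds]
    rintro s ⟨O', hO', hs, hk⟩
    exact Filter.mem_of_superset ((hO'.preimage h.continuous).mem_nhds hs) fun t ht => ⟨O', hO', ht, hk⟩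
  have hAclosed : IsClosed A := by
    rw [← closure_subset_iff_isClosed]
    intro s hs
    obtain ⟨s', hs'O, O', hO', hs'O', hk⟩ :=
      mem_closure_iff.1 hs _ ((hO s).preimage h.continuous) (hmem s)
    -- On the overlap, φτ₀ has positive integral over the curve. It is a multiple of either
    -- generator up to exact terms; the multiple of the generator at s is nonzero, so that generator
    -- is a multiple of the fixed one.
    obtain ⟨φ, hφ, hφ0, hφpos, hφO⟩ := exists_bump_of_mem ((hO s).inter hO') ⟨hs'O, hs'O'⟩
    have hsm : IsSmoothForm (fsmul φ τ₀) := h.symp.smooth.fsmul hφ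
    have hz : ∀ x, x ∉ O s ∩ O' → fsmul φ τ₀ x = 0 := fun x hx => by
      change φ x • τ₀ x = 0
      rw [hφO x hx, zero_smul]
    obtain ⟨k₁, hk₁⟩ := hk _ hsm fun t ht => hz _ fun hc => ht hc.2
    obtain ⟨k₂, hk₂⟩ := hloc s _ hsm fun t ht => hz _ fun hc => ht hc.1
    have hk₂0 := hne hk₂ (h.curveIntegral_fsmul_pos hφ.continuous hφ0 hφpos).ne'
    refine ⟨O s, hO s, hmem s, fun ξ hξ hξ0 => ?_⟩
    obtain ⟨k, hk⟩ := hloc s ξ hξ hξ0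
    exact ⟨_, hcomb hk (hcomb (hinv hk₂0 hk₂) hk₁)⟩
  have hA : A = Set.univ := by
    refine IsClopen.eq_univ ⟨hAclosed, hAopen⟩ ⟨s₀, O s₀, hO s₀, hmem s₀, hloc s₀⟩
  have hA' : ∀ s, s ∈ A := fun s => hA ▸ Set.mem_univ s
  choose O' hO' hmem' hloc' using hA'
  have hglob : ∀ ξ : Form 4 M 2, IsSmoothForm ξ → ∃ k : ℝ, CurveExact u (ξ - k • ω₀ s₀) := by
    intro ξ hξ
    obtain ⟨t, ht⟩ := h.isCompact_range.elim_finite_subcover O' hO' (by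
      rintro _ ⟨s, rfl⟩
      exact Set.mem_iUnion.2 ⟨s, hmem' s⟩)
    have ht2 : Set.range u ⊆ ⋃ i : t, O' i := by
      refine ht.trans ?_
      simp only [Set.iUnion_subset_iff]
      intro i hi
      exact Set.subset_iUnion (fun i : t => O' i) ⟨i, hi⟩
    obtain ⟨χ, hχ⟩ := SmoothPartitionOfUnity.exists_isSubordinate (𝓡 4) h.isCompact_range.isClosed
      (fun i : t => O' i) (fun i => hO' i) ht2
    choose k hk using fun i : t => hloc' i (fsmul (χ i) ξ) (hξ.fsmul (χ i).contMDiff) (fun s hs => by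
      change χ i (u s) • ξ (u s) = 0
      rw [show χ i (u s) = 0 by
        by_contra hc
        exact hs (hχ i (subset_tsupport _ hc)), zero_smul])
    refine ⟨∑ i, k i, (CurveExact.sum Finset.univ fun i _ => hk i).congr fun s => ?_⟩
    have h1 := χ.sum_eq_one (Set.mem_range_self s)
    rw [finsum_eq_sum_of_fintype] at h1
    rw [Finset.sum_apply]
    change ∑ i, (χ i (u s) • ξ (u s) - k i • ω₀ s₀ (u s)) = ξ (u s) - (∑ i, k i) • ω₀ s₀ (u s)
    rw [Finset.sum_sub_distrib, ← Finset.sum_smul, ← Finset.sum_smul, h1, one_smul]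
  obtain ⟨k, hk⟩ := hglob ξ hξ
  obtain ⟨l, hl⟩ := hglob (fsmul (fun _ => 1) τ₀) (h.symp.smooth.fsmul contMDiff_const)
  have hpos := h.curveIntegral_fsmul_pos (f := fun _ => 1) continuous_const (fun _ => zero_le_one)
    (s := s₀) one_pos
  have hfin := hcomb hk (hinv (hne hl hpos.ne') hl)
  -- Up to exact terms ξ is a multiple of τ₀. A nonzero multiple would make the integral of τ₀ over
  -- the curve vanish.
  by_cases h0 : k * l⁻¹ = 0
  · rw [h0] at hfin
    refine hfin.congr fun s => ?_
    change ξ (u s) - (0 : ℝ) • _ = ξ (u s)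
    rw [zero_smul, sub_zero]
  · exact absurd hint fun hc => by
      have h2 := h.curveIntegral_eq_zero (hinv h0 hfin)
      have h3 : fsmul (fun _ => 1) τ₀ - (k * l⁻¹)⁻¹ • ξ =
          fsmul (fun _ => 1) τ₀ + (-(k * l⁻¹)⁻¹) • ξ := by
        funext x
        exact form2_ext fun v w => by
          change 1 * τ₀ x ![v, w] - (k * l⁻¹)⁻¹ * ξ x ![v, w] =
            1 * τ₀ x ![v, w] + -(k * l⁻¹)⁻¹ * ξ x ![v, w]
          ring
      rw [h3, h.curveIntegral_add (h.symp.smooth.fsmul contMDiff_const) (hξ.smul _),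
        h.curveIntegral_smul, hint, mul_zero, add_zero] at h2
      exact hpos.ne' h2

end CurveCohomology

/-! ### The Thom form represents the Poincaré dual class. -/

section Duality

variable {M : Type*} [TopologicalSpace M] [T2Space M] [SigmaCompactSpace M]
    [ChartedSpace (E 4) M] [IsManifold (𝓡 4) ∞ M]
    {S : Type*} [TopologicalSpace S] [T2Space S] [CompactSpace S] [ConnectedSpace S]
    [ChartedSpace (E 2) S] [IsManifold (𝓡 2) ∞ S]
    {V : Type*} [NormedAddCommGroup V] [InnerProductSpace ℂ V] [FiniteDimensional ℂ V]
    [CompleteSpace V]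
    {τ₀ : Form 4 M 2} {J : ∀ x : M, TangentSpace (𝓡 4) x →L[ℝ] TangentSpace (𝓡 4) x}
    {j : ∀ s : S, TangentSpace (𝓡 2) s →L[ℝ] TangentSpace (𝓡 2) s} {u : S → M}
    {D : NormalData J u V} {b : ℝ → ℝ}

theorem wedgeForm_add_right (α β β' : Form 4 M 2) :
    wedgeForm α (β + β') = wedgeForm α β + wedgeForm α β' :=
  funext fun _ => wedgeAlt_add_right _ _ _

theorem wedgeForm_add_left (α α' β : Form 4 M 2) :
    wedgeForm (α + α') β = wedgeForm α β + wedgeForm α' β :=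
  funext fun _ => wedgeAlt_add_left _ _ _

theorem wedgeForm_smul_left (r : ℝ) (α β : Form 4 M 2) :
    wedgeForm (r • α) β = r • wedgeForm α β :=
  funext fun _ => wedgeAlt_smul_left _ _ _

theorem wedgeForm_smul_right (r : ℝ) (α β : Form 4 M 2) :
    wedgeForm α (r • β) = r • wedgeForm α β :=
  funext fun _ => wedgeAlt_smul_right _ _ _

theorem wedgeForm_comm (α β : Form 4 M 2) : wedgeForm α β = wedgeForm β α :=
  funext fun _ => wedgeAlt_comm _ _

theorem HasCompactSuppForm.wedge_right (α : Form 4 M 2) {β : Form 4 M 2}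
    (h : HasCompactSuppForm β) : HasCompactSuppForm (wedgeForm α β) := by
  obtain ⟨K, hK, h0⟩ := h
  refine ⟨K, hK, fun x hx => ?_⟩
  change wedgeAlt (α x) (β x) = 0
  rw [h0 x hx, wedgeAlt_zero_right]

theorem HasExtDeriv.isSmoothForm {n : ℕ} {X : Type*} [TopologicalSpace X] [ChartedSpace (E n) X]
    [IsManifold (𝓡 n) ∞ X] {k : ℕ} {σ : Form n X k} {θ : Form n X (k + 1)}
    (hσ : IsSmoothForm σ) (h : HasExtDeriv σ θ) : IsSmoothForm θ := by
  obtain ⟨θ', hs, h'⟩ := exists_hasExtDeriv hσ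
  rwa [h.unique h']

/-- The primitive μ need not have compact support; multiplying it by a function equal to 1 near the
support of R changes nothing in the integrand. -/
theorem HolCurve.integral_exact_wedge_closed (h : HolCurve τ₀ J j u) {μ : Form 4 M 1}
    {θ R : Form 4 M 2} (hμ : IsSmoothForm μ) (hθ : HasExtDeriv μ θ) (hR : IsSmoothForm R)
    (hRc : IsClosedForm R) (hRs : HasCompactSuppForm R) :
    integral (symplecticPos τ₀) (fun x v => wedgeForm θ R x v) = 0 := by
  have : LocallyCompactSpace M := ChartedSpace.locallyCompactSpace (E 4) M
  obtain ⟨K, hK, hK0⟩ := hRs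
  obtain ⟨K', hK', hKK', -⟩ := exists_compact_between hK isOpen_univ (Set.subset_univ _)
  obtain ⟨χ, hχ1, hχ0, -⟩ := exists_contMDiffMap_one_nhds_of_subset_interior
    (n := (⊤ : ℕ∞)) (𝓡 4) hK.isClosed hKK'
  have hs := hμ.fsmul χ.contMDiff
  obtain ⟨θ', hθ's, hθ'⟩ := exists_hasExtDeriv hs
  rw [← integral_closed_wedge_exact h.isVolume (HolCurve.orientedBy τ₀) hR hRc hs
    ⟨K', hK', fun x hx => by
      change χ x • μ x = 0
      rw [hχ0 x hx, zero_smul]⟩ hθ']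
  congr 1
  funext x v
  rw [wedgeForm_comm]
  change wedgeAlt (R x) (θ x) v = wedgeAlt (R x) (θ' x) v
  by_cases hx : x ∈ K
  · rw [hθ.eq_of_eventuallyEq hθ' ?_]
    refine (Filter.eventually_of_mem (nhds_le_nhdsSet hx hχ1) fun y hy => ?_)
    change μ y = χ y • μ y
    rw [show χ y = 1 from hy, one_smul]
  · rw [hK0 x hx, wedgeAlt_zero_left, wedgeAlt_zero_left]

theorem HolCurve.curveIntegral_pos (h : HolCurve τ₀ J j u) : 0 < curveIntegral j u τ₀ := by
  have h1 := h.curveIntegral_fsmul_pos (f := fun _ => 1) continuous_const (fun _ => zero_le_one)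
    (s := Classical.arbitrary S) one_pos
  rwa [show fsmul (fun _ => 1) τ₀ = τ₀ from funext fun x => one_smul ℝ (τ₀ x)] at h1

namespace NormalData

theorem isSmoothForm_fsmul_eta (hb : Profile D.m b) (h0 : b 0 = 0) :
    IsSmoothForm (fsmul (fun x => b (D.F x) / D.F x) D.eta) :=
  D.isSmoothForm_eta.fsmul (D.contMDiff_comp_F (hb.contDiff_div h0))

theorem integral_wedge_thomForm_congr (h : HolCurve τ₀ J j u) {b' : ℝ → ℝ} (hb : Profile D.m b)
    (hb' : Profile D.m b') (h0 : b 0 = b' 0) {ζ : Form 4 M 2} (hζ : IsSmoothForm ζ)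
    (hζc : IsClosedForm ζ) :
    integral (symplecticPos τ₀) (fun x v => wedgeForm ζ (D.thomForm b) x v) =
      integral (symplecticPos τ₀) (fun x v => wedgeForm ζ (D.thomForm b') x v) := by
  have hd := hb.sub hb'
  have hd0 : b 0 - b' 0 = 0 := sub_eq_zero.2 h0
  have h1 := integral_closed_wedge_exact h.isVolume (HolCurve.orientedBy τ₀) hζ hζc
    (isSmoothForm_fsmul_eta hd hd0) (hasCompactSuppForm_fsmul_eta hd) (hasExtDeriv_thomForm hd hd0)
  have h2 : D.thomForm b = D.thomForm (fun t => b t - b' t) + D.thomForm b' := by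
    rw [thomForm_sub hb hb', sub_add_cancel]
  rw [h2, wedgeForm_add_right, integral_add_form h.isVolume (HolCurve.orientedBy τ₀)
    (hζ.wedge (isSmoothForm_thomForm hd)).isContTop (hζ.wedge (isSmoothForm_thomForm hb')).isContTop
    ((hasCompactSuppForm_thomForm hd).wedge_right _) ((hasCompactSuppForm_thomForm hb').wedge_right _),
    h1, zero_add]

/-- Rescaling keeps b(0), hence the class: the integral is constant in δ and equals its limit. -/
theorem integral_wedge_thomForm_eq_of_tendsto (h : HolCurve τ₀ J j u) (hb : Profile D.m b)
    {ζ : Form 4 M 2} (hζ : IsSmoothForm ζ) (hζc : IsClosedForm ζ) {I : ℝ}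
    (hI : Filter.Tendsto (fun δ : ℝ => integral (symplecticPos τ₀)
      (fun x v => wedgeForm ζ (D.thomForm fun t => b (t / δ ^ 2)) x v)) (𝓝[>] 0) (𝓝 I)) :
    integral (symplecticPos τ₀) (fun x v => wedgeForm ζ (D.thomForm b) x v) = I := by
  refine tendsto_nhds_unique (tendsto_const_nhds.congr' ?_) hI
  filter_upwards [Ioc_mem_nhdsGT (zero_lt_one' ℝ)] with δ hδ
  exact integral_wedge_thomForm_congr h hb (hb.scale D.m_pos hδ.1 hδ.2) (by simp) hζ hζc

/-- The Thom form is a multiple of the Poincaré dual of the curve. -/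
theorem exists_integral_wedge_thomForm_eq (h : HolCurve τ₀ J j u) (hb : Profile D.m b)
    (hb' : ∀ t, deriv b t ≤ 0) {t₀ : ℝ} (ht₀ : 0 < t₀) (hbt : deriv b t₀ < 0) :
    ∃ κ < 0, ∀ ζ : Form 4 M 2, IsSmoothForm ζ → IsClosedForm ζ →
      integral (symplecticPos τ₀) (fun x v => wedgeForm ζ (D.thomForm b) x v) =
        κ * curveIntegral j u ζ := by
  obtain ⟨I, hI0, hI⟩ := exists_tendsto_neg h hb hb' ht₀ hbt
  have hτI := integral_wedge_thomForm_eq_of_tendsto h hb h.symp.smooth h.symp.closed hI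
  have hA : 0 < curveIntegral j u τ₀ := h.curveIntegral_pos
  set A := curveIntegral j u τ₀
  refine ⟨I / A, div_neg_of_neg_of_pos hI0 hA, fun ζ hζ hζc => ?_⟩
  -- With this multiple of τ₀ removed, ζ has zero integral over the curve and is exact along it.
  set c := curveIntegral j u ζ / A with hc
  have hξs : IsSmoothForm (ζ + (-c) • τ₀) := hζ.add (h.symp.smooth.smul _)
  have hξ0 : curveIntegral j u (ζ + (-c) • τ₀) = 0 := by
    rw [h.curveIntegral_add hζ (h.symp.smooth.smul _), h.curveIntegral_smul, hc]
    change _ + -(_ / A) * A = 0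
    field_simp
    ring
  obtain ⟨μ, θ, hμ, hθ, hθu⟩ := h.curveExact hξs hξ0
  have hθs := hθ.isSmoothForm hμ
  have hclosed : ∀ {α β : Form 4 M 2}, IsSmoothForm α → IsSmoothForm β → IsClosedForm α →
      IsClosedForm β → ∀ r : ℝ, IsClosedForm (α + r • β) := by
    intro α β hα hβ hα' hβ' r
    have h1 := HasExtDeriv.add hα (hβ.smul r) hα' (HasExtDeriv.smul hβ' r)
    rwa [smul_zero, add_zero] at h1
  have hz := integral_wedge_thomForm_eq_of_tendsto h hb (hξs.add (hθs.smul (-1)))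
    (hclosed hξs hθs (hclosed hζ h.symp.smooth hζc h.symp.closed _) (hθ.isClosedForm hμ) _)
    (tendsto_integral_zero h hb (hξs.add (hθs.smul (-1))) fun s => by
      change (ζ + (-c) • τ₀) (u s) + (-1 : ℝ) • θ (u s) = 0
      rw [hθu]
      exact form2_ext fun v w => by
        change _ + -1 * _ = (0 : ℝ)
        rw [neg_one_mul, add_neg_cancel])
  have hR := isSmoothForm_thomForm hb
  have hRs := hasCompactSuppForm_thomForm hb
  have hx := h.integral_exact_wedge_closed hμ hθ hR (isClosedForm_thomForm hb h.emb) hRs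
  -- The first summand is closed and vanishes along the curve, so its integral is the limit 0; the
  -- exact form θ integrates to zero against the closed Thom form. Only cτ₀ contributes.
  have e : ζ = ((ζ + (-c) • τ₀) + (-1 : ℝ) • θ) + (θ + c • τ₀) := by
    funext x
    refine form2_ext fun v w => ?_
    change ζ x ![v, w] = ζ x ![v, w] + -c * τ₀ x ![v, w] + -1 * θ x ![v, w] +
      (θ x ![v, w] + c * τ₀ x ![v, w])
    ring
  have hadd : ∀ {α β : Form 4 M 2}, IsSmoothForm α → IsSmoothForm β →
      integral (symplecticPos τ₀) (fun x v => wedgeForm (α + β) (D.thomForm b) x v) =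
      integral (symplecticPos τ₀) (fun x v => wedgeForm α (D.thomForm b) x v) +
      integral (symplecticPos τ₀) (fun x v => wedgeForm β (D.thomForm b) x v) := by
    intro α β hα hβ
    rw [wedgeForm_add_left, integral_add_form h.isVolume (HolCurve.orientedBy τ₀)
      (hα.wedge hR).isContTop (hβ.wedge hR).isContTop (hRs.wedge_right _) (hRs.wedge_right _)]
  rw [e, hadd (hξs.add (hθs.smul (-1))) (hθs.add (h.symp.smooth.smul c)), hz,
    hadd hθs (h.symp.smooth.smul c), hx, wedgeForm_smul_left,
    integral_smul_form h.isVolume (HolCurve.orientedBy τ₀), hτI, ← e, hc]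
  ring

theorem isPoincareDual (h : HolCurve τ₀ J j u) (hb : Profile D.m b) {κ : ℝ} (hκ : κ < 0)
    (hint : ∀ ζ : Form 4 M 2, IsSmoothForm ζ → IsClosedForm ζ →
      integral (symplecticPos τ₀) (fun x v => wedgeForm ζ (D.thomForm b) x v) =
        κ * curveIntegral j u ζ) : IsPoincareDual τ₀ j u (κ⁻¹ • D.thomForm b) where
  smooth := (isSmoothForm_thomForm hb).smul _
  closed := by
    have h1 := HasExtDeriv.smul (isClosedForm_thomForm hb h.emb) κ⁻¹
    rwa [smul_zero] at h1
  integral_eq η hη hηc _ := by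
    change integral (symplecticPos τ₀) (fun x v => wedgeForm η (κ⁻¹ • D.thomForm b) x v) = _
    rw [wedgeForm_smul_right, integral_smul_form h.isVolume (HolCurve.orientedBy τ₀), hint η hη hηc,
      inv_mul_cancel_left₀ hκ.ne]

/-- The pairing is symmetric. The Thom formula holds for the chosen dual form, whatever its support,
while duality of that form may be tested on the compactly supported Thom form. -/
theorem selfIntersection_eq (h : HolCurve τ₀ J j u) (hb : Profile D.m b) {κ : ℝ} (hκ : κ < 0)
    (hint : ∀ ζ : Form 4 M 2, IsSmoothForm ζ → IsClosedForm ζ →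
      integral (symplecticPos τ₀) (fun x v => wedgeForm ζ (D.thomForm b) x v) =
        κ * curveIntegral j u ζ) :
    selfIntersection τ₀ j u = curveIntegral j u (κ⁻¹ • D.thomForm b) := by
  have ha := isPoincareDual h hb hκ hint
  have he : IsPoincareDual τ₀ j u (Classical.epsilon (IsPoincareDual τ₀ j u)) :=
    Classical.epsilon_spec ⟨_, ha⟩
  have hs : HasCompactSuppForm (κ⁻¹ • D.thomForm b) := by
    obtain ⟨K, hK, h0⟩ := hasCompactSuppForm_thomForm hb
    exact ⟨K, hK, fun x hx => by rw [Pi.smul_apply, h0 x hx, smul_zero]⟩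
  have h1 : integral (symplecticPos τ₀)
      (fun x v => wedgeForm (κ⁻¹ • D.thomForm b) (Classical.epsilon (IsPoincareDual τ₀ j u)) x v) = _ :=
    he.integral_eq _ ha.smooth ha.closed hs
  rw [← h1, wedgeForm_comm, wedgeForm_smul_right,
    integral_smul_form h.isVolume (HolCurve.orientedBy τ₀), hint _ he.smooth he.closed,
    inv_mul_cancel_left₀ hκ.ne]
  rfl

end NormalData

end Duality

/-! ### Lower bounds on complex lines near the curve. -/

section TamingEstimates

open scoped InnerProductSpace

theorem apply_eq_pbE_symm {n : ℕ} {X : Type*} [TopologicalSpace X] [ChartedSpace (E n) X]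
    [IsManifold (𝓡 n) ∞ X] {Ψ : OpenPartialHomeomorph X (E n)}
    (hΨ : Ψ ∈ IsManifold.maximalAtlas (𝓡 n) ∞ X) {k : ℕ} (σ : Form n X k) {x : X} (hx : x ∈ Ψ.source)
    (v : Fin k → TangentSpace (𝓡 n) x) :
    σ x v = pbE (𝓡 n) Ψ.symm σ (Ψ x) fun i => dm n Ψ x (v i) := by
  obtain ⟨y, hy, rfl⟩ : ∃ y ∈ Ψ.target, Ψ.symm y = x := ⟨Ψ x, Ψ.map_source hx, Ψ.left_inv hx⟩
  rw [Ψ.right_inv hy]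
  change _ = σ _ fun i => frameAt Ψ y (dm n Ψ _ (v i))
  simp only [frameAt_dm hΨ hy]

theorem pair_eq_pbE_symm {n : ℕ} {X : Type*} [TopologicalSpace X] [ChartedSpace (E n) X]
    [IsManifold (𝓡 n) ∞ X] {Ψ : OpenPartialHomeomorph X (E n)}
    (hΨ : Ψ ∈ IsManifold.maximalAtlas (𝓡 n) ∞ X) (σ : Form n X 2) {x : X} (hx : x ∈ Ψ.source)
    (v w : TangentSpace (𝓡 n) x) :
    σ x ![v, w] = pbE (𝓡 n) Ψ.symm σ (Ψ x) ![dm n Ψ x v, dm n Ψ x w] := by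
  rw [apply_eq_pbE_symm hΨ σ hx]
  congr 1
  funext i
  fin_cases i <;> rfl

theorem dm_apply_J {n : ℕ} {X : Type*} [TopologicalSpace X] [ChartedSpace (E n) X]
    [IsManifold (𝓡 n) ∞ X] {J : ∀ x : X, TangentSpace (𝓡 n) x →L[ℝ] TangentSpace (𝓡 n) x}
    {Ψ : OpenPartialHomeomorph X (E n)}
    (hΨ : Ψ ∈ IsManifold.maximalAtlas (𝓡 n) ∞ X) {x : X} (hx : x ∈ Ψ.source)
    (v : TangentSpace (𝓡 n) x) : dm n Ψ x (J x v) = Jc J Ψ (Ψ x) (dm n Ψ x v) := by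
  obtain ⟨y, hy, rfl⟩ : ∃ y ∈ Ψ.target, Ψ.symm y = x := ⟨Ψ x, Ψ.map_source hx, Ψ.left_inv hx⟩
  rw [Ψ.right_inv hy, ← dm_frameAt hΨ hy (Jc J Ψ y _), frameAt_Jc hΨ hy, frameAt_dm hΨ hy]

variable {M : Type*} [TopologicalSpace M] [T2Space M] [SigmaCompactSpace M]
    [ChartedSpace (E 4) M] [IsManifold (𝓡 4) ∞ M]
    {S : Type*} [TopologicalSpace S] [T2Space S] [CompactSpace S] [ConnectedSpace S]
    [ChartedSpace (E 2) S] [IsManifold (𝓡 2) ∞ S]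
    {V : Type*} [NormedAddCommGroup V] [InnerProductSpace ℂ V] [FiniteDimensional ℂ V]
    [CompleteSpace V]
    {τ₀ : Form 4 M 2} {J : ∀ x : M, TangentSpace (𝓡 4) x →L[ℝ] TangentSpace (𝓡 4) x}
    {j : ∀ s : S, TangentSpace (𝓡 2) s →L[ℝ] TangentSpace (𝓡 2) s} {u : S → M}
    {D : NormalData J u V}

theorem eventually_abs_sub_le_chart (hJ : IsAlmostComplex J) {σ : Form 4 M 2} (hσ : IsSmoothForm σ)
    (x₀ : M) {ε : ℝ} (hε : 0 < ε) : ∀ᶠ x in 𝓝 x₀, ∀ v : TangentSpace (𝓡 4) x,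
      |σ x ![v, J x v] - pbE (𝓡 4) (chartAt (E 4) x₀).symm σ (chartAt (E 4) x₀ x₀)
        ![dm 4 (chartAt (E 4) x₀) x v, Jc J (chartAt (E 4) x₀) (chartAt (E 4) x₀ x₀)
          (dm 4 (chartAt (E 4) x₀) x v)]| ≤ ε * ‖dm 4 (chartAt (E 4) x₀) x v‖ ^ 2 := by
  set Ψ := chartAt (E 4) x₀
  have hΨ : Ψ ∈ IsManifold.maximalAtlas (𝓡 4) ∞ M := IsManifold.chart_mem_maximalAtlas x₀
  have hx₀ : x₀ ∈ Ψ.source := mem_chart_source _ x₀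
  have h1 := eventually_abs_sub_le (hσ.contDiffAt_pbE_symm hΨ (Ψ.map_source hx₀)).continuousAt
    (contDiffAt_Jc hJ hΨ (Ψ.map_source hx₀)).continuousAt hε
  filter_upwards [(Ψ.continuousAt hx₀).eventually h1, Ψ.open_source.mem_nhds hx₀] with x hx hxs v
  have h2 := hx (dm 4 Ψ x v)
  rwa [← dm_apply_J hΨ hxs, ← pair_eq_pbE_symm hΨ σ hxs] at h2

theorem exists_le_tame (hJ : IsAlmostComplex J) (hτ : IsSmoothForm τ₀) (ht : Tames τ₀ J) (x₀ : M) :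
    ∃ c > 0, ∀ᶠ x in 𝓝 x₀, ∀ v : TangentSpace (𝓡 4) x,
      c * ‖dm 4 (chartAt (E 4) x₀) x v‖ ^ 2 ≤ τ₀ x ![v, J x v] := by
  have hΨ : chartAt (E 4) x₀ ∈ IsManifold.maximalAtlas (𝓡 4) ∞ M :=
    IsManifold.chart_mem_maximalAtlas x₀
  have hx₀ : x₀ ∈ (chartAt (E 4) x₀).source := mem_chart_source _ x₀
  obtain ⟨c, hc, hcv⟩ := exists_pos_le_form
    (Ω := pbE (𝓡 4) (chartAt (E 4) x₀).symm τ₀ (chartAt (E 4) x₀ x₀))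
    (A := Jc J (chartAt (E 4) x₀) (chartAt (E 4) x₀ x₀)) (by
      intro v hv
      obtain ⟨w, rfl⟩ := dm_surjective hΨ hx₀ v
      rw [← dm_apply_J hΨ hx₀, ← pair_eq_pbE_symm hΨ τ₀ hx₀]
      exact ht x₀ w fun h0 => hv (by rw [h0, map_zero]))
  refine ⟨c / 2, half_pos hc, ?_⟩
  filter_upwards [eventually_abs_sub_le_chart hJ hτ x₀ (half_pos hc)] with x hx v
  have h1 := (abs_le.1 (hx v)).1
  have h2 := hcv (dm 4 (chartAt (E 4) x₀) x v)
  linarith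

/-- Coefficients are frozen at x₀, where the form is nonnegative. The error is at most εc|v|², which
is at most ετ₀(v, Jv) because τ₀ tames J. -/
theorem eventually_neg_le (hJ : IsAlmostComplex J) (hτ : IsSmoothForm τ₀) (ht : Tames τ₀ J)
    {σ : Form 4 M 2} (hσ : IsSmoothForm σ) {x₀ : M}
    (h0 : ∀ v : TangentSpace (𝓡 4) x₀, 0 ≤ σ x₀ ![v, J x₀ v]) {ε : ℝ} (hε : 0 < ε) :
    ∀ᶠ x in 𝓝 x₀, ∀ v : TangentSpace (𝓡 4) x, -(ε * τ₀ x ![v, J x v]) ≤ σ x ![v, J x v] := by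
  have hΨ : chartAt (E 4) x₀ ∈ IsManifold.maximalAtlas (𝓡 4) ∞ M :=
    IsManifold.chart_mem_maximalAtlas x₀
  have hx₀ : x₀ ∈ (chartAt (E 4) x₀).source := mem_chart_source _ x₀
  obtain ⟨c, hc, hcv⟩ := exists_le_tame hJ hτ ht x₀
  filter_upwards [hcv, eventually_abs_sub_le_chart hJ hσ x₀ (mul_pos hε hc)] with x hx hx' v
  have h1 := (abs_le.1 (hx' v)).1
  obtain ⟨w, hw⟩ := dm_surjective hΨ hx₀ (dm 4 (chartAt (E 4) x₀) x v)
  rw [← hw, ← dm_apply_J hΨ hx₀, ← pair_eq_pbE_symm hΨ σ hx₀, hw] at h1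
  have h2 := h0 w
  have h3 := mul_le_mul_of_nonneg_left (hx v) hε.le
  linarith

/-- The pointwise inequality behind `HolCurve.exists_wedgeOne_ge`. -/
theorem neg_le_of_near_holomorphic {a e : ℂ} {p q C n F : ℝ} (hC : 0 ≤ C) (hn : 0 ≤ n) (hF : 0 ≤ F)
    (he : ‖e‖ ≤ C * F * n) (hp : |p| ≤ C * n) (hq : |q| ≤ C * n) :
    -((6 * C ^ 2) * (F * n) ^ 2) ≤
      2 * (a.re * (Complex.I * a + e).im - (Complex.I * a + e).re * a.im) -
        F * (2 * a.re * q - 2 * (Complex.I * a + e).re * p) := by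
  have h1 := Complex.abs_re_le_norm e
  have h2 := Complex.abs_im_le_norm e
  have e1 : (Complex.I * a + e).im = a.re + e.im := by simp
  have e2 : (Complex.I * a + e).re = -a.im + e.re := by simp
  rw [e1, e2]
  have hk : 0 ≤ C * F * n := by positivity
  obtain ⟨r1, r2⟩ := abs_le.1 (h1.trans he)
  obtain ⟨i1, i2⟩ := abs_le.1 (h2.trans he)
  have hFp : |F * p| ≤ C * F * n := by
    rw [abs_mul, abs_of_nonneg hF]
    calc F * |p| ≤ F * (C * n) := mul_le_mul_of_nonneg_left hp hF
      _ = C * F * n := by ring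
  have hFq : |F * q| ≤ C * F * n := by
    rw [abs_mul, abs_of_nonneg hF]
    calc F * |q| ≤ F * (C * n) := mul_le_mul_of_nonneg_left hq hF
      _ = C * F * n := by ring
  have sq_le : ∀ {t : ℝ}, |t| ≤ C * F * n → t ^ 2 ≤ (C * F * n) ^ 2 := fun ht =>
    sq_le_sq' (abs_le.1 ht).1 (abs_le.1 ht).2
  have s1 := sq_le (h1.trans he)
  have s2 := sq_le (h2.trans he)
  have s3 := sq_le hFp
  have s4 := sq_le hFq
  have key : 2 * (a.re * (a.re + e.im) - (-a.im + e.re) * a.im) -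
        F * (2 * a.re * q - 2 * (-a.im + e.re) * p) =
      2 * a.re ^ 2 + 2 * a.im ^ 2 + 2 * a.re * (e.im - F * q) - 2 * a.im * (e.re + F * p) +
        2 * e.re * (F * p) := by ring
  rw [key]
  have hk2 : (6 * C ^ 2) * (F * n) ^ 2 = 6 * (C * F * n) ^ 2 := by ring
  rw [hk2]
  -- The main term is 2|a|². Completing the squares in the real and imaginary parts of a absorbs the
  -- cross terms and leaves errors of size (CFn)².
  nlinarith [sq_nonneg (2 * a.re + (e.im - F * q)), sq_nonneg (2 * a.im - (e.re + F * p)),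
    sq_nonneg (e.im + F * q), sq_nonneg (e.re - F * p), sq_nonneg (e.re + F * p)]

/-- Here dF∧η is twice Re∧Im of ⟨W, dW⟩. The defect dW∘J − i dW vanishes on the curve, hence is
O(|W|), and pairing it with W gives O(F); the correction Fν is O(F) too. A complex linear functional
contributes a nonnegative term, so the loss is quadratic in these errors, of order F². -/
theorem HolCurve.eventually_wedgeOne_ge (h : HolCurve τ₀ J j u) (D : NormalData J u V)
    {ν : Form 4 M 1} (hν : IsSmoothForm ν) (s : S) : ∃ C ≥ 0, ∀ᶠ x in 𝓝 (u s),
      ∀ v : TangentSpace (𝓡 4) x, -(C * D.F x ^ 2 * τ₀ x ![v, J x v]) ≤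
        wedgeOne (dfn D.F) (D.eta - fsmul D.F ν) x ![v, J x v] := by
  set Ψ := chartAt (E 4) (u s) with hΨdef
  have hΨ : Ψ ∈ IsManifold.maximalAtlas (𝓡 4) ∞ M := IsManifold.chart_mem_maximalAtlas _
  have hs : u s ∈ Ψ.source := mem_chart_source _ _
  have hst := Ψ.map_source hs
  obtain ⟨c, hc, hcv⟩ := exists_le_tame h.acs h.symp.smooth h.tame (u s)
  have hW := D.normalMap.smooth
  let mulI : V →L[ℝ] V := (Complex.I • ContinuousLinearMap.id ℂ V).restrictScalars ℝ
  let L : E 4 → E 4 →L[ℝ] V := fun y => fderiv ℝ (D.W ∘ Ψ.symm) y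
  let A : E 4 → E 4 →L[ℝ] E 4 := Jc J Ψ
  -- The failure of W to be holomorphic, read in the chart.
  let f : M → E 4 →L[ℝ] V := fun x => (L (Ψ x)).comp (A (Ψ x)) - mulI.comp (L (Ψ x))
  have hL : ContDiffAt ℝ ∞ L (Ψ (u s)) :=
    (contDiffAt_comp_symm hΨ hs (hW _)).fderiv_right (m := ∞) (by simp)
  have hA : ContDiffAt ℝ ∞ A (Ψ (u s)) := contDiffAt_Jc h.acs hΨ hst
  have hf : ContMDiffAt (𝓡 4) 𝓘(ℝ, E 4 →L[ℝ] V) ∞ f (u s) :=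
    ((hL.clm_comp hA).sub (contDiffAt_const.clm_comp hL)).contMDiffAt.comp (u s)
      (contMDiffAt_of_mem hΨ hs)
  have hdW : ∀ x ∈ Ψ.source, ∀ v, dm 4 D.W x v = L (Ψ x) (dm 4 Ψ x v) := fun x hx v =>
    dm_eq_fderiv_comp_symm hΨ hx (D.normalMap.mdifferentiableAt x) v
  have hJv : ∀ x ∈ Ψ.source, ∀ v, dm 4 D.W x (J x v) =
      Complex.I • dm 4 D.W x v + f x (dm 4 Ψ x v) := by
    intro x hx v
    rw [hdW x hx, hdW x hx, dm_apply_J hΨ hx]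
    change L (Ψ x) (A (Ψ x) _) = Complex.I • L (Ψ x) _ +
      (L (Ψ x) (A (Ψ x) _) - Complex.I • L (Ψ x) _)
    rw [add_sub_cancel]
  have hf0 : ∀ᶠ x in 𝓝 (u s), x ∈ Set.range u → f x = 0 := by
    filter_upwards [Ψ.open_source.mem_nhds hs] with x hx
    rintro ⟨t, rfl⟩
    refine ContinuousLinearMap.ext fun w => ?_
    obtain ⟨v, rfl⟩ := dm_surjective hΨ hx w
    have h1 := hJv _ hx v
    rw [D.normalMap.apply_J, left_eq_add] at h1
    exact h1
  obtain ⟨C₁, hC₁, hC₁f⟩ := D.normalMap.eventually_norm_le h.emb hf hf0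
  have hn : ContinuousAt (fun y => pbE (𝓡 4) Ψ.symm ν y) (Ψ (u s)) :=
    (hν.contDiffAt_pbE_symm hΨ hst).continuousAt
  obtain ⟨N, hN⟩ : ∃ N, N = ‖pbE (𝓡 4) Ψ.symm ν (Ψ (u s))‖ + 1 := ⟨_, rfl⟩
  obtain ⟨B, hB⟩ : ∃ B, B = ‖A (Ψ (u s))‖ + 1 := ⟨_, rfl⟩
  have hN1 : ∀ᶠ x in 𝓝 (u s), ‖pbE (𝓡 4) Ψ.symm ν (Ψ x)‖ < N :=
    (Ψ.continuousAt hs).eventually (hn.norm.eventually (gt_mem_nhds (by rw [hN]; exact lt_add_one _)))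
  have hB1 : ∀ᶠ x in 𝓝 (u s), ‖A (Ψ x)‖ < B := (Ψ.continuousAt hs).eventually
    (hA.continuousAt.norm.eventually (gt_mem_nhds (by rw [hB]; exact lt_add_one _)))
  have hN0 : 0 ≤ N := by rw [hN]; positivity
  have hB0 : 0 ≤ B := by rw [hB]; positivity
  -- One constant for three bounds: C₁ for the defect, N for ν(v) and N·B for ν(Jv).
  let C := C₁ + N + N * B
  have hC : 0 ≤ C := by positivity
  have hFs : D.F (u s) < D.m := by
    rw [(D.F_eq_zero _).2 ⟨s, rfl⟩]
    exact D.m_pos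
  refine ⟨6 * C ^ 2 / c, by positivity, ?_⟩
  filter_upwards [hcv, hC₁f, hN1, hB1, Ψ.open_source.mem_nhds hs, D.eventually_lt hFs] with
    x hτ hfx hNx hBx hx hFx v
  set w := dm 4 Ψ x v with hw
  have hν1 : ∀ v', |ν x ![v']| ≤ N * ‖dm 4 Ψ x v'‖ := by
    intro v'
    have h1 := (pbE (𝓡 4) Ψ.symm ν (Ψ x)).le_opNorm fun i => dm 4 Ψ x (![v'] i)
    rw [Fin.prod_univ_one] at h1
    rw [apply_eq_pbE_symm hΨ ν hx]
    refine h1.trans ?_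
    exact mul_le_mul_of_nonneg_right hNx.le (norm_nonneg _)
  have hF2 := D.F_eq x hFx
  have he : ‖⟪D.W x, f x w⟫_ℂ‖ ≤ C * D.F x * ‖w‖ := by
    calc ‖⟪D.W x, f x w⟫_ℂ‖ ≤ ‖D.W x‖ * (C₁ * ‖D.W x‖ * ‖w‖) :=
          (norm_inner_le_norm _ _).trans (mul_le_mul_of_nonneg_left
            (((f x).le_opNorm w).trans (mul_le_mul_of_nonneg_right hfx (norm_nonneg _)))
            (norm_nonneg _))
      _ = C₁ * D.F x * ‖w‖ := by rw [hF2]; ring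
      _ ≤ C * D.F x * ‖w‖ := by
        refine mul_le_mul_of_nonneg_right (mul_le_mul_of_nonneg_right ?_ (D.F_nonneg x)) (norm_nonneg _)
        simp only [C]
        nlinarith [mul_nonneg hN0 hB0]
  have hp : |ν x ![v]| ≤ C * ‖w‖ := (hν1 v).trans (mul_le_mul_of_nonneg_right (by
    simp only [C]
    nlinarith [mul_nonneg hN0 hB0]) (norm_nonneg _))
  have hq : |ν x ![J x v]| ≤ C * ‖w‖ := by
    refine (hν1 _).trans ?_
    rw [dm_apply_J hΨ hx]
    calc N * ‖A (Ψ x) w‖ ≤ N * (B * ‖w‖) := mul_le_mul_of_nonneg_left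
          (((A (Ψ x)).le_opNorm w).trans (mul_le_mul_of_nonneg_right hBx.le (norm_nonneg _))) hN0
      _ = N * B * ‖w‖ := by ring
      _ ≤ C * ‖w‖ := mul_le_mul_of_nonneg_right (by simp only [C]; linarith) (norm_nonneg _)
  have key := neg_le_of_near_holomorphic (a := ⟪D.W x, dm 4 D.W x v⟫_ℂ) hC (norm_nonneg w)
    (D.F_nonneg x) he hp hq
  have hin : ⟪D.W x, dm 4 D.W x (J x v)⟫_ℂ =
      Complex.I * ⟪D.W x, dm 4 D.W x v⟫_ℂ + ⟪D.W x, f x w⟫_ℂ := by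
    rw [hJv x hx, inner_add_right, inner_smul_right]
  rw [← hin] at key
  have hval : wedgeOne (dfn D.F) (D.eta - fsmul D.F ν) x ![v, J x v] =
      2 * ((⟪D.W x, dm 4 D.W x v⟫_ℂ).re * (⟪D.W x, dm 4 D.W x (J x v)⟫_ℂ).im -
        (⟪D.W x, dm 4 D.W x (J x v)⟫_ℂ).re * (⟪D.W x, dm 4 D.W x v⟫_ℂ).im) -
      D.F x * (2 * (⟪D.W x, dm 4 D.W x v⟫_ℂ).re * ν x ![J x v] -
        2 * (⟪D.W x, dm 4 D.W x (J x v)⟫_ℂ).re * ν x ![v]) := by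
    change dm 4 D.F x v * (D.eta x ![J x v] - D.F x * ν x ![J x v]) -
      dm 4 D.F x (J x v) * (D.eta x ![v] - D.F x * ν x ![v]) = _
    rw [NormalData.dm_F hFx, NormalData.dm_F hFx, D.eta_apply, D.eta_apply]
    ring
  rw [hval]
  refine le_trans (neg_le_neg ?_) key
  have h3 := mul_le_mul_of_nonneg_left (hτ v) (show 0 ≤ 6 * C ^ 2 / c * D.F x ^ 2 by positivity)
  have h4 : ∀ a n : ℝ, 6 * C ^ 2 * (a * n) ^ 2 = 6 * C ^ 2 / c * a ^ 2 * (c * n ^ 2) := by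
    intro a n
    field_simp
  exact (h4 _ _).le.trans h3

theorem HolCurve.tame_nonneg (h : HolCurve τ₀ J j u) (x : M) (v : TangentSpace (𝓡 4) x) :
    0 ≤ τ₀ x ![v, J x v] := by
  by_cases hv : v = 0
  · rw [hv, map_zero, form2_self]
  · exact (h.tame x v hv).le

theorem HolCurve.exists_wedgeOne_ge (h : HolCurve τ₀ J j u) (D : NormalData J u V)
    {ν : Form 4 M 1} (hν : IsSmoothForm ν) : ∃ C ≥ 0, ∃ ε > 0, ∀ x, D.F x < ε →
      ∀ v : TangentSpace (𝓡 4) x, -(C * D.F x ^ 2 * τ₀ x ![v, J x v]) ≤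
        wedgeOne (dfn D.F) (D.eta - fsmul D.F ν) x ![v, J x v] := by
  choose C hC0 hC using h.eventually_wedgeOne_ge D hν
  choose O hO hOopen hmem using fun s => eventually_nhds_iff.1 (hC s)
  obtain ⟨t, ht⟩ := h.isCompact_range.elim_finite_subcover O hOopen (by
    rintro _ ⟨s, rfl⟩
    exact Set.mem_iUnion.2 ⟨s, hmem s⟩)
  obtain ⟨ε, hε, hεO⟩ := D.exists_forall_mem_of_lt (isOpen_biUnion fun i (_ : i ∈ t) => hOopen i) ht
  -- The sum dominates each of the finitely many local constants.
  refine ⟨∑ i ∈ t, C i, Finset.sum_nonneg fun i _ => hC0 i, ε, hε, fun x hx v => ?_⟩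
  obtain ⟨i, hi, hxi⟩ := Set.mem_iUnion₂.1 (hεO x hx)
  refine le_trans (neg_le_neg ?_) (hO i x hxi v)
  exact mul_le_mul_of_nonneg_right (mul_le_mul_of_nonneg_right
    (Finset.single_le_sum (fun i _ => hC0 i) hi) (sq_nonneg _)) (h.tame_nonneg x v)

theorem HolCurve.exists_neg_le (h : HolCurve τ₀ J j u) (D : NormalData J u V) {σ : Form 4 M 2}
    (hσ : IsSmoothForm σ) (h0 : ∀ (s : S) (v : TangentSpace (𝓡 4) (u s)), 0 ≤ σ (u s) ![v, J (u s) v])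
    {ε : ℝ} (hε : 0 < ε) : ∃ δ > 0, ∀ x, D.F x < δ → ∀ v : TangentSpace (𝓡 4) x,
      -(ε * τ₀ x ![v, J x v]) ≤ σ x ![v, J x v] := by
  choose O hO hOopen hmem using fun s => eventually_nhds_iff.1
    (eventually_neg_le h.acs h.symp.smooth h.tame hσ (h0 s) hε)
  obtain ⟨δ, hδ, hδO⟩ := D.exists_forall_mem_of_lt (isOpen_iUnion hOopen) (by
    rintro _ ⟨s, rfl⟩
    exact Set.mem_iUnion.2 ⟨s, hmem s⟩)
  refine ⟨δ, hδ, fun x hx => ?_⟩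
  obtain ⟨i, hi⟩ := Set.mem_iUnion.1 (hδO x hx)
  exact hO i x hi

end TamingEstimates

/-! ### Logarithmic cutoff functions. -/

section Cutoff

theorem exists_norm_deriv_smoothTransition_le : ∃ C > 0, ∀ x, |deriv Real.smoothTransition x| ≤ C := by
  have hc : Continuous (deriv Real.smoothTransition) :=
    (Real.smoothTransition.contDiff (n := (1 : ℕ∞))).continuous_deriv (by simp)
  have hs : HasCompactSupport (deriv Real.smoothTransition) := by
    refine HasCompactSupport.intro (isCompact_Icc (a := (0 : ℝ)) (b := 1)) fun x hx => ?_
    rw [Set.mem_Icc, not_and_or, not_le, not_le] at hx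
    rcases hx with hx | hx
    · rw [Filter.EventuallyEq.deriv_eq (f := fun _ => (0 : ℝ)), deriv_const]
      filter_upwards [Iio_mem_nhds hx] with y hy
      exact Real.smoothTransition.zero_of_nonpos (le_of_lt hy)
    · rw [Filter.EventuallyEq.deriv_eq (f := fun _ => (1 : ℝ)), deriv_const]
      filter_upwards [Ioi_mem_nhds hx] with y hy
      exact Real.smoothTransition.one_of_one_le (le_of_lt hy)
  obtain ⟨C, hC⟩ := hc.bounded_above_of_compact_support hs
  exact ⟨|C| + 1, by positivity, fun x => ((Real.norm_eq_abs _).symm.le.trans (hC x)).trans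
    ((le_abs_self C).trans (le_add_of_nonneg_right zero_le_one))⟩

/-- Logarithmic cutoff functions. -/
theorem exists_log_cutoff {T ε : ℝ} (hT : 0 < T) (hε : 0 < ε) : ∃ b : ℝ → ℝ, ContDiff ℝ ∞ b ∧
    b 0 = 1 ∧ (∃ t₀ > 0, ∀ t < t₀, b t = 1) ∧ (∀ t ≥ T, b t = 0) ∧ (∀ t, 0 ≤ b t ∧ b t ≤ 1) ∧
    ∀ t, deriv b t ≤ 0 ∧ |t * deriv b t| ≤ ε := by
  obtain ⟨C, hC, hCb⟩ := exists_norm_deriv_smoothTransition_le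
  set e := ε / C with he
  have he0 : 0 < e := div_pos hε hC
  -- Since t l'(t) = e, the quantity t b'(t) is bounded by Ce = ε however small T is. The function l
  -- rises from 0 at t₀ = T exp(−1/e) to 1 at T.
  let l : ℝ → ℝ := fun t => 1 + e * Real.log (t / T)
  let t₀ := T * Real.exp (-(1 / e))
  have ht₀ : 0 < t₀ := mul_pos hT (Real.exp_pos _)
  let b : ℝ → ℝ := fun t => if t < t₀ then 1 else 1 - Real.smoothTransition (l t)
  have hb1 : ∀ t < t₀, b t = 1 := fun t ht => if_pos ht
  have hb2 : ∀ t > 0, b t = 1 - Real.smoothTransition (l t) := by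
    intro t ht
    by_cases h : t < t₀
    · have h1 : l t ≤ 0 := by
        have h2 : Real.log (t / T) ≤ -(1 / e) := by
          rw [Real.log_le_iff_le_exp (by positivity), div_le_iff₀ hT, mul_comm]
          exact h.le
        calc l t ≤ 1 + e * -(1 / e) := by
              simp only [l]
              gcongr
          _ = 0 := by field_simp; ring
      rw [hb1 t h, Real.smoothTransition.zero_of_nonpos h1, sub_zero]
    · exact if_neg h
  have hl : ∀ t > 0, HasDerivAt l (e / t) t := by
    intro t ht
    have h1 := ((hasDerivAt_id t).div_const T).log (by positivity)
    have h2 := (h1.const_mul e).const_add 1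
    have h3 : e * (1 / T / (t / T)) = e / t := by field_simp
    exact h2.congr_deriv h3
  have hder : ∀ t > 0, deriv b t = -(deriv Real.smoothTransition (l t) * (e / t)) := by
    intro t ht
    have h1 : HasDerivAt Real.smoothTransition (deriv Real.smoothTransition (l t)) (l t) :=
      (((Real.smoothTransition.contDiff (n := (1 : ℕ∞))).differentiable (by simp)) _).hasDerivAt
    have h2 := (h1.comp t (hl t ht)).const_sub 1
    rw [← h2.deriv]
    refine Filter.EventuallyEq.deriv_eq ?_
    filter_upwards [Ioi_mem_nhds ht] with s hs
    exact hb2 s hs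
  have hder0 : ∀ t < t₀, deriv b t = 0 := by
    intro t ht
    rw [Filter.EventuallyEq.deriv_eq (f := fun _ => (1 : ℝ)), deriv_const]
    filter_upwards [Iio_mem_nhds ht] with s hs
    exact hb1 s hs
  refine ⟨b, ?_, hb1 0 ht₀, ⟨t₀, ht₀, hb1⟩, fun t ht => ?_, fun t => ?_, fun t => ?_⟩
  · rw [contDiff_iff_contDiffAt]
    intro t
    rcases lt_or_ge t t₀ with h | h
    · refine (contDiffAt_const (c := (1 : ℝ))).congr_of_eventuallyEq ?_
      filter_upwards [Iio_mem_nhds h] with s hs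
      exact hb1 s hs
    · have ht : 0 < t := ht₀.trans_le h
      have h1 : ContDiffAt ℝ ∞ (fun t => 1 - Real.smoothTransition (l t)) t := by
        refine contDiffAt_const.sub (Real.smoothTransition.contDiffAt.comp t ?_)
        refine contDiffAt_const.add (contDiffAt_const.mul ((contDiffAt_id.div_const T).log ?_))
        simp only [id]
        positivity
      refine h1.congr_of_eventuallyEq ?_
      filter_upwards [Ioi_mem_nhds ht] with s hs
      exact hb2 s hs
  · have ht0 : 0 < t := hT.trans_le ht
    rw [hb2 t ht0, Real.smoothTransition.one_of_one_le, sub_self]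
    have h1 := Real.log_nonneg ((one_le_div hT).2 ht)
    have := mul_nonneg he0.le h1
    simp only [l]
    linarith
  · rcases lt_or_ge t t₀ with h | h
    · rw [hb1 t h]
      exact ⟨zero_le_one, le_rfl⟩
    · rw [hb2 t (ht₀.trans_le h)]
      exact ⟨sub_nonneg.2 (Real.smoothTransition.le_one _),
        sub_le_self _ (Real.smoothTransition.nonneg _)⟩
  · rcases lt_or_ge t t₀ with h | h
    · rw [hder0 t h, mul_zero, abs_zero]
      exact ⟨le_rfl, hε.le⟩
    · have ht : 0 < t := ht₀.trans_le h
      rw [hder t ht]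
      constructor
      · have h1 : 0 ≤ deriv Real.smoothTransition (l t) := Real.smoothTransition.monotone.deriv_nonneg
        exact neg_nonpos.2 (by positivity)
      · have h1 : t * -(deriv Real.smoothTransition (l t) * (e / t)) =
            -(deriv Real.smoothTransition (l t) * e) := by field_simp
        rw [h1, abs_neg, abs_mul, abs_of_pos he0]
        calc |deriv Real.smoothTransition (l t)| * e ≤ C * e :=
              mul_le_mul_of_nonneg_right (hCb _) he0.le
          _ = ε := by rw [he]; field_simp

end Cutoff

/-! ### Almost nonnegative representatives and the inflated family. -/

section Inflating

variable {M : Type*} [TopologicalSpace M] [T2Space M] [SigmaCompactSpace M]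
    [ChartedSpace (E 4) M] [IsManifold (𝓡 4) ∞ M]
    {S : Type*} [TopologicalSpace S] [T2Space S] [CompactSpace S] [ConnectedSpace S]
    [ChartedSpace (E 2) S] [IsManifold (𝓡 2) ∞ S]
    {V : Type*} [NormedAddCommGroup V] [InnerProductSpace ℂ V] [FiniteDimensional ℂ V]
    [CompleteSpace V]
    {τ₀ : Form 4 M 2} {J : ∀ x : M, TangentSpace (𝓡 4) x →L[ℝ] TangentSpace (𝓡 4) x}
    {j : ∀ s : S, TangentSpace (𝓡 2) s →L[ℝ] TangentSpace (𝓡 2) s} {u : S → M}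
    {D : NormalData J u V}

theorem Profile.exists_deriv_neg {m : ℝ} {b : ℝ → ℝ} (hb : Profile m b) (h1 : b 0 = 1)
    (hb' : ∀ t, _root_.deriv b t ≤ 0) : ∃ t₀ > 0, _root_.deriv b t₀ < 0 := by
  by_contra! hn
  obtain ⟨t₀, ht₀, h0⟩ := hb.deriv_eq_zero
  obtain ⟨t₁, -, hz⟩ := hb.eq_zero
  have hd : ∀ t, _root_.deriv b t = 0 := fun t => by
    rcases lt_or_ge t t₀ with h | h
    · exact h0 t h
    · exact le_antisymm (hb' t) (hn t (ht₀.trans_le h))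
  have h2 := is_const_of_deriv_eq_zero (hb.smooth.differentiable (by simp)) hd 0 (t₁ + 1)
  rw [h1, hz _ (lt_add_one _)] at h2
  exact one_ne_zero h2

/-- A representative of the Poincaré dual class which is almost nonnegative on complex lines. -/
theorem HolCurve.exists_profile_neg_le (h : HolCurve τ₀ J j u) (D : NormalData J u V) {κ : ℝ} (hκ : κ < 0)
    {μ : Form 4 M 1} {θ : Form 4 M 2} (hμ : IsSmoothForm μ) (hθ : IsSmoothForm θ)
    (h0 : ∀ (s : S) (v : TangentSpace (𝓡 4) (u s)),
      0 ≤ (κ⁻¹ • D.kappa + (-1 : ℝ) • θ) (u s) ![v, J (u s) v]) {ε : ℝ} (hε : 0 < ε) :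
    ∃ b : ℝ → ℝ, Profile D.m b ∧ b 0 = 1 ∧ (∀ t, deriv b t ≤ 0) ∧
      ∀ x (v : TangentSpace (𝓡 4) x), -(ε * τ₀ x ![v, J x v]) ≤
        (κ⁻¹ • D.thomForm b + (-1 : ℝ) •
          (wedgeOne (dfn fun x => b (D.F x)) μ + fsmul (fun x => b (D.F x)) θ)) x ![v, J x v] := by
  -- The choice ν = κμ: factoring κ⁻¹b'(F)/F out of the two terms with dF leaves dF∧(η − κFμ).
  obtain ⟨C, hC, δ₁, hδ₁, h1⟩ := h.exists_wedgeOne_ge D (hμ.smul κ)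
  obtain ⟨δ₂, hδ₂, h2⟩ := h.exists_neg_le D ((D.isSmoothForm_kappa.smul κ⁻¹).add (hθ.smul (-1))) h0
    (half_pos hε)
  obtain ⟨T, hT, hT1, hT2, hTm⟩ : ∃ T > 0, T ≤ δ₁ ∧ T ≤ δ₂ ∧ T < D.m :=
    ⟨min (min δ₁ δ₂) (D.m / 2), lt_min (lt_min hδ₁ hδ₂) (half_pos D.m_pos),
      (min_le_left _ _).trans (min_le_left _ _), (min_le_left _ _).trans (min_le_right _ _),
      (min_le_right _ _).trans_lt (half_lt_self D.m_pos)⟩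
  have hκ' : 0 < -κ := neg_pos.2 hκ
  -- This bound on |t b'(t)|, multiplied by C/|κ|, stays below ε/2; the denominator C + 1 allows C =
  -- 0.
  obtain ⟨b, hb, hb0, ⟨t₀, ht₀, hbc⟩, hbT, hb01, hb'⟩ := exists_log_cutoff (ε := ε / 2 * (-κ) / (C + 1)) hT
    (by positivity)
  have hprof : Profile D.m b := ⟨hb, ⟨t₀, ht₀, fun t ht => by rw [hbc t ht, hb0]⟩,
    ⟨T, hTm, fun t ht => hbT t ht.le⟩⟩
  refine ⟨b, hprof, hb0, fun t => (hb' t).1, fun x v => ?_⟩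
  have hτ := h.tame_nonneg x v
  have hdb : ∀ w, dm 4 (fun x => b (D.F x)) x w = deriv b (D.F x) * dm 4 D.F x w := fun w =>
    NormalData.dm_comp_F (hb.differentiable (by simp) _) w
  have hval : (κ⁻¹ • D.thomForm b + (-1 : ℝ) •
        (wedgeOne (dfn fun x => b (D.F x)) μ + fsmul (fun x => b (D.F x)) θ)) x ![v, J x v] =
      κ⁻¹ * (deriv b (D.F x) / D.F x * wedgeOne (dfn D.F) D.eta x ![v, J x v]) -
        deriv b (D.F x) * wedgeOne (dfn D.F) μ x ![v, J x v] +
      b (D.F x) * (κ⁻¹ • D.kappa + (-1 : ℝ) • θ) x ![v, J x v] := by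
    change κ⁻¹ * D.thomForm b x ![v, J x v] + -1 * (dm 4 (fun x => b (D.F x)) x v * μ x ![J x v] -
      dm 4 (fun x => b (D.F x)) x (J x v) * μ x ![v] + b (D.F x) * θ x ![v, J x v]) =
      _ - deriv b (D.F x) * (dm 4 D.F x v * μ x ![J x v] - dm 4 D.F x (J x v) * μ x ![v]) +
      b (D.F x) * (κ⁻¹ * D.kappa x ![v, J x v] + -1 * θ x ![v, J x v])
    rw [D.thomForm_apply, hdb, hdb]
    ring
  rw [hval]
  rcases le_or_gt T (D.F x) with hF | hF
  · have hd : deriv b (D.F x) = 0 := by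
      -- At F x ≥ T the nonnegative b attains its minimum 0, so b' vanishes, even at the endpoint T.
      have : IsMinOn b Set.univ (D.F x) := fun t _ => by
        change b (D.F x) ≤ b t
        rw [hbT _ hF]
        exact (hb01 t).1
      exact (this.isLocalMin Filter.univ_mem).deriv_eq_zero
    rw [hd, hbT _ hF]
    have := mul_nonneg hε.le hτ
    simp only [zero_div, zero_mul, mul_zero, sub_zero, add_zero]
    linarith
  · have e2 : -(ε / 2 * τ₀ x ![v, J x v]) ≤
        b (D.F x) * (κ⁻¹ • D.kappa + (-1 : ℝ) • θ) x ![v, J x v] := by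
      have h3 := mul_le_mul_of_nonneg_left (h2 x (hF.trans_le hT2) v) (hb01 (D.F x)).1
      have h4 := mul_le_mul_of_nonneg_right (hb01 (D.F x)).2 (mul_nonneg (half_pos hε).le hτ)
      linarith
    have e1 : -(ε / 2 * τ₀ x ![v, J x v]) ≤
        κ⁻¹ * (deriv b (D.F x) / D.F x * wedgeOne (dfn D.F) D.eta x ![v, J x v]) -
          deriv b (D.F x) * wedgeOne (dfn D.F) μ x ![v, J x v] := by
      rcases (D.F_nonneg x).eq_or_lt with hF0 | hF0
      · rw [← hF0, hprof.deriv_zero]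
        have := mul_nonneg (half_pos hε).le hτ
        simp only [zero_div, zero_mul, mul_zero, sub_zero]
        linarith
      · have h3 := h1 x (hF.trans_le hT1) v
        have h4 : wedgeOne (dfn D.F) (D.eta - fsmul D.F (κ • μ)) x ![v, J x v] =
            wedgeOne (dfn D.F) D.eta x ![v, J x v] -
              D.F x * κ * wedgeOne (dfn D.F) μ x ![v, J x v] := by
          change dm 4 D.F x v * (D.eta x ![J x v] - D.F x * (κ * μ x ![J x v])) -
            dm 4 D.F x (J x v) * (D.eta x ![v] - D.F x * (κ * μ x ![v])) =
            (dm 4 D.F x v * D.eta x ![J x v] - dm 4 D.F x (J x v) * D.eta x ![v]) -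
            D.F x * κ * (dm 4 D.F x v * μ x ![J x v] - dm 4 D.F x (J x v) * μ x ![v])
          ring
        rw [h4] at h3
        -- Both κ and b' are nonpositive, so the factor in front of the wedge product is nonnegative
        -- and the lower bound survives multiplication.
        have hp : 0 ≤ κ⁻¹ * (deriv b (D.F x) / D.F x) := mul_nonneg_of_nonpos_of_nonpos
          (inv_nonpos.2 hκ.le) (div_nonpos_of_nonpos_of_nonneg (hb' _).1 hF0.le)
        have h5 := mul_le_mul_of_nonneg_left h3 hp
        have e5 : κ⁻¹ * (deriv b (D.F x) / D.F x) * (wedgeOne (dfn D.F) D.eta x ![v, J x v] -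
              D.F x * κ * wedgeOne (dfn D.F) μ x ![v, J x v]) =
            κ⁻¹ * (deriv b (D.F x) / D.F x * wedgeOne (dfn D.F) D.eta x ![v, J x v]) -
              deriv b (D.F x) * wedgeOne (dfn D.F) μ x ![v, J x v] := by
          have h7 : ∀ d F W N : ℝ, F ≠ 0 →
              κ⁻¹ * (d / F) * (W - F * κ * N) = κ⁻¹ * (d / F * W) - d * N := by
            intro d F W N hF
            have := hκ.ne
            field_simp
          exact h7 _ _ _ _ hF0.ne'
        rw [e5] at h5
        refine le_trans ?_ h5
        have e6 : κ⁻¹ * (deriv b (D.F x) / D.F x) * -(C * D.F x ^ 2 * τ₀ x ![v, J x v]) =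
            -((-κ)⁻¹ * (-(D.F x * deriv b (D.F x))) * C * τ₀ x ![v, J x v]) := by
          have h7 : ∀ d F t : ℝ, F ≠ 0 →
              κ⁻¹ * (d / F) * -(C * F ^ 2 * t) = -((-κ)⁻¹ * (-(F * d)) * C * t) := by
            intro d F t hF
            have := hκ.ne
            rw [inv_neg]
            field_simp
          exact h7 _ _ _ hF0.ne'
        rw [e6]
        refine neg_le_neg (mul_le_mul_of_nonneg_right ?_ hτ)
        have h6 : -(D.F x * deriv b (D.F x)) ≤ ε / 2 * (-κ) / (C + 1) :=
          (neg_le_abs _).trans (hb' (D.F x)).2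
        calc (-κ)⁻¹ * (-(D.F x * deriv b (D.F x))) * C
            ≤ (-κ)⁻¹ * (ε / 2 * (-κ) / (C + 1)) * C := by gcongr
          _ = ε / 2 * (C / (C + 1)) := by
            have h8 : ∀ k : ℝ, k ≠ 0 → k⁻¹ * (ε / 2 * k / (C + 1)) * C = ε / 2 * (C / (C + 1)) := by
              intro k hk
              field_simp
            exact h8 _ hκ'.ne'
          _ ≤ ε / 2 * 1 := by
            refine mul_le_mul_of_nonneg_left ?_ (half_pos hε).le
            rw [div_le_one (by positivity)]
            linarith
          _ = ε / 2 := mul_one _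
    linarith

theorem inChart_sum {n : ℕ} {X : Type*} [TopologicalSpace X] [ChartedSpace (E n) X] {k : ℕ}
    {ι : Type*} (s : Finset ι) (σ : ι → Form n X k) (c : X) :
    inChart (∑ i ∈ s, σ i) c = ∑ i ∈ s, inChart (σ i) c := by
  classical
  induction s using Finset.induction_on with
  | empty => exact inChart_zero c
  | insert a s ha ih => rw [Finset.sum_insert ha, Finset.sum_insert ha, inChart_add, ih]

theorem sum_smul_form_apply {n : ℕ} {X : Type*} [TopologicalSpace X] [ChartedSpace (E n) X] {k : ℕ}
    {ι : Type*} (s : Finset ι) (f : ι → ℝ) (σ : ι → Form n X k) (x : X)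
    (v : Fin k → TangentSpace (𝓡 n) x) :
    (∑ i ∈ s, f i • σ i) x v = ∑ i ∈ s, f i * σ i x v := by
  classical
  induction s using Finset.induction_on with
  | empty => rfl
  | insert a s ha ih =>
    rw [Finset.sum_insert ha, Finset.sum_insert ha, ← ih]
    rfl

/-- Inflation along a sequence of representatives of a class which are almost nonnegative on
complex lines. -/
theorem exists_inflation (hτ : IsSymplectic τ₀) (ht : Tames τ₀ J) {a : Form 4 M 2}
    (has : IsSmoothForm a) (hac : IsClosedForm a) {ρ : ℕ → Form 4 M 2} {γ : ℕ → Form 4 M 1}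
    (hγ : ∀ k, IsSmoothForm (γ k)) (hργ : ∀ k, HasExtDeriv (γ k) (ρ k - a))
    (hρ : ∀ (k : ℕ) (x : M) (v : TangentSpace (𝓡 4) x),
      -(1 / ((k : ℝ) + 1) * τ₀ x ![v, J x v]) ≤ ρ k x ![v, J x v]) :
    ∃ τ : ℝ → Form 4 M 2, IsSmoothFamily τ ∧ τ 0 = τ₀ ∧ ∀ l : ℝ, 0 ≤ l →
      IsSymplectic (τ l) ∧ Tames (τ l) J ∧ Cohomologous (τ l) (τ₀ + l • a) := by
  have hρs : ∀ k, IsSmoothForm (ρ k) := fun k => by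
    have := ((hργ k).isSmoothForm (hγ k)).add has
    rwa [sub_add_cancel] at this
  have hρc : ∀ k, IsClosedForm (ρ k) := fun k => by
    have := HasExtDeriv.add ((hργ k).isSmoothForm (hγ k)) has ((hργ k).isClosedForm (hγ k)) hac
    rwa [sub_add_cancel, add_zero] at this
  -- A partition of the parameter line: χ k l ≠ 0 forces l/(k+1) < 1, so that l ρ k > −τ₀ on complex
  -- lines, and a convex combination of such terms still leaves τ₀ + l Σ χ_k ρ_k positive.
  obtain ⟨χ, hχ⟩ := SmoothPartitionOfUnity.exists_isSubordinate 𝓘(ℝ, ℝ) isClosed_univ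
    (fun k : ℕ => Set.Iio ((k : ℝ) + 1)) (fun _ => isOpen_Iio) (fun l _ => by
      obtain ⟨k, hk⟩ := exists_nat_gt l
      exact Set.mem_iUnion.2 ⟨k, hk.trans (lt_add_one _)⟩)
  let τ : ℝ → Form 4 M 2 := fun l => τ₀ + l • ∑ k ∈ χ.finsupport l, χ k l • ρ k
  -- Near a given parameter one fixed finite index set works, which gives smoothness in l.
  have hτ_eq : ∀ {l : ℝ} {I : Finset ℕ}, χ.finsupport l ⊆ I →
      τ l = τ₀ + l • ∑ k ∈ I, χ k l • ρ k := by
    intro l I hI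
    change τ₀ + l • ∑ k ∈ χ.finsupport l, χ k l • ρ k = _
    rw [Finset.sum_subset hI fun k _ hk => ?_]
    have h0 : χ k l = 0 := by
      by_contra hne
      exact hk ((χ.mem_finsupport l).2 hne)
    funext x
    rw [h0]
    exact zero_smul ℝ (ρ k x)
  have happ : ∀ l x (v : TangentSpace (𝓡 4) x), τ l x ![v, J x v] =
      τ₀ x ![v, J x v] + l * ∑ k ∈ χ.finsupport l, χ k l * ρ k x ![v, J x v] := by
    intro l x v
    change τ₀ x ![v, J x v] + l * (∑ k ∈ χ.finsupport l, χ k l • ρ k) x ![v, J x v] = _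
    rw [sum_smul_form_apply]
  have hsum : ∀ l, ∑ k ∈ χ.finsupport l, χ k l = 1 := fun l => χ.sum_finsupport l (Set.mem_univ l)
  have hpos : ∀ {l k}, k ∈ χ.finsupport l → 0 < χ k l ∧ l < (k : ℝ) + 1 := by
    intro l k hk
    have hne : χ k l ≠ 0 := (χ.mem_finsupport l).1 hk
    exact ⟨(χ.nonneg k l).lt_of_ne' hne, hχ k (subset_tsupport _ hne)⟩
  have htame : ∀ l, 0 ≤ l → Tames (τ l) J := by
    intro l hl x v hv
    have hv0 := ht x v hv
    have hlt : ∑ k ∈ χ.finsupport l, χ k l * -τ₀ x ![v, J x v] <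
        ∑ k ∈ χ.finsupport l, l * (χ k l * ρ k x ![v, J x v]) := by
      refine Finset.sum_lt_sum_of_nonempty ?_ fun k hk => ?_
      · by_contra hne
        have := hsum l
        rw [Finset.not_nonempty_iff_eq_empty.1 hne, Finset.sum_empty] at this
        exact zero_ne_one this
      · obtain ⟨h1, h2⟩ := hpos hk
        have hk0 : (0 : ℝ) < (k : ℝ) + 1 := by positivity
        have h3 := mul_le_mul_of_nonneg_left (hρ k x v) hl
        have h4 : l * (1 / ((k : ℝ) + 1)) < 1 := by
          rw [mul_one_div, div_lt_one hk0]
          exact h2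
        have h5 := mul_lt_mul_of_pos_right h4 hv0
        have h6 : -τ₀ x ![v, J x v] < l * ρ k x ![v, J x v] := by linarith
        have h7 := mul_lt_mul_of_pos_left h6 h1
        linarith
    rw [← Finset.sum_mul, hsum, one_mul, ← Finset.mul_sum] at hlt
    rw [happ]
    linarith
  refine ⟨τ, ?_, ?_, fun l hl => ⟨⟨?_, ?_, fun x v hv => ?_⟩, htame l hl, ?_⟩⟩
  · rintro c ⟨l, y⟩ ⟨-, hy⟩
    rw [extChartAt_target_eq] at hy
    have hcd : ∀ {σ : Form 4 M 2}, IsSmoothForm σ →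
        ContDiffAt ℝ ∞ (fun p : ℝ × E 4 => inChart σ c p.2) (l, y) := fun hσ =>
      ContDiffAt.comp (l, y) (hσ.contDiffAt hy) contDiffAt_snd
    have h1 : ContDiffAt ℝ ∞ (fun p : ℝ × E 4 => inChart τ₀ c p.2 +
        p.1 • ∑ k ∈ χ.fintsupport l, χ k p.1 • inChart (ρ k) c p.2) (l, y) := by
      refine (hcd hτ.smooth).add (contDiffAt_fst.smul (ContDiffAt.sum fun k _ => ?_))
      exact ((χ k).contMDiff.contDiff.contDiffAt.comp (l, y) contDiffAt_fst).smul (hcd (hρs k))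
    refine (h1.congr_of_eventuallyEq ?_).contDiffWithinAt
    filter_upwards [continuousAt_fst.eventually (χ.eventually_finsupport_subset l)] with p hp
    rw [hτ_eq hp, inChart_add, inChart_smul, inChart_sum]
    simp only [inChart_smul, Pi.add_apply, Pi.smul_apply, Finset.sum_apply]
  · funext x
    exact form2_ext fun v w => by
      change τ₀ x ![v, w] + 0 * _ = _
      rw [zero_mul, add_zero]
  · exact hτ.smooth.add ((isSmoothForm_sum _ fun k _ => (hρs k).smul _).smul l)
  · have h1 := HasExtDeriv.sum (χ.finsupport l) (fun k _ => (hρs k).smul (χ k l))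
      (fun k _ => HasExtDeriv.smul (hρc k) (χ k l))
    have h2 := HasExtDeriv.add hτ.smooth
      ((isSmoothForm_sum (χ.finsupport l) fun k _ => (hρs k).smul (χ k l)).smul l) hτ.closed (h1.smul l)
    have e : (0 : Form 4 M 3) + l • ∑ k ∈ χ.finsupport l, χ k l • (0 : Form 4 M 3) = 0 := by
      simp only [smul_zero, Finset.sum_const_zero, add_zero]
    rwa [e] at h2
  · by_contra hne
    exact (htame l hl x v hne).ne' (hv _)
  -- Because the functions χ_k sum to 1, the combination of the ρ_k differs from a by the same
  -- combination of the exact forms.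
  · refine ⟨l • ∑ k ∈ χ.finsupport l, χ k l • γ k,
      (isSmoothForm_sum _ fun k _ => (hγ k).smul _).smul l, ?_⟩
    have h1 := HasExtDeriv.smul (HasExtDeriv.sum (χ.finsupport l) (fun k _ => (hγ k).smul (χ k l))
      (fun k _ => (hργ k).smul (χ k l))) l
    convert h1 using 1
    funext x
    refine form2_ext fun v w => ?_
    change τ₀ x ![v, w] + l * (∑ k ∈ χ.finsupport l, χ k l • ρ k) x ![v, w] -
      (τ₀ x ![v, w] + l * a x ![v, w]) = l * (∑ k ∈ χ.finsupport l, χ k l • (ρ k - a)) x ![v, w]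
    rw [sum_smul_form_apply, sum_smul_form_apply]
    have e : ∀ k, χ k l * (ρ k - a) x ![v, w] = χ k l * ρ k x ![v, w] - χ k l * a x ![v, w] :=
      fun k => mul_sub _ _ _
    simp only [e]
    rw [Finset.sum_sub_distrib, ← Finset.sum_mul, hsum]
    ring

/-- Inflation along an embedded holomorphic curve of nonnegative self-intersection. -/
theorem HolCurve.inflation (h : HolCurve τ₀ J j u) (hZ : 0 ≤ selfIntersection τ₀ j u) :
    ∃ a : Form 4 M 2, IsPoincareDual τ₀ j u a ∧ ∃ τ : ℝ → Form 4 M 2,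
      IsSmoothFamily τ ∧ τ 0 = τ₀ ∧ ∀ l : ℝ, 0 ≤ l →
        IsSymplectic (τ l) ∧ Tames (τ l) J ∧ Cohomologous (τ l) (τ₀ + l • a) := by
  obtain ⟨k, W, hW⟩ := h.exists_normalMap
  obtain ⟨D⟩ := hW.nonempty_normalData h.emb
  -- A reference profile, used only to fix the dual form a; the profiles adapted to ε come later and
  -- share its value at 0.
  obtain ⟨b₁, hb₁, hb₁0, ⟨t₀, ht₀, hbc⟩, hbT, -, hb₁'⟩ := exists_log_cutoff (half_pos D.m_pos) one_pos
  have hprof₁ : Profile D.m b₁ := ⟨hb₁, ⟨t₀, ht₀, fun t ht => by rw [hbc t ht, hb₁0]⟩,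
    ⟨D.m / 2, half_lt_self D.m_pos, fun t ht => hbT t ht.le⟩⟩
  obtain ⟨t₁, ht₁, hneg⟩ := hprof₁.exists_deriv_neg hb₁0 fun t => (hb₁' t).1
  obtain ⟨κ, hκ, hint⟩ := NormalData.exists_integral_wedge_thomForm_eq h hprof₁
    (fun t => (hb₁' t).1) ht₁ hneg
  have ha := NormalData.isPoincareDual h hprof₁ hκ hint
  have hself := NormalData.selfIntersection_eq h hprof₁ hκ hint
  set a : Form 4 M 2 := κ⁻¹ • D.thomForm b₁ with haD
  have hA : 0 < curveIntegral j u τ₀ := h.curveIntegral_pos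
  rw [hself] at hZ
  -- The hypothesis on the self-intersection enters only through c ≥ 0.
  set c := curveIntegral j u a / curveIntegral j u τ₀ with hc
  have hc0 : 0 ≤ c := div_nonneg hZ hA.le
  have hξ : IsSmoothForm (a + (-c) • τ₀) := ha.smooth.add (h.symp.smooth.smul _)
  obtain ⟨μ, θ, hμ, hθ, hθu⟩ := h.curveExact hξ (by
    rw [h.curveIntegral_add ha.smooth (h.symp.smooth.smul _), h.curveIntegral_smul (-c), hc, neg_mul,
      div_mul_cancel₀ _ hA.ne', add_neg_cancel])
  have hθs := hθ.isSmoothForm hμ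
  -- Along the curve θ = a − cτ₀ and a = κ⁻¹ kappa, so the form in question is cτ₀ there.
  have h0 : ∀ (s : S) (v : TangentSpace (𝓡 4) (u s)),
      0 ≤ (κ⁻¹ • D.kappa + (-1 : ℝ) • θ) (u s) ![v, J (u s) v] := by
    intro s v
    have h1 : D.thomForm b₁ (u s) = D.kappa (u s) := by
      rw [NormalData.thomForm_apply_u hprof₁, hb₁0]
      exact one_smul ℝ (D.kappa (u s))
    change 0 ≤ κ⁻¹ * D.kappa (u s) ![v, J (u s) v] + -1 * θ (u s) ![v, J (u s) v]
    rw [hθu]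
    change 0 ≤ κ⁻¹ * D.kappa (u s) ![v, J (u s) v] + -1 * (κ⁻¹ * D.thomForm b₁ (u s) ![v, J (u s) v] +
      -c * τ₀ (u s) ![v, J (u s) v])
    rw [h1]
    have := mul_nonneg hc0 (h.tame_nonneg (u s) v)
    linarith
  choose b hb hb0 hb' hle using fun k : ℕ => h.exists_profile_neg_le D hκ hμ hθs h0
    (ε := 1 / ((k : ℝ) + 1)) (by positivity)
  -- The k-th representative differs from a by κ⁻¹ times the Thom form of b k − b₁, which is exact
  -- since this profile vanishes at 0, and by −d(b k(F) μ).
  refine ⟨a, ha, exists_inflation (γ := fun k => κ⁻¹ •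
    fsmul (fun x => (b k (D.F x) - b₁ (D.F x)) / D.F x) D.eta + (-1 : ℝ) • fsmul (fun x => b k (D.F x)) μ)
    h.symp h.tame ha.smooth ha.closed (fun k => ?_) (fun k => ?_) hle⟩
  · exact ((NormalData.isSmoothForm_fsmul_eta ((hb k).sub hprof₁) (by rw [hb0, hb₁0, sub_self])).smul _).add
      ((hμ.fsmul (D.contMDiff_comp_F (hb k).smooth)).smul _)
  · have hd := (hb k).sub hprof₁
    have hd0 : b k 0 - b₁ 0 = 0 := by rw [hb0, hb₁0, sub_self]
    have h1 := HasExtDeriv.smul (NormalData.hasExtDeriv_thomForm hd hd0) κ⁻¹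
    have h2 := HasExtDeriv.smul (HasExtDeriv.fsmul hμ hθ (D.contMDiff_comp_F (hb k).smooth)) (-1)
    have h3 := HasExtDeriv.add ((NormalData.isSmoothForm_fsmul_eta hd hd0).smul κ⁻¹)
      ((hμ.fsmul (D.contMDiff_comp_F (hb k).smooth)).smul (-1)) h1 h2
    convert h3 using 1
    rw [NormalData.thomForm_sub (hb k) hprof₁, haD]
    funext x
    refine form2_ext fun v w => ?_
    change κ⁻¹ * D.thomForm (b k) x ![v, w] + -1 * _ - κ⁻¹ * D.thomForm b₁ x ![v, w] =
      κ⁻¹ * (D.thomForm (b k) x ![v, w] - D.thomForm b₁ x ![v, w]) + -1 * _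
    ring

end Inflating

end Inflation

end

theorem lemma3p1
    {M : Type*} [TopologicalSpace M] [T2Space M] [SigmaCompactSpace M]
    [ChartedSpace (EuclideanSpace ℝ (Fin 4)) M] [IsManifold (𝓡 4) ∞ M]
    (τ₀ : Inflation.Form 4 M 2) (hτ₀ : Inflation.IsSymplectic τ₀)
    (J : ∀ x : M, TangentSpace (𝓡 4) x →L[ℝ] TangentSpace (𝓡 4) x)
    (hJ : Inflation.IsAlmostComplex J) (htame : Inflation.Tames τ₀ J)
    {S : Type*} [TopologicalSpace S] [T2Space S] [CompactSpace S] [ConnectedSpace S]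
    [ChartedSpace (EuclideanSpace ℝ (Fin 2)) S] [IsManifold (𝓡 2) ∞ S]
    (j : ∀ s : S, TangentSpace (𝓡 2) s →L[ℝ] TangentSpace (𝓡 2) s)
    (hj : Inflation.IsAlmostComplex j)
    (u : S → M) (hu : Manifold.IsSmoothEmbedding (𝓡 2) (𝓡 4) ∞ u)
    (hol : Inflation.IsHolomorphic j J u)
    (hZ : 0 ≤ Inflation.selfIntersection τ₀ j u) :
    ∃ a : Inflation.Form 4 M 2, Inflation.IsPoincareDual τ₀ j u a ∧
      ∃ τ : ℝ → Inflation.Form 4 M 2,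
        Inflation.IsSmoothFamily τ ∧ τ 0 = τ₀ ∧
        ∀ l : ℝ, 0 ≤ l →
          Inflation.IsSymplectic (τ l) ∧ Inflation.Tames (τ l) J ∧
          Inflation.Cohomologous (τ l) (τ₀ + l • a) := by
  exact Inflation.HolCurve.inflation ⟨hτ₀, hJ, htame, hj, hu, hol⟩ hZ
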